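/- Fix a number $t$ of types of parentheses. In a string over the $2t$ open and close parentheses of these types, an open parenthesis at position $i$ and a close parenthesis of the same type at position $j>i$ \emph{match} if every parenthesis of that type strictly between them matches one strictly between them. The string $S$ is \emph{balanced} if each of its parentheses belongs to a matching pair. Let $\mathrm{rev}(S)$ be the string that has at position $i$ the opposite (same type, open and close exchanged) of the symbol of $S$ at position $|S|+1-i$. If the symbol of $S$ at position $i$ is an open parenthesis of type $k$, let $S'$ be $S$ followed by as many close parentheses of type $k$ as are needed to make position $i$ matched (none if $S$ is balanced), and let $\mathrm{son}(S,i)$ be the number of positions $j$ with $i<j\le|S|$ that hold a parenthesis of type $k$ and for which the closest matching pair of type $k$ in $S'$ enclosing $j$ and its match consists of $i$ and its match. If the symbol at position $i$ is a close parenthesis, let $\mathrm{son}(S,i)=\mathrm{son}(\mathrm{rev}(S),|S|+1-i)$. (For balanced $S$, $\mathrm{son}(S,i)$ is twice the number of matching pairs of type $k$ nested directly inside the pair of position $i$.) The model of computation is the unit-cost RAM in which a step reads, writes, or performs an arithmetic or bitwise logical operation on $O(\log |S|)$ consecutive bits. A string over the $2t$ parentheses is stored with $\lceil\log_2(2t)\rceil$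 bits per symbol, and $A+B$ denotes the concatenation of the bit strings $A$ and $B$ preceded by a header of $O(\log(|A|+|B|))$ bits from which the positions of $A$ and $B$ can be read off. \textbf{Lemma.} For every fixed $t$ there are a map $\chi_2$ from strings over $t$ types of parentheses to bit strings, two RAM programs, and constants $c$ and $C$, all depending only on $t$, such that (i) $|\chi_2(S)|=o(|S|)$: for every $\varepsilon>0$ there is $N$ such that $|\chi_2(S)|\le\varepsilon|S|$ for all balanced $S$ with $|S|\ge N$; and, for every balanced string $S$ over $t$ types of parentheses and every word size $w\ge c(\lfloor\log_2|S|\rfloor+1)$ (where $\lfloor\log_2 0\rfloor$ is read as $0$), (ii) the first program computes $\chi_2(S)$ from $S$ in at most $C(|S|+1)$ steps; (iii) for every position $i$ of $S$, the second program computes $\mathrm{son}(S,i)$ from $S+\chi_2(S)$ and $i$ in at most $C$ steps. -/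

import Mathlib

/-! ## Strings of several types of parentheses

Positions in a string are counted from `0`, so that position `i` here is position `i + 1` in the
convention where the first symbol has index `1`. -/

namespace ParenString

/-- A parenthesis of one of `t` types, open or close. -/
structure Paren (t : ℕ) where
  kind : Fin t
  isOpen : Bool

variable {t : ℕ}

/-- The opposite parenthesis of the same type. -/
def Paren.opposite (p : Paren t) : Paren t := ⟨p.kind, !p.isOpen⟩

/-- The reversal of `S`: its symbol at position `i` is the opposite of the symbol of `S` at
the mirrored position. -/
def rev (S : List (Paren t)) : List (Paren t) := (S.map Paren.opposite).reverse

/-- The open parenthesis at position `i` and the close parenthesis at position `j > i`, of the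
same type, match if every parenthesis of that type enclosed by them matches one enclosed by
them. -/
def Matches (S : List (Paren t)) (i j : ℕ) : Prop :=
  i < j ∧ ∃ k : Fin t, S[i]? = some ⟨k, true⟩ ∧ S[j]? = some ⟨k, false⟩ ∧
    ∀ p : ℕ, i < p → p < j → (∃ o : Bool, S[p]? = some ⟨k, o⟩) →
      ∃ q : ℕ, ∃ _ : i < q ∧ q < j, Matches S p q ∨ Matches S q p
termination_by j - i

/-- `j` is the position of the parenthesis that matches the one at position `i`. -/
def IsMatchOf (S : List (Paren t)) (i j : ℕ) : Prop := Matches S i j ∨ Matches S j i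

/-- Every parenthesis of type `k` belongs to a matching pair. -/
def BalancedIn (k : Fin t) (S : List (Paren t)) : Prop :=
  ∀ (i : ℕ) (o : Bool), S[i]? = some ⟨k, o⟩ → ∃ j : ℕ, IsMatchOf S i j

/-- Balanced in all types of parentheses (in particular the empty string is balanced). -/
def Balanced (S : List (Paren t)) : Prop := ∀ k : Fin t, BalancedIn k S

/-- `(j₁, j₂)` is a matching pair of type `k` that encloses the positions `i₁` and `i₂`. -/
def EnclosingPair (k : Fin t) (S : List (Paren t)) (i₁ i₂ j₁ j₂ : ℕ) : Prop :=
  Matches S j₁ j₂ ∧ S[j₁]? = some ⟨k, true⟩ ∧ (j₁ < i₁ ∧ i₁ < j₂) ∧ (j₁ < i₂ ∧ i₂ < j₂)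

/-- `(j₁, j₂)` is the closest matching pair of type `k` that encloses `i₁` and `i₂`. -/
def IsEnclose (k : Fin t) (S : List (Paren t)) (i₁ i₂ j₁ j₂ : ℕ) : Prop :=
  EnclosingPair k S i₁ i₂ j₁ j₂ ∧
    ∀ a b : ℕ, EnclosingPair k S i₁ i₂ a b → a ≤ j₁ ∧ j₂ ≤ b

/-- `S` followed by the least number of close parentheses of type `k` (none, if possible) for
which the open parenthesis of type `k` at position `i` becomes matched. -/
noncomputable def closeUp (S : List (Paren t)) (k : Fin t) (i : ℕ) : List (Paren t) :=
  S ++ List.replicate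
    (sInf {m : ℕ | ∃ j : ℕ, Matches (S ++ List.replicate m ⟨k, false⟩) i j}) ⟨k, false⟩

open Classical in
/-- `son` at an open parenthesis of type `k`: the number of positions `j > i` of `S` that hold a
parenthesis of type `k` and for which the closest pair of type `k` enclosing `j` and its match
consists of `i` and its match, all matches being taken in `closeUp S k i`. -/
noncomputable def sonOpen (S : List (Paren t)) (k : Fin t) (i : ℕ) : ℕ :=
  ((Finset.range S.length).filter fun j : ℕ =>
    i < j ∧ (∃ o : Bool, S[j]? = some ⟨k, o⟩) ∧
      ∃ j' i' : ℕ, IsMatchOf (closeUp S k i) j j' ∧ IsMatchOf (closeUp S k i) i i' ∧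
        IsEnclose k (closeUp S k i) j j' i i').card

/-- `son S i`; at a close parenthesis it is read off at the mirrored position of `rev S`
(and it is `0` if `i` is not a position of `S`). -/
noncomputable def son (S : List (Paren t)) (i : ℕ) : ℕ :=
  match S[i]? with
  | none => 0
  | some ⟨k, true⟩ => sonOpen S k i
  | some ⟨k, false⟩ => sonOpen (rev S) k (S.length - 1 - i)

end ParenString

/-! ## Bit strings -/

namespace BitString

/-- The `l` low-order bits of `v`, least significant bit first. -/
def ofNat (l v : ℕ) : List Bool := (List.range l).map v.testBit

/-- Each symbol takes `⌈log₂ (2 t)⌉` bits. -/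
def encode {t : ℕ} (S : List (ParenString.Paren t)) : List Bool :=
  S.flatMap fun p => ofNat (Nat.clog 2 (2 * t)) (2 * p.kind.val + if p.isOpen then 1 else 0)

/-- A self-delimiting code, of `4 L + 1` bits, for two numbers of at most `L` bits each. -/
def header (a b : ℕ) : List Bool :=
  let L := Nat.size (a + b)
  List.replicate L true ++ [false] ++ ofNat L L ++ ofNat L a ++ ofNat L b

/-- The concatenation `A + B` of two bit strings, preceded by logarithmically many bits from
which the positions of `A` and `B` in the concatenation can be read off. -/
def join (A B : List Bool) : List Bool := header A.length B.length ++ A ++ B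

end BitString

/-! ## Unit-cost RAM with `w`-bit words

The memory is an array of bits. There are finitely many registers in a program, each holding a
`w`-bit number. One step performs one operation on registers, or reads or writes at most `w`
consecutive bits of the memory at an address held in a register. -/

namespace WordRAM

/-- Arithmetic and logical operations on words. -/
inductive Op where
  | add | sub | mul | div | mod | and | or | xor | shl | shr

/-- The value of an operation; results are reduced modulo `2 ^ w`, subtraction is truncated at
`0`, and division by `0` gives `0`. -/
def Op.eval (w : ℕ) (o : Op) (x y : ℕ) : ℕ :=
  match o with
  | .add => (x + y) % 2 ^ w
  | .sub => (x - y) % 2 ^ w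
  | .mul => (x * y) % 2 ^ w
  | .div => (x / y) % 2 ^ w
  | .mod => (x % y) % 2 ^ w
  | .and => (x &&& y) % 2 ^ w
  | .or => (x ||| y) % 2 ^ w
  | .xor => (x ^^^ y) % 2 ^ w
  | .shl => (x <<< y) % 2 ^ w
  | .shr => (x >>> y) % 2 ^ w

/-- Instructions; `d a b l s` are names of registers, `v` is a constant, and `target` is a
position in the program. -/
inductive Instr where
  /-- put the constant `v` into register `d` -/
  | const (d v : ℕ)
  /-- put the value of the operation on the registers `a` and `b` into register `d` -/
  | op (o : Op) (d a b : ℕ)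
  /-- read into register `d` as many bits as register `l` says (at most `w`) from the memory,
  beginning at the address in register `a` -/
  | load (d a l : ℕ)
  /-- write as many low-order bits of register `s` as register `l` says (at most `w`) to the
  memory, beginning at the address in register `a` -/
  | store (s a l : ℕ)
  /-- go to `target` -/
  | jump (target : ℕ)
  /-- go to `target` if the number in register `a` is less than the one in register `b` -/
  | jumpLT (a b target : ℕ)

/-- A program is a fixed finite list of instructions. -/
abbrev Program := List Instr

structure State where
  /-- program counter -/
  pc : ℕ
  /-- registers -/
  reg : ℕ → ℕ
  /-- bit memory -/
  mem : ℕ → Bool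

/-- The number stored in the `l` bits of memory beginning at address `a`, least significant bit
first. -/
def readBits (mem : ℕ → Bool) (a l : ℕ) : ℕ :=
  ∑ q ∈ Finset.range l, if mem (a + q) then 2 ^ q else 0

/-- The memory after the `l` low-order bits of `v` have been written from address `a` on. -/
def writeBits (mem : ℕ → Bool) (a l v : ℕ) : ℕ → Bool := fun p =>
  if a ≤ p ∧ p < a + l then v.testBit (p - a) else mem p

/-- The effect of one instruction. -/
def Instr.exec (w : ℕ) (s : State) : Instr → State
  | .const d v => { s with pc := s.pc + 1, reg := Function.update s.reg d (v % 2 ^ w) }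
  | .op o d a b =>
      { s with pc := s.pc + 1, reg := Function.update s.reg d (o.eval w (s.reg a) (s.reg b)) }
  | .load d a l =>
      { s with
        pc := s.pc + 1
        reg := Function.update s.reg d (readBits s.mem (s.reg a) (min (s.reg l) w)) }
  | .store r a l =>
      { s with
        pc := s.pc + 1
        mem := writeBits s.mem (s.reg a) (min (s.reg l) w) (s.reg r) }
  | .jump target => { s with pc := target }
  | .jumpLT a b target =>
      { s with pc := if s.reg a < s.reg b then target else s.pc + 1 }

/-- `HaltsWithin w P T s s'`: started in `s`, the program `P` executes at most `T` instructions,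
the program counter then leaves the program, and the final state is `s'`. -/
inductive HaltsWithin (w : ℕ) (P : Program) : ℕ → State → State → Prop
  | done (T : ℕ) (s : State) (h : P[s.pc]? = none) : HaltsWithin w P T s s
  | step (T : ℕ) (s s' : State) (I : Instr) (h : P[s.pc]? = some I)
      (hrest : HaltsWithin w P T (I.exec w s) s') : HaltsWithin w P (T + 1) s s'

/-- The initial state: the input occupies the memory from address `0` on (all other bits are
`0`), its length is in register `0`, and the further arguments are in registers `1, 2, …`. -/
def init (w : ℕ) (input : List Bool) (args : List ℕ) : State where
  pc := 0
  reg := fun r => ((input.length :: args)[r]?.getD 0) % 2 ^ w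
  mem := fun p => input[p]?.getD false

/-- A bit string is output by leaving its address in register `0` and its length in
register `1`. -/
def State.output (s : State) : List Bool :=
  (List.range (s.reg 1)).map fun q => s.mem (s.reg 0 + q)

end WordRAM

/-! Fix a type `k` and let `E q` be the number of open minus close parentheses of type `k` before
position `q`. In a balanced string the match of an open parenthesis at `i` is the first `i' > i`
with `E (i' + 1) = E i` (`matches_iff`), and the pairs nested directly inside correspond to the
close parentheses strictly between `i` and `i'` after which the level is `E i + 1`. So `son` is
twice such a count (`BalancedIn.sonOpen_eq`). Close parentheses are treated as open parentheses of
the reversed string; hence `2 t` indexes are stored, one for each type and direction.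

Let `R` be of the order of `(log n) ^ (1 / 4)`. The string is cut into blocks of `R ^ 5` symbols,
each consisting of `R ^ 3` leaves of `R ^ 2` symbols. The symbols of a leaf, spread into fields of
`O(R ^ 2)` bits, and the summaries of all leaves of a block, `8 R` bits each, occupy `O(R ^ 4) =
O(log n)` bits. Arithmetic on packed fields (`geq_eq`, `fsum_eq`, `psum_eq`, `first_eq`) therefore
searches a block for the first level below a threshold, and counts close parentheses at a given
level, in constantly many steps. A leaf summary holds only the least level and how often a close
parenthesis attains it. This is enough for counting, because no level inside the pair is below `E i
+ 1`. Pairs within one block are settled in this way (`close_near`, `near_eq`).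

For pairs between different blocks some pairs, the pioneers, are stored explicitly with the block of
the match and the count. A far pair is a pioneer if the preceding far close parenthesis in the block
of its right end, if any, is not matched into the block of its left end. As matching pairs do not
cross, there are at most two pioneers per block (`Walk.count_pio_le`). For any other far pair `(i,
i')` the first pioneer after `i` lies in the block of `i` and is matched into the block of `i'`
(`degree_eq`), so `i'` is found by a search in that block. The pioneer pair spans everything between
the two blocks at levels above `E i + 1`, so only the two end blocks contribute to the count
(`far_eq`).

Blocks and pioneers cost `O(R ^ 4)` bits per `R ^ 5` symbols, leaves `O(R)` bits per `R ^ 2`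
symbols; altogether `O(n / R) = o(n)`. The arrays are built in two scans. The first keeps a stack of
unmatched open parentheses with their counts so far and marks the pioneers; the second numbers them
(`Walk.index`).

On the machine side, `Comp` collects the functions that are values of one fixed expression for all
sufficiently long words. It is closed under the operations used, which gives the query program from
its formula (`QueryComp.degree`). `Can` and `Reach` combine such expressions into simultaneous
stores, output and loops, which gives the construction (`emits_indexTo`). -/

namespace ParenString

/-! ### Symbol codes, levels, and matching in terms of levels. -/

variable {t : ℕ}

/-- The number that encodes a parenthesis. -/
def code (p : Paren t) : ℕ := 2 * p.kind.val + if p.isOpen then 1 else 0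

/-- The code of the symbol at a position, `2 t` outside the string. -/
def scode (S : List (Paren t)) (q : ℕ) : ℕ := (S[q]?.map code).getD (2 * t)

theorem code_lt (p : Paren t) : code p < 2 * t := by
  have := p.kind.isLt
  unfold code; split <;> omega

theorem scode_eq_iff (S : List (Paren t)) (q : ℕ) (k : Fin t) (o : Bool) :
    S[q]? = some ⟨k, o⟩ ↔ scode S q = 2 * k.val + if o then 1 else 0 := by
  unfold scode
  have hk := k.isLt
  rcases h : S[q]? with _ | ⟨k', o'⟩
  · simp only [Option.map_none, Option.getD_none]
    constructor
    · simp
    · intro h; split at h <;> omega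
  · simp only [Option.map_some, Option.getD_some, Option.some.injEq, Paren.mk.injEq, code]
    rw [Fin.ext_iff]
    cases o <;> cases o' <;> simp <;> omega

theorem scode_open (S : List (Paren t)) (q : ℕ) (k : Fin t) :
    S[q]? = some ⟨k, true⟩ ↔ scode S q = 2 * k.val + 1 := by
  simp [scode_eq_iff]

theorem scode_close (S : List (Paren t)) (q : ℕ) (k : Fin t) :
    S[q]? = some ⟨k, false⟩ ↔ scode S q = 2 * k.val := by
  simp [scode_eq_iff]

theorem scode_of_le {S : List (Paren t)} {q : ℕ} (h : S.length ≤ q) : scode S q = 2 * t := by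
  simp [scode, List.getElem?_eq_none h]

theorem scode_lt_iff (S : List (Paren t)) (q : ℕ) : scode S q < 2 * t ↔ q < S.length := by
  constructor
  · intro h
    by_contra h'
    rw [scode_of_le (by omega)] at h
    omega
  · intro h
    simp only [scode, List.getElem?_eq_getElem h, Option.map_some, Option.getD_some]
    exact code_lt _

/-- The number of open minus the number of close parentheses of type `k` before a position. -/
def lvl (c : ℕ → ℕ) (k : ℕ) : ℕ → ℤ
  | 0 => 0
  | q + 1 => if c q = 2 * k + 1 then lvl c k q + 1
      else if c q = 2 * k then lvl c k q - 1 else lvl c k q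

/-- A matching pair in terms of levels. -/
def LvlPair (c : ℕ → ℕ) (k i j : ℕ) : Prop :=
  i < j ∧ c i = 2 * k + 1 ∧ c j = 2 * k ∧ lvl c k (j + 1) = lvl c k i ∧
    ∀ r, i < r → r ≤ j → lvl c k i < lvl c k r

section
variable {c : ℕ → ℕ} {k : ℕ}

theorem lvl_open {q : ℕ} (h : c q = 2 * k + 1) : lvl c k (q + 1) = lvl c k q + 1 := by
  simp [lvl, h]

theorem lvl_close {q : ℕ} (h : c q = 2 * k) : lvl c k (q + 1) = lvl c k q - 1 := by
  simp [lvl, h]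

theorem lvl_neutral {q : ℕ} (h : c q ≠ 2 * k + 1) (h' : c q ≠ 2 * k) :
    lvl c k (q + 1) = lvl c k q := by
  simp [lvl, h, h']

theorem lvl_step (q : ℕ) : (c q = 2 * k + 1 ∧ lvl c k (q + 1) = lvl c k q + 1) ∨
    (c q = 2 * k ∧ lvl c k (q + 1) = lvl c k q - 1) ∨
    (c q ≠ 2 * k + 1 ∧ c q ≠ 2 * k ∧ lvl c k (q + 1) = lvl c k q) := by
  by_cases h : c q = 2 * k + 1
  · exact Or.inl ⟨h, lvl_open h⟩
  by_cases h' : c q = 2 * k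
  · exact Or.inr (Or.inl ⟨h', lvl_close h'⟩)
  · exact Or.inr (Or.inr ⟨h, h', lvl_neutral h h'⟩)

/-- Levels change by at most one per position, so the first return to the level of `p` is made by a
close parenthesis of type `k`. The position `e` witnesses that a return happens and limits how late
it is. -/
theorem LvlPair.of_open {p e : ℕ} (hp : c p = 2 * k + 1) (hpe : p < e)
    (h : lvl c k e ≤ lvl c k p) : ∃ q, q < e ∧ LvlPair c k p q := by
  classical
  have hex : ∃ q, p < q ∧ lvl c k q ≤ lvl c k p := ⟨e, hpe, h⟩
  obtain ⟨h1, h2⟩ := Nat.find_spec hex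
  have hle : Nat.find hex ≤ e := Nat.find_min' hex ⟨hpe, h⟩
  have hmin : ∀ r, p < r → r < Nat.find hex → lvl c k p < lvl c k r := by
    intro r hr hr'
    have := Nat.find_min hex hr'
    simp only [not_and, not_le] at this
    exact this hr
  obtain ⟨q, hq⟩ : ∃ q, Nat.find hex = q + 1 := ⟨Nat.find hex - 1, by omega⟩
  rw [hq] at h1 h2 hle hmin
  have hpq : p ≠ q := by
    rintro rfl
    rw [lvl_open hp] at h2
    omega
  have hq' := hmin q (by omega) (by omega)
  refine ⟨q, by omega, by omega, hp, ?_, ?_, fun r hr hr' => hmin r hr (by omega)⟩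
  · rcases lvl_step (c := c) (k := k) q with h | h | h
    · omega
    · exact h.1
    · omega
  · rcases lvl_step (c := c) (k := k) q with h | h | h <;> omega

/-- Mirror image of `LvlPair.of_open`: the partner is the last position up to `p` whose level is not
above the level after `p`. -/
theorem LvlPair.of_close {p a : ℕ} (hp : c p = 2 * k) (hpa : a ≤ p)
    (h : lvl c k a ≤ lvl c k (p + 1)) : ∃ q, a ≤ q ∧ LvlPair c k q p := by
  classical
  have hP : lvl c k a ≤ lvl c k (p + 1) := h
  obtain ⟨q, hqp, hq, hmax⟩ : ∃ q, q ≤ p ∧ (lvl c k q ≤ lvl c k (p + 1) ∧ a ≤ q) ∧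
      ∀ r, q < r → r ≤ p → lvl c k (p + 1) < lvl c k r := by
    refine ⟨Nat.findGreatest (fun r => lvl c k r ≤ lvl c k (p + 1)) p, Nat.findGreatest_le _,
      ⟨Nat.findGreatest_spec (P := fun r => lvl c k r ≤ lvl c k (p + 1)) hpa h,
        Nat.le_findGreatest hpa h⟩, fun r hr hr' => ?_⟩
    have := Nat.findGreatest_is_greatest hr hr'
    omega
  have hpq : q ≠ p := by
    rintro rfl
    rw [lvl_close hp] at hq
    omega
  have hq' := hmax (q + 1) (by omega) (by omega)
  have : c q = 2 * k + 1 ∧ lvl c k q = lvl c k (p + 1) := by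
    rcases lvl_step (c := c) (k := k) q with h | h | h
    · exact ⟨h.1, by omega⟩
    · omega
    · omega
  exact ⟨q, hq.2, by omega, this.1, hp, this.2.symm, fun r hr hr' => by
    rw [this.2]; exact hmax r hr hr'⟩

end

/-- Induction on the distance turns the recursive condition into levels: every enclosed parenthesis
of the type has its partner enclosed as well, so enclosed parentheses cancel in pairs and the level
inside never falls back to that at `i`. -/
theorem matches_iff (S : List (Paren t)) (i j : ℕ) :
    Matches S i j ↔ ∃ k : Fin t, LvlPair (scode S) k i j := by
  induction hd : j - i using Nat.strong_induction_on generalizing i j with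
  | _ d ih =>
  rw [Matches]
  constructor
  · rintro ⟨hij, k, hi, hj, hall⟩
    rw [scode_open] at hi
    rw [scode_close] at hj
    have hall' : ∀ p, i < p → p < j → (scode S p = 2 * k.val + 1 →
        ∃ q, p < q ∧ q < j ∧ lvl (scode S) k (q + 1) = lvl (scode S) k p) ∧
        (scode S p = 2 * k.val →
        ∃ q, i < q ∧ q < p ∧ lvl (scode S) k (p + 1) = lvl (scode S) k q) := by
      intro p hp hp'
      have key : (∃ o : Bool, S[p]? = some ⟨k, o⟩) → _ := hall p hp hp'
      have aux : (∃ o : Bool, S[p]? = some ⟨k, o⟩) → ∃ q, (i < q ∧ q < j) ∧ ∃ k' : Fin t,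
          LvlPair (scode S) k' p q ∨ LvlPair (scode S) k' q p := by
        intro h
        obtain ⟨q, hq, h⟩ := key h
        refine ⟨q, hq, ?_⟩
        rcases h with h | h
        · by_cases hpq : q - p < d
          · obtain ⟨k', h⟩ := (ih _ hpq p q rfl).1 h
            exact ⟨k', Or.inl h⟩
          · omega
        · by_cases hpq : p - q < d
          · obtain ⟨k', h⟩ := (ih _ hpq q p rfl).1 h
            exact ⟨k', Or.inr h⟩
          · omega
      constructor
      · intro hc
        obtain ⟨q, hq, k', h | h⟩ := aux ⟨true, (scode_open _ _ _).2 hc⟩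
        · have : k'.val = k.val := by have := h.2.1; omega
          rw [this] at h
          exact ⟨q, h.1, hq.2, h.2.2.2.1⟩
        · have := h.2.2.1; omega
      · intro hc
        obtain ⟨q, hq, k', h | h⟩ := aux ⟨false, (scode_close _ _ _).2 hc⟩
        · have := h.2.1; omega
        · have : k'.val = k.val := by have := h.2.2.1; omega
          rw [this] at h
          exact ⟨q, hq.1, h.1, h.2.2.2.1⟩
    -- A close parenthesis brings the level back to the one before its partner. The partner lies to
    -- the right of `i`, where the bound is already known.
    have hA : ∀ r, i < r → r ≤ j → lvl (scode S) k i < lvl (scode S) k r := by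
      intro r
      induction r using Nat.strong_induction_on with
      | _ r ihr =>
      intro hr hr'
      obtain ⟨r, rfl⟩ : ∃ r', r = r' + 1 := ⟨r - 1, by omega⟩
      rcases Nat.lt_or_ge i r with hir | hir
      · have h1 := ihr r (by omega) hir (by omega)
        rcases lvl_step (c := scode S) (k := k) r with h | h | h
        · omega
        · obtain ⟨q, hq, hqr, he⟩ := (hall' r hir (by omega)).2 h.1
          have := ihr q (by omega) hq (by omega)
          omega
        · omega
      · have : r = i := by omega
        subst this
        rw [lvl_open hi]; omega
    -- The same from the right: after the partner of an open parenthesis at `r` the level is again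
    -- that at `r`. Taken at `i + 1`, and together with `hA` at `j`, this forces the level at `j` to
    -- be one above that at `i`.
    have hB : ∀ e r, j - r = e → i < r → r ≤ j → lvl (scode S) k j ≤ lvl (scode S) k r := by
      intro e
      induction e using Nat.strong_induction_on with
      | _ e ihe =>
      intro r he hr hr'
      rcases Nat.lt_or_ge r j with hrj | hrj
      · have h1 := ihe (j - (r + 1)) (by omega) (r + 1) rfl (by omega) (by omega)
        rcases lvl_step (c := scode S) (k := k) r with h | h | h
        · obtain ⟨q, hq, hqr, he⟩ := (hall' r hr hrj).1 h.1
          have := ihe (j - (q + 1)) (by omega) (q + 1) rfl (by omega) (by omega)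
          omega
        · omega
        · omega
      · have : r = j := by omega
        subst this; exact le_refl _
    refine ⟨k, hij, hi, hj, ?_, hA⟩
    have h1 := hB _ (i + 1) rfl (by omega) (by omega)
    have h2 := hA j hij le_rfl
    rw [lvl_open hi] at h1
    rw [lvl_close hj]
    omega
  · rintro ⟨k, hij, hi, hj, he, hall⟩
    refine ⟨hij, k, (scode_open _ _ _).2 hi, (scode_close _ _ _).2 hj, ?_⟩
    -- The levels at `i + 1` and at `j` are equal and least inside the pair, so the searches for
    -- partners below cannot leave it.
    have hlj : lvl (scode S) k j = lvl (scode S) k i + 1 := by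
      rw [lvl_close hj] at he; omega
    rintro p hp hp' ⟨o, ho⟩
    have hlp := hall p hp hp'.le
    have hlp' := hall (p + 1) (by omega) (by omega)
    cases o
    · rw [scode_close] at ho
      obtain ⟨q, hq, hpair⟩ := LvlPair.of_close (a := i + 1) ho (by omega)
        (by rw [lvl_open hi]; omega)
      have := hpair.1
      exact ⟨q, ⟨by omega, by omega⟩, Or.inr ((ih (p - q) (by omega) q p rfl).2 ⟨k, hpair⟩)⟩
    · rw [scode_open] at ho
      obtain ⟨q, hq, hpair⟩ := LvlPair.of_open ho hp' (by omega)
      have := hpair.1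
      exact ⟨q, ⟨by omega, by omega⟩, Or.inl ((ih (q - p) (by omega) p q rfl).2 ⟨k, hpair⟩)⟩

/-! ### Level functions of balanced strings as walks on the natural numbers. -/

/-- A matching pair of a walk on the natural numbers. -/
def PairAt (c : ℕ → ℕ) (k : ℕ) (E : ℕ → ℕ) (i j : ℕ) : Prop :=
  i < j ∧ c i = 2 * k + 1 ∧ c j = 2 * k ∧ E (j + 1) = E i ∧ ∀ r, i < r → r ≤ j → E i < E r

/-- `E` is the level function of a balanced string of length `n` with symbol codes `c`,
for the parentheses of type `k`. -/
structure Walk (n k : ℕ) (c E : ℕ → ℕ) : Prop where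
  zero : E 0 = 0
  opn : ∀ q, c q = 2 * k + 1 → E (q + 1) = E q + 1
  cls : ∀ q, c q = 2 * k → E (q + 1) + 1 = E q
  neu : ∀ q, c q ≠ 2 * k + 1 → c q ≠ 2 * k → E (q + 1) = E q
  ran : ∀ q, (c q = 2 * k + 1 ∨ c q = 2 * k) → q < n
  mat : ∀ q, c q = 2 * k + 1 → ∃ j, PairAt c k E q j

/-- The level function with values in the natural numbers. -/
def nlvl (c : ℕ → ℕ) (k q : ℕ) : ℕ := (lvl c k q).toNat

/-- After a close parenthesis the level is that of an earlier position, namely of its partner, so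
strong induction applies. It follows that levels can be taken in `ℕ`. -/
theorem BalancedIn.lvl_nonneg {k : Fin t} {S : List (Paren t)} (h : BalancedIn k S) (q : ℕ) :
    0 ≤ lvl (scode S) k q := by
  induction q using Nat.strong_induction_on with
  | _ q ih =>
  rcases q with _ | q
  · simp [lvl]
  have h0 := ih q (by omega)
  rcases lvl_step (c := scode S) (k := k) q with h1 | h1 | h1
  · omega
  · obtain ⟨j, hj⟩ := h q false ((scode_close _ _ _).2 h1.1)
    rcases hj with hj | hj
    · obtain ⟨k', hp⟩ := (matches_iff _ _ _).1 hj
      have := hp.2.1; omega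
    · obtain ⟨k', hp⟩ := (matches_iff _ _ _).1 hj
      have hk : k'.val = k.val := by have := hp.2.2.1; omega
      rw [hk] at hp
      rw [hp.2.2.2.1]
      exact ih j (by have := hp.1; omega)
  · omega

theorem BalancedIn.pairAt_iff {k : Fin t} {S : List (Paren t)} (h : BalancedIn k S) (i j : ℕ) :
    PairAt (scode S) k (nlvl (scode S) k) i j ↔ LvlPair (scode S) k i j := by
  have hn := h.lvl_nonneg
  unfold PairAt LvlPair nlvl
  have e1 : ∀ a b, (lvl (scode S) k a).toNat = (lvl (scode S) k b).toNat ↔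
      lvl (scode S) k a = lvl (scode S) k b := by
    intro a b; have := hn a; have := hn b; omega
  have e2 : ∀ a b, (lvl (scode S) k a).toNat < (lvl (scode S) k b).toNat ↔
      lvl (scode S) k a < lvl (scode S) k b := by
    intro a b; have := hn a; have := hn b; omega
  simp only [e1, e2]

theorem BalancedIn.matches_iff_pairAt {k : Fin t} {S : List (Paren t)} (h : BalancedIn k S)
    {i j : ℕ} (hi : scode S i = 2 * k.val + 1 ∨ scode S j = 2 * k.val) :
    Matches S i j ↔ PairAt (scode S) k (nlvl (scode S) k) i j := by
  rw [h.pairAt_iff, matches_iff]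
  constructor
  · rintro ⟨k', hp⟩
    have : k'.val = k.val := by have := hp.2.1; have := hp.2.2.1; omega
    rwa [this] at hp
  · exact fun hp => ⟨k, hp⟩

theorem BalancedIn.walk {k : Fin t} {S : List (Paren t)} (h : BalancedIn k S) :
    Walk S.length k (scode S) (nlvl (scode S) k) where
  zero := by simp [nlvl, lvl]
  opn q hq := by
    have := h.lvl_nonneg q; have := lvl_open hq; unfold nlvl; omega
  cls q hq := by
    have := h.lvl_nonneg (q + 1); have := lvl_close hq; unfold nlvl; omega
  neu q hq hq' := by
    have := lvl_neutral hq hq'; unfold nlvl; omega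
  ran q hq := by
    rw [← scode_lt_iff]; have := k.isLt; omega
  mat q hq := by
    obtain ⟨j, hj | hj⟩ := h q true ((scode_open _ _ _).2 hq)
    · exact ⟨j, (h.matches_iff_pairAt (Or.inl hq)).1 hj⟩
    · obtain ⟨k', hp⟩ := (matches_iff _ _ _).1 hj
      have := hp.2.2.1; omega

section Walk
variable {n k : ℕ} {c E : ℕ → ℕ}

theorem Walk.step (W : Walk n k c E) (q : ℕ) : (c q = 2 * k + 1 ∧ E (q + 1) = E q + 1) ∨
    (c q = 2 * k ∧ E (q + 1) + 1 = E q) ∨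
    (c q ≠ 2 * k + 1 ∧ c q ≠ 2 * k ∧ E (q + 1) = E q) := by
  by_cases h : c q = 2 * k + 1
  · exact Or.inl ⟨h, W.opn q h⟩
  by_cases h' : c q = 2 * k
  · exact Or.inr (Or.inl ⟨h', W.cls q h'⟩)
  · exact Or.inr (Or.inr ⟨h, h', W.neu q h h'⟩)

theorem Walk.le (W : Walk n k c E) (q : ℕ) : E q ≤ q := by
  induction q with
  | zero => exact W.zero.le
  | succ q ih => rcases W.step q with h | h | h <;> omega

theorem Walk.le_add (W : Walk n k c E) (q d : ℕ) : E (q + d) ≤ E q + d := by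
  induction d with
  | zero => simp
  | succ d ih =>
    rw [← add_assoc]
    rcases W.step (q + d) with h | h | h <;> omega

theorem Walk.le_sub (W : Walk n k c E) (q d : ℕ) : E q ≤ E (q + d) + d := by
  induction d with
  | zero => simp
  | succ d ih =>
    have e : q + (d + 1) = q + d + 1 := rfl
    rw [e]
    rcases W.step (q + d) with h | h | h <;> omega

theorem PairAt.unique_right {i j j' : ℕ} (h : PairAt c k E i j) (h' : PairAt c k E i j') :
    j = j' := by
  rcases Nat.lt_trichotomy j j' with hlt | rfl | hlt
  · have := h'.2.2.2.2 (j + 1) (by have := h.1; omega) (by omega)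
    have := h.2.2.2.1; omega
  · rfl
  · have := h.2.2.2.2 (j' + 1) (by have := h'.1; omega) (by omega)
    have := h'.2.2.2.1; omega

theorem PairAt.unique_left {i i' j : ℕ} (h : PairAt c k E i j)
    (h' : PairAt c k E i' j) : i = i' := by
  have e1 := h.2.2.2.1
  have e2 := h'.2.2.2.1
  rcases Nat.lt_trichotomy i i' with hlt | rfl | hlt
  · have := h.2.2.2.2 i' hlt (by have := h'.1; omega); omega
  · rfl
  · have := h'.2.2.2.2 i hlt (by have := h.1; omega); omega

/-- Matching pairs do not cross: if `b` were beyond `j`, the level after `j`, which is `E i`, would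
have to exceed `E a > E i`. -/
theorem PairAt.nested {i j a b : ℕ} (h : PairAt c k E i j) (h' : PairAt c k E a b)
    (hia : i < a) (haj : a < j) : b < j := by
  have h1 := h.2.2.2.2 a hia haj.le
  by_contra hb
  have hbj : b ≠ j := by
    rintro rfl
    have := h.2.2.2.1; have := h'.2.2.2.1; omega
  have := h'.2.2.2.2 (j + 1) (by omega) (by omega)
  have := h.2.2.2.1
  omega

/-- Every close parenthesis is matched. -/
theorem Walk.mat_close (W : Walk n k c E) {j : ℕ} (hj : c j = 2 * k) :
    ∃ i, PairAt c k E i j := by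
  classical
  have hE := W.cls j hj
  let P : ℕ → Prop := fun r => E r ≤ E (j + 1)
  have h0 : P 0 := by show E 0 ≤ _; rw [W.zero]; omega
  have hs : P (Nat.findGreatest P j) := Nat.findGreatest_spec (P := P) (Nat.zero_le j) h0
  have hmax : ∀ r, Nat.findGreatest P j < r → r ≤ j → E (j + 1) < E r := by
    intro r hr hr'
    have := Nat.findGreatest_is_greatest hr hr'
    show _
    simp only [P, not_le] at this
    exact this
  have hle : Nat.findGreatest P j ≤ j := Nat.findGreatest_le j
  generalize Nat.findGreatest P j = i at *
  simp only [P] at hs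
  have hij : i ≠ j := by rintro rfl; omega
  have h1 := hmax (i + 1) (by omega) (by omega)
  rcases W.step i with h | h | h
  · have e : E (j + 1) = E i := by omega
    exact ⟨i, by omega, h.1, hj, e, fun r hr hr' => by rw [← e]; exact hmax r hr hr'⟩
  · omega
  · omega

/-- The number of close parentheses in `[a, b)` after which the level is `v`. -/
def ccount (c E : ℕ → ℕ) (k v a b : ℕ) : ℕ :=
  ((Finset.Ico a b).filter fun r => c r = 2 * k ∧ E (r + 1) = v).card

theorem ccount_add {v a b d : ℕ} (hab : a ≤ b) (hbd : b ≤ d) :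
    ccount c E k v a d = ccount c E k v a b + ccount c E k v b d := by
  unfold ccount
  rw [← Finset.card_union_of_disjoint, ← Finset.filter_union, Finset.Ico_union_Ico_eq_Ico hab hbd]
  exact Finset.disjoint_filter_filter (Finset.Ico_disjoint_Ico_consecutive a b d)

theorem ccount_succ {v a b : ℕ} (hab : a ≤ b) :
    ccount c E k v a (b + 1) = ccount c E k v a b +
      if c b = 2 * k ∧ E (b + 1) = v then 1 else 0 := by
  rw [ccount_add hab (Nat.le_succ b)]
  congr 1
  unfold ccount
  rw [Nat.Ico_succ_singleton, Finset.filter_singleton]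
  split <;> simp

theorem ccount_self {v a : ℕ} : ccount c E k v a a = 0 := by
  simp [ccount]

theorem ccount_le {v a b : ℕ} : ccount c E k v a b ≤ b - a := by
  unfold ccount
  exact (Finset.card_filter_le _ _).trans (by simp)

theorem ccount_eq_zero {v a b : ℕ} (h : ∀ r, a ≤ r → r < b → c r = 2 * k → E (r + 1) ≠ v) :
    ccount c E k v a b = 0 := by
  unfold ccount
  rw [Finset.card_eq_zero, Finset.filter_eq_empty_iff]
  intro r hr
  rw [Finset.mem_Ico] at hr
  exact fun h' => h r hr.1 hr.2 h'.1 h'.2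

/-- Up-steps from and down-steps to a level balance. -/
theorem Walk.open_count (W : Walk n k c E) {v a b : ℕ} (hab : a ≤ b) :
    ((Finset.Ico a b).filter fun r => c r = 2 * k + 1 ∧ E r = v).card +
      (if v < E a then 1 else 0) = ccount c E k v a b + if v < E b then 1 else 0 := by
  induction b, hab using Nat.le_induction with
  | base => simp [ccount]
  | succ b hab ih =>
    rw [ccount_succ hab, ← Finset.insert_Ico_right_eq_Ico_add_one hab, Finset.filter_insert]
    have hn : b ∉ Finset.filter (fun r => c r = 2 * k + 1 ∧ E r = v) (Finset.Ico a b) := by simp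
    generalize (if v < E a then 1 else 0) = z at *
    rcases W.step b with ⟨h, h'⟩ | ⟨h, h'⟩ | ⟨h, h'', h'⟩
    · have hc : c b ≠ 2 * k := by omega
      by_cases hv : E b = v
      · rw [if_pos ⟨h, hv⟩, Finset.card_insert_of_notMem hn, if_neg (by tauto)]
        rw [if_neg (by omega : ¬ v < E b)] at ih
        rw [if_pos (by omega : v < E (b + 1))]
        omega
      · rw [if_neg (by tauto), if_neg (by tauto)]
        have : (v < E (b + 1)) ↔ v < E b := by omega
        simp only [this]
        omega
    · have hc : c b ≠ 2 * k + 1 := by omega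
      rw [if_neg (by tauto)]
      by_cases hv : E (b + 1) = v
      · rw [if_pos ⟨h, hv⟩, if_neg (by omega : ¬ v < E (b + 1))]
        rw [if_pos (by omega : v < E b)] at ih
        omega
      · rw [if_neg (by tauto)]
        have : (v < E (b + 1)) ↔ v < E b := by omega
        simp only [this]
        omega
    · rw [if_neg (by tauto), if_neg (by tauto), h']
      omega

end Walk

/-! ### The number `son` as a count of close parentheses at one level. -/

theorem closeUp_of_matches {S : List (Paren t)} {k : Fin t} {i : ℕ} (h : ∃ j, Matches S i j) :
    closeUp S k i = S := by
  have : sInf {m : ℕ | ∃ j : ℕ, Matches (S ++ List.replicate m ⟨k, false⟩) i j} = 0 := by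
    rw [Nat.sInf_eq_zero]
    left
    simpa using h
  unfold closeUp
  rw [this]; simp

theorem BalancedIn.isMatchOf_open {k : Fin t} {S : List (Paren t)} (h : BalancedIn k S)
    {i j : ℕ} (hi : scode S i = 2 * k.val + 1) :
    IsMatchOf S i j ↔ PairAt (scode S) k (nlvl (scode S) k) i j := by
  unfold IsMatchOf
  rw [h.matches_iff_pairAt (Or.inl hi)]
  constructor
  · rintro (hp | hp)
    · exact hp
    · obtain ⟨k', hp⟩ := (matches_iff _ _ _).1 hp
      have := hp.2.2.1; omega
  · exact Or.inl

theorem BalancedIn.isMatchOf_close {k : Fin t} {S : List (Paren t)} (h : BalancedIn k S)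
    {i j : ℕ} (hi : scode S i = 2 * k.val) :
    IsMatchOf S i j ↔ PairAt (scode S) k (nlvl (scode S) k) j i := by
  unfold IsMatchOf
  rw [h.matches_iff_pairAt (j := i) (Or.inr hi)]
  constructor
  · rintro (hp | hp)
    · obtain ⟨k', hp⟩ := (matches_iff _ _ _).1 hp
      have := hp.2.1; omega
    · exact hp
  · exact Or.inr

/-- `son` at an open parenthesis of a balanced string counts the matching pairs nested directly
inside. -/
theorem BalancedIn.sonOpen_eq {k : Fin t} {S : List (Paren t)} (h : BalancedIn k S) {i i' : ℕ}
    (hp : PairAt (scode S) k (nlvl (scode S) k) i i') :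
    sonOpen S k i =
      2 * ccount (scode S) (nlvl (scode S) k) k (nlvl (scode S) k i + 1) (i + 1) i' := by
  classical
  have W := h.walk
  set c := scode S with hc
  set E := nlvl c k with hE
  have hmi : Matches S i i' := (h.matches_iff_pairAt (Or.inl hp.2.1)).2 hp
  have hcl : closeUp S k i = S := closeUp_of_matches ⟨i', hmi⟩
  have hi' : i' < S.length := W.ran i' (Or.inr hp.2.2.1)
  have hEi := W.opn i hp.2.1
  have hEi' : E i' = E i + 1 := by have := W.cls i' hp.2.2.1; have := hp.2.2.2.1; omega
  have hencl : ∀ a b j j', EnclosingPair k S j j' a b ↔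
      PairAt c k E a b ∧ (a < j ∧ j < b) ∧ (a < j' ∧ j' < b) := by
    intro a b j j'
    unfold EnclosingPair
    rw [scode_open]
    constructor
    · rintro ⟨h1, h2, h3⟩
      exact ⟨(h.matches_iff_pairAt (Or.inl h2)).1 h1, h3⟩
    · rintro ⟨h1, h3⟩
      exact ⟨(h.matches_iff_pairAt (Or.inl h1.2.1)).2 h1, h1.2.1, h3⟩
  -- the closest enclosing pair of a pair
  have key : ∀ a b, PairAt c k E a b → (IsEnclose k S a b i i' ↔ (i < a ∧ b < i') ∧ E a = E i + 1) := by
    intro a b hab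
    have hab1 := hab.1
    unfold IsEnclose
    simp only [hencl]
    constructor
    · rintro ⟨⟨-, h1, h2⟩, h3⟩
      refine ⟨⟨h1.1, h2.2⟩, ?_⟩
      by_contra hne
      have hgt := hp.2.2.2.2 a h1.1 h1.2.le
      -- the last open parenthesis at the lower level
      let P : ℕ → Prop := fun r => E r ≤ E i + 1
      have h0 : P (i + 1) := hEi.le
      have hs : P (Nat.findGreatest P a) := Nat.findGreatest_spec (P := P) (by omega) h0
      have hge : i + 1 ≤ Nat.findGreatest P a := Nat.le_findGreatest (by omega) h0
      have hmax : ∀ r, Nat.findGreatest P a < r → r ≤ a → E i + 1 < E r := by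
        intro r hr hr'
        have := Nat.findGreatest_is_greatest hr hr'
        simp only [P, not_le] at this
        exact this
      have hle : Nat.findGreatest P a ≤ a := Nat.findGreatest_le a
      generalize Nat.findGreatest P a = p at *
      simp only [P] at hs
      have hpa : p ≠ a := by rintro rfl; omega
      have hp1 := hmax (p + 1) (by omega) (by omega)
      rcases W.step p with hw | hw | hw
      · obtain ⟨p', hpp⟩ := W.mat p hw.1
        have hpp1 := hpp.1
        have hpa' : a < p' := by
          by_contra hcon
          rcases Nat.lt_or_ge p' a with hlt | hge'
          · have := hmax (p' + 1) (by omega) (by omega)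
            have := hpp.2.2.2.1
            omega
          · have : p' = a := by omega
            subst this
            have := hpp.2.2.1; have := hab.2.1; omega
        have hb' := hpp.nested hab (by omega) hpa'
        have := (h3 p p' ⟨hpp, ⟨by omega, by omega⟩, ⟨by omega, by omega⟩⟩).1
        omega
      · omega
      · omega
    · rintro ⟨⟨h1, h2⟩, h3⟩
      refine ⟨⟨hp, ⟨h1, by omega⟩, ⟨by omega, h2⟩⟩, ?_⟩
      rintro d e ⟨hde, h4, h5⟩
      have hdi : d ≤ i := by
        by_contra hcon
        have := hde.2.2.2.2 a h4.1 h4.2.le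
        have := hp.2.2.2.2 d (by omega) (by omega)
        omega
      refine ⟨hdi, ?_⟩
      rcases Nat.lt_or_ge d i with hlt | hge
      · exact (hde.nested hp hlt (by omega)).le
      · have : d = i := by omega
        subst this
        exact (hp.unique_right hde).le
  -- The counted positions come in two kinds: left ends, which have level `E i + 1` before them, and
  -- right ends, which have this level after them.
  have hset : ((Finset.range S.length).filter fun j : ℕ =>
      i < j ∧ (∃ o : Bool, S[j]? = some ⟨k, o⟩) ∧
        ∃ j' i'' : ℕ, IsMatchOf (closeUp S k i) j j' ∧ IsMatchOf (closeUp S k i) i i'' ∧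
          IsEnclose k (closeUp S k i) j j' i i'') =
      ((Finset.Ico (i + 1) i').filter fun r => c r = 2 * k.val + 1 ∧ E r = E i + 1) ∪
      ((Finset.Ico (i + 1) i').filter fun r => c r = 2 * k.val ∧ E (r + 1) = E i + 1) := by
    rw [hcl]
    ext j
    simp only [Finset.mem_filter, Finset.mem_range, Finset.mem_union, Finset.mem_Ico]
    have hsymm : ∀ a b, IsEnclose k S b a i i' ↔ IsEnclose k S a b i i' := by
      intro a b
      unfold IsEnclose EnclosingPair
      constructor
      · rintro ⟨⟨h1, h2, h3, h4⟩, h5⟩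
        exact ⟨⟨h1, h2, h4, h3⟩, fun a b ⟨g1, g2, g3, g4⟩ => h5 a b ⟨g1, g2, g4, g3⟩⟩
      · rintro ⟨⟨h1, h2, h3, h4⟩, h5⟩
        exact ⟨⟨h1, h2, h4, h3⟩, fun a b ⟨g1, g2, g3, g4⟩ => h5 a b ⟨g1, g2, g4, g3⟩⟩
    constructor
    · rintro ⟨hj, hij, ⟨o, ho⟩, j', i'', hjj, hii, he⟩
      have : i'' = i' := ((h.isMatchOf_open hp.2.1).1 hii).unique_right hp
      subst this
      cases o
      · right
        have hcj := (scode_close _ _ _).1 ho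
        have hpj := (h.isMatchOf_close hcj).1 hjj
        have := (key j' j hpj).1 ((hsymm _ _).1 he)
        refine ⟨⟨by omega, this.1.2⟩, hcj, hpj.2.2.2.1.trans this.2⟩
      · left
        have hcj := (scode_open _ _ _).1 ho
        have hpj := (h.isMatchOf_open hcj).1 hjj
        have := (key j j' hpj).1 he
        refine ⟨⟨by omega, by have := hpj.1; omega⟩, hcj, this.2⟩
    · rintro (⟨hj, hcj, hEj⟩ | ⟨hj, hcj, hEj⟩)
      · obtain ⟨j', hpj⟩ := W.mat j hcj
        have hjj := hp.nested hpj (by omega) hj.2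
        exact ⟨by omega, by omega, ⟨true, (scode_open _ _ _).2 hcj⟩, j', i',
          (h.isMatchOf_open hcj).2 hpj, (h.isMatchOf_open hp.2.1).2 hp,
          (key j j' hpj).2 ⟨⟨by omega, hjj⟩, hEj⟩⟩
      · obtain ⟨j', hpj⟩ := W.mat_close hcj
        have e := hpj.2.2.2.1
        have hlt := hpj.1
        have hij : i < j' := by
          by_contra hcon
          rcases Nat.lt_or_ge j' i with hlt' | hge
          · have := hpj.2.2.2.2 i hlt' (by omega); omega
          · have : j' = i := by omega
            subst this; omega
        exact ⟨by omega, by omega, ⟨false, (scode_close _ _ _).2 hcj⟩, j', i',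
          (h.isMatchOf_close hcj).2 hpj, (h.isMatchOf_open hp.2.1).2 hp,
          (hsymm _ _).2 ((key j' j hpj).2 ⟨⟨hij, by omega⟩, by omega⟩)⟩
  unfold sonOpen
  -- Both ends of the range have level exactly `E i + 1`, so the two correction terms of
  -- `Walk.open_count` vanish, and there are as many left ends as right ends.
  have hcard : ((Finset.Ico (i + 1) i').filter fun r => c r = 2 * k.val + 1 ∧ E r = E i + 1).card =
      ccount c E k (E i + 1) (i + 1) i' := by
    have := W.open_count (v := E i + 1) (a := i + 1) (b := i') hp.1
    rw [hEi, hEi'] at this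
    simpa using this
  have hcard2 : ((Finset.Ico (i + 1) i').filter fun r => c r = 2 * k.val ∧
      E (r + 1) = E i + 1).card = ccount c E k (E i + 1) (i + 1) i' := rfl
  rw [show ∀ s₁ s₂ : Finset ℕ, s₁ = s₂ → s₁.card = s₂.card from fun _ _ h => by rw [h]]
  rotate_left 2
  · convert hset
  rw [Finset.card_union_of_disjoint, hcard, hcard2]
  · ring
  · rw [Finset.disjoint_filter]
    intro r _ h1 h2
    omega

/-! ### Reversal -/

theorem length_rev (S : List (Paren t)) : (rev S).length = S.length := by simp [rev]

theorem rev_getElem? (S : List (Paren t)) {q : ℕ} (h : q < S.length) :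
    (rev S)[q]? = (S[S.length - 1 - q]?).map Paren.opposite := by
  unfold rev
  rw [List.getElem?_reverse (by simpa using h)]
  simp

theorem code_opposite (p : Paren t) :
    code p.opposite = if code p % 2 = 1 then code p - 1 else code p + 1 := by
  unfold code Paren.opposite
  cases p.isOpen <;> simp

theorem scode_rev (S : List (Paren t)) {q : ℕ} (h : q < S.length) :
    scode (rev S) q = if scode S (S.length - 1 - q) % 2 = 1 then scode S (S.length - 1 - q) - 1
      else scode S (S.length - 1 - q) + 1 := by
  have h' : S.length - 1 - q < S.length := by omega
  simp only [scode, rev_getElem? S h, List.getElem?_eq_getElem h', Option.map_some,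
    Option.getD_some, code_opposite]

/-- Reversal exchanges open and close and also the direction of reading; the two sign changes
cancel, and subtracting the final level makes the reversed walk start at `0`. -/
theorem lvl_rev (S : List (Paren t)) (k : Fin t) {q : ℕ} (h : q ≤ S.length) :
    lvl (scode (rev S)) k q = lvl (scode S) k (S.length - q) - lvl (scode S) k S.length := by
  induction q with
  | zero => simp [lvl]
  | succ q ih =>
    have ih := ih (by omega)
    have hs := scode_rev S (q := q) (by omega)
    have e : S.length - q = (S.length - 1 - q) + 1 := by omega
    have e' : S.length - (q + 1) = S.length - 1 - q := by omega
    rw [e'] 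
    rw [e] at ih
    rcases lvl_step (c := scode S) (k := k) (S.length - 1 - q) with h1 | h1 | h1
    · rw [h1.1] at hs
      have : scode (rev S) q = 2 * k.val := by rw [hs]; rw [if_pos (by omega)]; rfl
      rw [lvl_close this]; omega
    · rw [h1.1] at hs
      have : scode (rev S) q = 2 * k.val + 1 := by rw [hs]; rw [if_neg (by omega)]
      rw [lvl_open this]; omega
    · rw [lvl_neutral]
      · omega
      · rw [hs]; split <;> omega
      · rw [hs]; split <;> omega

theorem LvlPair.rev {S : List (Paren t)} {k : Fin t} {i j : ℕ} (h : LvlPair (scode S) k i j)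
    (hj : j < S.length) :
    LvlPair (scode (rev S)) k (S.length - 1 - j) (S.length - 1 - i) := by
  obtain ⟨h1, h2, h3, h4, h5⟩ := h
  have hlj := lvl_close h3
  have hli := lvl_open h2
  refine ⟨by omega, ?_, ?_, ?_, ?_⟩
  · rw [scode_rev S (by omega), show S.length - 1 - (S.length - 1 - j) = j by omega, h3,
      if_neg (by omega)]
  · rw [scode_rev S (by omega), show S.length - 1 - (S.length - 1 - i) = i by omega, h2,
      if_pos (by omega)]
    rfl
  · rw [lvl_rev S k (by omega), lvl_rev S k (by omega),
      show S.length - (S.length - 1 - i + 1) = i by omega,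
      show S.length - (S.length - 1 - j) = j + 1 by omega, h4]
  · intro r hr hr'
    rw [lvl_rev S k (by omega), lvl_rev S k (by omega),
      show S.length - (S.length - 1 - j) = j + 1 by omega, h4]
    have := h5 (S.length - r) (by omega) (by omega)
    omega

theorem Balanced.rev {S : List (Paren t)} (h : Balanced S) : Balanced (rev S) := by
  intro k i o hi
  have hi' : i < S.length := by
    rw [← length_rev]; exact (List.getElem?_eq_some_iff.1 hi).1
  have hi0 := hi
  rw [rev_getElem? S hi'] at hi
  obtain ⟨p, hp, hpo⟩ := Option.map_eq_some_iff.1 hi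
  have hp' : S[S.length - 1 - i]? = some ⟨k, !o⟩ := by
    rw [hp]
    obtain ⟨k', o'⟩ := p
    simp only [Paren.opposite, Paren.mk.injEq] at hpo
    rw [← hpo.1, ← hpo.2]; simp
  obtain ⟨j, hj⟩ := h k _ _ hp'
  have hlen : ∀ {q : ℕ}, scode S q = 2 * k.val ∨ scode S q = 2 * k.val + 1 → q < S.length := by
    intro q hq; rw [← scode_lt_iff]; have := k.isLt; omega
  rcases hj with hj | hj
  · obtain ⟨k', hpair⟩ := (matches_iff _ _ _).1 hj
    have hjl : j < S.length := by
      rw [← scode_lt_iff]; have := k'.isLt; have := hpair.2.2.1; omega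
    have := hpair.rev hjl
    rw [show S.length - 1 - (S.length - 1 - i) = i by omega] at this
    exact ⟨_, Or.inr ((matches_iff _ _ _).2 ⟨k', this⟩)⟩
  · obtain ⟨k', hpair⟩ := (matches_iff _ _ _).1 hj
    have := hpair.rev (by omega)
    rw [show S.length - 1 - (S.length - 1 - i) = i by omega] at this
    exact ⟨_, Or.inl ((matches_iff _ _ _).2 ⟨k', this⟩)⟩

end ParenString

/-! ### Structured programs and their compilation. -/

namespace WordRAM

theorem HaltsWithin.mono {w : ℕ} {P : Program} {T T' : ℕ} {s s' : State}
    (h : HaltsWithin w P T s s') (hT : T ≤ T') : HaltsWithin w P T' s s' := by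
  induction h generalizing T' with
  | done T s h => exact .done _ _ h
  | step T s s' I h _ ih =>
    obtain ⟨T', rfl⟩ : ∃ T'', T' = T'' + 1 := ⟨T' - 1, by omega⟩
    exact .step _ _ _ I h (ih (by omega))

/-- Structured programs. -/
inductive Cmd where
  | basic (I : Instr)
  | seq (c d : Cmd)
  | ite (a b : ℕ) (c d : Cmd)
  | loop (a b : ℕ) (c : Cmd)

/-- The length of the compiled program. -/
def Cmd.size : Cmd → ℕ
  | .basic _ => 1
  | .seq c d => c.size + d.size
  | .ite _ _ c d => 2 + d.size + c.size
  | .loop _ _ c => 3 + c.size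

/-- Compilation of a structured program to be placed at the given address. -/
def Cmd.compile : Cmd → ℕ → Program
  | .basic I, _ => [I]
  | .seq c d, p => c.compile p ++ d.compile (p + c.size)
  | .ite a b c d, p =>
      .jumpLT a b (p + 2 + d.size) :: (d.compile (p + 1) ++
        (.jump (p + 2 + d.size + c.size) :: c.compile (p + 2 + d.size)))
  | .loop a b c, p =>
      .jumpLT a b (p + 2) :: .jump (p + 3 + c.size) :: (c.compile (p + 2) ++ [.jump p])

theorem Cmd.length_compile (c : Cmd) (p : ℕ) : (c.compile p).length = c.size := by
  induction c generalizing p <;> simp_all [Cmd.compile, Cmd.size] <;> omega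

/-- The program `P` contains the code `Q` at the address `p`. -/
def HasCode (P : Program) (p : ℕ) (Q : Program) : Prop :=
  ∀ i < Q.length, P[p + i]? = Q[i]?

theorem HasCode.append {P : Program} {p : ℕ} {Q Q' : Program} (h : HasCode P p (Q ++ Q')) :
    HasCode P p Q ∧ HasCode P (p + Q.length) Q' := by
  constructor
  · intro i hi
    rw [h i (by simp; omega), List.getElem?_append_left hi]
  · intro i hi
    have := h (Q.length + i) (by simp; omega)
    rw [List.getElem?_append_right (by omega)] at this
    rw [add_assoc, this]; simp

theorem HasCode.cons {P : Program} {p : ℕ} {I : Instr} {Q : Program} (h : HasCode P p (I :: Q)) :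
    P[p]? = some I ∧ HasCode P (p + 1) Q := by
  constructor
  · simpa using h 0 (by simp)
  · intro i hi
    have := h (i + 1) (by simpa using hi)
    rw [add_assoc, add_comm 1 i, this]; simp

/-- The structured program leads from the first registers and memory to the second ones. -/
def Runs (w : ℕ) (c : Cmd) (reg : ℕ → ℕ) (mem : ℕ → Bool) (reg' : ℕ → ℕ) (mem' : ℕ → Bool)
    (T : ℕ) : Prop :=
  ∀ P p, HasCode P p (c.compile p) → ∀ T₀ sf,
    HaltsWithin w P T₀ ⟨p + c.size, reg', mem'⟩ sf → HaltsWithin w P (T + T₀) ⟨p, reg, mem⟩ sf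

section Runs
variable {w : ℕ} {c d : Cmd} {reg reg' reg'' : ℕ → ℕ} {mem mem' mem'' : ℕ → Bool} {T T' : ℕ}

theorem Runs.mono (h : Runs w c reg mem reg' mem' T) (hT : T ≤ T') :
    Runs w c reg mem reg' mem' T' :=
  fun P p hP T₀ sf hs => (h P p hP T₀ sf hs).mono (by omega)

theorem Runs.basic {I : Instr}
    (h : ∀ p, I.exec w ⟨p, reg, mem⟩ = ⟨p + 1, reg', mem'⟩) :
    Runs w (.basic I) reg mem reg' mem' 1 := by
  intro P p hP T₀ sf hs
  rw [add_comm]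
  refine .step _ _ _ I (HasCode.cons hP).1 ?_
  rw [h]; exact hs

theorem Runs.const (d v : ℕ) :
    Runs w (.basic (.const d v)) reg mem (Function.update reg d (v % 2 ^ w)) mem 1 :=
  Runs.basic fun _ => rfl

theorem Runs.op (o : Op) (d a b : ℕ) : Runs w (.basic (.op o d a b)) reg mem
    (Function.update reg d (o.eval w (reg a) (reg b))) mem 1 :=
  Runs.basic fun _ => rfl

theorem Runs.load (d a l : ℕ) : Runs w (.basic (.load d a l)) reg mem
    (Function.update reg d (readBits mem (reg a) (min (reg l) w))) mem 1 :=
  Runs.basic fun _ => rfl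

theorem Runs.store (r a l : ℕ) : Runs w (.basic (.store r a l)) reg mem
    reg (writeBits mem (reg a) (min (reg l) w) (reg r)) 1 :=
  Runs.basic fun _ => rfl

theorem Runs.seq (h : Runs w c reg mem reg' mem' T) (h' : Runs w d reg' mem' reg'' mem'' T') :
    Runs w (.seq c d) reg mem reg'' mem'' (T + T') := by
  intro P p hP T₀ sf hs
  obtain ⟨h1, h2⟩ := HasCode.append hP
  rw [Cmd.length_compile] at h2
  rw [add_assoc]
  refine h P p h1 _ _ (h' P _ h2 _ _ ?_)
  rw [add_assoc]; exact hs

theorem Runs.ite {a b : ℕ} (h : reg a < reg b → Runs w c reg mem reg' mem' T)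
    (h' : ¬ reg a < reg b → Runs w d reg mem reg' mem' T) :
    Runs w (.ite a b c d) reg mem reg' mem' (T + 2) := by
  intro P p hP T₀ sf hs
  obtain ⟨h1, h2⟩ := HasCode.cons hP
  obtain ⟨h2, h3⟩ := HasCode.append h2
  obtain ⟨h3, h4⟩ := HasCode.cons h3
  rw [Cmd.length_compile] at h3 h4
  rw [show T + 2 + T₀ = (T + (T₀ + 1)) + 1 by ring]
  refine .step _ _ _ _ h1 ?_
  simp only [Instr.exec]
  simp only [Cmd.size] at hs
  by_cases hlt : reg a < reg b
  · rw [if_pos hlt]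
    refine h hlt P _ ?_ _ _ ?_
    · convert h4 using 1; omega
    · refine HaltsWithin.mono ?_ (Nat.le_succ T₀)
      convert hs using 2; omega
  · rw [if_neg hlt]
    refine h' hlt P _ h2 _ _ (.step _ _ _ _ h3 ?_)
    simp only [Instr.exec]
    convert hs using 2; omega

theorem Runs.loop_exit {a b : ℕ} (h : ¬ reg a < reg b) :
    Runs w (.loop a b c) reg mem reg mem 2 := by
  intro P p hP T₀ sf hs
  obtain ⟨h1, h2⟩ := HasCode.cons hP
  obtain ⟨h2, h3⟩ := HasCode.cons h2
  rw [show 2 + T₀ = (T₀ + 1) + 1 by ring]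
  refine .step _ _ _ _ h1 ?_
  simp only [Instr.exec, if_neg h]
  refine .step _ _ _ _ h2 ?_
  simp only [Instr.exec]
  simp only [Cmd.size] at hs
  rw [show p + 3 + c.size = p + (3 + c.size) by ring]
  exact hs

/-- Each round pays two steps beyond its body: the test and the jump back. The rest of the loop is
again a run of the same code at the same address, which allows induction on the rounds. -/
theorem Runs.loop_step {a b : ℕ} (hlt : reg a < reg b) (h : Runs w c reg mem reg' mem' T)
    (h' : Runs w (.loop a b c) reg' mem' reg'' mem'' T') :
    Runs w (.loop a b c) reg mem reg'' mem'' (T + 2 + T') := by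
  intro P p hP T₀ sf hs
  obtain ⟨h1, h2⟩ := HasCode.cons hP
  obtain ⟨h2, h3⟩ := HasCode.cons h2
  obtain ⟨h3, h4⟩ := HasCode.append h3
  obtain ⟨h4, -⟩ := HasCode.cons h4
  rw [Cmd.length_compile] at h4
  rw [show T + 2 + T' + T₀ = (T + (T' + T₀ + 1)) + 1 by ring]
  refine .step _ _ _ _ h1 ?_
  simp only [Instr.exec, if_pos hlt]
  refine h P _ h3 _ _ (.step _ _ _ _ h4 ?_)
  simp only [Instr.exec]
  exact h' P p hP _ _ hs

end Runs

/-! ### Expressions and their evaluation. -/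

/-- Expressions over registers and memory. -/
inductive Expr where
  | reg (r : ℕ)
  | const (v : ℕ)
  | op (o : Op) (a b : Expr)
  | load (a l : Expr)
  | ite (a b c d : Expr)

/-- The value of an expression. -/
def Expr.eval (w : ℕ) (reg : ℕ → ℕ) (mem : ℕ → Bool) : Expr → ℕ
  | .reg r => reg r % 2 ^ w
  | .const v => v % 2 ^ w
  | .op o a b => o.eval w (a.eval w reg mem) (b.eval w reg mem)
  | .load a l => readBits mem (a.eval w reg mem) (min (l.eval w reg mem) w)
  | .ite a b c d =>
      if a.eval w reg mem < b.eval w reg mem then c.eval w reg mem else d.eval w reg mem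

/-- All registers of the expression are below `d`. -/
def Expr.Below (d : ℕ) : Expr → Prop
  | .reg r => r < d
  | .const _ => True
  | .op _ a b => a.Below d ∧ b.Below d
  | .load a l => a.Below d ∧ l.Below d
  | .ite a b c e => a.Below d ∧ b.Below d ∧ c.Below d ∧ e.Below d

theorem Expr.Below.mono {e : Expr} {d d' : ℕ} (h : e.Below d) (hd : d ≤ d') : e.Below d' := by
  induction e <;> simp_all [Expr.Below]
  omega

theorem Expr.eval_congr {w : ℕ} {e : Expr} {d : ℕ} {reg reg' : ℕ → ℕ} {mem : ℕ → Bool}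
    (h : e.Below d) (hr : ∀ r < d, reg' r = reg r) :
    e.eval w reg' mem = e.eval w reg mem := by
  induction e <;> simp_all [Expr.Below, Expr.eval]

/-- Code that puts the value of the expression into register `d`, and uses only the registers
from `d` on. -/
def Expr.code : Expr → ℕ → Cmd
  | .reg r, d => .seq (.basic (.const d 0)) (.basic (.op .or d d r))
  | .const v, d => .basic (.const d v)
  | .op o a b, d => .seq (a.code d) (.seq (b.code (d + 1)) (.basic (.op o d d (d + 1))))
  | .load a l, d => .seq (a.code d) (.seq (l.code (d + 1)) (.basic (.load d d (d + 1))))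
  | .ite a b c e, d =>
      .seq (a.code d) (.seq (b.code (d + 1)) (.ite d (d + 1) (c.code d) (e.code d)))

/-- A bound for the number of steps of the code of an expression. -/
def Expr.cost : Expr → ℕ
  | .reg _ => 2
  | .const _ => 1
  | .op _ a b => a.cost + b.cost + 1
  | .load a l => a.cost + l.cost + 1
  | .ite a b c e => a.cost + b.cost + c.cost + e.cost + 2

/-- The registers from `d` on serve as an evaluation stack. As everything below `d` survives, the
inputs stay readable and an operand in `d` is safe while the next one is computed from `d + 1` on.
-/
theorem Expr.runs (w : ℕ) (e : Expr) (d : ℕ) (reg : ℕ → ℕ) (mem : ℕ → Bool) (h : e.Below d) :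
    ∃ reg', Runs w (e.code d) reg mem reg' mem e.cost ∧ reg' d = e.eval w reg mem ∧
      ∀ r < d, reg' r = reg r := by
  have two : ∀ (a b : Expr) (d : ℕ) (reg : ℕ → ℕ), a.Below d → b.Below d →
      (∀ (d : ℕ) (reg : ℕ → ℕ), a.Below d →
        ∃ reg', Runs w (a.code d) reg mem reg' mem a.cost ∧ reg' d = a.eval w reg mem ∧
          ∀ r < d, reg' r = reg r) →
      (∀ (d : ℕ) (reg : ℕ → ℕ), b.Below d →
        ∃ reg', Runs w (b.code d) reg mem reg' mem b.cost ∧ reg' d = b.eval w reg mem ∧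
          ∀ r < d, reg' r = reg r) →
      ∃ r1 r2, Runs w (a.code d) reg mem r1 mem a.cost ∧
        Runs w (b.code (d + 1)) r1 mem r2 mem b.cost ∧ r2 d = a.eval w reg mem ∧
        r2 (d + 1) = b.eval w reg mem ∧ ∀ r < d, r2 r = reg r := by
    intro a b d reg ha hb iha ihb
    obtain ⟨r1, h1, h1d, h1r⟩ := iha d reg ha
    obtain ⟨r2, h2, h2d, h2r⟩ := ihb (d + 1) r1 (hb.mono (by omega))
    refine ⟨r1, r2, h1, h2, ?_, ?_, ?_⟩
    · rw [h2r d (by omega), h1d]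
    · rw [h2d, Expr.eval_congr hb h1r]
    · intro r hr; rw [h2r r (by omega), h1r r hr]
  induction e generalizing d reg with
  | reg r =>
    have hr : r < d := h
    refine ⟨_, Runs.seq (Runs.const _ _) (Runs.op _ _ _ _), ?_, ?_⟩
    · simp [Op.eval, Expr.eval, hr.ne]
    · intro q hq; simp [hq.ne]
  | const v =>
    refine ⟨_, Runs.const _ _, ?_, ?_⟩
    · simp [Expr.eval]
    · intro q hq; simp [hq.ne]
  | op o a b iha ihb =>
    obtain ⟨r1, r2, h1, h2, hd, hd', hr⟩ := two a b d reg h.1 h.2 iha ihb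
    refine ⟨_, ((Runs.seq h1 (Runs.seq h2 (Runs.op _ _ _ _))).mono
      (by simp [Expr.cost]; omega)), ?_, ?_⟩
    · simp [Expr.eval, hd, hd']
    · intro q hq; simp [hq.ne, hr q hq]
  | load a b iha ihb =>
    obtain ⟨r1, r2, h1, h2, hd, hd', hr⟩ := two a b d reg h.1 h.2 iha ihb
    refine ⟨_, ((Runs.seq h1 (Runs.seq h2 (Runs.load _ _ _))).mono
      (by simp [Expr.cost]; omega)), ?_, ?_⟩
    · simp [Expr.eval, hd, hd']
    · intro q hq; simp [hq.ne, hr q hq]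
  | ite a b c e iha ihb ihc ihe =>
    obtain ⟨r1, r2, h1, h2, hd, hd', hr⟩ := two a b d reg h.1 h.2.1 iha ihb
    obtain ⟨r3, h3, h3d, h3r⟩ := ihc d r2 h.2.2.1
    obtain ⟨r4, h4, h4d, h4r⟩ := ihe d r2 h.2.2.2
    rw [Expr.eval_congr h.2.2.1 hr] at h3d
    rw [Expr.eval_congr h.2.2.2 hr] at h4d
    refine ⟨if r2 d < r2 (d + 1) then r3 else r4, ((Runs.seq h1 (Runs.seq h2
      (Runs.ite (T := c.cost + e.cost) (fun hlt => ?_) (fun hlt => ?_)))).mono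
      (by simp [Expr.cost]; omega)), ?_, ?_⟩
    · rw [if_pos hlt]; exact h3.mono (by omega)
    · rw [if_neg hlt]; exact h4.mono (by omega)
    · rw [hd, hd']
      simp only [Expr.eval]
      split
      · exact h3d
      · exact h4d
    · intro r hr'
      split
      · rw [h3r r hr', hr r hr']
      · rw [h4r r hr', hr r hr']

/-! ### Computable functions of a situation -/

theorem readBits_lt (mem : ℕ → Bool) (a l : ℕ) : readBits mem a l < 2 ^ l := by
  unfold readBits
  induction l with
  | zero => simp
  | succ l ih =>
    rw [Finset.sum_range_succ, pow_succ]
    split <;> omega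

theorem readBits_congr {mem mem' : ℕ → Bool} {a l : ℕ}
    (h : ∀ p, a ≤ p → p < a + l → mem p = mem' p) : readBits mem a l = readBits mem' a l := by
  unfold readBits
  refine Finset.sum_congr rfl fun q hq => ?_
  rw [Finset.mem_range] at hq
  rw [h (a + q) (by omega) (by omega)]

/-- A family of situations, with the registers and memories that represent them. -/
structure Sys (σ : Type) where
  /-- unit for numbers of bits -/
  u : σ → ℕ
  one_le : ∀ x, 1 ≤ u x
  /-- admissible situations -/
  ok : σ → Prop
  /-- the registers and the memory represent the situation -/
  rel : ℕ → σ → (ℕ → ℕ) → (ℕ → Bool) → Prop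

section Comp
variable {σ : Type} {Y : Sys σ} {F G A B : σ → ℕ}

/-- The function is bounded by a multiple of the unit. -/
def Small (Y : Sys σ) (F : σ → ℕ) : Prop := ∃ K, ∀ x, Y.ok x → F x ≤ K * Y.u x

/-- The function is the value of an expression. -/
def Comp (Y : Sys σ) (F : σ → ℕ) : Prop :=
  ∃ (e : Expr) (K : ℕ), e.Below 8 ∧ ∀ x, Y.ok x → ∀ w reg mem, K * Y.u x ≤ w →
    Y.rel w x reg mem → e.eval w reg mem = F x ∧ F x < 2 ^ (K * Y.u x)

theorem Small.of_le (h : Small Y G) (hle : ∀ x, Y.ok x → F x ≤ G x) : Small Y F := by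
  obtain ⟨K, hK⟩ := h
  exact ⟨K, fun x hx => (hle x hx).trans (hK x hx)⟩

theorem Small.const (v : ℕ) : Small Y fun _ => v :=
  ⟨v, fun x _ => Nat.le_mul_of_pos_right _ (Y.one_le x)⟩

theorem Small.const_mul (v : ℕ) (h : Small Y F) : Small Y fun x => v * F x := by
  obtain ⟨K, hK⟩ := h
  exact ⟨v * K, fun x hx => by rw [mul_assoc]; exact Nat.mul_le_mul_left _ (hK x hx)⟩

theorem Comp.congr (h : Comp Y F) (he : ∀ x, Y.ok x → F x = G x) : Comp Y G := by
  obtain ⟨e, K, hb, h⟩ := h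
  exact ⟨e, K, hb, fun x hx w reg mem hw hr => by rw [← he x hx]; exact h x hx w reg mem hw hr⟩

/-- A bound for a computable function. -/
theorem Comp.bound (h : Comp Y F) : ∃ K, ∀ x, Y.ok x → ∀ w reg mem, K * Y.u x ≤ w →
    Y.rel w x reg mem → F x < 2 ^ (K * Y.u x) := by
  obtain ⟨e, K, -, h⟩ := h
  exact ⟨K, fun x hx w reg mem hw hr => (h x hx w reg mem hw hr).2⟩

/-- The machine reduces results modulo `2 ^ w`. The hypothesis `hf` says that the true result still
has a number of bits linear in the unit, so the reduction does nothing once `w` is large enough. -/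
theorem Comp.op (o : Op) (f : ℕ → ℕ → ℕ) (ho : ∀ w x y, o.eval w x y = f x y % 2 ^ w)
    (hF : Comp Y F) (hG : Comp Y G)
    (hf : ∀ K, ∃ K', ∀ x, Y.ok x → F x < 2 ^ (K * Y.u x) → G x < 2 ^ (K * Y.u x) →
      f (F x) (G x) < 2 ^ (K' * Y.u x)) : Comp Y fun x => f (F x) (G x) := by
  obtain ⟨e, K, hb, h⟩ := hF
  obtain ⟨e', K', hb', h'⟩ := hG
  obtain ⟨K'', hK⟩ := hf (K + K')
  refine ⟨.op o e e', K + K' + K'', ⟨hb, hb'⟩, fun x hx w reg mem hw hr => ?_⟩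
  have m : ∀ {a b : ℕ}, a ≤ b → a * Y.u x ≤ b * Y.u x := fun h => Nat.mul_le_mul_right _ h
  have p : ∀ {a b : ℕ}, a ≤ b → 2 ^ (a * Y.u x) ≤ 2 ^ (b * Y.u x) := fun h =>
    Nat.pow_le_pow_right (by norm_num) (m h)
  obtain ⟨h1, h2⟩ := h x hx w reg mem ((m (by omega)).trans hw) hr
  obtain ⟨h3, h4⟩ := h' x hx w reg mem ((m (by omega)).trans hw) hr
  have h5 := hK x hx (h2.trans_le (p (by omega))) (h4.trans_le (p (by omega)))
  have h6 := h5.trans_le (p (by omega : K'' ≤ K + K' + K''))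
  refine ⟨?_, h6⟩
  rw [Expr.eval, ho, h1, h3, Nat.mod_eq_of_lt (h6.trans_le (Nat.pow_le_pow_right (by norm_num) hw))]

theorem Comp.add (hF : Comp Y F) (hG : Comp Y G) : Comp Y fun x => F x + G x := by
  refine hF.op .add (· + ·) (fun _ _ _ => rfl) hG fun K => ⟨K + 1, fun x _ h h' => ?_⟩
  have := Y.one_le x
  have : 2 ^ (K * Y.u x) * 2 ≤ 2 ^ ((K + 1) * Y.u x) := by
    rw [← pow_succ]; exact Nat.pow_le_pow_right (by norm_num) (by rw [add_mul]; omega)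
  show F x + G x < _
  omega

theorem Comp.mul (hF : Comp Y F) (hG : Comp Y G) : Comp Y fun x => F x * G x := by
  refine hF.op .mul (· * ·) (fun _ _ _ => rfl) hG fun K => ⟨K + K, fun x _ h h' => ?_⟩
  rw [add_mul, pow_add]
  exact Nat.mul_lt_mul'' h h'

/-- A result that is at most the left operand needs no separate size bound. -/
theorem Comp.op_left (o : Op) (f : ℕ → ℕ → ℕ) (ho : ∀ w x y, o.eval w x y = f x y % 2 ^ w)
    (hF : Comp Y F) (hG : Comp Y G) (hf : ∀ x y, f x y ≤ x) : Comp Y fun x => f (F x) (G x) :=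
  hF.op o f ho hG fun K => ⟨K, fun _ _ h _ => (hf _ _).trans_lt h⟩

theorem Comp.sub (hF : Comp Y F) (hG : Comp Y G) : Comp Y fun x => F x - G x :=
  hF.op_left .sub (· - ·) (fun _ _ _ => rfl) hG fun _ _ => Nat.sub_le _ _

theorem Comp.div (hF : Comp Y F) (hG : Comp Y G) : Comp Y fun x => F x / G x :=
  hF.op_left .div (· / ·) (fun _ _ _ => rfl) hG fun _ _ => Nat.div_le_self _ _

theorem Comp.mod (hF : Comp Y F) (hG : Comp Y G) : Comp Y fun x => F x % G x :=
  hF.op_left .mod (· % ·) (fun _ _ _ => rfl) hG fun _ _ => Nat.mod_le _ _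

theorem Comp.and (hF : Comp Y F) (hG : Comp Y G) : Comp Y fun x => F x &&& G x :=
  hF.op_left .and (· &&& ·) (fun _ _ _ => rfl) hG fun _ _ => Nat.and_le_left

theorem Comp.const (v : ℕ) : Comp Y fun _ => v := by
  refine ⟨.const v, v, trivial, fun x _ w reg mem hw _ => ?_⟩
  have h : v < 2 ^ (v * Y.u x) := Nat.lt_two_pow_self.trans_le
    (Nat.pow_le_pow_right (by norm_num) (Nat.le_mul_of_pos_right _ (Y.one_le x)))
  exact ⟨Nat.mod_eq_of_lt (h.trans_le (Nat.pow_le_pow_right (by norm_num) hw)), h⟩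

/-- The exponent itself has to be linear in the unit; a bound on its number of bits would not make
the power fit into a word. -/
theorem Comp.two_pow (hG : Comp Y G) (hs : Small Y G) : Comp Y fun x => 2 ^ G x := by
  obtain ⟨K', hK'⟩ := hs
  have := (Comp.const (Y := Y) 1).op .shl (fun x y => x <<< y) (fun _ _ _ => rfl) hG fun K =>
    ⟨K' + 1, fun x hx _ _ => by
      rw [Nat.one_shiftLeft]
      have := hK' x hx
      have := Y.one_le x
      exact Nat.pow_lt_pow_right (by norm_num) (by rw [add_mul]; omega)⟩
  exact this.congr fun x _ => Nat.one_shiftLeft _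

theorem Comp.ite_lt (hF : Comp Y F) (hG : Comp Y G) (hA : Comp Y A) (hB : Comp Y B) :
    Comp Y fun x => if F x < G x then A x else B x := by
  obtain ⟨e1, K1, hb1, h1⟩ := hF
  obtain ⟨e2, K2, hb2, h2⟩ := hG
  obtain ⟨e3, K3, hb3, h3⟩ := hA
  obtain ⟨e4, K4, hb4, h4⟩ := hB
  refine ⟨.ite e1 e2 e3 e4, K1 + K2 + K3 + K4, ⟨hb1, hb2, hb3, hb4⟩,
    fun x hx w reg mem hw hr => ?_⟩
  have m : ∀ {a b : ℕ}, a ≤ b → a * Y.u x ≤ b * Y.u x := fun h => Nat.mul_le_mul_right _ h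
  have p : ∀ {a b : ℕ}, a ≤ b → 2 ^ (a * Y.u x) ≤ 2 ^ (b * Y.u x) := fun h =>
    Nat.pow_le_pow_right (by norm_num) (m h)
  obtain ⟨g1, -⟩ := h1 x hx w reg mem ((m (by omega)).trans hw) hr
  obtain ⟨g2, -⟩ := h2 x hx w reg mem ((m (by omega)).trans hw) hr
  obtain ⟨g3, k3⟩ := h3 x hx w reg mem ((m (by omega)).trans hw) hr
  obtain ⟨g4, k4⟩ := h4 x hx w reg mem ((m (by omega)).trans hw) hr
  rw [Expr.eval, g1, g2, g3, g4]
  refine ⟨rfl, ?_⟩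
  beta_reduce
  split
  · exact k3.trans_le (p (by omega))
  · exact k4.trans_le (p (by omega))

theorem Comp.ite_le (hF : Comp Y F) (hG : Comp Y G) (hA : Comp Y A) (hB : Comp Y B) :
    Comp Y fun x => if F x ≤ G x then A x else B x :=
  (hG.ite_lt hF hB hA).congr fun x _ => by
    by_cases h : F x ≤ G x
    · rw [if_pos h, if_neg (by omega)]
    · rw [if_neg h, if_pos (by omega)]

theorem Comp.ite_eq (hF : Comp Y F) (hG : Comp Y G) (hA : Comp Y A) (hB : Comp Y B) :
    Comp Y fun x => if F x = G x then A x else B x :=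
  (hF.ite_lt hG hB (hG.ite_lt hF hB hA)).congr fun x _ => by
    rcases Nat.lt_trichotomy (F x) (G x) with h | h | h
    · rw [if_pos h, if_neg (by omega)]
    · rw [if_pos h, if_neg (by omega), if_neg (by omega)]
    · rw [if_neg (by omega), if_pos h, if_neg (by omega)]

theorem Comp.min (hF : Comp Y F) (hG : Comp Y G) : Comp Y fun x => min (F x) (G x) :=
  (hF.ite_le hG hF hG).congr fun x _ => by rw [Nat.min_def]

theorem Comp.pow (hF : Comp Y F) (e : ℕ) : Comp Y fun x => F x ^ e := by
  induction e with
  | zero => exact (Comp.const 1).congr fun x _ => by simp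
  | succ e ih => exact (ih.mul hF).congr fun x _ => by rw [pow_succ]

/-- A length linear in the unit makes the cut at `w` bits ineffective. Only the bits actually read
have to be determined by the situation. -/
theorem Comp.load {m : σ → ℕ → Bool} (hF : Comp Y F) (hG : Comp Y G) (hs : Small Y G)
    (hm : ∀ x, Y.ok x → ∀ w reg mem, Y.rel w x reg mem →
      ∀ p, F x ≤ p → p < F x + G x → mem p = m x p) :
    Comp Y fun x => readBits (m x) (F x) (G x) := by
  obtain ⟨e1, K1, hb1, h1⟩ := hF
  obtain ⟨e2, K2, hb2, h2⟩ := hG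
  obtain ⟨K, hK⟩ := hs
  refine ⟨.load e1 e2, K1 + K2 + K, ⟨hb1, hb2⟩, fun x hx w reg mem hw hr => ?_⟩
  have l : ∀ {a b : ℕ}, a ≤ b → a * Y.u x ≤ b * Y.u x := fun h => Nat.mul_le_mul_right _ h
  obtain ⟨g1, -⟩ := h1 x hx w reg mem ((l (by omega)).trans hw) hr
  obtain ⟨g2, -⟩ := h2 x hx w reg mem ((l (by omega)).trans hw) hr
  have h3 := (hK x hx).trans (l (by omega : K ≤ K1 + K2 + K))
  rw [Expr.eval, g1, g2, min_eq_left (h3.trans hw)]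
  refine ⟨readBits_congr (hm x hx w reg mem hr), ?_⟩
  exact (readBits_lt _ _ _).trans_le (Nat.pow_le_pow_right (by norm_num) h3)

theorem Comp.register (r : ℕ) (hr : r < 8)
    (h : ∀ x, Y.ok x → ∀ w reg mem, Y.rel w x reg mem → reg r = F x % 2 ^ w)
    (hb : ∃ K, ∀ x, Y.ok x → F x < 2 ^ (K * Y.u x)) : Comp Y F := by
  obtain ⟨K, hK⟩ := hb
  refine ⟨.reg r, K, hr, fun x hx w reg mem hw hrel => ⟨?_, hK x hx⟩⟩
  rw [Expr.eval, h x hx w reg mem hrel, Nat.mod_mod, Nat.mod_eq_of_lt]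
  exact (hK x hx).trans_le (Nat.pow_le_pow_right (by norm_num) hw)

end Comp

end WordRAM

/-! ## Arithmetic of numbers that are packed into the fields of one number -/

namespace Packed

/-- The number with the `c` fields `a 0, a 1, …` of `f` bits each. -/
def pk (f c : ℕ) (a : ℕ → ℕ) : ℕ := ∑ j ∈ Finset.range c, a j * 2 ^ (f * j)

section
variable {f c : ℕ} {a b : ℕ → ℕ}

theorem pk_succ : pk f (c + 1) a = pk f c a + a c * 2 ^ (f * c) := by
  simp [pk, Finset.sum_range_succ]

theorem pk_congr (h : ∀ j < c, a j = b j) : pk f c a = pk f c b :=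
  Finset.sum_congr rfl fun j hj => by rw [h j (Finset.mem_range.1 hj)]

theorem pk_add : pk f c a + pk f c b = pk f c fun j => a j + b j := by
  simp [pk, ← Finset.sum_add_distrib, add_mul]

theorem pk_mul (v : ℕ) : v * pk f c a = pk f c fun j => v * a j := by
  simp [pk, Finset.mul_sum, mul_assoc]

theorem pk_sub (h : ∀ j < c, b j ≤ a j) : pk f c a - pk f c b = pk f c fun j => a j - b j := by
  rw [Nat.sub_eq_iff_eq_add, pk_add]
  · exact pk_congr fun j hj => (Nat.sub_add_cancel (h j hj)).symm
  · exact Finset.sum_le_sum fun j hj => Nat.mul_le_mul_right _ (h j (Finset.mem_range.1 hj))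

theorem pk_lt (h : ∀ j < c, a j < 2 ^ f) : pk f c a < 2 ^ (f * c) := by
  induction c with
  | zero => simp [pk]
  | succ c ih =>
    rw [pk_succ, mul_add, mul_one, pow_add]
    have h1 := ih fun j hj => h j (by omega)
    have h2 := h c (by omega)
    nlinarith [Nat.two_pow_pos (f * c)]

theorem pk_split (x y : ℕ) :
    pk f (x + y) a = pk f x a + 2 ^ (f * x) * pk f y fun j => a (x + j) := by
  simp only [pk, Finset.sum_range_add, Finset.mul_sum]
  congr 1
  refine Finset.sum_congr rfl fun j _ => ?_
  rw [mul_add, pow_add]; ring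

theorem pk_mod (h : ∀ j < c, a j < 2 ^ f) {x : ℕ} (hx : x ≤ c) :
    pk f c a % 2 ^ (f * x) = pk f x a := by
  obtain ⟨y, rfl⟩ := Nat.exists_eq_add_of_le hx
  rw [pk_split, Nat.add_mul_mod_self_left, Nat.mod_eq_of_lt]
  exact pk_lt fun j hj => h j (by omega)

theorem pk_div (h : ∀ j < c, a j < 2 ^ f) {x : ℕ} (hx : x ≤ c) :
    pk f c a / 2 ^ (f * x) = pk f (c - x) fun j => a (x + j) := by
  obtain ⟨y, rfl⟩ := Nat.exists_eq_add_of_le hx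
  rw [pk_split, Nat.add_mul_div_left _ _ (by positivity), Nat.div_eq_of_lt, zero_add,
    Nat.add_sub_cancel_left]
  exact pk_lt fun j hj => h j (by omega)

theorem pk_field (h : ∀ j < c, a j < 2 ^ f) {x : ℕ} (hx : x < c) :
    pk f c a / 2 ^ (f * x) % 2 ^ f = a x := by
  rw [pk_div h hx.le]
  have := pk_mod (f := f) (c := c - x) (a := fun j => a (x + j)) (fun j hj => h _ (by omega))
    (x := 1) (by omega)
  rw [mul_one] at this
  rw [this]
  simp [pk]

theorem pk_testBit (h : ∀ j < c, a j < 2 ^ f) {j q : ℕ} (hj : j < c) (hq : q < f) :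
    (pk f c a).testBit (f * j + q) = (a j).testBit q := by
  conv_rhs => rw [← pk_field h hj]
  rw [Nat.testBit_mod_two_pow, Nat.testBit_div_two_pow, add_comm]
  simp [hq]

theorem pk_testBit_of_le (h : ∀ j < c, a j < 2 ^ f) {i : ℕ} (hi : f * c ≤ i) :
    (pk f c a).testBit i = false :=
  Nat.testBit_lt_two_pow ((pk_lt h).trans_le (Nat.pow_le_pow_right (by norm_num) hi))

theorem pk_ext (hf : 0 < f) {X : ℕ} (h : ∀ j < c, a j < 2 ^ f)
    (h1 : ∀ j < c, ∀ q < f, X.testBit (f * j + q) = (a j).testBit q)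
    (h2 : ∀ i, f * c ≤ i → X.testBit i = false) : X = pk f c a := by
  refine Nat.eq_of_testBit_eq fun i => ?_
  rcases Nat.lt_or_ge i (f * c) with hi | hi
  · have hj : i / f < c := Nat.div_lt_of_lt_mul hi
    have hq : i % f < f := Nat.mod_lt _ hf
    have e : i = f * (i / f) + i % f := (Nat.div_add_mod i f).symm
    rw [e, h1 _ hj _ hq, pk_testBit h hj hq]
  · rw [h2 i hi, pk_testBit_of_le h hi]

theorem pk_and (hf : 0 < f) (h : ∀ j < c, a j < 2 ^ f) (h' : ∀ j < c, b j < 2 ^ f) :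
    pk f c a &&& pk f c b = pk f c fun j => a j &&& b j := by
  refine pk_ext hf (fun j hj => (Nat.and_le_left).trans_lt (h j hj)) (fun j hj q hq => ?_)
    fun i hi => ?_
  · rw [Nat.testBit_and, Nat.testBit_and, pk_testBit h hj hq, pk_testBit h' hj hq]
  · rw [Nat.testBit_and, pk_testBit_of_le h hi, Bool.false_and]

theorem pk_one (hf : 0 < f) : pk f c (fun _ => 1) = (2 ^ (f * c) - 1) / (2 ^ f - 1) := by
  have h2 : 2 ≤ 2 ^ f := by
    calc 2 = 2 ^ 1 := rfl
      _ ≤ 2 ^ f := Nat.pow_le_pow_right (by norm_num) hf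
  rw [pow_mul, ← Nat.geomSum_eq h2]
  simp [pk, pow_mul]

/-- Casting out nines: `2 ^ f` is `1` modulo `2 ^ f - 1`, so one remainder adds up all fields. -/
theorem pk_modEq : pk f c a ≡ ∑ j ∈ Finset.range c, a j [MOD 2 ^ f - 1] := by
  have h1 : 2 ^ f ≡ 1 [MOD 2 ^ f - 1] := by
    have : 1 ≤ 2 ^ f := Nat.one_le_two_pow
    have := (Nat.modEq_iff_dvd' (n := 2 ^ f - 1) this).2 dvd_rfl
    exact this.symm
  induction c with
  | zero => simp [pk]; rfl
  | succ c ih =>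
    rw [pk_succ, Finset.sum_range_succ]
    refine ih.add ?_
    have := (h1.pow c).mul_left (a c)
    rw [one_pow, mul_one, ← pow_mul] at this
    exact this

/-- Multiplication by the number with all fields `1` adds shifted copies, so field `j` collects the
fields up to `j`. Carries are avoided by verifying the congruence after multiplication by `2 ^ f -
1`, where both sides telescope; that factor is odd and can be cancelled. -/
theorem pk_psum :
    pk f c a * pk f c (fun _ => 1) ≡ pk f c (fun j => ∑ i ∈ Finset.range (j + 1), a i)
      [MOD 2 ^ (f * c)] := by
  -- For `f = 0` the modulus is `1`; the cancellation below needs `2 ^ f - 1` odd.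
  rcases Nat.eq_zero_or_pos f with rfl | hf
  · simp [Nat.modEq_one]
  have e1 : (pk f c (fun j => ∑ i ∈ Finset.range (j + 1), a i) : ℤ) * (2 ^ f - 1) + pk f c a =
      2 ^ (f * c) * ∑ i ∈ Finset.range c, (a i : ℤ) := by
    induction c with
    | zero => simp [pk]
    | succ c ih =>
      simp only [pk_succ, Finset.sum_range_succ, mul_add, mul_one, pow_add] at ih ⊢
      push_cast at ih ⊢
      linear_combination ih
  have e2 : (pk f c (fun _ => 1) : ℤ) * (2 ^ f - 1) = 2 ^ (f * c) - 1 := by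
    clear e1
    induction c with
    | zero => simp [pk]
    | succ c ih =>
      simp only [pk_succ, mul_add, mul_one, pow_add]
      push_cast
      linear_combination ih
  refine (Nat.modEq_iff_dvd.2 ?_).symm
  have hco : IsCoprime ((2 ^ (f * c) : ℕ) : ℤ) (2 ^ f - 1) := by
    have : IsCoprime (2 : ℤ) (2 ^ f - 1) := by
      obtain ⟨g, rfl⟩ : ∃ g, f = g + 1 := ⟨f - 1, by omega⟩
      exact ⟨2 ^ g, -1, by ring⟩
    push_cast
    exact this.pow_left
  refine hco.dvd_of_dvd_mul_right ⟨pk f c a - ∑ i ∈ Finset.range c, (a i : ℤ), ?_⟩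
  push_cast
  linear_combination (pk f c a : ℤ) * e2 - e1

end

/-! ### Word-parallel comparison, summation, search and spreading. -/

/-- A power of two with bounded exponent. -/
def pw (β y : ℕ) : ℕ := 2 ^ min y β

/-- The number with `c` fields that contain `1`. -/
def ones (β f c : ℕ) : ℕ := (pw β (f * c) - 1) / (pw β f - 1)

/-- The fields that are at least `v`. -/
def geq (β f c X v : ℕ) : ℕ :=
  ((X + pw β (f - 1) * ones β f c - v * ones β f c) / pw β (f - 1)) &&& ones β f c

/-- The sum of the fields. -/
def fsum (β f X : ℕ) : ℕ := X % (pw β f - 1)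

/-- The prefix sums. -/
def psum (β f c X : ℕ) : ℕ := X * ones β f c % pw β (f * c)

/-- The number of the first field that is `1`. -/
def first (β f c X : ℕ) : ℕ := c - fsum β f (geq β f c (psum β f c X) 1)

/-- The fields from number `x` on. -/
def dropF (β f x X : ℕ) : ℕ := X / pw β (f * x) * pw β (f * x)

/-- The fields before number `x`. -/
def takeF (β f x X : ℕ) : ℕ := X % pw β (f * x)

/-- The field with number `x`. -/
def getF (β f x X : ℕ) : ℕ := X / pw β (f * x) % pw β f

/-- The fields of `X` that are selected by the mask `M`. -/
def selF (β f X M : ℕ) : ℕ := X &&& ((pw β f - 1) * M)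

/-- Symbols of `b` bits each put into fields of `f` bits. -/
def spread (β b f c X : ℕ) : ℕ := (X * ones β (f - b) c) &&& ((pw β b - 1) * ones β f c)

/-- Symbols of `b` bits each put into fields of `f` bits, in reverse order. -/
def spreadRev (β b f c X : ℕ) : ℕ :=
  (X * ones β (f + b) c / pw β ((c - 1) * b)) &&& ((pw β b - 1) * ones β f c)

section
variable {β f c : ℕ} {a : ℕ → ℕ}

theorem pw_eq {y : ℕ} (h : y ≤ β) : pw β y = 2 ^ y := by rw [pw, min_eq_left h]

theorem ones_eq (hf : 0 < f) (hc : f * c ≤ β) (hfβ : f ≤ β) : ones β f c = pk f c fun _ => 1 := by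
  rw [ones, pw_eq hc, pw_eq hfβ, pk_one hf]

theorem two_pow_pred (hf : 0 < f) : 2 ^ f = 2 ^ (f - 1) * 2 := by
  rw [← pow_succ]; congr 1; omega

/-- The top bit of every field is free. Setting it before subtracting `v` keeps borrows inside the
fields, and it survives exactly where the field was at least `v`. -/
theorem geq_eq (hf : 0 < f) (hc : f * c ≤ β) (hfβ : f ≤ β) {v : ℕ} (hv : v ≤ 2 ^ (f - 1))
    (ha : ∀ j < c, a j < 2 ^ (f - 1)) :
    geq β f c (pk f c a) v = pk f c fun j => if v ≤ a j then 1 else 0 := by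
  have h2 := two_pow_pred hf
  rw [geq, ones_eq hf hc hfβ, pw_eq (by omega), pk_mul, pk_mul, pk_add, pk_sub]
  swap
  · intro j hj; omega
  simp only [mul_one]
  have hb : ∀ j < c, a j + 2 ^ (f - 1) - v < 2 ^ f := fun j hj => by have := ha j hj; omega
  have h1 : 1 < 2 ^ f := Nat.one_lt_two_pow hf.ne'
  refine pk_ext hf (fun j _ => by split <;> omega) (fun j hj q hq => ?_) fun i hi => ?_
  · rw [Nat.testBit_and, Nat.testBit_div_two_pow, pk_testBit (fun _ _ => h1) hj hq]
    rcases Nat.eq_zero_or_pos q with rfl | hq'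
    · rw [add_zero, pk_testBit hb hj (by omega)]
      have hbj := hb j hj
      by_cases hva : v ≤ a j
      · rw [if_pos hva]
        have : (a j + 2 ^ (f - 1) - v).testBit (f - 1) = true := by
          rw [Nat.testBit_eq_decide_div_mod_eq, decide_eq_true_eq]
          have : (a j + 2 ^ (f - 1) - v) / 2 ^ (f - 1) = 1 :=
            Nat.div_eq_of_lt_le (by omega) (by omega)
          rw [this]
        rw [this]; simp
      · rw [if_neg hva]
        have : (a j + 2 ^ (f - 1) - v).testBit (f - 1) = false :=
          Nat.testBit_lt_two_pow (by omega)
        rw [this]; simp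
    · have e : ∀ x, x ≤ 1 → x.testBit q = false := fun x hx =>
        Nat.testBit_lt_two_pow (hx.trans_lt (Nat.one_lt_two_pow hq'.ne'))
      rw [e 1 le_rfl, Bool.and_false, e]
      split <;> omega
  · rw [Nat.testBit_and, pk_testBit_of_le (fun _ _ => h1) hi, Bool.and_false]

/-- The remainder is the sum itself as long as the sum is below the modulus. -/
theorem fsum_eq (hfβ : f ≤ β) (hs : ∑ j ∈ Finset.range c, a j < 2 ^ f - 1) :
    fsum β f (pk f c a) = ∑ j ∈ Finset.range c, a j := by
  rw [fsum, pw_eq hfβ, pk_modEq, Nat.mod_eq_of_lt hs]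

theorem psum_eq (hf : 0 < f) (hc : f * c ≤ β) (hfβ : f ≤ β)
    (hs : ∑ j ∈ Finset.range c, a j < 2 ^ f) :
    psum β f c (pk f c a) = pk f c fun j => ∑ i ∈ Finset.range (j + 1), a i := by
  rw [psum, ones_eq hf hc hfβ, pw_eq hc, pk_psum, Nat.mod_eq_of_lt]
  refine pk_lt fun j hj => lt_of_le_of_lt ?_ hs
  exact Finset.sum_le_sum_of_subset (Finset.range_mono hj)

/-- Prefix sums of a mask are positive exactly from the first marked field on, so `c` minus the
number of positive ones is the number of that field, and it is `c` if no field is marked. -/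
theorem first_eq (hf : 0 < f) (hc : f * c ≤ β) (hfβ : f ≤ β) (hcf : c + 1 < 2 ^ (f - 1))
    (p : ℕ → Prop) [DecidablePred p] :
    first β f c (pk f c fun j => if p j then 1 else 0) ≤ c ∧
    (∀ j < first β f c (pk f c fun j => if p j then 1 else 0), ¬ p j) ∧
    (first β f c (pk f c fun j => if p j then 1 else 0) < c →
      p (first β f c (pk f c fun j => if p j then 1 else 0))) := by
  have h2 := two_pow_pred hf
  have hle : ∀ j, ∑ i ∈ Finset.range j, (if p i then 1 else 0) ≤ j := by
    intro j
    refine (Finset.sum_le_sum (g := fun _ => 1) fun i _ => ?_).trans (by simp)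
    split <;> omega
  have key : first β f c (pk f c fun j => if p j then 1 else 0) =
      c - ((Finset.range c).filter fun j => ∃ i, i ≤ j ∧ p i).card := by
    rw [first, psum_eq hf hc hfβ (by have := hle c; omega), geq_eq hf hc hfβ (by omega), fsum_eq hfβ]
    · rw [Finset.card_filter]
      congr 1
      refine Finset.sum_congr rfl fun j _ => ?_
      have : 1 ≤ ∑ i ∈ Finset.range (j + 1), (if p i then 1 else 0) ↔ ∃ i, i ≤ j ∧ p i := by
        rw [Nat.one_le_iff_ne_zero, Ne, Finset.sum_eq_zero_iff]
        simp
      simp only [this]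
    · refine lt_of_le_of_lt (Finset.sum_le_sum (g := fun _ => 1) fun i _ => ?_) ?_
      · split <;> omega
      · simp; omega
    · intro j hj
      exact lt_of_le_of_lt (hle (j + 1)) (by omega)
  rw [key]
  classical
  by_cases hex : ∃ i, i < c ∧ p i
  · obtain ⟨hlt, hp⟩ := Nat.find_spec hex
    have hmin : ∀ j, j < Nat.find hex → ¬ p j := by
      intro j hj hpj
      exact Nat.find_min hex hj ⟨by omega, hpj⟩
    generalize Nat.find hex = ρ at *
    have : ((Finset.range c).filter fun j => ∃ i, i ≤ j ∧ p i) = Finset.Ico ρ c := by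
      ext j
      simp only [Finset.mem_filter, Finset.mem_range, Finset.mem_Ico]
      constructor
      · rintro ⟨h1, i, hi, hpi⟩
        refine ⟨?_, h1⟩
        by_contra hcon
        exact hmin i (by omega) hpi
      · rintro ⟨h1, h2⟩
        exact ⟨h2, ρ, h1, hp⟩
    rw [this, Nat.card_Ico, show c - (c - ρ) = ρ by omega]
    exact ⟨hlt.le, hmin, fun _ => hp⟩
  · have : ((Finset.range c).filter fun j => ∃ i, i ≤ j ∧ p i) = ∅ := by
      rw [Finset.filter_eq_empty_iff]
      rintro j hj ⟨i, hi, hpi⟩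
      exact hex ⟨i, by rw [Finset.mem_range] at hj; omega, hpi⟩
    rw [this]
    simp only [Finset.card_empty, Nat.sub_zero]
    exact ⟨le_rfl, fun j hj hpj => hex ⟨j, hj, hpj⟩, fun h => absurd h (lt_irrefl _)⟩

theorem dropF_eq {x : ℕ} (hx : x ≤ c) (hxβ : f * x ≤ β) (ha : ∀ j < c, a j < 2 ^ f) :
    dropF β f x (pk f c a) = pk f c fun j => if x ≤ j then a j else 0 := by
  rw [dropF, pw_eq hxβ, pk_div ha hx]
  obtain ⟨y, rfl⟩ := Nat.exists_eq_add_of_le hx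
  rw [pk_split, Nat.add_sub_cancel_left]
  have h0 : pk f x (fun j => if x ≤ j then a j else 0) = 0 := by
    unfold pk
    refine Finset.sum_eq_zero fun j hj => ?_
    rw [Finset.mem_range] at hj
    beta_reduce
    rw [if_neg (by omega), zero_mul]
  rw [h0, zero_add, mul_comm]
  congr 1
  exact pk_congr fun j _ => by rw [if_pos (by omega)]

theorem takeF_eq {x : ℕ} (hx : x ≤ c) (hxβ : f * x ≤ β) (ha : ∀ j < c, a j < 2 ^ f) :
    takeF β f x (pk f c a) = pk f x a := by
  rw [takeF, pw_eq hxβ, pk_mod ha hx]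

theorem getF_eq {x : ℕ} (hx : x < c) (hxβ : f * x ≤ β) (hfβ : f ≤ β)
    (ha : ∀ j < c, a j < 2 ^ f) : getF β f x (pk f c a) = a x := by
  rw [getF, pw_eq hxβ, pw_eq hfβ, pk_field ha hx]

theorem selF_eq (hf : 0 < f) (hfβ : f ≤ β) (ha : ∀ j < c, a j < 2 ^ f) (p : ℕ → Prop)
    [DecidablePred p] :
    selF β f (pk f c a) (pk f c fun j => if p j then 1 else 0) =
      pk f c fun j => if p j then a j else 0 := by
  have h1 : 1 ≤ 2 ^ f := Nat.one_le_two_pow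
  rw [selF, pw_eq hfβ, pk_mul, pk_and hf ha]
  · refine pk_congr fun j hj => ?_
    split
    · rw [mul_one, Nat.and_two_pow_sub_one_eq_mod, Nat.mod_eq_of_lt (ha j hj)]
    · simp
  · intro j _
    split <;> omega

theorem pk_const_eq (v : ℕ) (hf : 0 < f) (hc : f * c ≤ β) (hfβ : f ≤ β) :
    v * ones β f c = pk f c fun _ => v := by
  rw [ones_eq hf hc hfβ, pk_mul]; simp

/-- Only the low `b` bits of each field have to be right; the mask clears whatever garbage lies
above them. -/
theorem and_mask_eq {b X : ℕ} (hbf : b ≤ f) (hf : 0 < f) (hc : f * c ≤ β) (hfβ : f ≤ β)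
    (ha : ∀ j < c, a j < 2 ^ b)
    (h : ∀ j < c, ∀ q < b, X.testBit (f * j + q) = (a j).testBit q) :
    X &&& ((pw β b - 1) * ones β f c) = pk f c a := by
  rw [pk_const_eq _ hf hc hfβ, pw_eq (hbf.trans hfβ)]
  have h1 : 1 ≤ 2 ^ b := Nat.one_le_two_pow
  have hbf2 : 2 ^ b ≤ 2 ^ f := Nat.pow_le_pow_right (by norm_num) hbf
  have hm : ∀ j < c, 2 ^ b - 1 < 2 ^ f := fun j _ => by omega
  refine pk_ext hf (fun j hj => (ha j hj).trans_le hbf2) (fun j hj q hq => ?_) fun i hi => ?_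
  · rw [Nat.testBit_and, pk_testBit (a := fun _ => 2 ^ b - 1) hm hj hq, Nat.testBit_two_pow_sub_one]
    by_cases hqb : q < b
    · rw [h j hj q hqb]; simp [hqb]
    · rw [Nat.testBit_lt_two_pow ((ha j hj).trans_le
        (Nat.pow_le_pow_right (by norm_num) (by omega)))]
      simp [hqb]
  · rw [Nat.testBit_and, pk_testBit_of_le (a := fun _ => 2 ^ b - 1) hm hi, Bool.and_false]

/-- The product puts copies of the packed symbols at distance `f - b`. Since `f * j = (f - b) * j +
b * j`, the low end of field `j` shows symbol `j` of copy `j`. The bound `hbf` keeps the copies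
apart. -/
theorem spread_eq {b : ℕ} (hb : 0 < b) (hbf : b * (c + 1) ≤ f) (hc : f * c ≤ β) (hfβ : f ≤ β)
    (ha : ∀ j < c, a j < 2 ^ b) : spread β b f c (pk b c a) = pk f c a := by
  have hbf' : b ≤ f := le_trans (Nat.le_mul_of_pos_right _ (by omega)) hbf
  have hbc : b * (c + 1) = b * c + b := by ring
  rw [spread]
  rcases Nat.eq_zero_or_pos c with rfl | hc0
  · simp [pk, ones, pw]
  have hbpos : 0 < b * c := Nat.mul_pos hb hc0
  rw [pk_const_eq _ (by omega : 0 < f - b)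
    ((Nat.mul_le_mul_right _ (Nat.sub_le _ _)).trans hc) (by omega)]
  refine and_mask_eq hbf' (by omega) hc hfβ ha fun j hj q hq => ?_
  have hjq : b * j + q < b * c := by
    have : b * (j + 1) ≤ b * c := Nat.mul_le_mul_left _ hj
    rw [mul_add, mul_one] at this; omega
  have e : f * j + q = (f - b) * j + (b * j + q) := by
    have : b * j ≤ f * j := Nat.mul_le_mul_right _ hbf'
    rw [Nat.sub_mul]; omega
  rw [e, pk_testBit (f := f - b) (a := fun _ => pk b c a) (fun _ _ => (pk_lt ha).trans_le
    (Nat.pow_le_pow_right (by norm_num) (by omega))) hj (by omega), pk_testBit ha hj hq]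

/-- With copies at distance `f + b` and a shift by `(c - 1) * b`, the start of field `j` falls on
symbol `c - 1 - j` of copy `j`, because `f * j + (c - 1) * b = (f + b) * j + b * (c - 1 - j)`. -/
theorem spreadRev_eq {b : ℕ} (hb : 0 < b) (hbf : b * (c + 1) ≤ f) (hc : (f + b) * c ≤ β)
    (hfβ : f + b ≤ β) (ha : ∀ j < c, a j < 2 ^ b) :
    spreadRev β b f c (pk b c a) = pk f c fun j => a (c - 1 - j) := by
  have hbf' : b ≤ f := le_trans (Nat.le_mul_of_pos_right _ (by omega)) hbf
  have hbc : b * (c + 1) = b * c + b := by ring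
  have hc' : f * c ≤ β := (Nat.mul_le_mul_right _ (by omega)).trans hc
  rw [spreadRev]
  rcases Nat.eq_zero_or_pos c with rfl | hc0
  · simp [pk, ones, pw]
  have hcb : (c - 1) * b ≤ b * c := by rw [mul_comm]; exact Nat.mul_le_mul_left _ (by omega)
  rw [pk_const_eq _ (by omega : 0 < f + b) hc hfβ, pw_eq (by omega)]
  refine and_mask_eq hbf' (by omega) hc' (by omega) (fun j hj => ha _ (by omega))
    fun j hj q hq => ?_
  have hjq : b * (c - 1 - j) + q < b * c := by
    have : b * (c - 1 - j + 1) ≤ b * c := Nat.mul_le_mul_left _ (by omega)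
    rw [mul_add, mul_one] at this; omega
  have e : f * j + q + (c - 1) * b = (f + b) * j + (b * (c - 1 - j) + q) := by
    obtain ⟨i, rfl⟩ : ∃ i, c = j + 1 + i := ⟨c - j - 1, by omega⟩
    rw [show j + 1 + i - 1 - j = i by omega, show j + 1 + i - 1 = j + i by omega]
    ring
  rw [Nat.testBit_div_two_pow, e, pk_testBit (f := f + b) (a := fun _ => pk b c a)
    (fun _ _ => (pk_lt ha).trans_le
    (Nat.pow_le_pow_right (by norm_num) (by omega))) hj (by omega), pk_testBit ha (by omega) hq]

end

end Packed

/-! ### Bit strings and arrays in the memory. -/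

namespace BitString
open WordRAM Packed

/-- The memory holds the bit string from address `a` on. -/
def Has (mem : ℕ → Bool) (a : ℕ) (l : List Bool) : Prop :=
  ∀ p, (h : p < l.length) → mem (a + p) = l[p]

theorem Has.append_iff {mem : ℕ → Bool} {a : ℕ} {l l' : List Bool} :
    Has mem a (l ++ l') ↔ Has mem a l ∧ Has mem (a + l.length) l' := by
  constructor
  · intro h
    constructor
    · intro p hp
      rw [h p (by simp; omega), List.getElem_append_left hp]
    · intro p hp
      rw [add_assoc, h (l.length + p) (by simp; omega), List.getElem_append_right (by omega)]
      simp
  · rintro ⟨h, h'⟩ p hp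
    by_cases hlt : p < l.length
    · rw [List.getElem_append_left hlt, h p hlt]
    · rw [List.getElem_append_right (by omega)]
      have := h' (p - l.length) (by simp at hp; omega)
      rw [← this]; congr 1; omega

theorem Has.flatMap {α : Type} {mem : ℕ → Bool} {w : ℕ} {g : α → List Bool} {l : List α}
    (hg : ∀ x, (g x).length = w) {a : ℕ} (h : Has mem a (l.flatMap g)) {j : ℕ}
    (hj : j < l.length) : Has mem (a + w * j) (g l[j]) := by
  induction l generalizing a j with
  | nil => simp at hj
  | cons x l ih =>
    rw [List.flatMap_cons, Has.append_iff, hg] at h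
    rcases j with _ | j
    · simpa using h.1
    · have := ih h.2 (j := j) (by simpa using hj)
      rw [mul_add, mul_one, add_comm (w * j), ← add_assoc]
      simpa using this

theorem length_ofNat (l v : ℕ) : (ofNat l v).length = l := by simp [ofNat]

theorem length_flatMap_const {α : Type} {w : ℕ} {g : α → List Bool} {l : List α}
    (hg : ∀ x, (g x).length = w) : (l.flatMap g).length = w * l.length := by
  simp [List.length_flatMap, hg, mul_comm]

/-- An array with `n` entries of `w` bits each. -/
def arr (w n : ℕ) (f : ℕ → ℕ) : List Bool := (List.range n).flatMap fun j => ofNat w (f j)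

theorem length_arr (w n : ℕ) (f : ℕ → ℕ) : (arr w n f).length = w * n := by
  rw [arr, length_flatMap_const (w := w) fun _ => length_ofNat _ _]; simp

theorem arr_succ (w n : ℕ) (f : ℕ → ℕ) : arr w (n + 1) f = arr w n f ++ ofNat w (f n) := by
  simp [arr, List.range_succ]

theorem readBits_add (mem : ℕ → Bool) (a x y : ℕ) :
    readBits mem a (x + y) = readBits mem a x + 2 ^ x * readBits mem (a + x) y := by
  simp only [readBits, Finset.sum_range_add, Finset.mul_sum]
  congr 1
  refine Finset.sum_congr rfl fun q _ => ?_
  rw [add_assoc]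
  split <;> simp [pow_add]

theorem readBits_mul (mem : ℕ → Bool) (a f c : ℕ) :
    readBits mem a (f * c) = pk f c fun j => readBits mem (a + f * j) f := by
  induction c with
  | zero => simp [readBits, pk]
  | succ c ih => rw [mul_add, mul_one, readBits_add, ih, pk_succ, mul_comm (2 ^ _)]

theorem readBits_eq_mod {mem : ℕ → Bool} {a l v : ℕ} (h : ∀ q < l, mem (a + q) = v.testBit q) :
    readBits mem a l = v % 2 ^ l := by
  induction l with
  | zero => simp [readBits, Nat.mod_one]
  | succ l ih =>
    rw [readBits_add, ih fun q hq => h q (by omega), Nat.mod_pow_succ]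
    congr 2
    have := h l (by omega)
    rw [Nat.testBit_eq_decide_div_mod_eq] at this
    simp only [readBits, Finset.range_one, Finset.sum_singleton, add_zero, this, decide_eq_true_eq,
      pow_zero]
    split <;> omega

theorem Has.readBits {mem : ℕ → Bool} {a l v : ℕ} (h : Has mem a (ofNat l v)) :
    WordRAM.readBits mem a l = v % 2 ^ l := by
  refine readBits_eq_mod fun q hq => ?_
  rw [h q (by rwa [length_ofNat])]
  simp [ofNat]

theorem Has.arr {mem : ℕ → Bool} {a w n : ℕ} {f : ℕ → ℕ} (h : Has mem a (arr w n f)) {j : ℕ}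
    (hj : j < n) : WordRAM.readBits mem (a + w * j) w = f j % 2 ^ w := by
  have := Has.flatMap (w := w) (fun _ => length_ofNat _ _) h (j := j) (by simpa using hj)
  simpa using this.readBits

/-- Consecutive array entries already form a packed number, so a single load makes them available to
the word-parallel operations. -/
theorem Has.arr_pk {mem : ℕ → Bool} {a w n : ℕ} {f : ℕ → ℕ} (h : Has mem a (BitString.arr w n f))
    {j c : ℕ} (hj : j + c ≤ n) (hf : ∀ i < n, f i < 2 ^ w) :
    WordRAM.readBits mem (a + w * j) (w * c) = pk w c fun i => f (j + i) := by
  rw [readBits_mul]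
  refine pk_congr fun i hi => ?_
  rw [add_assoc, ← mul_add, h.arr (by omega), Nat.mod_eq_of_lt (hf _ (by omega))]

/-! ### The symbols of a string -/

/-- The number of bits of a symbol. -/
abbrev symBits (t : ℕ) : ℕ := Nat.clog 2 (2 * t)

theorem code_lt_two_pow {t : ℕ} (p : ParenString.Paren t) :
    ParenString.code p < 2 ^ symBits t :=
  (ParenString.code_lt p).trans_le (Nat.le_pow_clog (by norm_num) _)

theorem length_encode {t : ℕ} (S : List (ParenString.Paren t)) :
    (encode S).length = symBits t * S.length :=
  length_flatMap_const fun _ => length_ofNat _ _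

theorem Has.encode {t : ℕ} {S : List (ParenString.Paren t)} {mem : ℕ → Bool} {a q : ℕ}
    (h : Has mem a (encode S)) (hq : q < S.length) :
    WordRAM.readBits mem (a + symBits t * q) (symBits t) = ParenString.scode S q := by
  have := (Has.flatMap (w := symBits t) (fun _ => length_ofNat _ _) h hq).readBits
  rw [this, Nat.mod_eq_of_lt]
  · simp [ParenString.scode, List.getElem?_eq_getElem hq, ParenString.code]
  · exact code_lt_two_pow _

/-! ### Self-delimiting numbers -/

/-- The number `L` in `L` bits after its unary code. -/
def selfDelim (L : ℕ) : List Bool := List.replicate L true ++ [false] ++ ofNat L L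

theorem length_selfDelim (L : ℕ) : (selfDelim L).length = 2 * L + 1 := by
  simp [selfDelim, length_ofNat]; omega

/-- The number encoded by `selfDelim` at the low end of a word. -/
def parse (v : ℕ) : ℕ := v / ((v ^^^ (v + 1)) + 1) % (((v ^^^ (v + 1)) + 1) / 2)

/-- Adding one flips the trailing ones and the lowest zero and nothing else, so the exclusive or
shows the length of the unary part whatever follows it. -/
theorem xor_succ_eq (L y : ℕ) :
    (2 ^ L - 1 + 2 ^ (L + 1) * y) ^^^ (2 ^ L - 1 + 2 ^ (L + 1) * y + 1) = 2 ^ (L + 1) - 1 := by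
  have h1 : 1 ≤ 2 ^ L := Nat.one_le_two_pow
  have h2 : 2 ^ (L + 1) = 2 ^ L * 2 := pow_succ 2 L
  rw [show 2 ^ L - 1 + 2 ^ (L + 1) * y + 1 = 2 ^ L + 2 ^ (L + 1) * y by omega]
  refine Nat.eq_of_testBit_eq fun i => ?_
  rw [Nat.testBit_xor, Nat.testBit_two_pow_sub_one]
  rw [add_comm, add_comm (2 ^ L), Nat.testBit_two_pow_mul_add _ (by omega),
    Nat.testBit_two_pow_mul_add _ (by omega)]
  split
  · rw [Nat.testBit_two_pow_sub_one, Nat.testBit_two_pow]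
    rcases Nat.lt_trichotomy i L with h | h | h
    · simp [h, h.ne']; omega
    · simp [h]
    · omega
  · simp; omega

theorem parse_eq {L y : ℕ} (hy : y % 2 ^ L = L) : parse (2 ^ L - 1 + 2 ^ (L + 1) * y) = L := by
  have h1 : 1 ≤ 2 ^ L := Nat.one_le_two_pow
  have h2 : 2 ^ (L + 1) = 2 ^ L * 2 := pow_succ 2 L
  rw [parse, xor_succ_eq, show 2 ^ (L + 1) - 1 + 1 = 2 ^ (L + 1) by omega]
  rw [Nat.add_mul_div_left _ _ (by positivity), Nat.div_eq_of_lt (by omega), zero_add, h2,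
    Nat.mul_div_cancel _ (by norm_num), hy]

/-- The number `y` gathers all bits after the unary part and its end mark, however many were read.
Hence a reader need not know `L` to choose the length of the load. -/
theorem readBits_selfDelim {mem : ℕ → Bool} {a L l : ℕ} (h : Has mem a (selfDelim L))
    (hl : 2 * L + 1 ≤ l) :
    ∃ y, readBits mem a l = 2 ^ L - 1 + 2 ^ (L + 1) * y ∧ y % 2 ^ L = L := by
  obtain ⟨d, rfl⟩ := Nat.exists_eq_add_of_le hl
  rw [selfDelim, Has.append_iff, Has.append_iff] at h
  obtain ⟨⟨h1, h2⟩, h3⟩ := h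
  simp only [List.length_replicate, List.length_append, List.length_singleton] at h2 h3
  refine ⟨L % 2 ^ L + 2 ^ L * readBits mem (a + (L + 1) + L) d, ?_, ?_⟩
  · rw [show 2 * L + 1 + d = (L + 1) + (L + d) by ring, readBits_add, readBits_add _ _ L d,
      h3.readBits]
    congr 1
    have : ∀ q < L + 1, mem (a + q) = (2 ^ L - 1).testBit q := by
      intro q hq
      rw [Nat.testBit_two_pow_sub_one]
      rcases Nat.lt_or_ge q L with hq' | hq'
      · rw [h1 q (by simpa using hq')]; simp [hq']
      · have : q = L := by omega
        subst this
        simpa using h2 0 (by simp)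
    rw [readBits_eq_mod this, Nat.mod_eq_of_lt]
    have : 2 ^ (L + 1) = 2 ^ L * 2 := pow_succ 2 L
    have : 1 ≤ 2 ^ L := Nat.one_le_two_pow
    omega
  · rw [Nat.add_mul_mod_self_left, Nat.mod_mod, Nat.mod_eq_of_lt Nat.lt_two_pow_self]

theorem join_eq (A B : List Bool) : join A B =
    selfDelim (Nat.size (A.length + B.length)) ++
      (ofNat (Nat.size (A.length + B.length)) A.length ++
        (ofNat (Nat.size (A.length + B.length)) B.length ++ (A ++ B))) := by
  simp [join, header, selfDelim]

theorem has_getD (l : List Bool) : Has (fun p => l[p]?.getD false) 0 l := by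
  intro p hp
  simp [List.getElem?_eq_getElem hp]

end BitString

/-! ### The index and the query algorithm. -/

namespace ParenString
open WordRAM BitString Packed

/-- The arrays of the index for one type of parentheses: for every block the level and the number
of pioneers before it; for every leaf the relative level at its start, the least relative level
in it, the number of close parentheses that attain it, and the relative number of pioneers before
it; for every pioneer its position in its block, the block of its match, and its degree. -/
structure Arrays where
  bE : ℕ → ℕ
  bR : ℕ → ℕ
  lE : ℕ → ℕ
  lM : ℕ → ℕ
  lC : ℕ → ℕ
  lR : ℕ → ℕ
  pP : ℕ → ℕ
  pB : ℕ → ℕ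
  pD : ℕ → ℕ

/-- The number of blocks. -/
def numBlocks (R n : ℕ) : ℕ := n / R ^ 5 + 1

/-- The number of leaves. -/
def numLeaves (R n : ℕ) : ℕ := numBlocks R n * R ^ 3

/-- The number of entries for pioneers. -/
def numPio (R n : ℕ) : ℕ := 2 * numBlocks R n + R ^ 2

/-- The bit string of the arrays. -/
def chunk (R n : ℕ) (D : Arrays) : List Bool :=
  arr (R ^ 4) (numBlocks R n) D.bE ++ (arr (R ^ 4) (numBlocks R n) D.bR ++
  (arr (8 * R) (numLeaves R n) D.lE ++ (arr (8 * R) (numLeaves R n) D.lM ++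
  (arr (8 * R) (numLeaves R n) D.lC ++ (arr (8 * R) (numLeaves R n) D.lR ++
  (arr (8 * R) (numPio R n) D.pP ++ (arr (R ^ 4) (numPio R n) D.pB ++
  arr (R ^ 4) (numPio R n) D.pD)))))))

/-- The length of the bit string of the arrays. -/
def chunkLen (R n : ℕ) : ℕ :=
  R ^ 4 * numBlocks R n + R ^ 4 * numBlocks R n + 8 * R * numLeaves R n + 8 * R * numLeaves R n +
  8 * R * numLeaves R n + 8 * R * numLeaves R n + 8 * R * numPio R n + R ^ 4 * numPio R n +
  R ^ 4 * numPio R n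

theorem length_chunk (R n : ℕ) (D : Arrays) : (chunk R n D).length = chunkLen R n := by
  simp only [chunk, chunkLen, List.length_append, length_arr]; ring

/-- The arrays are correct for the walk; `F` marks the pioneers. -/
structure Index (R n k : ℕ) (c E : ℕ → ℕ) (F : ℕ → ℕ) (D : Arrays) : Prop where
  bE : ∀ b, b * R ^ 5 < n → D.bE b = E (b * R ^ 5)
  lE : ∀ x, x * R ^ 2 < n → D.lE x + E (x / R ^ 3 * R ^ 5) = E (x * R ^ 2) + R ^ 5
  lM_le : ∀ x r, x * R ^ 2 ≤ r → r < (x + 1) * R ^ 2 → r < n →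
    D.lM x + E (x / R ^ 3 * R ^ 5) ≤ E (r + 1) + R ^ 5
  lM_eq : ∀ x, x * R ^ 2 < n → ∃ r, x * R ^ 2 ≤ r ∧ r < (x + 1) * R ^ 2 ∧ r < n ∧
    D.lM x + E (x / R ^ 3 * R ^ 5) = E (r + 1) + R ^ 5
  lC : ∀ x, x * R ^ 2 < n → ∀ v, v + R ^ 5 = D.lM x + E (x / R ^ 3 * R ^ 5) →
    D.lC x = ccount c E k v (x * R ^ 2) (min ((x + 1) * R ^ 2) n)
  lM_lt : ∀ x, D.lM x < 2 ^ (8 * R - 1)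
  lC_le : ∀ x, D.lC x ≤ R ^ 2
  pP_lt : ∀ i, D.pP i < 2 ^ (8 * R - 1)
  bR : ∀ b, b * R ^ 5 < n → D.bR b = Nat.count (fun p => F p ≠ 0) (b * R ^ 5)
  lR : ∀ x, x * R ^ 2 < n → D.lR x + Nat.count (fun p => F p ≠ 0) (x / R ^ 3 * R ^ 5) =
    Nat.count (fun p => F p ≠ 0) (x * R ^ 2)
  pio : ∀ p, F p ≠ 0 → ∃ p', PairAt c k E p p' ∧ p / R ^ 5 ≠ p' / R ^ 5 ∧
    D.pP (Nat.count (fun p => F p ≠ 0) p) = p % R ^ 5 ∧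
    D.pB (Nat.count (fun p => F p ≠ 0) p) = p' / R ^ 5 ∧
    D.pD (Nat.count (fun p => F p ≠ 0) p) = ccount c E k (E p + 1) (p + 1) p'
  exists_pio : ∀ i i', PairAt c k E i i' → i / R ^ 5 ≠ i' / R ^ 5 →
    ∃ p p', i ≤ p ∧ F p ≠ 0 ∧ PairAt c k E p p' ∧ p / R ^ 5 = i / R ^ 5 ∧ p' / R ^ 5 = i' / R ^ 5
  count_le : Nat.count (fun p => F p ≠ 0) n ≤ 2 * numBlocks R n

/-- The data of a query: number of bits of a symbol, length and parameter, type and direction,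
addresses of the string and of the arrays, and the memory. -/
structure Query where
  bw : ℕ
  n : ℕ
  R : ℕ
  k : ℕ
  d : ℕ
  S : ℕ
  a : ℕ
  mem : ℕ → Bool

namespace Query
variable (q : Query)

/-- A bound for the number of bits in a word. -/
def β : ℕ := 40 * q.bw * q.R ^ 4
/-- The number of bits of a field of a spread leaf. -/
def f : ℕ := 9 * q.bw * q.R ^ 2
/-- The number of bits of a field of a summary. -/
def g : ℕ := 8 * q.R
-- The cut at `β` bits keeps the value within the word bound in every situation, without assuming
-- that the index is correct; under `Query.Good` it is ineffective for the lengths used.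
def rd (p len : ℕ) : ℕ := readBits q.mem p (min len q.β)
def nb : ℕ := numBlocks q.R q.n
def nl : ℕ := numLeaves q.R q.n
def np : ℕ := numPio q.R q.n
-- This and the following accessors add up the lengths of the preceding arrays in the order of
-- `chunk`. `LM` and `LC` fetch the entries of all leaves of a block in one load, `PP` a window of
-- `R ^ 2` pioneers.
def bE (b : ℕ) : ℕ := q.rd (q.a + q.R ^ 4 * b) (q.R ^ 4)
def bR (b : ℕ) : ℕ := q.rd (q.a + q.R ^ 4 * q.nb + q.R ^ 4 * b) (q.R ^ 4)
def oL : ℕ := q.a + q.R ^ 4 * q.nb + q.R ^ 4 * q.nb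
def lE (x : ℕ) : ℕ := q.rd (q.oL + q.g * x) q.g
def LM (b : ℕ) : ℕ := q.rd (q.oL + q.g * q.nl + q.g * (b * q.R ^ 3)) (q.g * q.R ^ 3)
def LC (b : ℕ) : ℕ := q.rd (q.oL + q.g * q.nl + q.g * q.nl + q.g * (b * q.R ^ 3)) (q.g * q.R ^ 3)
def lR (x : ℕ) : ℕ := q.rd (q.oL + q.g * q.nl + q.g * q.nl + q.g * q.nl + q.g * x) q.g
def oP : ℕ := q.oL + q.g * q.nl + q.g * q.nl + q.g * q.nl + q.g * q.nl
def PP (i : ℕ) : ℕ := q.rd (q.oP + q.g * i) (q.g * q.R ^ 2)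
def pP (i : ℕ) : ℕ := q.rd (q.oP + q.g * i) q.g
def pB (i : ℕ) : ℕ := q.rd (q.oP + q.g * q.np + q.R ^ 4 * i) (q.R ^ 4)
def pD (i : ℕ) : ℕ := q.rd (q.oP + q.g * q.np + q.R ^ 4 * q.np + q.R ^ 4 * i) (q.R ^ 4)

/-- The number of symbols of leaf `x`. -/
def cnt (x : ℕ) : ℕ := min (q.R ^ 2) (q.n - x * q.R ^ 2)

/-- The spread symbols of leaf `x`. -/
def syms (x : ℕ) : ℕ :=
  if q.d = 0 then
    spread q.β q.bw q.f (q.cnt x) (q.rd (q.S + q.bw * (x * q.R ^ 2)) (q.bw * q.cnt x))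
  else
    spreadRev q.β q.bw q.f (q.cnt x)
      (q.rd (q.S + q.bw * (q.n - x * q.R ^ 2 - q.cnt x)) (q.bw * q.cnt x))

/-- The symbols of leaf `x` that have the code `v`. -/
def eqMask (x v : ℕ) : ℕ :=
  geq q.β q.f (q.cnt x) (q.syms x) v - geq q.β q.f (q.cnt x) (q.syms x) (v + 1)

/-- The open parentheses of leaf `x`. -/
def opn (x : ℕ) : ℕ := if q.d = 0 then q.eqMask x (2 * q.k + 1) else q.eqMask x (2 * q.k)

/-- The close parentheses of leaf `x`. -/
def cls (x : ℕ) : ℕ := if q.d = 0 then q.eqMask x (2 * q.k) else q.eqMask x (2 * q.k + 1)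

/-- The relative levels in leaf `x`. -/
def levels (x : ℕ) : ℕ :=
  q.lE x * ones q.β q.f (q.cnt x) + psum q.β q.f (q.cnt x) (q.opn x) -
    psum q.β q.f (q.cnt x) (q.cls x)

/-- The first place from `a` on in leaf `x` with level below `v`. -/
def leafSearch (x a v : ℕ) : ℕ :=
  first q.β q.f (q.cnt x) (dropF q.β q.f a
    (ones q.β q.f (q.cnt x) - geq q.β q.f (q.cnt x) (q.levels x) v))

/-- The first leaf from number `y` on in block `b` that attains a level below `v`. -/
def sumSearch (b y v : ℕ) : ℕ :=
  first q.β q.g (q.R ^ 3) (dropF q.β q.g y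
    (ones q.β q.g (q.R ^ 3) - geq q.β q.g (q.R ^ 3) (q.LM b) v))

/-- The first position in block `b`, from place `a` in leaf `x` on, after which the relative level
is below `v`; if there is none, `n`. -/
def find (b x a v : ℕ) : ℕ :=
  if q.leafSearch x a v < q.cnt x then x * q.R ^ 2 + q.leafSearch x a v
  else if q.sumSearch b (x - b * q.R ^ 3 + 1) v < q.R ^ 3 then
    (b * q.R ^ 3 + q.sumSearch b (x - b * q.R ^ 3 + 1) v) * q.R ^ 2 +
      q.leafSearch (b * q.R ^ 3 + q.sumSearch b (x - b * q.R ^ 3 + 1) v) 0 v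
  else q.n

/-- The number of close parentheses in the places `[a, e)` of leaf `x` with level `v`. -/
def leafCount (x a e v : ℕ) : ℕ :=
  fsum q.β q.f (takeF q.β q.f e (dropF q.β q.f a
    ((geq q.β q.f (q.cnt x) (q.levels x) v - geq q.β q.f (q.cnt x) (q.levels x) (v + 1)) &&&
      q.cls x)))

/-- The number of close parentheses in the leaves `[y, z)` of block `b` with level `v`, provided
that no smaller level occurs there. -/
def sumCount (b y z v : ℕ) : ℕ :=
  fsum q.β q.g (takeF q.β q.g z (dropF q.β q.g y (selF q.β q.g (q.LC b)
    (geq q.β q.g (q.R ^ 3) (q.LM b) v - geq q.β q.g (q.R ^ 3) (q.LM b) (v + 1)))))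

/-- The relative level after position `i`. -/
def lev (i : ℕ) : ℕ := getF q.β q.f (i % q.R ^ 2) (q.levels (i / q.R ^ 2))

/-- The match of `i`, if it is in the same block, otherwise `n`. -/
def close (i : ℕ) : ℕ := q.find (i / q.R ^ 5) (i / q.R ^ 2) (i % q.R ^ 2) (q.lev i)

/-- The count for a pair of positions in the same block. -/
def near (i j : ℕ) : ℕ :=
  if i / q.R ^ 2 = j / q.R ^ 2 then
    q.leafCount (i / q.R ^ 2) (i % q.R ^ 2) (j % q.R ^ 2) (q.lev i)
  else q.leafCount (i / q.R ^ 2) (i % q.R ^ 2) (q.R ^ 2) (q.lev i) +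
    q.sumCount (i / q.R ^ 5) (i / q.R ^ 2 % q.R ^ 3 + 1) (j / q.R ^ 2 % q.R ^ 3) (q.lev i) +
    q.leafCount (j / q.R ^ 2) 0 (j % q.R ^ 2) (q.lev i)

/-- The number of pioneers before the leaf of `i`. -/
def rank (i : ℕ) : ℕ := q.bR (i / q.R ^ 5) + q.lR (i / q.R ^ 2)

/-- The number of the first pioneer from `i` on. -/
def pioIdx (i : ℕ) : ℕ :=
  q.rank i + first q.β q.g (q.R ^ 2) (geq q.β q.g (q.R ^ 2) (q.PP (q.rank i)) (i % q.R ^ 5))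

/-- The level of `i` relative to block `b`. -/
def levAt (i b : ℕ) : ℕ := q.lev i + q.bE (i / q.R ^ 5) - q.bE b

/-- The match of `i` in the block `b`. -/
def closeIn (i b : ℕ) : ℕ := q.find b (b * q.R ^ 3) 0 (q.levAt i b)

/-- The count for a pair of positions in different blocks, the second one in block `b`. -/
def far (i b j : ℕ) : ℕ :=
  q.leafCount (i / q.R ^ 2) (i % q.R ^ 2) (q.R ^ 2) (q.lev i) +
    q.sumCount (i / q.R ^ 5) (i / q.R ^ 2 % q.R ^ 3 + 1) (q.R ^ 3) (q.lev i) +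
    (q.sumCount b 0 (j / q.R ^ 2 % q.R ^ 3) (q.levAt i b) +
    q.leafCount (j / q.R ^ 2) 0 (j % q.R ^ 2) (q.levAt i b))

/-- The number of pairs nested directly inside the pair of the open parenthesis at `i`. -/
def degree (i : ℕ) : ℕ :=
  if q.close i < q.n then q.near i (q.close i)
  else if q.pP (q.pioIdx i) = i % q.R ^ 5 then q.pD (q.pioIdx i)
  else q.far i (q.pB (q.pioIdx i)) (q.closeIn i (q.pB (q.pioIdx i)))

end Query

end ParenString

/-! ### Correctness of searching and counting inside a block. -/

namespace ParenString
open WordRAM BitString Packed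

/-- Since `R < 2 ^ R`, fields of `8 * R` bits hold all relative levels, which are at most `2 * R ^
5`, and leave the top bit free as `geq_eq` requires: `5 * R + 2 ≤ 8 * R - 1`. -/
theorem pow_five_lt (R : ℕ) (hR : 0 < R) : 4 * R ^ 5 < 2 ^ (8 * R - 1) := by
  have h1 : R ^ 5 < (2 ^ R) ^ 5 := Nat.pow_lt_pow_left Nat.lt_two_pow_self (by norm_num)
  have h2 : 4 * (2 ^ R) ^ 5 ≤ 2 ^ (8 * R - 1) := by
    rw [← pow_mul, show 4 = 2 ^ 2 by norm_num, ← pow_add]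
    exact Nat.pow_le_pow_right (by norm_num) (by omega)
  omega

theorem div_leaf (R i : ℕ) : i / R ^ 2 / R ^ 3 = i / R ^ 5 := by
  rw [Nat.div_div_eq_div_mul, ← pow_add]

theorem leaf_mul (R b y : ℕ) : (b * R ^ 3 + y) * R ^ 2 = b * R ^ 5 + y * R ^ 2 := by ring

section Sums
variable {n k : ℕ} {c E : ℕ → ℕ}

/-- Written as an equation of two sums, so that no truncated subtraction occurs; it lets `psum`
recover all levels of a leaf from the level at its start. -/
theorem Walk.prefix_sum (W : Walk n k c E) (a j : ℕ) :
    E (a + j) + ∑ i ∈ Finset.range j, (if c (a + i) = 2 * k then 1 else 0) =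
      E a + ∑ i ∈ Finset.range j, (if c (a + i) = 2 * k + 1 then 1 else 0) := by
  induction j with
  | zero => simp
  | succ j ih =>
    rw [Finset.sum_range_succ, Finset.sum_range_succ, ← add_assoc a]
    rcases W.step (a + j) with ⟨h, h'⟩ | ⟨h, h'⟩ | ⟨h, h1, h'⟩
    · rw [if_pos h, if_neg (by omega)]; omega
    · rw [if_pos h, if_neg (by omega)]; omega
    · rw [if_neg h, if_neg h1]; omega

theorem sum_eq_ccount (v p a e : ℕ) (hae : a ≤ e) :
    ∑ j ∈ Finset.range e, (if a ≤ j then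
      (if c (p + j) = 2 * k ∧ E (p + j + 1) = v then 1 else 0) else 0) =
      ccount c E k v (p + a) (p + e) := by
  induction e, hae using Nat.le_induction with
  | base =>
    rw [ccount_self]
    refine Finset.sum_eq_zero fun j hj => ?_
    rw [if_neg]
    rw [Finset.mem_range] at hj; omega
  | succ e hae ih =>
    rw [Finset.sum_range_succ, ih, ← add_assoc, ccount_succ (by omega), if_pos hae]

theorem ccount_same {v a b : ℕ} (hab : a < b) (ha : c a = 2 * k + 1) :
    ccount c E k v a b = ccount c E k v (a + 1) b := by
  rw [ccount_add (Nat.le_succ a) hab, ccount_eq_zero (b := a + 1), zero_add]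
  intro r h1 h2 h3
  have : r = a := by omega
  subst this; omega

end Sums

/-- The memory of the query holds the string and the arrays. -/
structure Query.Good (q : Query) (c E F : ℕ → ℕ) (D : Arrays) : Prop where
  bw_pos : 0 < q.bw
  R_pos : 0 < q.R
  n_lt : q.n < 2 ^ q.R ^ 4
  walk : Walk q.n q.k c E
  k_lt : 2 * q.k + 1 < 2 ^ q.bw
  sym0 : q.d = 0 → ∀ p < q.n, c p = readBits q.mem (q.S + q.bw * p) q.bw
  sym1 : q.d ≠ 0 → ∀ p < q.n, c p =
    if readBits q.mem (q.S + q.bw * (q.n - 1 - p)) q.bw % 2 = 1 then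
      readBits q.mem (q.S + q.bw * (q.n - 1 - p)) q.bw - 1
    else readBits q.mem (q.S + q.bw * (q.n - 1 - p)) q.bw + 1
  has : Has q.mem q.a (chunk q.R q.n D)
  index : Index q.R q.n q.k c E F D

namespace Query.Good
variable {q : Query} {c E F : ℕ → ℕ} {D : Arrays} (h : q.Good c E F D)
include h

theorem s_pos : 0 < q.R ^ 2 := pow_pos h.R_pos 2
theorem m_pos : 0 < q.R ^ 3 := pow_pos h.R_pos 3
theorem B_pos : 0 < q.R ^ 5 := pow_pos h.R_pos 5

theorem pow_le {a b : ℕ} (hab : a ≤ b) : q.R ^ a ≤ q.R ^ b := Nat.pow_le_pow_right h.R_pos hab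

theorem R4_le_β : 40 * q.R ^ 4 ≤ q.β := by
  have := h.bw_pos
  unfold β
  exact Nat.mul_le_mul_right _ (by omega)

theorem g_pos : 0 < q.g := by have := h.R_pos; unfold g; omega

theorem g_mul_le {e : ℕ} (he : e ≤ q.R ^ 3) : q.g * e ≤ q.β := by
  refine le_trans ?_ h.R4_le_β
  calc q.g * e ≤ 8 * q.R * q.R ^ 3 := Nat.mul_le_mul_left _ he
    _ = 8 * q.R ^ 4 := by ring
    _ ≤ _ := by omega

theorem g_le : q.g ≤ q.β := by
  have := h.g_mul_le (e := 1) h.m_pos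
  rwa [mul_one] at this

/-- The width `f + bw` is the distance of the copies in the reversed spreading, the most
space-consuming operation on a leaf; the factor `40` in `β` leaves ample room for it. -/
theorem f_le' : q.f + q.bw ≤ q.β ∧ (q.f + q.bw) * q.R ^ 2 ≤ q.β := by
  have h2 : 1 ≤ q.R ^ 2 := h.s_pos
  have e : (q.f + q.bw) * q.R ^ 2 ≤ q.β := by
    unfold f β
    have : q.bw * q.R ^ 2 ≤ q.bw * q.R ^ 4 := Nat.mul_le_mul_left _ (h.pow_le (by omega))
    calc (9 * q.bw * q.R ^ 2 + q.bw) * q.R ^ 2 = 9 * (q.bw * q.R ^ 4) + q.bw * q.R ^ 2 := by ring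
      _ ≤ 40 * (q.bw * q.R ^ 4) := by omega
      _ = _ := by ring
  exact ⟨(Nat.le_mul_of_pos_right _ h2).trans e, e⟩

theorem f_le : q.f ≤ q.β := by have := h.f_le'; omega

theorem f_mul_le {e : ℕ} (he : e ≤ q.R ^ 2) : q.f * e ≤ q.β :=
  (Nat.mul_le_mul (Nat.le_add_right _ _) he).trans h.f_le'.2

theorem g_le_f : q.g ≤ q.f := by
  unfold g f
  have h1 := h.bw_pos
  have : q.R ≤ q.R ^ 2 := Nat.le_self_pow (by norm_num) _
  have : 1 * q.R ^ 2 ≤ q.bw * q.R ^ 2 := Nat.mul_le_mul_right _ h1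
  have e : 9 * q.bw * q.R ^ 2 = 9 * (q.bw * q.R ^ 2) := by ring
  omega

theorem f_pos : 0 < q.f := h.g_pos.trans_le h.g_le_f

theorem B_lt_g : 4 * q.R ^ 5 < 2 ^ (q.g - 1) := pow_five_lt _ h.R_pos

theorem B_lt_f : 4 * q.R ^ 5 < 2 ^ (q.f - 1) :=
  h.B_lt_g.trans_le (Nat.pow_le_pow_right (by norm_num) (Nat.sub_le_sub_right h.g_le_f 1))

theorem two_pow_g : 2 ^ q.g = 2 ^ (q.g - 1) * 2 := two_pow_pred h.g_pos

theorem two_pow_f : 2 ^ q.f = 2 ^ (q.f - 1) * 2 := two_pow_pred h.f_pos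

theorem bw_lt_f : q.bw ≤ q.f - 1 ∧ q.bw * (q.R ^ 2 + 1) ≤ q.f := by
  have h1 := h.bw_pos
  have h2 : 1 ≤ q.R ^ 2 := h.s_pos
  have : q.bw * 1 ≤ q.bw * q.R ^ 2 := Nat.mul_le_mul_left _ h2
  have e : 9 * q.bw * q.R ^ 2 = 9 * (q.bw * q.R ^ 2) := by ring
  rw [mul_add]
  unfold f
  omega

omit h in
theorem cnt_le (x : ℕ) : q.cnt x ≤ q.R ^ 2 := min_le_left _ _

omit h in
theorem pos_of_lt {x j : ℕ} (hj : j < q.cnt x) : x * q.R ^ 2 + j < q.n ∧ j < q.R ^ 2 := by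
  unfold cnt at hj; omega

theorem block_lt {b : ℕ} (hb : b * q.R ^ 5 < q.n) : b < q.nb := by
  unfold nb numBlocks
  have : b ≤ q.n / q.R ^ 5 := (Nat.le_div_iff_mul_le h.B_pos).2 hb.le
  omega

theorem leaf_bounds (x : ℕ) : x / q.R ^ 3 * q.R ^ 5 ≤ x * q.R ^ 2 ∧
    (x + 1) * q.R ^ 2 ≤ x / q.R ^ 3 * q.R ^ 5 + q.R ^ 5 := by
  have h1 := Nat.div_add_mod x (q.R ^ 3)
  have h2 := Nat.mod_lt x h.m_pos
  have e := leaf_mul q.R (x / q.R ^ 3) (x % q.R ^ 3)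
  have e' := leaf_mul q.R (x / q.R ^ 3) (x % q.R ^ 3 + 1)
  rw [mul_comm (q.R ^ 3)] at h1
  rw [h1] at e
  rw [← add_assoc, h1] at e'
  have : (x % q.R ^ 3 + 1) * q.R ^ 2 ≤ q.R ^ 3 * q.R ^ 2 := Nat.mul_le_mul_right _ h2
  rw [← pow_add] at this
  norm_num at this
  omega

theorem leaf_lt {x : ℕ} (hx : x * q.R ^ 2 < q.n) : x < q.nl := by
  have h1 := h.block_lt (b := x / q.R ^ 3) ((h.leaf_bounds x).1.trans_lt hx)
  unfold nl numLeaves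
  exact (Nat.div_lt_iff_lt_mul h.m_pos).1 h1

omit h in
theorem rd_eq {p len : ℕ} (hl : len ≤ q.β) : q.rd p len = readBits q.mem p len := by
  rw [rd, min_eq_left hl]

theorem parts :
    Has q.mem q.a (arr (q.R ^ 4) q.nb D.bE) ∧
    Has q.mem (q.a + q.R ^ 4 * q.nb) (arr (q.R ^ 4) q.nb D.bR) ∧
    Has q.mem q.oL (arr q.g q.nl D.lE) ∧
    Has q.mem (q.oL + q.g * q.nl) (arr q.g q.nl D.lM) ∧
    Has q.mem (q.oL + q.g * q.nl + q.g * q.nl) (arr q.g q.nl D.lC) ∧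
    Has q.mem (q.oL + q.g * q.nl + q.g * q.nl + q.g * q.nl) (arr q.g q.nl D.lR) ∧
    Has q.mem q.oP (arr q.g q.np D.pP) ∧
    Has q.mem (q.oP + q.g * q.np) (arr (q.R ^ 4) q.np D.pB) ∧
    Has q.mem (q.oP + q.g * q.np + q.R ^ 4 * q.np) (arr (q.R ^ 4) q.np D.pD) := by
  have := h.has
  simp only [chunk, Has.append_iff, length_arr] at this
  exact this

theorem R4_le : q.R ^ 4 ≤ q.β := by have := h.R4_le_β; omega

theorem bE_eq {b : ℕ} (hb : b * q.R ^ 5 < q.n) : q.bE b = E (b * q.R ^ 5) := by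
  have h1 := h.walk.le (b * q.R ^ 5)
  rw [bE, rd_eq h.R4_le, h.parts.1.arr (h.block_lt hb), h.index.bE b hb, Nat.mod_eq_of_lt]
  have := h.n_lt; omega

theorem bR_eq {b : ℕ} (hb : b * q.R ^ 5 < q.n) :
    q.bR b = Nat.count (fun p => F p ≠ 0) (b * q.R ^ 5) := by
  have h1 : Nat.count (fun p => F p ≠ 0) (b * q.R ^ 5) ≤ b * q.R ^ 5 := Nat.count_le _
  rw [bR, rd_eq h.R4_le, h.parts.2.1.arr (h.block_lt hb), h.index.bR b hb, Nat.mod_eq_of_lt]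
  have := h.n_lt; omega

/-- Within a block the level changes by at most `R ^ 5`, so the shifted relative level lies between
`0` and `2 * R ^ 5` and is not truncated to its field. -/
theorem lE_eq {x : ℕ} (hx : x * q.R ^ 2 < q.n) : q.lE x = D.lE x := by
  have h1 := h.index.lE x hx
  have h2 := h.leaf_bounds x
  have h3 := h.walk.le_add (x / q.R ^ 3 * q.R ^ 5) (x * q.R ^ 2 - x / q.R ^ 3 * q.R ^ 5)
  rw [Nat.add_sub_cancel' h2.1] at h3
  have h5 : 0 < q.R ^ 2 := h.s_pos
  rw [add_mul] at h2
  rw [lE, rd_eq h.g_le, h.parts.2.2.1.arr (h.leaf_lt hx), Nat.mod_eq_of_lt]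
  have := h.B_lt_g
  have := h.two_pow_g
  omega

theorem lR_eq {x : ℕ} (hx : x * q.R ^ 2 < q.n) : q.lR x = D.lR x := by
  have h1 := h.index.lR x hx
  have h2 := h.leaf_bounds x
  have h3 : Nat.count (fun p => F p ≠ 0) (x * q.R ^ 2) ≤
      Nat.count (fun p => F p ≠ 0) (x / q.R ^ 3 * q.R ^ 5) +
        (x * q.R ^ 2 - x / q.R ^ 3 * q.R ^ 5) := by
    conv_lhs => rw [← Nat.add_sub_cancel' h2.1]
    rw [Nat.count_add]
    exact Nat.add_le_add_left (Nat.count_le _) _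
  have h5 : 0 < q.R ^ 2 := h.s_pos
  rw [add_mul] at h2
  rw [lR, rd_eq h.g_le, h.parts.2.2.2.2.2.1.arr (h.leaf_lt hx), Nat.mod_eq_of_lt]
  have := h.B_lt_g
  have := h.two_pow_g
  omega

theorem s_le_B : q.R ^ 2 ≤ q.R ^ 5 := h.pow_le (by norm_num)

theorem m_le_B : q.R ^ 3 ≤ q.R ^ 5 := h.pow_le (by norm_num)

theorem half_lt : 2 ^ (q.g - 1) < 2 ^ q.g := by
  have := h.two_pow_g
  have := h.B_lt_g
  omega

theorem block_leaves {b : ℕ} (hb : b * q.R ^ 5 < q.n) : b * q.R ^ 3 + q.R ^ 3 ≤ q.nl := by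
  have h1 : (b + 1) * q.R ^ 3 ≤ q.nb * q.R ^ 3 := Nat.mul_le_mul_right _ (h.block_lt hb)
  rw [add_mul, one_mul] at h1
  exact h1

theorem LM_eq {b : ℕ} (hb : b * q.R ^ 5 < q.n) :
    q.LM b = pk q.g (q.R ^ 3) fun y => D.lM (b * q.R ^ 3 + y) := by
  rw [LM, rd_eq (h.g_mul_le le_rfl), h.parts.2.2.2.1.arr_pk (h.block_leaves hb)]
  exact fun i _ => (h.index.lM_lt i).trans h.half_lt

theorem lC_lt (x : ℕ) : D.lC x < 2 ^ (q.g - 1) := by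
  have := h.index.lC_le x
  have := h.B_lt_g
  have := h.s_le_B
  omega

theorem LC_eq {b : ℕ} (hb : b * q.R ^ 5 < q.n) :
    q.LC b = pk q.g (q.R ^ 3) fun y => D.lC (b * q.R ^ 3 + y) := by
  rw [LC, rd_eq (h.g_mul_le le_rfl), h.parts.2.2.2.2.1.arr_pk (h.block_leaves hb)]
  exact fun i _ => (h.lC_lt i).trans h.half_lt

theorem s_le_m : q.R ^ 2 ≤ q.R ^ 3 := h.pow_le (by norm_num)

theorem PP_eq {i : ℕ} (hi : i + q.R ^ 2 ≤ q.np) :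
    q.PP i = pk q.g (q.R ^ 2) fun y => D.pP (i + y) := by
  rw [PP, rd_eq (h.g_mul_le h.s_le_m), h.parts.2.2.2.2.2.2.1.arr_pk hi]
  exact fun i _ => (h.index.pP_lt i).trans h.half_lt

theorem pio_reads {p : ℕ} (hp : F p ≠ 0) : ∃ p', PairAt c q.k E p p' ∧
    p / q.R ^ 5 ≠ p' / q.R ^ 5 ∧
    q.pP (Nat.count (fun p => F p ≠ 0) p) = p % q.R ^ 5 ∧
    q.pB (Nat.count (fun p => F p ≠ 0) p) = p' / q.R ^ 5 ∧
    q.pD (Nat.count (fun p => F p ≠ 0) p) = ccount c E q.k (E p + 1) (p + 1) p' := by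
  obtain ⟨p', h1, h2, h3, h4, h5⟩ := h.index.pio p hp
  have hp' : p' < q.n := h.walk.ran p' (Or.inr h1.2.2.1)
  have hpp := h1.1
  have hlt : Nat.count (fun p => F p ≠ 0) p < q.np := by
    have : Nat.count (fun p => F p ≠ 0) p ≤ Nat.count (fun p => F p ≠ 0) q.n :=
      Nat.count_monotone _ (by omega)
    have h6 := h.index.count_le
    have h7 := h.s_pos
    unfold np numPio
    omega
  have hn := h.n_lt
  refine ⟨p', h1, h2, ?_, ?_, ?_⟩
  · rw [pP, rd_eq h.g_le, h.parts.2.2.2.2.2.2.1.arr hlt, h3, Nat.mod_eq_of_lt]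
    have := Nat.mod_lt p h.B_pos
    have := h.B_lt_g
    have := h.half_lt
    omega
  · rw [pB, rd_eq h.R4_le, h.parts.2.2.2.2.2.2.2.1.arr hlt, h4, Nat.mod_eq_of_lt]
    have := Nat.div_le_self p' (q.R ^ 5)
    omega
  · rw [pD, rd_eq h.R4_le, h.parts.2.2.2.2.2.2.2.2.arr hlt, h5, Nat.mod_eq_of_lt]
    have : ccount c E q.k (E p + 1) (p + 1) p' ≤ p' - (p + 1) := ccount_le
    omega

/-! ### Leaves -/

/-- Equality with `v` is the difference of the threshold masks for `v` and `v + 1`. -/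
theorem eqMask_eq {x v : ℕ} {a : ℕ → ℕ} (ha : ∀ j < q.cnt x, a j < 2 ^ q.bw)
    (hs : q.syms x = pk q.f (q.cnt x) a) (hv : v < 2 ^ q.bw) :
    q.eqMask x v = pk q.f (q.cnt x) fun j => if a j = v then 1 else 0 := by
  have h1 : 2 ^ q.bw ≤ 2 ^ (q.f - 1) := Nat.pow_le_pow_right (by norm_num) h.bw_lt_f.1
  have ha' : ∀ j < q.cnt x, a j < 2 ^ (q.f - 1) := fun j hj => (ha j hj).trans_le h1
  have hc := h.f_mul_le (cnt_le x)
  rw [eqMask, hs, geq_eq h.f_pos hc h.f_le (by omega) ha', geq_eq h.f_pos hc h.f_le (by omega) ha',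
    pk_sub]
  · refine pk_congr fun j hj => ?_
    rcases Nat.lt_trichotomy (a j) v with hlt | hlt | hlt
    · rw [if_neg (by omega), if_neg (by omega), if_neg (by omega)]
    · rw [if_pos (by omega), if_neg (by omega), if_pos (by omega)]
    · rw [if_pos (by omega), if_pos (by omega), if_neg (by omega)]
  · intro j hj
    by_cases hlt : v + 1 ≤ a j
    · rw [if_pos hlt, if_pos (by omega)]
    · rw [if_neg hlt]; exact Nat.zero_le _

/-- For the reversed direction the leaf is a stretch of the stored string read backwards, with the
roles of the codes `2 * k` and `2 * k + 1` exchanged; the reversed string itself is never stored. -/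
theorem masks {x : ℕ} (hx : x * q.R ^ 2 < q.n) :
    q.opn x = pk q.f (q.cnt x)
      (fun j => if c (x * q.R ^ 2 + j) = 2 * q.k + 1 then 1 else 0) ∧
    q.cls x = pk q.f (q.cnt x) (fun j => if c (x * q.R ^ 2 + j) = 2 * q.k then 1 else 0) := by
  have hk := h.k_lt
  have hcnt := cnt_le (q := q) x
  have hbw : q.bw * q.cnt x ≤ q.β := by
    refine le_trans (Nat.mul_le_mul ?_ hcnt) h.f_le'.2
    omega
  have hbf : q.bw * (q.cnt x + 1) ≤ q.f :=
    (Nat.mul_le_mul_left _ (by omega)).trans h.bw_lt_f.2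
  have hcn : q.cnt x ≤ q.n - x * q.R ^ 2 := min_le_right _ _
  by_cases hd : q.d = 0
  · have hs : q.syms x = pk q.f (q.cnt x) fun j => c (x * q.R ^ 2 + j) := by
      rw [syms, if_pos hd, rd_eq hbw, readBits_mul]
      rw [spread_eq h.bw_pos hbf (h.f_mul_le hcnt) h.f_le fun j _ => readBits_lt _ _ _]
      refine pk_congr fun j hj => ?_
      rw [h.sym0 hd _ (pos_of_lt hj).1]
      congr 1; ring
    have hlt : ∀ j < q.cnt x, c (x * q.R ^ 2 + j) < 2 ^ q.bw := fun j hj => by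
      rw [h.sym0 hd _ (pos_of_lt hj).1]; exact readBits_lt _ _ _
    rw [opn, cls, if_pos hd, if_pos hd, h.eqMask_eq hlt hs hk, h.eqMask_eq hlt hs (by omega)]
    exact ⟨rfl, rfl⟩
  · let o : ℕ → ℕ := fun j => readBits q.mem (q.S + q.bw * (q.n - 1 - (x * q.R ^ 2 + j))) q.bw
    have hs : q.syms x = pk q.f (q.cnt x) o := by
      rw [syms, if_neg hd, rd_eq hbw, readBits_mul]
      rw [spreadRev_eq h.bw_pos hbf ((Nat.mul_le_mul_left _ hcnt).trans h.f_le'.2) h.f_le'.1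
        fun j _ => readBits_lt _ _ _]
      refine pk_congr fun j hj => ?_
      show _ = readBits _ _ _
      congr 1
      have := pos_of_lt hj
      rw [add_assoc, ← mul_add]
      congr 2
      omega
    have hlt : ∀ j < q.cnt x, o j < 2 ^ q.bw := fun j hj => readBits_lt _ _ _
    rw [opn, cls, if_neg hd, if_neg hd, h.eqMask_eq hlt hs hk, h.eqMask_eq hlt hs (by omega)]
    have e : ∀ j < q.cnt x, c (x * q.R ^ 2 + j) = if o j % 2 = 1 then o j - 1 else o j + 1 :=
      fun j hj => h.sym1 hd _ (pos_of_lt hj).1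
    constructor
    · refine pk_congr fun j hj => ?_
      rw [e j hj]
      have : (o j = 2 * q.k) ↔ ((if o j % 2 = 1 then o j - 1 else o j + 1) = 2 * q.k + 1) := by
        split <;> omega
      simp only [this]
    · refine pk_congr fun j hj => ?_
      rw [e j hj]
      have : (o j = 2 * q.k + 1) ↔ ((if o j % 2 = 1 then o j - 1 else o j + 1) = 2 * q.k) := by
        split <;> omega
      simp only [this]

theorem level_bounds {x j : ℕ} (hj : j < q.R ^ 2) :
    E (x / q.R ^ 3 * q.R ^ 5) ≤ E (x * q.R ^ 2 + j + 1) + q.R ^ 5 ∧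
    E (x * q.R ^ 2 + j + 1) ≤ E (x / q.R ^ 3 * q.R ^ 5) + q.R ^ 5 := by
  have h2 := h.leaf_bounds x
  rw [add_mul, one_mul] at h2
  obtain ⟨d, hd⟩ := Nat.exists_eq_add_of_le (show x / q.R ^ 3 * q.R ^ 5 ≤ x * q.R ^ 2 + j + 1 by omega)
  have h3 := h.walk.le_add (x / q.R ^ 3 * q.R ^ 5) d
  have h4 := h.walk.le_sub (x / q.R ^ 3 * q.R ^ 5) d
  rw [← hd] at h3 h4
  omega

/-- All levels in a leaf come out at once: the level at its start plus prefix sums of the open mask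
minus prefix sums of the close mask. The shift by `R ^ 5` keeps every field nonnegative. -/
theorem levels_eq {x : ℕ} (hx : x * q.R ^ 2 < q.n) :
    q.levels x = pk q.f (q.cnt x) fun j =>
      E (x * q.R ^ 2 + j + 1) + q.R ^ 5 - E (x / q.R ^ 3 * q.R ^ 5) := by
  obtain ⟨ho, hc⟩ := h.masks hx
  have hcnt := cnt_le (q := q) x
  have hf := h.f_mul_le hcnt
  have hsum : ∀ (p : ℕ → Prop) [DecidablePred p],
      ∑ j ∈ Finset.range (q.cnt x), (if p j then 1 else 0) < 2 ^ q.f := by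
    intro p _
    have h1 : ∑ j ∈ Finset.range (q.cnt x), (if p j then 1 else 0) ≤ q.cnt x := by
      refine (Finset.sum_le_sum (g := fun _ => 1) fun i _ => ?_).trans (by simp)
      split <;> omega
    have h2 := h.B_lt_f
    have h3 := h.s_le_B
    have := h.two_pow_f
    omega
  rw [levels, ho, hc, h.lE_eq hx, pk_const_eq _ h.f_pos hf h.f_le,
    psum_eq h.f_pos hf h.f_le (hsum _), psum_eq h.f_pos hf h.f_le (hsum _), pk_add, pk_sub]
  · refine pk_congr fun j hj => ?_
    have h1 := h.walk.prefix_sum (x * q.R ^ 2) (j + 1)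
    have h2 := h.index.lE x hx
    have h3 := h.level_bounds (x := x) (pos_of_lt hj).2
    rw [← add_assoc] at h1
    omega
  · intro j hj
    have h1 := h.walk.prefix_sum (x * q.R ^ 2) (j + 1)
    have h2 := h.index.lE x hx
    have h3 := h.level_bounds (x := x) (pos_of_lt hj).2
    rw [← add_assoc] at h1
    omega

theorem level_lt {x : ℕ} : ∀ j < q.cnt x,
    E (x * q.R ^ 2 + j + 1) + q.R ^ 5 - E (x / q.R ^ 3 * q.R ^ 5) < 2 ^ (q.f - 1) := by
  intro j hj
  have h3 := h.level_bounds (x := x) (pos_of_lt hj).2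
  have := h.B_lt_f
  omega

omit h in
theorem sub_mask {f c v : ℕ} (a : ℕ → ℕ) :
    (pk f c fun _ => 1) - (pk f c fun j => if v ≤ a j then 1 else 0) =
      pk f c fun j => if a j < v then 1 else 0 := by
  rw [pk_sub]
  · refine pk_congr fun j _ => ?_
    by_cases hlt : v ≤ a j
    · rw [if_pos hlt, if_neg (by omega)]
    · rw [if_neg hlt, if_pos (by omega)]
  · intro j _; split <;> omega

omit h in
theorem drop_mask {β f c x : ℕ} (hf : 0 < f) (hx : x ≤ c) (hxβ : f * x ≤ β) (p : ℕ → Prop)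
    [DecidablePred p] : dropF β f x (pk f c fun j => if p j then 1 else 0) =
      pk f c fun j => if x ≤ j ∧ p j then 1 else 0 := by
  have h1 : 1 < 2 ^ f := Nat.one_lt_two_pow hf.ne'
  rw [dropF_eq hx hxβ fun j _ => by split <;> omega]
  refine pk_congr fun j _ => ?_
  by_cases h1 : x ≤ j <;> by_cases h2 : p j <;> simp [h1, h2]

/-- The fields below `v` are the complement of a threshold mask; those before place `a` are erased
before the first one is located. -/
theorem leafSearch_spec {x a v : ℕ} (hx : x * q.R ^ 2 < q.n) (ha : a ≤ q.cnt x)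
    (hv : v ≤ 2 * q.R ^ 5 + 1) :
    q.leafSearch x a v ≤ q.cnt x ∧
    (∀ j < q.leafSearch x a v, a ≤ j →
      v + E (x / q.R ^ 3 * q.R ^ 5) ≤ E (x * q.R ^ 2 + j + 1) + q.R ^ 5) ∧
    (q.leafSearch x a v < q.cnt x → a ≤ q.leafSearch x a v ∧
      E (x * q.R ^ 2 + q.leafSearch x a v + 1) + q.R ^ 5 < v + E (x / q.R ^ 3 * q.R ^ 5)) := by
  have hcnt := cnt_le (q := q) x
  have hf := h.f_mul_le hcnt
  have hB := h.B_lt_f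
  have hB0 := h.B_pos
  have hs := h.s_le_B
  unfold leafSearch
  rw [h.levels_eq hx, geq_eq h.f_pos hf h.f_le (by omega) h.level_lt, ones_eq h.f_pos hf h.f_le,
    sub_mask, drop_mask h.f_pos ha (h.f_mul_le (ha.trans hcnt))]
  obtain ⟨h1, h2, h3⟩ := first_eq h.f_pos hf h.f_le (by omega) (fun j => a ≤ j ∧
    E (x * q.R ^ 2 + j + 1) + q.R ^ 5 - E (x / q.R ^ 3 * q.R ^ 5) < v)
  generalize first q.β q.f (q.cnt x) _ = ρ at *
  refine ⟨h1, fun j hj haj => ?_, fun hlt => ?_⟩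
  · have h4 := h2 j hj
    have h5 := h.level_bounds (x := x) (j := j) (by omega)
    by_contra hcon
    exact h4 ⟨haj, by omega⟩
  · have h4 := h3 hlt
    have h5 := h.level_bounds (x := x) (j := ρ) (by omega)
    exact ⟨h4.1, by omega⟩

theorem sumSearch_spec {b y v : ℕ} (hb : b * q.R ^ 5 < q.n) (hy : y ≤ q.R ^ 3)
    (hv : v ≤ 2 * q.R ^ 5 + 1) :
    q.sumSearch b y v ≤ q.R ^ 3 ∧
    (∀ j < q.sumSearch b y v, y ≤ j → v ≤ D.lM (b * q.R ^ 3 + j)) ∧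
    (q.sumSearch b y v < q.R ^ 3 → y ≤ q.sumSearch b y v ∧
      D.lM (b * q.R ^ 3 + q.sumSearch b y v) < v) := by
  have hf := h.g_mul_le (e := q.R ^ 3) le_rfl
  have hB := h.B_lt_g
  have hB0 := h.B_pos
  have hm := h.m_le_B
  unfold sumSearch
  rw [h.LM_eq hb, geq_eq h.g_pos hf h.g_le (by omega) fun j _ => h.index.lM_lt _,
    ones_eq h.g_pos hf h.g_le, sub_mask, drop_mask h.g_pos hy (h.g_mul_le hy)]
  obtain ⟨h1, h2, h3⟩ := first_eq h.g_pos hf h.g_le (by omega) (fun j => y ≤ j ∧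
    D.lM (b * q.R ^ 3 + j) < v)
  generalize first q.β q.g (q.R ^ 3) _ = ρ at *
  refine ⟨h1, fun j hj haj => ?_, fun hlt => h3 hlt⟩
  have h4 := h2 j hj
  by_contra hcon
  exact h4 ⟨haj, by omega⟩

theorem leafSearch_eq {x a v j : ℕ} (hx : x * q.R ^ 2 < q.n) (ha : a ≤ j) (hj : j < q.cnt x)
    (hv : v ≤ 2 * q.R ^ 5 + 1)
    (h1 : E (x * q.R ^ 2 + j + 1) + q.R ^ 5 < v + E (x / q.R ^ 3 * q.R ^ 5))
    (h2 : ∀ r, a ≤ r → r < j →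
      v + E (x / q.R ^ 3 * q.R ^ 5) ≤ E (x * q.R ^ 2 + r + 1) + q.R ^ 5) :
    q.leafSearch x a v = j := by
  obtain ⟨g1, g2, g3⟩ := h.leafSearch_spec hx (ha.trans hj.le) hv
  rcases Nat.lt_trichotomy (q.leafSearch x a v) j with hlt | heq | hlt
  · have := g3 (by omega)
    have := h2 _ this.1 hlt
    omega
  · exact heq
  · have := g2 j hlt ha
    omega

theorem leafSearch_none {x a v : ℕ} (hx : x * q.R ^ 2 < q.n) (ha : a ≤ q.cnt x)
    (hv : v ≤ 2 * q.R ^ 5 + 1)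
    (h2 : ∀ r, a ≤ r → r < q.cnt x →
      v + E (x / q.R ^ 3 * q.R ^ 5) ≤ E (x * q.R ^ 2 + r + 1) + q.R ^ 5) :
    ¬ q.leafSearch x a v < q.cnt x := by
  intro hlt
  obtain ⟨g1, g2, g3⟩ := h.leafSearch_spec hx ha hv
  have := g3 hlt
  have := h2 _ this.1 hlt
  omega

theorem leaf_of (p : ℕ) : p / q.R ^ 2 * q.R ^ 2 + p % q.R ^ 2 = p ∧ p % q.R ^ 2 < q.R ^ 2 :=
  ⟨Nat.div_add_mod' p _, Nat.mod_lt _ h.s_pos⟩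

theorem mod_lt_cnt {p : ℕ} (hp : p < q.n) : p % q.R ^ 2 < q.cnt (p / q.R ^ 2) := by
  have := h.leaf_of p
  unfold cnt
  omega

theorem block_of (p : ℕ) : p / q.R ^ 5 * q.R ^ 5 ≤ p ∧ p < p / q.R ^ 5 * q.R ^ 5 + q.R ^ 5 := by
  have := Nat.div_mul_le_self p (q.R ^ 5)
  have := Nat.lt_div_mul_add h.B_pos (a := p)
  omega

theorem leaf_block (p : ℕ) : p / q.R ^ 2 =
    p / q.R ^ 5 * q.R ^ 3 + p / q.R ^ 2 % q.R ^ 3 ∧ p / q.R ^ 2 % q.R ^ 3 < q.R ^ 3 := by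
  rw [← div_leaf]
  exact ⟨(Nat.div_add_mod' _ _).symm, Nat.mod_lt _ h.m_pos⟩

theorem leaf_div {b y : ℕ} (hy : y < q.R ^ 3) : (b * q.R ^ 3 + y) / q.R ^ 3 = b := by
  rw [mul_comm, Nat.mul_add_div h.m_pos, Nat.div_eq_of_lt hy, add_zero]

omit h in
theorem leaf_mono {x y : ℕ} (hxy : x ≤ y) : x * q.R ^ 2 ≤ y * q.R ^ 2 := Nat.mul_le_mul_right _ hxy

omit h in
theorem m_mul_s : q.R ^ 3 * q.R ^ 2 = q.R ^ 5 := by rw [← pow_add]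

/-- If `p` is not in leaf `x`, the next leaf whose minimum is below `v` must be the leaf of `p`:
minima are attained, so an earlier such leaf would contain an earlier hit, and the leaf of `p`
qualifies because of `p`. -/
theorem find_eq {b x a v p : ℕ} (hb : x / q.R ^ 3 = b) (hxn : x * q.R ^ 2 < q.n)
    (hxa : x * q.R ^ 2 + a ≤ p) (hp : p < q.n)
    (hpb : p / q.R ^ 5 = b) (hv : v ≤ 2 * q.R ^ 5 + 1)
    (h1 : E (p + 1) + q.R ^ 5 < v + E (b * q.R ^ 5))
    (h2 : ∀ r, x * q.R ^ 2 + a ≤ r → r < p → v + E (b * q.R ^ 5) ≤ E (r + 1) + q.R ^ 5)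
    (ha : a ≤ q.cnt x) :
    q.find b x a v = p := by
  have hcnt := cnt_le (q := q) x
  have hlp := h.leaf_of p
  have hlp' := Nat.div_mul_le_self p (q.R ^ 2)
  have hbp := h.leaf_block p
  have hs := h.s_pos
  unfold find
  rcases Nat.lt_or_ge p (x * q.R ^ 2 + q.cnt x) with hin | hout
  · have : q.leafSearch x a v = p - x * q.R ^ 2 := by
      refine h.leafSearch_eq hxn (by omega) (by omega) hv ?_ ?_
      · rw [hb, show x * q.R ^ 2 + (p - x * q.R ^ 2) = p by omega]; exact h1
      · intro r hr hr'
        rw [hb]; exact h2 _ (by omega) (by omega)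
    rw [this, if_pos (by omega)]; omega
  -- A position `p < n` beyond the symbols of leaf `x` shows that this leaf is not cut off by the
  -- end of the string.
  · have hfull : q.cnt x = q.R ^ 2 := by unfold cnt at *; omega
    rw [if_neg (h.leafSearch_none hxn ha hv fun r hr hr' => by
      rw [hb]; exact h2 _ (by omega) (by omega))]
    have hxp : x + 1 ≤ p / q.R ^ 2 := by
      rw [Nat.le_div_iff_mul_le hs, add_mul]; omega
    rw [hpb] at hbp
    have hxb : b * q.R ^ 3 ≤ x := by rw [← hb]; exact Nat.div_mul_le_self _ _
    generalize hyp : p / q.R ^ 2 % q.R ^ 3 = yp at *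
    generalize hxpd : p / q.R ^ 2 = xp at *
    have hbn : b * q.R ^ 5 < q.n := by
      have := (h.block_of p).1; rw [hpb] at this; omega
    have hxb5 : xp / q.R ^ 3 = b := by rw [hbp.1]; exact h.leaf_div hbp.2
    obtain ⟨g1, g2, g3⟩ := h.sumSearch_spec (b := b) (y := x - b * q.R ^ 3 + 1) hbn (by omega) hv
    have e1 : D.lM xp < v := by
      have := h.index.lM_le xp p (by omega) (by rw [add_mul]; omega) hp
      rw [hxb5] at this
      omega
    have hσ : q.sumSearch b (x - b * q.R ^ 3 + 1) v = yp := by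
      generalize q.sumSearch b (x - b * q.R ^ 3 + 1) v = σ at *
      rcases Nat.lt_trichotomy σ yp with hlt | heq | hlt
      · have h3 := g3 (by omega)
        have hle : (b * q.R ^ 3 + σ + 1) * q.R ^ 2 ≤ xp * q.R ^ 2 := leaf_mono (by omega)
        have hge : (x + 1) * q.R ^ 2 ≤ (b * q.R ^ 3 + σ) * q.R ^ 2 := leaf_mono (by omega)
        rw [add_mul _ 1] at hle hge
        obtain ⟨r, hr1, hr2, hr3, hr4⟩ := h.index.lM_eq (b * q.R ^ 3 + σ) (by omega)
        rw [h.leaf_div (by omega)] at hr4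
        rw [add_mul _ 1] at hr2
        have := h2 r (by omega) (by omega)
        omega
      · exact heq
      · have := g2 yp hlt (by omega)
        rw [← hbp.1] at this
        omega
    rw [hσ, if_pos hbp.2, ← hbp.1]
    have hge : (x + 1) * q.R ^ 2 ≤ xp * q.R ^ 2 := leaf_mono hxp
    rw [add_mul _ 1] at hge
    rw [h.leafSearch_eq (x := xp) (a := 0) (v := v) (j := p % q.R ^ 2) (by omega) (Nat.zero_le _)
      (by unfold cnt; omega) hv (by rw [hxb5, hlp.1]; exact h1) fun r _ hr => by
        rw [hxb5]; exact h2 _ (by omega) (by omega)]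
    exact hlp.1

/-- The block has to be complete: leaves beyond the end of the string have no meaningful minimum in
the array and could be taken for a hit. -/
theorem find_none {b x a v : ℕ} (hb : x / q.R ^ 3 = b) (hfull : (b + 1) * q.R ^ 5 ≤ q.n)
    (ha : a ≤ q.R ^ 2) (hv : v ≤ 2 * q.R ^ 5 + 1)
    (h2 : ∀ r, x * q.R ^ 2 + a ≤ r → r < (b + 1) * q.R ^ 5 →
      v + E (b * q.R ^ 5) ≤ E (r + 1) + q.R ^ 5) :
    q.find b x a v = q.n := by
  have hs := h.s_pos
  have hB := h.B_pos
  have hlb := h.leaf_bounds x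
  rw [hb] at hlb
  rw [add_mul, one_mul] at hlb
  rw [add_mul, one_mul] at hfull
  have hcnt : q.cnt x = q.R ^ 2 := by unfold cnt; omega
  have hxb : b * q.R ^ 3 ≤ x := by rw [← hb]; exact Nat.div_mul_le_self _ _
  have hxb2 : x < b * q.R ^ 3 + q.R ^ 3 := by
    have := Nat.div_add_mod' x (q.R ^ 3)
    have := Nat.mod_lt x h.m_pos
    rw [hb] at *
    omega
  unfold find
  rw [if_neg (h.leafSearch_none (by omega) (by omega) hv fun r hr hr' => by
    rw [hb]; exact h2 _ (by omega) (by rw [add_mul, one_mul]; omega))]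
  rw [if_neg]
  intro hlt
  obtain ⟨g1, g2, g3⟩ := h.sumSearch_spec (b := b) (y := x - b * q.R ^ 3 + 1) (by omega)
    (by omega) hv
  have h3 := g3 hlt
  generalize q.sumSearch b (x - b * q.R ^ 3 + 1) v = σ at *
  have hge : (x + 1) * q.R ^ 2 ≤ (b * q.R ^ 3 + σ) * q.R ^ 2 := leaf_mono (by omega)
  have hle := h.leaf_bounds (b * q.R ^ 3 + σ)
  rw [h.leaf_div hlt] at hle
  rw [add_mul _ 1] at hle hge
  obtain ⟨r, hr1, hr2, hr3, hr4⟩ := h.index.lM_eq (b * q.R ^ 3 + σ) (by omega)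
  rw [h.leaf_div hlt] at hr4
  rw [add_mul _ 1] at hr2
  have := h2 r (by omega) (by rw [add_mul, one_mul]; omega)
  omega

/-! ### Counting -/

omit h in
theorem eq_mask {f c v : ℕ} (a : ℕ → ℕ) :
    (pk f c fun j => if v ≤ a j then 1 else 0) - (pk f c fun j => if v + 1 ≤ a j then 1 else 0) =
      pk f c fun j => if a j = v then 1 else 0 := by
  rw [pk_sub]
  · refine pk_congr fun j hj => ?_
    rcases Nat.lt_trichotomy (a j) v with hlt | hlt | hlt
    · rw [if_neg (by omega), if_neg (by omega), if_neg (by omega)]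
    · rw [if_pos (by omega), if_neg (by omega), if_pos (by omega)]
    · rw [if_pos (by omega), if_pos (by omega), if_neg (by omega)]
  · intro j _
    by_cases hlt : v + 1 ≤ a j
    · rw [if_pos hlt, if_pos (by omega)]
    · rw [if_neg hlt]; exact Nat.zero_le _

/-- Here `v` is the level relative to the block, as stored in the fields, and `u` the absolute one.
The mask of places at level `v` is intersected with the close mask, cut to `[a, e)` and summed. -/
theorem leafCount_eq {x a e v u : ℕ} (hx : x * q.R ^ 2 < q.n) (hae : a ≤ e) (he : e ≤ q.cnt x)
    (hv : v ≤ 2 * q.R ^ 5 + 1) (hu : u + q.R ^ 5 = v + E (x / q.R ^ 3 * q.R ^ 5)) :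
    q.leafCount x a e v = ccount c E q.k u (x * q.R ^ 2 + a) (x * q.R ^ 2 + e) := by
  have hcnt := cnt_le (q := q) x
  have hf := h.f_mul_le hcnt
  have hB := h.B_lt_f
  have hB0 := h.B_pos
  have hs := h.s_le_B
  have h2f := h.two_pow_f
  have h1 : 1 < 2 ^ q.f := Nat.one_lt_two_pow h.f_pos.ne'
  unfold leafCount
  rw [h.levels_eq hx, geq_eq h.f_pos hf h.f_le (by omega) h.level_lt,
    geq_eq h.f_pos hf h.f_le (by omega) h.level_lt, eq_mask, (h.masks hx).2,
    pk_and h.f_pos (fun j _ => by split <;> omega) (fun j _ => by split <;> omega)]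
  rw [dropF_eq (hae.trans he) (h.f_mul_le (by omega)), takeF_eq he (h.f_mul_le (by omega)),
    fsum_eq h.f_le]
  · rw [← sum_eq_ccount u _ a e hae]
    refine Finset.sum_congr rfl fun j hj => ?_
    rw [Finset.mem_range] at hj
    have h5 := h.level_bounds (x := x) (j := j) (by omega)
    have : (E (x * q.R ^ 2 + j + 1) + q.R ^ 5 - E (x / q.R ^ 3 * q.R ^ 5) = v) ↔
        E (x * q.R ^ 2 + j + 1) = u := by omega
    simp only [this]
    by_cases c1 : a ≤ j <;> by_cases c2 : c (x * q.R ^ 2 + j) = 2 * q.k <;>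
      by_cases c3 : E (x * q.R ^ 2 + j + 1) = u <;> simp [c1, c2, c3]
  · refine lt_of_le_of_lt (Finset.sum_le_sum (g := fun _ => 1) fun j _ => ?_) ?_
    · split
      · exact Nat.and_le_left.trans (by split <;> omega)
      · omega
    · simp; omega
  · intro j _
    split
    · exact Nat.and_le_left.trans_lt (by split <;> omega)
    · omega
  · intro j _
    exact Nat.and_le_left.trans_lt (by split <;> omega)

/-- As no level below `u` occurs, either the minimum of the leaf is `u` and its multiplicity is the
wanted count, or level `u` is not attained at all. -/
theorem leaf_ccount {x v u : ℕ} (hx : (x + 1) * q.R ^ 2 ≤ q.n)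
    (hu : u + q.R ^ 5 = v + E (x / q.R ^ 3 * q.R ^ 5))
    (hmin : ∀ r, x * q.R ^ 2 ≤ r → r < (x + 1) * q.R ^ 2 → u ≤ E (r + 1)) :
    (if D.lM x = v then D.lC x else 0) =
      ccount c E q.k u (x * q.R ^ 2) ((x + 1) * q.R ^ 2) := by
  have hs := h.s_pos
  have hx' := hx
  rw [add_mul, one_mul] at hx'
  split
  · next heq =>
    rw [h.index.lC x (by omega) u (by rw [heq]; exact hu), min_eq_left hx]
  · next hne =>
    rw [ccount_eq_zero]
    intro r hr hr' _ hEr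
    have h1 := h.index.lM_le x r hr hr' (by omega)
    obtain ⟨r', g1, g2, g3, g4⟩ := h.index.lM_eq x (by omega)
    have := hmin r' g1 g2
    omega

/-- Selecting the multiplicities of the leaves with minimum `v` adds up `leaf_ccount`; `hmin` is the
condition under which minima alone decide. -/
theorem sumCount_eq {b y z v u : ℕ} (hb : b * q.R ^ 5 < q.n) (hyz : y ≤ z) (hz : z ≤ q.R ^ 3)
    (hzn : (b * q.R ^ 3 + z) * q.R ^ 2 ≤ q.n)
    (hv : v ≤ 2 * q.R ^ 5 + 1) (hu : u + q.R ^ 5 = v + E (b * q.R ^ 5))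
    (hmin : ∀ r, (b * q.R ^ 3 + y) * q.R ^ 2 ≤ r → r < (b * q.R ^ 3 + z) * q.R ^ 2 →
      u ≤ E (r + 1)) :
    q.sumCount b y z v = ccount c E q.k u ((b * q.R ^ 3 + y) * q.R ^ 2)
      ((b * q.R ^ 3 + z) * q.R ^ 2) := by
  have hf := h.g_mul_le (e := q.R ^ 3) le_rfl
  have hB := h.B_lt_g
  have hB0 := h.B_pos
  have h2g := h.two_pow_g
  have hlt : ∀ j, D.lC (b * q.R ^ 3 + j) < 2 ^ q.g := fun j => (h.lC_lt _).trans h.half_lt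
  unfold sumCount
  rw [h.LM_eq hb, h.LC_eq hb, geq_eq h.g_pos hf h.g_le (by omega) fun j _ => h.index.lM_lt _,
    geq_eq h.g_pos hf h.g_le (by omega) fun j _ => h.index.lM_lt _, eq_mask,
    selF_eq h.g_pos h.g_le fun j _ => hlt j]
  rw [dropF_eq (hyz.trans hz) (h.g_mul_le (by omega)), takeF_eq hz (h.g_mul_le (by omega)),
    fsum_eq h.g_le]
  · clear hf hlt
    induction z, hyz using Nat.le_induction with
    | base =>
      rw [ccount_self]
      refine Finset.sum_eq_zero fun j hj => ?_
      rw [Finset.mem_range] at hj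
      rw [if_neg (by omega)]
    | succ z hyz ih =>
      have e : (b * q.R ^ 3 + z) * q.R ^ 2 ≤ (b * q.R ^ 3 + (z + 1)) * q.R ^ 2 :=
        leaf_mono (by omega)
      rw [Finset.sum_range_succ, ih (by omega) (by omega) fun r hr hr' => hmin r hr (by omega),
        if_pos hyz, ccount_add (leaf_mono (by omega)) e, ← add_assoc (b * q.R ^ 3)]
      congr 1
      refine h.leaf_ccount hzn (by rw [h.leaf_div (by omega)]; exact hu) fun r hr hr' => ?_
      exact hmin r ((leaf_mono (by omega)).trans hr) hr'
  -- The sum is at most `R ^ 3 * R ^ 2 = R ^ 5`, which is below `2 ^ g - 1`, so `fsum` does not wrap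
  -- around.
  · have h1 : ∑ j ∈ Finset.range z, (if y ≤ j then
        if D.lM (b * q.R ^ 3 + j) = v then D.lC (b * q.R ^ 3 + j) else 0 else 0) ≤ z * q.R ^ 2 := by
      refine (Finset.sum_le_sum (g := fun _ => q.R ^ 2) fun j _ => ?_).trans (by simp)
      have := h.index.lC_le (b * q.R ^ 3 + j)
      split
      · split <;> omega
      · omega
    have h2 : z * q.R ^ 2 ≤ q.R ^ 3 * q.R ^ 2 := leaf_mono hz
    rw [m_mul_s] at h2
    omega
  · intro j _
    have := hlt j
    split
    · split <;> omega
    · omega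
  · intro j _
    have := hlt j
    split <;> omega

/-! ### The degree -/

theorem lev_eq {i : ℕ} (hi : i < q.n) :
    q.lev i + E (i / q.R ^ 5 * q.R ^ 5) = E (i + 1) + q.R ^ 5 ∧ q.lev i ≤ 2 * q.R ^ 5 := by
  have h1 := h.leaf_of i
  have hx : i / q.R ^ 2 * q.R ^ 2 < q.n := (Nat.div_mul_le_self i _).trans_lt hi
  have h3 := h.level_bounds (x := i / q.R ^ 2) h1.2
  have hf := h.two_pow_f
  rw [lev, h.levels_eq hx, getF_eq (h.mod_lt_cnt hi) (h.f_mul_le h1.2.le) h.f_le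
    fun j hj => by have := h.level_lt (x := i / q.R ^ 2) j hj; omega]
  rw [h1.1, div_leaf] at *
  omega

end Query.Good

end ParenString

/-! ### Correctness of queries for near and far pairs. -/

namespace ParenString
open WordRAM BitString Packed

theorem exists_count_eq (P : ℕ → Prop) [DecidablePred P] {y N : ℕ} (hy : y < Nat.count P N) :
    ∃ p < N, P p ∧ Nat.count P p = y := by
  induction N with
  | zero => simp at hy
  | succ N ih =>
    rw [Nat.count_succ] at hy
    by_cases hP : P N
    · rw [if_pos hP] at hy
      rcases Nat.lt_or_ge y (Nat.count P N) with h | h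
      · obtain ⟨p, hp, h'⟩ := ih h; exact ⟨p, by omega, h'⟩
      · exact ⟨N, by omega, hP, by omega⟩
    · rw [if_neg hP] at hy
      obtain ⟨p, hp, h'⟩ := ih hy; exact ⟨p, by omega, h'⟩

namespace Query.Good
variable {q : Query} {c E F : ℕ → ℕ} {D : Arrays} (h : q.Good c E F D)
include h

theorem lev_open {i i' : ℕ} (hp : PairAt c q.k E i i') :
    i < q.n ∧ i' < q.n ∧ E (i + 1) = E i + 1 ∧
    q.lev i + E (i / q.R ^ 5 * q.R ^ 5) = E i + 1 + q.R ^ 5 ∧ q.lev i ≤ 2 * q.R ^ 5 := by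
  have h1 := h.walk.ran i (Or.inl hp.2.1)
  have h2 := h.walk.ran i' (Or.inr hp.2.2.1)
  have h3 := h.walk.opn i hp.2.1
  have h4 := h.lev_eq h1
  omega

/-- The threshold is the level just after `i`; the first level below it is the first return to `E
i`, which is the match. -/
theorem close_near {i i' : ℕ} (hp : PairAt c q.k E i i') (hb : i / q.R ^ 5 = i' / q.R ^ 5) :
    q.close i = i' := by
  obtain ⟨h1, h2, h3, h4, h5⟩ := h.lev_open hp
  have h6 := h.leaf_of i
  obtain ⟨g1, g2, g3, g4, g5⟩ := hp
  have h7 := (h.mod_lt_cnt h1).le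
  refine h.find_eq (div_leaf _ _) ((Nat.div_mul_le_self i _).trans_lt h1) (by omega) h2 hb.symm
    (by omega) (by omega) (fun r hr hr' => ?_) h7
  have := g5 (r + 1) (by omega) (by omega)
  omega

/-- The match lies in a later block, so the block of `i` is complete and the level stays above `E i`
up to its end. -/
theorem close_far {i i' : ℕ} (hp : PairAt c q.k E i i') (hb : i / q.R ^ 5 ≠ i' / q.R ^ 5) :
    q.close i = q.n := by
  obtain ⟨h1, h2, h3, h4, h5⟩ := h.lev_open hp
  have h6 := h.leaf_of i
  obtain ⟨g1, g2, g3, g4, g5⟩ := hp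
  have hlt : i / q.R ^ 5 + 1 ≤ i' / q.R ^ 5 := by
    have := Nat.div_le_div_right (c := q.R ^ 5) g1.le
    omega
  have h7 : (i / q.R ^ 5 + 1) * q.R ^ 5 ≤ i' :=
    (Nat.mul_le_mul_right _ hlt).trans (Nat.div_mul_le_self _ _)
  refine h.find_none (div_leaf _ _) (by omega) h6.2.le (by omega) fun r hr hr' => ?_
  have := g5 (r + 1) (by omega) (by omega)
  omega

/-- The part of the pair from `i` up to a leaf boundary in its block: the rest of the leaf of `i`,
then whole leaves. The open parenthesis at `i` is never counted, so the range may start at `i + 1`.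
-/
theorem left_count {i i' : ℕ} (hp : PairAt c q.k E i i') {z : ℕ}
    (hz : i / q.R ^ 2 % q.R ^ 3 + 1 ≤ z) (hz' : z ≤ q.R ^ 3)
    (hzi : (i / q.R ^ 5 * q.R ^ 3 + z) * q.R ^ 2 ≤ i') :
    q.leafCount (i / q.R ^ 2) (i % q.R ^ 2) (q.R ^ 2) (q.lev i) +
      q.sumCount (i / q.R ^ 5) (i / q.R ^ 2 % q.R ^ 3 + 1) z (q.lev i) =
    ccount c E q.k (E i + 1) (i + 1) ((i / q.R ^ 5 * q.R ^ 3 + z) * q.R ^ 2) := by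
  obtain ⟨h1, h2, h3, h4, h5⟩ := h.lev_open hp
  have h6 := h.leaf_of i
  have h7 := h.leaf_block i
  obtain ⟨g1, g2, g3, g4, g5⟩ := hp
  have e1 : (i / q.R ^ 5 * q.R ^ 3 + (i / q.R ^ 2 % q.R ^ 3 + 1)) * q.R ^ 2 =
      i / q.R ^ 2 * q.R ^ 2 + q.R ^ 2 := by
    rw [← add_assoc, ← h7.1, add_mul, one_mul]
  have e2 : (i / q.R ^ 5 * q.R ^ 3 + (i / q.R ^ 2 % q.R ^ 3 + 1)) * q.R ^ 2 ≤
      (i / q.R ^ 5 * q.R ^ 3 + z) * q.R ^ 2 := leaf_mono (by omega)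
  have hx := Nat.div_mul_le_self i (q.R ^ 2)
  rw [h.leafCount_eq (u := E i + 1) (by omega) h6.2.le (by unfold cnt; omega) (by omega)
    (by rw [div_leaf]; omega)]
  rw [h.sumCount_eq (u := E i + 1) ((h.block_of i).1.trans_lt h1) hz hz' (by omega) (by omega)
    (by omega) fun r hr hr' => g5 (r + 1) (by omega) (by omega), e1, h6.1,
    ← ccount_add (by omega) (by omega), ccount_same (by omega) g2]

/-- The part of the pair from a leaf boundary in the block of `i'` on: whole leaves, then the
beginning of the leaf of `i'`. The level is relative to that block, hence the separate `v`. -/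
theorem right_count {i i' b v : ℕ} (hp : PairAt c q.k E i i') (hb : i' / q.R ^ 5 = b)
    {y : ℕ} (hy : y ≤ i' / q.R ^ 2 % q.R ^ 3)
    (hyi : i < (b * q.R ^ 3 + y) * q.R ^ 2) (hv : v ≤ 2 * q.R ^ 5 + 1)
    (hu : E i + 1 + q.R ^ 5 = v + E (b * q.R ^ 5)) :
    q.sumCount b y (i' / q.R ^ 2 % q.R ^ 3) v +
      q.leafCount (i' / q.R ^ 2) 0 (i' % q.R ^ 2) v =
    ccount c E q.k (E i + 1) ((b * q.R ^ 3 + y) * q.R ^ 2) i' := by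
  obtain ⟨h1, h2, h3, h4, h5⟩ := h.lev_open hp
  have h6 := h.leaf_of i'
  have h7 := h.leaf_block i'
  have h8 := (h.mod_lt_cnt h2).le
  have h9 := Nat.div_mul_le_self i' (q.R ^ 2)
  have h10 := (h.block_of i').1
  obtain ⟨g1, g2, g3, g4, g5⟩ := hp
  rw [hb] at h7 h10
  have e : (b * q.R ^ 3 + y) * q.R ^ 2 ≤ (b * q.R ^ 3 + i' / q.R ^ 2 % q.R ^ 3) * q.R ^ 2 :=
    leaf_mono (by omega)
  rw [h.leafCount_eq (u := E i + 1) (by omega) (Nat.zero_le _) h8 (by omega)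
    (by rw [div_leaf, hb]; omega), h.sumCount_eq (u := E i + 1) (by omega) hy h7.2.le
    (by rw [← h7.1]; omega) (by omega) (by omega) (fun r hr hr' => g5 (r + 1) (by omega)
      (by rw [← h7.1] at hr'; omega))]
  rw [← h7.1] at e ⊢
  rw [h6.1, add_zero, ← ccount_add (by omega) h9]

theorem near_eq {i i' : ℕ} (hp : PairAt c q.k E i i') (hb : i / q.R ^ 5 = i' / q.R ^ 5) :
    q.near i i' = ccount c E q.k (E i + 1) (i + 1) i' := by
  obtain ⟨h1, h2, h3, h4, h5⟩ := h.lev_open hp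
  have h6 := h.leaf_of i
  have h6' := h.leaf_of i'
  have hii := hp.1
  have hx := Nat.div_mul_le_self i (q.R ^ 2)
  unfold near
  split
  · next he =>
    have := (h.mod_lt_cnt h2).le
    rw [← he] at h6' this
    rw [h.leafCount_eq (u := E i + 1) (by omega) (by omega) this (by omega)
      (by rw [div_leaf]; omega), h6.1, h6'.1, ccount_same hii hp.2.1]
  · next he =>
    have h7 := h.leaf_block i
    have h7' := h.leaf_block i'
    have h8 := Nat.div_mul_le_self i' (q.R ^ 2)
    have hle : i / q.R ^ 2 ≤ i' / q.R ^ 2 := Nat.div_le_div_right hii.le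
    have hz : i / q.R ^ 2 % q.R ^ 3 + 1 ≤ i' / q.R ^ 2 % q.R ^ 3 := by
      rw [← hb] at h7'; omega
    have e : (i / q.R ^ 5 * q.R ^ 3 + i' / q.R ^ 2 % q.R ^ 3) * q.R ^ 2 =
      i' / q.R ^ 2 * q.R ^ 2 := by rw [hb, ← h7'.1]
    have e3 : (i / q.R ^ 2 + 1) * q.R ^ 2 ≤ i' / q.R ^ 2 * q.R ^ 2 := leaf_mono (by omega)
    rw [add_mul, one_mul] at e3
    have e2 : i < i' / q.R ^ 2 * q.R ^ 2 := by
      have := Nat.lt_div_mul_add h.s_pos (a := i)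
      omega
    rw [h.left_count hp hz h7'.2.le (by omega), e]
    -- With `y` equal to the number of the last leaf, this only relates an empty stretch of leaves
    -- and the last leaf; the remaining count is evaluated directly below.
    have := h.right_count (b := i' / q.R ^ 5) (v := q.lev i) hp rfl
      (y := i' / q.R ^ 2 % q.R ^ 3) le_rfl
      (by rw [← h7'.1]; omega) (by omega) (by rw [← hb]; omega)
    rw [← h7'.1] at this
    rw [show q.leafCount (i' / q.R ^ 2) 0 (i' % q.R ^ 2) (q.lev i) =
      ccount c E q.k (E i + 1) (i' / q.R ^ 2 * q.R ^ 2) i' by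
        rw [h.leafCount_eq (u := E i + 1) (by omega) (Nat.zero_le _) (h.mod_lt_cnt h2).le
          (by omega) (by rw [div_leaf, ← hb]; omega), h6'.1, add_zero]]
    exact (ccount_add (by omega) h8).symm

theorem rank_eq {i : ℕ} (hi : i < q.n) :
    q.rank i = Nat.count (fun p => F p ≠ 0) (i / q.R ^ 2 * q.R ^ 2) := by
  have hx : i / q.R ^ 2 * q.R ^ 2 < q.n := (Nat.div_mul_le_self i _).trans_lt hi
  have := h.index.lR _ hx
  rw [div_leaf] at this
  rw [rank, h.bR_eq ((h.block_of i).1.trans_lt hi), h.lR_eq hx]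
  omega

theorem pio_lt {p : ℕ} (hp : F p ≠ 0) : p < q.n := by
  obtain ⟨p', h1, _⟩ := h.index.pio p hp
  exact h.walk.ran p (Or.inl h1.2.1)

/-- The pioneers from the start of the leaf of `i` on have consecutive numbers, and fewer than `R ^
2` of them precede `i`, so one window of `R ^ 2` entries reaches the first one from `i` on. Those
before `i` lie in the same block, where comparing offsets compares positions. -/
theorem pioIdx_eq {i p : ℕ} (hip : i ≤ p) (hF : F p ≠ 0) (hb : p / q.R ^ 5 = i / q.R ^ 5)
    (hmin : ∀ r, i ≤ r → r < p → F r = 0) :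
    q.pioIdx i = Nat.count (fun p => F p ≠ 0) p := by
  set P : ℕ → Prop := fun p => F p ≠ 0 with hP
  have hpn := h.pio_lt hF
  have hcount : Nat.count P i = Nat.count P p := by
    obtain ⟨d, rfl⟩ := Nat.exists_eq_add_of_le hip
    rw [Nat.count_add]
    have : Nat.count (fun k => P (i + k)) d = 0 := by
      rw [Nat.count_iff_forall_not]
      intro m hm; simp [hP, hmin (i + m) (by omega) (by omega)]
    omega
  have hxi := Nat.div_mul_le_self i (q.R ^ 2)
  have hxi' := Nat.lt_div_mul_add h.s_pos (a := i)
  have hr : q.rank i = Nat.count P (i / q.R ^ 2 * q.R ^ 2) := h.rank_eq (by omega)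
  have hle : q.rank i ≤ Nat.count P i := by rw [hr]; exact Nat.count_monotone _ hxi
  have hlt : Nat.count P i < q.rank i + q.R ^ 2 := by
    rw [hr]
    obtain ⟨d, hd⟩ := Nat.exists_eq_add_of_le hxi
    conv_lhs => rw [hd, Nat.count_add]
    have : Nat.count (fun k => P (i / q.R ^ 2 * q.R ^ 2 + k)) d ≤ d := Nat.count_le _
    omega
  -- The additional `R ^ 2` entries in `numPio` keep the window inside the array even for the last
  -- pioneers.
  have hnp : q.rank i + q.R ^ 2 ≤ q.np := by
    have h1 : Nat.count P q.n ≤ _ := h.index.count_le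
    have h2 : Nat.count P i ≤ Nat.count P q.n := Nat.count_monotone _ (by omega)
    unfold np numPio
    omega
  have hread : ∀ r, F r ≠ 0 → D.pP (Nat.count P r) = r % q.R ^ 5 := by
    intro r hr
    obtain ⟨_, _, _, h3, _⟩ := h.index.pio r hr
    exact h3
  have hB := h.B_lt_g
  have hBi := Nat.mod_lt i h.B_pos
  have hi5 := Nat.div_add_mod i (q.R ^ 5)
  have hp5 := Nat.div_add_mod p (q.R ^ 5)
  rw [hb] at hp5
  rw [pioIdx, h.PP_eq hnp, geq_eq h.g_pos (h.g_mul_le h.s_le_m) h.g_le (by omega)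
    fun j _ => h.index.pP_lt _]
  obtain ⟨h1, h2, h3⟩ := first_eq (β := q.β) h.g_pos (h.g_mul_le h.s_le_m) h.g_le
    (by have := h.s_le_B; have := h.B_pos; omega) (fun j => i % q.R ^ 5 ≤ D.pP (q.rank i + j))
  generalize first q.β q.g (q.R ^ 2) _ = ρ at *
  rcases Nat.lt_trichotomy (q.rank i + ρ) (Nat.count P p) with hc | hc | hc
  · exfalso
    obtain ⟨r, hr1, hr2, hr3⟩ := exists_count_eq P hc
    have hri : r < i := by
      by_contra hcon
      exact hr2 (hmin r (by omega) hr1)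
    have hxr : i / q.R ^ 2 * q.R ^ 2 ≤ r := by
      by_contra hcon
      have := Nat.count_strict_mono hr2 (show r < i / q.R ^ 2 * q.R ^ 2 by omega)
      omega
    have h4 := h3 (by omega)
    rw [← hr3, hread r hr2] at h4
    have hbx : i / q.R ^ 5 ≤ r / q.R ^ 5 := by
      rw [Nat.le_div_iff_mul_le h.B_pos]
      have := (h.leaf_bounds (i / q.R ^ 2)).1
      rw [div_leaf] at this
      omega
    have hbx' : r / q.R ^ 5 ≤ i / q.R ^ 5 := Nat.div_le_div_right hri.le
    have hr5 := Nat.div_add_mod r (q.R ^ 5)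
    rw [show r / q.R ^ 5 = i / q.R ^ 5 by omega] at hr5
    omega
  · exact hc
  · exfalso
    refine h2 (Nat.count P p - q.rank i) (by omega) ?_
    rw [Nat.add_sub_cancel' (by omega), hread p hF]
    omega

/-- A pair `(p, p')` strictly inside `(i, i')` with ends in the same two blocks covers everything
between these blocks and keeps the level there above `E i + 1`; only the end blocks can contribute.
-/
theorem far_eq {i i' p p' : ℕ} (hp : PairAt c q.k E i i') (hb : i / q.R ^ 5 ≠ i' / q.R ^ 5)
    (hp2 : PairAt c q.k E p p') (hip : i < p) (hbp : p / q.R ^ 5 = i / q.R ^ 5)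
    (hbp' : p' / q.R ^ 5 = i' / q.R ^ 5) (hpi : p' < i') :
    q.far i (i' / q.R ^ 5) (q.closeIn i (i' / q.R ^ 5)) =
      ccount c E q.k (E i + 1) (i + 1) i' := by
  obtain ⟨h1, h2, h3, h4, h5⟩ := h.lev_open hp
  have hp0 := hp
  obtain ⟨g1, g2, g3, g4, g5⟩ := hp
  have hlt : i / q.R ^ 5 + 1 ≤ i' / q.R ^ 5 := by
    have := Nat.div_le_div_right (c := q.R ^ 5) g1.le
    omega
  have hlt' : (i / q.R ^ 5 + 1) * q.R ^ 5 ≤ i' / q.R ^ 5 * q.R ^ 5 := Nat.mul_le_mul_right _ hlt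
  have hbi := h.block_of i
  have hbi' := h.block_of i'
  have hbq := h.block_of p
  have hbq' := h.block_of p'
  rw [hbp] at hbq
  rw [hbp'] at hbq'
  rw [add_mul, one_mul] at hlt'
  -- From the start of its block to `i'` the level drops by at most `R ^ 5`, so the subtraction in
  -- `levAt` is not truncated.
  obtain ⟨d, hd⟩ := Nat.exists_eq_add_of_le (show i' / q.R ^ 5 * q.R ^ 5 ≤ i' + 1 by omega)
  have l1 := h.walk.le_sub (i' / q.R ^ 5 * q.R ^ 5) d
  rw [← hd] at l1
  have l2 := g5 (i' / q.R ^ 5 * q.R ^ 5) (by omega) (by omega)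
  have hlev : q.levAt i (i' / q.R ^ 5) + E (i' / q.R ^ 5 * q.R ^ 5) = E i + 1 + q.R ^ 5 := by
    rw [levAt, h.bE_eq (by omega), h.bE_eq (by omega)]
    omega
  have hclose : q.closeIn i (i' / q.R ^ 5) = i' := by
    have hm := h.m_pos
    have e := leaf_mul q.R (i' / q.R ^ 5) 0
    rw [zero_mul, add_zero, add_zero] at e
    refine h.find_eq (by rw [Nat.mul_div_cancel _ hm]) (by omega) (by omega) h2 rfl (by omega)
      (by omega) (fun r hr hr' => ?_) (Nat.zero_le _)
    have := g5 (r + 1) (by omega) (by omega)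
    omega
  have hm := (h.leaf_block i).2
  have e1 : (i / q.R ^ 5 * q.R ^ 3 + q.R ^ 3) * q.R ^ 2 = i / q.R ^ 5 * q.R ^ 5 + q.R ^ 5 := by
    ring
  have e2 : (i' / q.R ^ 5 * q.R ^ 3 + 0) * q.R ^ 2 = i' / q.R ^ 5 * q.R ^ 5 := by ring
  rw [hclose, far, h.left_count hp0 hm le_rfl (by omega),
    h.right_count hp0 rfl (Nat.zero_le _) (by omega) (by omega) (by omega), e1, e2]
  have hmid : ccount c E q.k (E i + 1) (i / q.R ^ 5 * q.R ^ 5 + q.R ^ 5)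
      (i' / q.R ^ 5 * q.R ^ 5) = 0 := by
    refine ccount_eq_zero fun r hr hr' _ => ?_
    have := hp2.2.2.2.2 (r + 1) (by omega) (by omega)
    have := g5 p hip (by have := hp2.1; omega)
    omega
  rw [ccount_add (a := i + 1) (b := i / q.R ^ 5 * q.R ^ 5 + q.R ^ 5) (d := i') (by omega)
    (by omega), ccount_add (a := i / q.R ^ 5 * q.R ^ 5 + q.R ^ 5)
    (b := i' / q.R ^ 5 * q.R ^ 5) (d := i') (by omega) (by omega), hmid, zero_add]

/-- The first pioneer `p` from `i` on lies between `i` and the pioneer `p0` that `exists_pio`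
provides for the two blocks. By nesting, the match of `p` lies between the match of `p0` and `i'`,
hence in the block of `i'`. -/
theorem degree_eq {i i' : ℕ} (hp : PairAt c q.k E i i') :
    q.degree i = ccount c E q.k (E i + 1) (i + 1) i' := by
  obtain ⟨h1, h2, h3, h4, h5⟩ := h.lev_open hp
  unfold degree
  by_cases hb : i / q.R ^ 5 = i' / q.R ^ 5
  · rw [h.close_near hp hb, if_pos h2, h.near_eq hp hb]
  rw [h.close_far hp hb, if_neg (lt_irrefl _)]
  obtain ⟨p0, p0', hi0, hF0, hp0, hb0, hb0'⟩ := h.index.exists_pio i i' hp hb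
  have hex : ∃ r, i ≤ r ∧ F r ≠ 0 := ⟨p0, hi0, hF0⟩
  obtain ⟨hip, hFp⟩ := Nat.find_spec hex
  have hle : Nat.find hex ≤ p0 := Nat.find_min' hex ⟨hi0, hF0⟩
  have hmin : ∀ r, i ≤ r → r < Nat.find hex → F r = 0 := by
    intro r hr hr'
    by_contra hcon
    exact Nat.find_min hex hr' ⟨hr, hcon⟩
  generalize Nat.find hex = p at *
  have hbp : p / q.R ^ 5 = i / q.R ^ 5 := by
    have e1 := Nat.div_le_div_right (c := q.R ^ 5) hle
    have e2 := Nat.div_le_div_right (c := q.R ^ 5) hip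
    omega
  obtain ⟨p', g1, g2, g3, g4, g5⟩ := h.pio_reads hFp
  rw [h.pioIdx_eq hip hFp hbp hmin, g3]
  have hmod := Nat.div_add_mod i (q.R ^ 5)
  have hmod' := Nat.div_add_mod p (q.R ^ 5)
  rw [hbp] at hmod'
  split
  -- Both positions are in the same block, so equal offsets mean that `i` is itself the pioneer.
  · next he =>
    have : p = i := by omega
    subst this
    rw [g5, g1.unique_right hp]
  · next hne =>
    have hlt : i < p := by
      rcases Nat.eq_or_lt_of_le hip with rfl | hlt
      · exact absurd rfl hne
      · exact hlt
    -- A match in another block lies to the right of everything in the block of its left end; this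
    -- supplies the overlap that `PairAt.nested` needs.
    have hcross : ∀ {a b a' b' : ℕ}, a ≤ b → a' / q.R ^ 5 ≠ a / q.R ^ 5 → a < a' →
        b / q.R ^ 5 = a / q.R ^ 5 → b < a' := by
      intro a b a' _ hab hne hlt hbb
      by_contra hcon
      have e1 := Nat.div_le_div_right (c := q.R ^ 5) (show a' ≤ b by omega)
      have e2 := Nat.div_le_div_right (c := q.R ^ 5) hlt.le
      omega
    have n1 : p' < i' := hp.nested g1 hlt (hcross (b' := 0) hip (Ne.symm hb) hp.1 hbp)
    have n2 : p0' ≤ p' := by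
      rcases Nat.eq_or_lt_of_le hle with rfl | hlt'
      · exact (hp0.unique_right g1).le
      · exact (g1.nested hp0 hlt' (hcross (b' := 0) hle (Ne.symm g2) g1.1 (by omega))).le
    have hbp' : p' / q.R ^ 5 = i' / q.R ^ 5 := by
      have e1 := Nat.div_le_div_right (c := q.R ^ 5) n2
      have e2 := Nat.div_le_div_right (c := q.R ^ 5) n1.le
      omega
    rw [g4, hbp']
    exact h.far_eq hp hb g1 hlt hbp hbp' n1

end Query.Good

end ParenString

namespace ParenString

/-! ### The construction of the arrays

The construction works on columns: `M col row` is the entry of column `col` in row `row`. -/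

/-- Every column gets one new entry. -/
def put (M : ℕ → ℕ → ℕ) (row val : ℕ → ℕ) : ℕ → ℕ → ℕ := fun col r =>
  if r = row col then val col else M col r

section Steps
variable (R k y : ℕ) (M : ℕ → ℕ → ℕ) (q : ℕ)

/-- The level after the symbol `y`. -/
def newLevel : ℕ :=
  if y = 2 * k + 1 then M 0 0 + 1 else if y = 2 * k then M 0 0 - 1 else M 0 0

/-- The position of the last open parenthesis that has not been closed. -/
def top : ℕ := M 4 (M 0 0 - 1)

/-- The block of the opening parenthesis, plus `1`, of the last pair that ended in this block
and began in another one. -/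
def lastFar : ℕ := if q % R ^ 5 = 0 then 0 else M 1 0

/-- The level at the beginning of the block. -/
def baseLevel : ℕ := if q % R ^ 5 = 0 then M 0 0 else M 6 (q / R ^ 5)

/-- The least level in the leaf so far. -/
def newMin : ℕ := if q % R ^ 2 = 0 then newLevel k y M else min (M 2 0) (newLevel k y M)

/-- How often a close parenthesis has attained the least level. -/
def newCount : ℕ :=
  (if q % R ^ 2 = 0 then 0 else if newLevel k y M < M 2 0 then 0 else M 3 0) +
    if y = 2 * k then if newLevel k y M = newMin R k y M q then 1 else 0 else 0

/-- The value `v` if a pioneer has been closed, otherwise `v'`. -/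
def ifPioneer (v v' : ℕ) : ℕ :=
  if y = 2 * k then if top M / R ^ 5 = q / R ^ 5 then v' else
    if lastFar R M q = top M / R ^ 5 + 1 then v' else v else v'

/-- The rows of the new entries in the first pass. -/
def row₁ : ℕ → ℕ
  | 4 => M 0 0
  | 5 => if y = 2 * k + 1 then M 0 0 + 1 else M 0 0 - 1
  | 6 => q / R ^ 5
  | 7 => q / R ^ 2
  | 8 => q / R ^ 2
  | 9 => q / R ^ 2
  | 10 => top M
  | 11 => top M
  | _ => 0

/-- The new entries in the first pass. -/
def val₁ : ℕ → ℕ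
  | 0 => newLevel k y M
  | 1 => if y = 2 * k then if top M / R ^ 5 = q / R ^ 5 then lastFar R M q else top M / R ^ 5 + 1
      else lastFar R M q
  | 2 => newMin R k y M q
  | 3 => newCount R k y M q
  | 4 => if y = 2 * k + 1 then q else M 4 (M 0 0)
  | 5 => if y = 2 * k + 1 then 0 else
      if y = 2 * k then M 5 (M 0 0 - 1) + 1 else M 5 (M 0 0 - 1)
  | 6 => baseLevel R M q
  | 7 => if q % R ^ 2 = 0 then M 0 0 + R ^ 5 - baseLevel R M q else M 7 (q / R ^ 2)
  | 8 => newMin R k y M q + R ^ 5 - baseLevel R M q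
  | 9 => newCount R k y M q
  | 10 => ifPioneer R k y M q (q / R ^ 5 + 1) (M 10 (top M))
  | 11 => ifPioneer R k y M q (M 5 (M 0 0)) (M 11 (top M))
  | col => M col 0

/-- The number of pioneers before the block. -/
def baseCount : ℕ := if q % R ^ 5 = 0 then M 12 0 else M 13 (q / R ^ 5)

/-- The rows of the new entries in the second pass. -/
def row₂ : ℕ → ℕ
  | 13 => q / R ^ 5
  | 14 => q / R ^ 2
  | 15 => M 12 0
  | 16 => M 12 0
  | 17 => M 12 0
  | _ => 0

/-- The new entries in the second pass. -/
def val₂ : ℕ → ℕ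
  | 12 => if M 10 q = 0 then M 12 0 else M 12 0 + 1
  | 13 => baseCount R M q
  | 14 => if q % R ^ 2 = 0 then M 12 0 - baseCount R M q else M 14 (q / R ^ 2)
  | 15 => if M 10 q = 0 then M 15 (M 12 0) else q % R ^ 5
  | 16 => if M 10 q = 0 then M 16 (M 12 0) else M 10 q - 1
  | 17 => if M 10 q = 0 then M 17 (M 12 0) else M 11 q
  | col => M col 0

end Steps

/-- The columns after `q` steps of the first pass. -/
def pass₁ (R k : ℕ) (c : ℕ → ℕ) : ℕ → ℕ → ℕ → ℕ
  | 0 => fun _ _ => 0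
  | q + 1 => put (pass₁ R k c q) (row₁ R k (c q) (pass₁ R k c q) q)
      (val₁ R k (c q) (pass₁ R k c q) q)

/-- The columns after `q` steps of the second pass. -/
def pass₂ (R : ℕ) (M : ℕ → ℕ → ℕ) : ℕ → ℕ → ℕ → ℕ
  | 0 => M
  | q + 1 => put (pass₂ R M q) (row₂ R (pass₂ R M q) q) (val₂ R (pass₂ R M q) q)

/-- The columns after both passes. -/
def passes (R k n : ℕ) (c : ℕ → ℕ) : ℕ → ℕ → ℕ := pass₂ R (pass₁ R k c n) n

/-- The arrays read off from the columns. -/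
def arraysOf (M : ℕ → ℕ → ℕ) : Arrays where
  bE := M 6
  bR := M 13
  lE := M 7
  lM := M 8
  lC := M 9
  lR := M 14
  pP := M 15
  pB := M 16
  pD := M 17

/-! ### Bounds -/

theorem put_le {M : ℕ → ℕ → ℕ} {row val : ℕ → ℕ} {b : ℕ → ℕ} (hM : ∀ col r, M col r ≤ b col)
    (hv : ∀ col, val col ≤ b col) (col r : ℕ) : put M row val col r ≤ b col := by
  unfold put; split
  · exact hv col
  · exact hM col r

theorem newLevel_le {k y : ℕ} {M : ℕ → ℕ → ℕ} : newLevel k y M ≤ M 0 0 + 1 := by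
  unfold newLevel; split
  · exact le_rfl
  · split <;> omega

/-- Crude bounds suffice: entries have to fit into their cells and to be admissible row numbers.
Columns `7` and `8` hold levels shifted by `R ^ 5`. -/
theorem pass₁_le (R k : ℕ) (c : ℕ → ℕ) (q col r : ℕ) :
    pass₁ R k c q col r ≤ q + 1 + if col = 7 ∨ col = 8 then R ^ 5 else 0 := by
  induction q generalizing col r with
  | zero => simp [pass₁]
  | succ q ih =>
    rw [pass₁]
    refine put_le (b := fun col => q + 1 + 1 + if col = 7 ∨ col = 8 then R ^ 5 else 0)
      (fun col r => (ih col r).trans (by omega)) (fun col => ?_) col r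
    generalize pass₁ R k c q = M at *
    have h0 : M 0 0 ≤ q + 1 := by simpa using ih 0 0
    have hl := newLevel_le (k := k) (y := c q) (M := M)
    have h1 : lastFar R M q ≤ q + 1 := by
      have : M 1 0 ≤ q + 1 := by simpa using ih 1 0
      unfold lastFar; split <;> omega
    have h2 : newMin R k (c q) M q ≤ q + 2 := by
      unfold newMin; split
      · omega
      · exact (min_le_right _ _).trans (by omega)
    have h3 : newCount R k (c q) M q ≤ q + 2 := by
      have : M 3 0 ≤ q + 1 := by simpa using ih 3 0
      unfold newCount
      split <;> split <;> (try split) <;> (try split) <;> omega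
    have h4 : top M ≤ q + 1 := by simpa [top] using ih 4 (M 0 0 - 1)
    have h5 : ∀ r, M 5 r ≤ q + 1 := fun r => by simpa using ih 5 r
    have h6 : baseLevel R M q ≤ q + 1 := by
      have : M 6 (q / R ^ 5) ≤ q + 1 := by simpa using ih 6 (q / R ^ 5)
      unfold baseLevel; split <;> omega
    have hp : ∀ v v', v ≤ q + 2 → v' ≤ q + 2 → ifPioneer R k (c q) M q v v' ≤ q + 2 := by
      intro v v' hv hv'
      unfold ifPioneer
      split
      · split
        · exact hv'
        · split <;> assumption
      · exact hv'
    have hd := Nat.div_le_self (top M) (R ^ 5)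
    have hd' := Nat.div_le_self q (R ^ 5)
    have hcol := fun r => ih col r
    unfold val₁
    split <;> simp at hcol ⊢
    · omega
    · split
      · split <;> omega
      · omega
    · omega
    · omega
    · have := hcol (M 0 0)
      split <;> omega
    · have := hcol (M 0 0 - 1)
      split
      · omega
      · split <;> omega
    · omega
    · have := hcol (q / R ^ 2)
      split <;> omega
    · omega
    · omega
    · exact hp _ _ (by omega) ((hcol _).trans (by omega))
    · exact hp _ _ ((h5 _).trans (by omega)) ((hcol _).trans (by omega))
    · exact (ih _ _).trans (by omega)

theorem pass₂_le {R : ℕ} {M : ℕ → ℕ → ℕ} {b : ℕ} (hM : ∀ col r, M col r ≤ b)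
    (h12 : M 12 0 = 0) (q : ℕ) (hq : q ≤ b) :
    (∀ col r, pass₂ R M q col r ≤ b) ∧ pass₂ R M q 12 0 ≤ q := by
  induction q with
  | zero => exact ⟨hM, h12.le⟩
  | succ q ih =>
    obtain ⟨ih, ih0⟩ := ih (by omega)
    rw [pass₂]
    generalize pass₂ R M q = N at *
    have h6 : baseCount R N q ≤ b := by unfold baseCount; split <;> exact ih _ _
    have hmod := Nat.mod_le q (R ^ 5)
    constructor
    · refine put_le (b := fun _ => b) ih fun col => ?_
      have hcol := fun r => ih col r
      unfold val₂
      split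
      · split <;> omega
      · exact h6
      · split
        · have := ih 12 0; omega
        · exact ih _ _
      · split
        · exact ih _ _
        · omega
      · split
        · exact ih _ _
        · have := ih 10 q; omega
      · split <;> exact ih _ _
      · exact ih _ _
    · simp only [put, row₂, val₂, if_true]
      split <;> omega

theorem pass₁_twelve (R k : ℕ) (c : ℕ → ℕ) (q col r : ℕ) (hcol : 12 ≤ col) :
    pass₁ R k c q col r = 0 := by
  induction q generalizing r with
  | zero => rfl
  | succ q ih =>
    rw [pass₁, put]
    split
    · unfold val₁
      split <;> first | omega | exact ih _
    · exact ih r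

/-- The second pass also writes into the old columns, but only their own entry back into row `0`. -/
theorem pass₂_lt_twelve (R : ℕ) (M : ℕ → ℕ → ℕ) (q col r : ℕ) (hcol : col < 12) :
    pass₂ R M q col r = M col r := by
  induction q generalizing r with
  | zero => rfl
  | succ q ih =>
    rw [pass₂, put]
    split
    · next h =>
      have h0 : r = 0 := by
        rw [h]; unfold row₂
        split <;> omega
      unfold val₂
      split <;> first | omega | (rw [h0]; exact ih _)
    · exact ih r

end ParenString

/-! ### Correctness of the first pass. -/

namespace ParenString

section Pass
variable {n k R : ℕ} {c E : ℕ → ℕ}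

theorem succ_div_of_mod_ne {q B : ℕ} (h : (q + 1) % B ≠ 0) : (q + 1) / B = q / B := by
  rw [Nat.succ_div, if_neg, add_zero]
  rintro h'
  exact h (Nat.mod_eq_zero_of_dvd h')

theorem div_mul_of_mod {q B : ℕ} (h : q % B = 0) : q / B * B = q :=
  Nat.div_mul_cancel (Nat.dvd_of_mod_eq_zero h)

theorem div_mul_lt_of_mod {q B : ℕ} (h : q % B ≠ 0) : q / B * B < q := by
  have := Nat.div_add_mod' q B
  omega

theorem lt_of_div_mul_lt {q B x : ℕ} (hB : 0 < B) (h : x * B < q + 1) (hx : x ≠ q / B) :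
    x < q / B := by
  have : x ≤ q / B := (Nat.le_div_iff_mul_le hB).2 (by omega)
  omega

theorem mul_lt_of_lt_div {q B x : ℕ} (hB : 0 < B) (hx : x < q / B) : (x + 1) * B ≤ q :=
  (Nat.le_div_iff_mul_le hB).1 hx

theorem Walk.newLevel_eq (W : Walk n k c E) {q : ℕ} {M : ℕ → ℕ → ℕ} (h : M 0 0 = E q) :
    newLevel k (c q) M = E (q + 1) := by
  unfold newLevel
  rcases W.step q with ⟨h1, h2⟩ | ⟨h1, h2⟩ | ⟨h1, h3, h2⟩
  · rw [if_pos h1]; omega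
  · rw [if_neg (by omega), if_pos h1]; omega
  · rw [if_neg h1, if_neg h3]; omega

/-- `f` is the block, plus `1`, of the partner of the last close parenthesis in `[a, q)` that
has its partner in another block, or `0` if there is none. -/
def IsLastFar (R k : ℕ) (c E : ℕ → ℕ) (a q f : ℕ) : Prop :=
  (f = 0 ∧ ∀ p r, a ≤ r → r < q → PairAt c k E p r → p / R ^ 5 = r / R ^ 5) ∨
  ∃ p r, a ≤ r ∧ r < q ∧ PairAt c k E p r ∧ p / R ^ 5 ≠ r / R ^ 5 ∧ f = p / R ^ 5 + 1 ∧
    ∀ p' r', r < r' → r' < q → PairAt c k E p' r' → p' / R ^ 5 = r' / R ^ 5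

variable (W : Walk n k c E)
include W

theorem Walk.pass₁_level (q : ℕ) : pass₁ R k c q 0 0 = E q := by
  induction q with
  | zero => exact W.zero.symm
  | succ q ih =>
    exact W.newLevel_eq ih

theorem Walk.pass₁_newLevel (q : ℕ) : newLevel k (c q) (pass₁ R k c q) = E (q + 1) :=
  W.newLevel_eq (W.pass₁_level q)

/-- Column `4` is a stack indexed by level: row `v` holds the unmatched open parenthesis that raised
the level from `v`. Row `v + 1` of column `5` counts the pairs directly inside it that have been
closed so far. Rows above the current level are stale and not part of the invariant. -/
theorem Walk.pass₁_stack (q v : ℕ) (hv : v < E q) :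
    pass₁ R k c q 4 v < q ∧ c (pass₁ R k c q 4 v) = 2 * k + 1 ∧ E (pass₁ R k c q 4 v) = v ∧
    (∀ r, pass₁ R k c q 4 v < r → r ≤ q → v < E r) ∧
    pass₁ R k c q 5 (v + 1) = ccount c E k (v + 1) (pass₁ R k c q 4 v + 1) q := by
  induction q with
  | zero => rw [W.zero] at hv; omega
  | succ q ih =>
    have h0 := W.pass₁_level (R := R) q
    have e4 : pass₁ R k c (q + 1) 4 v = if v = E q then
        if c q = 2 * k + 1 then q else pass₁ R k c q 4 (E q) else pass₁ R k c q 4 v := by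
      rw [← h0]; rfl
    have e5 : pass₁ R k c (q + 1) 5 (v + 1) =
        if v + 1 = (if c q = 2 * k + 1 then E q + 1 else E q - 1) then
          if c q = 2 * k + 1 then 0 else if c q = 2 * k then pass₁ R k c q 5 (E q - 1) + 1
            else pass₁ R k c q 5 (E q - 1) else pass₁ R k c q 5 (v + 1) := by
      rw [← h0]; rfl
    rcases W.step q with ⟨h1, h2⟩ | ⟨h1, h2⟩ | ⟨h1, h3, h2⟩
    · rw [if_pos h1] at e4
      rw [if_pos h1, if_pos h1] at e5
      by_cases hvq : v = E q
      · rw [if_pos hvq] at e4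
        rw [if_pos (by omega)] at e5
        rw [e4, e5]
        refine ⟨by omega, h1, hvq.symm, fun r hr hr' => ?_, ccount_self.symm⟩
        have : r = q + 1 := by omega
        subst this; omega
      · rw [if_neg hvq] at e4
        rw [if_neg (by omega)] at e5
        rw [e4, e5]
        obtain ⟨g1, g2, g3, g4, g5⟩ := ih (by omega)
        refine ⟨by omega, g2, g3, fun r hr hr' => ?_, ?_⟩
        · rcases Nat.lt_or_ge q r with hqr | hqr
          · have : r = q + 1 := by omega
            subst this; omega
          · exact g4 r hr hqr
        · rw [g5, ccount_succ (by omega), if_neg (by omega), add_zero]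
    · have hn : c q ≠ 2 * k + 1 := by omega
      rw [if_neg (by omega)] at e4
      rw [if_neg hn, if_neg hn, if_pos h1] at e5
      rw [e4, e5]
      obtain ⟨g1, g2, g3, g4, g5⟩ := ih (by omega)
      refine ⟨by omega, g2, g3, fun r hr hr' => ?_, ?_⟩
      · rcases Nat.lt_or_ge q r with hqr | hqr
        · have : r = q + 1 := by omega
          subst this; omega
        · exact g4 r hr hqr
      -- The close parenthesis ends a child of the open parenthesis at level `v` exactly if it
      -- leaves the level `v + 1`, and this is the row that is increased.
      · rw [ccount_succ (by omega), ← g5]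
        by_cases hvq : v + 1 = E q - 1
        · rw [if_pos hvq, if_pos (by omega), ← hvq]
        · rw [if_neg hvq, if_neg (by omega), add_zero]
    · rw [if_neg (by omega)] at e4
      rw [if_neg h1, if_neg h1, if_neg h3] at e5
      rw [e4, e5]
      obtain ⟨g1, g2, g3, g4, g5⟩ := ih (by omega)
      refine ⟨by omega, g2, g3, fun r hr hr' => ?_, ?_⟩
      · rcases Nat.lt_or_ge q r with hqr | hqr
        · have : r = q + 1 := by omega
          subst this; omega
        · exact g4 r hr hqr
      · have e : ccount c E k (v + 1) (pass₁ R k c q 4 v + 1) (q + 1) =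
            ccount c E k (v + 1) (pass₁ R k c q 4 v + 1) q := by
          rw [ccount_succ (by omega), if_neg (fun h => h3 h.1), add_zero]
        rw [e, ← g5]
        by_cases hvq : v + 1 = E q - 1
        · rw [if_pos hvq, ← hvq]
        · rw [if_neg hvq]

/-- The top of the stack satisfies the level description of the partner of `q`, and its completed
count is still in its row before the step at `q`. -/
theorem Walk.top_pair {q : ℕ} (hq : c q = 2 * k) :
    PairAt c k E (top (pass₁ R k c q)) q ∧ pass₁ R k c q 5 (pass₁ R k c q 0 0) =
      ccount c E k (E (top (pass₁ R k c q)) + 1) (top (pass₁ R k c q) + 1) q := by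
  have h1 := W.cls q hq
  unfold top
  rw [W.pass₁_level]
  obtain ⟨g1, g2, g3, g4, g5⟩ := W.pass₁_stack (R := R) q (E q - 1) (by omega)
  rw [Nat.sub_add_cancel (by omega)] at g5
  refine ⟨⟨g1, g2, hq, by omega, fun r hr hr' => ?_⟩, ?_⟩
  · rw [g3]; exact g4 r hr hr'
  · rw [g3, Nat.sub_add_cancel (by omega), g5]

theorem Walk.pass₁_lastFar (q : ℕ) :
    IsLastFar R k c E (q / R ^ 5 * R ^ 5) q (lastFar R (pass₁ R k c q) q) := by
  induction q with
  | zero =>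
    left
    refine ⟨by simp [lastFar], fun p r _ hr => by omega⟩
  | succ q ih =>
    by_cases hB : (q + 1) % R ^ 5 = 0
    · left
      refine ⟨by rw [lastFar, if_pos hB], fun p r hr hr' => ?_⟩
      rw [div_mul_of_mod hB] at hr; omega
    · have e : lastFar R (pass₁ R k c (q + 1)) (q + 1) = if c q = 2 * k then
          if top (pass₁ R k c q) / R ^ 5 = q / R ^ 5 then lastFar R (pass₁ R k c q) q
            else top (pass₁ R k c q) / R ^ 5 + 1 else lastFar R (pass₁ R k c q) q := by
        rw [lastFar, if_neg hB]; rfl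
      rw [succ_div_of_mod_ne hB]
      -- Common to all positions that are not far close parentheses: the register and its witness
      -- are carried over.
      have keep : (∀ p, PairAt c k E p q → p / R ^ 5 = q / R ^ 5) →
          lastFar R (pass₁ R k c (q + 1)) (q + 1) = lastFar R (pass₁ R k c q) q →
          IsLastFar R k c E (q / R ^ 5 * R ^ 5) (q + 1)
            (lastFar R (pass₁ R k c (q + 1)) (q + 1)) := by
        intro h1 h2
        rcases ih with ⟨g1, g2⟩ | ⟨p, r, g1, g2, g3, g4, g5, g6⟩
        · left
          refine ⟨by rw [h2, g1], fun p r hr hr' hp => ?_⟩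
          rcases Nat.lt_or_ge r q with hlt | hge
          · exact g2 p r hr hlt hp
          · have : r = q := by omega
            subst this; exact h1 p hp
        · right
          refine ⟨p, r, g1, by omega, g3, g4, by rw [h2, g5], fun p' r' hr hr' hp => ?_⟩
          rcases Nat.lt_or_ge r' q with hlt | hge
          · exact g6 p' r' hr hlt hp
          · have : r' = q := by omega
            subst this; exact h1 p' hp
      by_cases hc : c q = 2 * k
      · obtain ⟨ht, -⟩ := W.top_pair (R := R) hc
        rw [if_pos hc] at e
        by_cases hb : top (pass₁ R k c q) / R ^ 5 = q / R ^ 5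
        · rw [if_pos hb] at e
          refine keep (fun p hp => ?_) e
          rw [hp.unique_left ht, hb]
        · rw [if_neg hb] at e
          right
          exact ⟨_, q, Nat.div_mul_le_self _ _, by omega, ht, hb, e, fun _ r' _ _ => by omega⟩
      · rw [if_neg hc] at e
        exact keep (fun p hp => absurd hp.2.2.1 hc) e

theorem Walk.pass₁_base (hR : 0 < R) (q : ℕ) :
    (∀ b, b * R ^ 5 < q → pass₁ R k c q 6 b = E (b * R ^ 5)) ∧
    baseLevel R (pass₁ R k c q) q = E (q / R ^ 5 * R ^ 5) := by
  have hB : 0 < R ^ 5 := pow_pos hR 5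
  have key : ∀ q, (∀ b, b * R ^ 5 < q → pass₁ R k c q 6 b = E (b * R ^ 5)) →
      baseLevel R (pass₁ R k c q) q = E (q / R ^ 5 * R ^ 5) := by
    intro q h
    unfold baseLevel
    split
    · next h' => rw [W.pass₁_level, div_mul_of_mod h']
    · next h' => exact h _ (div_mul_lt_of_mod h')
  suffices h : ∀ b, b * R ^ 5 < q → pass₁ R k c q 6 b = E (b * R ^ 5) from ⟨h, key q h⟩
  induction q with
  | zero => intro b hb; omega
  | succ q ih =>
    intro b hb
    show (if b = q / R ^ 5 then baseLevel R (pass₁ R k c q) q else pass₁ R k c q 6 b) = _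
    split
    · next h => rw [key q ih, h]
    · next h =>
      have := mul_lt_of_lt_div hB (lt_of_div_mul_lt hB hb h)
      rw [add_mul] at this
      exact ih b (by omega)

/-- A strictly smaller level discards the old multiplicity, an equal one after a close parenthesis
increases it. The start of a leaf resets both values, so only positions of the current leaf enter.
-/
theorem Walk.pass₁_leaf (q : ℕ) :
    (∀ r, q / R ^ 2 * R ^ 2 ≤ r → r ≤ q → newMin R k (c q) (pass₁ R k c q) q ≤ E (r + 1)) ∧
    (∃ r, q / R ^ 2 * R ^ 2 ≤ r ∧ r ≤ q ∧ newMin R k (c q) (pass₁ R k c q) q = E (r + 1)) ∧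
    newCount R k (c q) (pass₁ R k c q) q =
      ccount c E k (newMin R k (c q) (pass₁ R k c q) q) (q / R ^ 2 * R ^ 2) (q + 1) := by
  have hL := W.pass₁_newLevel (R := R)
  have start : ∀ q, q % R ^ 2 = 0 → _ := fun q (h0 : q % R ^ 2 = 0) => show
    (∀ r, q / R ^ 2 * R ^ 2 ≤ r → r ≤ q → newMin R k (c q) (pass₁ R k c q) q ≤ E (r + 1)) ∧
    (∃ r, q / R ^ 2 * R ^ 2 ≤ r ∧ r ≤ q ∧ newMin R k (c q) (pass₁ R k c q) q = E (r + 1)) ∧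
    newCount R k (c q) (pass₁ R k c q) q =
      ccount c E k (newMin R k (c q) (pass₁ R k c q) q) (q / R ^ 2 * R ^ 2) (q + 1) by
    rw [div_mul_of_mod h0, newCount, newMin, if_pos h0, hL, if_pos rfl, if_pos h0]
    refine ⟨fun r hr hr' => ?_, ⟨q, le_rfl, le_rfl, rfl⟩, ?_⟩
    · have : r = q := by omega
      subst this; exact le_rfl
    · rw [ccount_succ le_rfl, ccount_self]
      by_cases hc : c q = 2 * k <;> simp [hc]
  induction q with
  | zero => exact start 0 (Nat.zero_mod _)
  | succ q ih =>
    by_cases h0 : (q + 1) % R ^ 2 = 0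
    · exact start _ h0
    have e2 : pass₁ R k c (q + 1) 2 0 = newMin R k (c q) (pass₁ R k c q) q := rfl
    have e3 : pass₁ R k c (q + 1) 3 0 = newCount R k (c q) (pass₁ R k c q) q := rfl
    have hx := succ_div_of_mod_ne h0
    obtain ⟨g1, ⟨r0, g2, g3, g4⟩, g5⟩ := ih
    have hle := Nat.div_mul_le_self q (R ^ 2)
    have hcnt : newCount R k (c (q + 1)) (pass₁ R k c (q + 1)) (q + 1) =
        (if E (q + 2) < newMin R k (c q) (pass₁ R k c q) q then 0 else
          newCount R k (c q) (pass₁ R k c q) q) + if c (q + 1) = 2 * k then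
          if E (q + 2) = min (newMin R k (c q) (pass₁ R k c q) q) (E (q + 2)) then 1 else 0
          else 0 := by
      rw [newCount, newMin, if_neg h0, if_neg h0, hL, e2, e3]
    have hmin : newMin R k (c (q + 1)) (pass₁ R k c (q + 1)) (q + 1) =
        min (newMin R k (c q) (pass₁ R k c q) q) (E (q + 2)) := by
      rw [newMin, if_neg h0, hL, e2]
    rw [hcnt, hmin, hx]
    generalize newMin R k (c q) (pass₁ R k c q) q = m at *
    generalize newCount R k (c q) (pass₁ R k c q) q = u at *
    generalize q / R ^ 2 * R ^ 2 = a at *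
    refine ⟨fun r hr hr' => ?_, ?_, ?_⟩
    · rcases Nat.lt_or_ge q r with hlt | hge
      · have : r = q + 1 := by omega
        subst this; exact min_le_right _ _
      · exact (min_le_left _ _).trans (g1 r hr hge)
    · rcases Nat.lt_or_ge (E (q + 2)) m with hlt | hge
      · exact ⟨q + 1, by omega, le_rfl, min_eq_right hlt.le⟩
      · exact ⟨r0, g2, by omega, by rw [min_eq_left hge, g4]⟩
    · rw [ccount_succ (by omega)]
      rcases Nat.lt_or_ge (E (q + 2)) m with hlt | hge
      · rw [min_eq_right hlt.le, if_pos hlt, ccount_eq_zero]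
        · by_cases hc : c (q + 1) = 2 * k <;> simp [hc]
        · intro r hr hr' _ he
          have := g1 r hr (by omega); omega
      · rw [min_eq_left hge, if_neg (by omega), g5]
        by_cases hc : c (q + 1) = 2 * k <;> simp [hc]

theorem Walk.pass₁_lE (hR : 0 < R) (q x : ℕ) (hx : x * R ^ 2 < q) :
    pass₁ R k c q 7 x = E (x * R ^ 2) + R ^ 5 - E (x * R ^ 2 / R ^ 5 * R ^ 5) := by
  have hs : 0 < R ^ 2 := pow_pos hR 2
  induction q with
  | zero => omega
  | succ q ih =>
    show (if x = q / R ^ 2 then if q % R ^ 2 = 0 then pass₁ R k c q 0 0 + R ^ 5 -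
      baseLevel R (pass₁ R k c q) q else pass₁ R k c q 7 (q / R ^ 2) else pass₁ R k c q 7 x) = _
    split
    · next h =>
      split
      · next h' => rw [W.pass₁_level, (W.pass₁_base hR q).2, h, div_mul_of_mod h']
      · next h' => rw [← h]; exact ih (by rw [h]; exact div_mul_lt_of_mod h')
    · next h =>
      have := mul_lt_of_lt_div hs (lt_of_div_mul_lt hs hx h)
      rw [add_mul] at this
      exact ih (by omega)

omit W in
-- The entry of a leaf is overwritten at each of its positions; what remains are the running values
-- at `r`, the last position of the leaf that has been processed.
theorem pass₁_leaf_arrays (hR : 0 < R) (q x : ℕ) (hx : x * R ^ 2 < q) :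
    ∃ r, r / R ^ 2 = x ∧ r + 1 = min ((x + 1) * R ^ 2) q ∧
      pass₁ R k c q 8 x = newMin R k (c r) (pass₁ R k c r) r + R ^ 5 -
        baseLevel R (pass₁ R k c r) r ∧
      pass₁ R k c q 9 x = newCount R k (c r) (pass₁ R k c r) r := by
  have hs : 0 < R ^ 2 := pow_pos hR 2
  induction q with
  | zero => omega
  | succ q ih =>
    have e8 : pass₁ R k c (q + 1) 8 x = if x = q / R ^ 2 then
      newMin R k (c q) (pass₁ R k c q) q + R ^ 5 - baseLevel R (pass₁ R k c q) q else
        pass₁ R k c q 8 x := rfl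
    have e9 : pass₁ R k c (q + 1) 9 x = if x = q / R ^ 2 then
      newCount R k (c q) (pass₁ R k c q) q else pass₁ R k c q 9 x := rfl
    by_cases h : x = q / R ^ 2
    · rw [if_pos h] at e8 e9
      refine ⟨q, h.symm, ?_, e8, e9⟩
      have := Nat.lt_div_mul_add hs (a := q)
      rw [min_eq_right]
      rw [h, add_mul]; omega
    · rw [if_neg h] at e8 e9
      have hlt := mul_lt_of_lt_div hs (lt_of_div_mul_lt hs hx h)
      obtain ⟨r, h1, h2, h3, h4⟩ := ih (by rw [add_mul] at hlt; omega)
      refine ⟨r, h1, ?_, by rw [e8, h3], by rw [e9, h4]⟩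
      rw [min_eq_left hlt] at h2
      rw [min_eq_left (by omega), h2]

/-- The pair `(p, r)` is in different blocks, and the last close parenthesis before `r` in the
block of `r` whose partner is in another block does not have its partner in the block of `p`. -/
def IsPio (R k : ℕ) (c E : ℕ → ℕ) (p r : ℕ) : Prop :=
  PairAt c k E p r ∧ p / R ^ 5 ≠ r / R ^ 5 ∧ lastFar R (pass₁ R k c r) r ≠ p / R ^ 5 + 1

/-- Whether a pair is a pioneer is decided when it is closed, and the mark goes to the row of its
left end. The block number is stored plus `1`, so that `0` means no pioneer. -/
theorem Walk.pass₁_pio (q : ℕ) :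
    (∀ p r, r < q → IsPio R k c E p r → pass₁ R k c q 10 p = r / R ^ 5 + 1 ∧
      pass₁ R k c q 11 p = ccount c E k (E p + 1) (p + 1) r) ∧
    ∀ p, pass₁ R k c q 10 p ≠ 0 → ∃ r < q, IsPio R k c E p r := by
  induction q with
  | zero => exact ⟨fun p r hr => by omega, fun p hp => absurd rfl hp⟩
  | succ q ih =>
    have e10 : ∀ p, pass₁ R k c (q + 1) 10 p = if p = top (pass₁ R k c q) then
      ifPioneer R k (c q) (pass₁ R k c q) q (q / R ^ 5 + 1)
        (pass₁ R k c q 10 (top (pass₁ R k c q))) else pass₁ R k c q 10 p := fun p => rfl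
    have e11 : ∀ p, pass₁ R k c (q + 1) 11 p = if p = top (pass₁ R k c q) then
      ifPioneer R k (c q) (pass₁ R k c q) q (pass₁ R k c q 5 (pass₁ R k c q 0 0))
        (pass₁ R k c q 11 (top (pass₁ R k c q))) else pass₁ R k c q 11 p := fun p => rfl
    have new : ∀ p, IsPio R k c E p q → c q = 2 * k ∧ p = top (pass₁ R k c q) := by
      intro p hp
      refine ⟨hp.1.2.2.1, hp.1.unique_left (W.top_pair hp.1.2.2.1).1⟩
    have hif : ∀ v v', (IsPio R k c E (top (pass₁ R k c q)) q ∧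
        ifPioneer R k (c q) (pass₁ R k c q) q v v' = v) ∨
        (¬ IsPio R k c E (top (pass₁ R k c q)) q ∧
        ifPioneer R k (c q) (pass₁ R k c q) q v v' = v') := by
      intro v v'
      unfold ifPioneer IsPio
      by_cases hc : c q = 2 * k
      · have ht := (W.top_pair (R := R) hc).1
        rw [if_pos hc]
        by_cases h1 : top (pass₁ R k c q) / R ^ 5 = q / R ^ 5
        · rw [if_pos h1]; exact Or.inr ⟨fun h => h.2.1 h1, rfl⟩
        · rw [if_neg h1]
          by_cases h2 : lastFar R (pass₁ R k c q) q = top (pass₁ R k c q) / R ^ 5 + 1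
          · rw [if_pos h2]; exact Or.inr ⟨fun h => h.2.2 h2, rfl⟩
          · rw [if_neg h2]; exact Or.inl ⟨⟨ht, h1, h2⟩, rfl⟩
      · rw [if_neg hc]; exact Or.inr ⟨fun h => hc h.1.2.2.1, rfl⟩
    constructor
    · intro p r hr hp
      rw [e10, e11]
      rcases Nat.lt_or_ge r q with hlt | hge
      · have hne : ¬ IsPio R k c E p q := fun h => by
          have := h.1.unique_right hp.1
          omega
        obtain ⟨g1, g2⟩ := ih.1 p r hlt hp
        by_cases ht : p = top (pass₁ R k c q)
        · rw [if_pos ht, if_pos ht, ← ht]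
          rw [ht] at hne
          refine ⟨?_, ?_⟩
          · rcases hif (q / R ^ 5 + 1) (pass₁ R k c q 10 p) with h | h
            · exact absurd h.1 hne
            · rw [h.2, g1]
          · rcases hif (pass₁ R k c q 5 (pass₁ R k c q 0 0)) (pass₁ R k c q 11 p) with h | h
            · exact absurd h.1 hne
            · rw [h.2, g2]
        · rw [if_neg ht, if_neg ht]; exact ⟨g1, g2⟩
      · have : r = q := by omega
        subst this
        obtain ⟨hc, ht⟩ := new p hp
        rw [ht] at hp
        rw [if_pos ht, if_pos ht, ht]
        refine ⟨?_, ?_⟩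
        · rcases hif (r / R ^ 5 + 1) (pass₁ R k c r 10 (top (pass₁ R k c r))) with h | h
          · exact h.2
          · exact absurd hp h.1
        · rcases hif (pass₁ R k c r 5 (pass₁ R k c r 0 0))
            (pass₁ R k c r 11 (top (pass₁ R k c r))) with h | h
          · rw [h.2, (W.top_pair hc).2]
          · exact absurd hp h.1
    · intro p hp
      have old : pass₁ R k c q 10 p ≠ 0 → ∃ r < q + 1, IsPio R k c E p r := fun h => by
        obtain ⟨r, hr, h'⟩ := ih.2 p h
        exact ⟨r, by omega, h'⟩
      rw [e10] at hp
      by_cases ht : p = top (pass₁ R k c q)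
      · rw [if_pos ht] at hp
        rcases hif (q / R ^ 5 + 1) (pass₁ R k c q 10 (top (pass₁ R k c q))) with h | h
        · exact ⟨q, by omega, by rw [ht]; exact h.1⟩
        · rw [h.2, ← ht] at hp; exact old hp
      · rw [if_neg ht] at hp; exact old hp

omit W in
theorem PairAt.not_cross {i j a b : ℕ} (h : PairAt c k E i j) (h' : PairAt c k E a b) (h1 : i < a)
    (h2 : a < j) (h3 : j < b) : False := by
  have := h.nested h' h1 h2; omega

/-- Take the first close parenthesis in the block of `i'` whose partner is in the block of `i`. No
earlier one in its block can be matched there, so it belongs to a pioneer, and as pairs do not cross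
it lies within `(i, i')`. -/
theorem Walk.exists_pio {i i' : ℕ} (hp : PairAt c k E i i') (hb : i / R ^ 5 ≠ i' / R ^ 5) :
    ∃ p p', i ≤ p ∧ p' ≤ i' ∧ IsPio R k c E p p' ∧ p / R ^ 5 = i / R ^ 5 ∧
      p' / R ^ 5 = i' / R ^ 5 := by
  have hex : ∃ r, ∃ p, PairAt c k E p r ∧ r / R ^ 5 = i' / R ^ 5 ∧ p / R ^ 5 = i / R ^ 5 :=
    ⟨i', i, hp, rfl, rfl⟩
  classical
  obtain ⟨p, h1, h2, h3⟩ := Nat.find_spec hex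
  have hmin := fun m => Nat.find_min hex (m := m)
  have hle : Nat.find hex ≤ i' := Nat.find_min' hex ⟨i, hp, rfl, rfl⟩
  generalize Nat.find hex = r at *
  refine ⟨p, r, ?_, hle, ⟨h1, by omega, fun hl => ?_⟩, h3, h2⟩
  · by_contra hcon
    have hir : i < r := by
      by_contra hcon'
      have e1 := Nat.div_le_div_right (c := R ^ 5) (show r ≤ i by omega)
      have e2 := Nat.div_le_div_right (c := R ^ 5) hp.1.le
      omega
    rcases Nat.eq_or_lt_of_le hle with rfl | hlt
    · have := h1.unique_left hp; omega
    · exact h1.not_cross hp (by omega) hir hlt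
  · rcases W.pass₁_lastFar (R := R) r with ⟨g1, -⟩ | ⟨p', r', g1, g2, g3, g4, g5, -⟩
    · rw [g1] at hl; exact absurd hl.symm (Nat.succ_ne_zero _)
    · refine hmin r' g2 ⟨p', g3, ?_, by omega⟩
      have e1 := Nat.div_le_div_right (c := R ^ 5) g2.le
      rcases Nat.eq_zero_or_pos (R ^ 5) with h0 | h0
      · rw [h0] at g4; simp at g4
      · have := (Nat.le_div_iff_mul_le h0).2 g1
        omega

/-- Two ways of charging pioneers. Without an earlier far close parenthesis in its block, a pioneer
is the first one there and is charged to that block. Otherwise it is charged to the block `b` into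
which the previous far one is matched: a second pioneer charged to `b` would have its predecessor's
pair cross the first pioneer. -/
theorem Walk.pio_injOn (hR : 0 < R) {p₁ r₁ p₂ r₂ : ℕ} (h₁ : IsPio R k c E p₁ r₁)
    (h₂ : IsPio R k c E p₂ r₂) (hr : r₁ < r₂) :
    (lastFar R (pass₁ R k c r₁) r₁ = 0 → lastFar R (pass₁ R k c r₂) r₂ = 0 →
      r₁ / R ^ 5 ≠ r₂ / R ^ 5) ∧
    (lastFar R (pass₁ R k c r₁) r₁ ≠ 0 → lastFar R (pass₁ R k c r₂) r₂ ≠ 0 →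
      lastFar R (pass₁ R k c r₁) r₁ ≠ lastFar R (pass₁ R k c r₂) r₂) := by
  have hB : 0 < R ^ 5 := pow_pos hR 5
  obtain ⟨a1, a2, a3⟩ := h₁
  obtain ⟨b1, b2, b3⟩ := h₂
  have hlt := mul_lt_of_lt_div hB (q := r₂) (x := r₁ / R ^ 5)
  have hlt' := Nat.lt_div_mul_add hB (a := r₁)
  rw [add_mul, one_mul] at hlt
  have hle2 := Nat.div_le_div_right (c := R ^ 5) hr.le
  constructor
  · intro _ h h'
    rcases W.pass₁_lastFar (R := R) r₂ with ⟨-, g⟩ | ⟨p, r, -, -, -, -, g, -⟩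
    · refine a2 (g p₁ r₁ ?_ hr a1)
      rw [← h']; exact Nat.div_mul_le_self _ _
    · rw [h] at g; exact absurd g.symm (Nat.succ_ne_zero _)
  · intro h h' he
    rcases W.pass₁_lastFar (R := R) r₁ with ⟨g, -⟩ | ⟨p, r, g1, g2, g3, g4, g5, g6⟩
    · exact absurd g h
    rcases W.pass₁_lastFar (R := R) r₂ with ⟨g, -⟩ | ⟨p', r', f1, f2, f3, f4, f5, f6⟩
    · exact absurd g h'
    have hpp : p / R ^ 5 = p' / R ^ 5 := by omega
    -- `r'` is the last far close parenthesis before `r₂` in its block, and `r₁` is far, so `r₁`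
    -- cannot lie between them.
    have hr1 : r₁ ≤ r' := by
      by_contra hcon
      rcases Nat.eq_or_lt_of_le hle2 with heq | hlt2
      · exact a2 (f6 p₁ r₁ (by omega) hr a1)
      · have := hlt hlt2
        have := Nat.mul_le_mul_right (R ^ 5) hlt2
        rw [Nat.succ_mul] at this
        omega
    have hr2 : r₁ ≠ r' := by
      rintro rfl
      have := a1.unique_left f3
      subst this
      omega
    have hpr : p / R ^ 5 < r₁ / R ^ 5 := by
      have e1 := Nat.div_le_div_right (c := R ^ 5) g3.1.le
      have e2 := Nat.div_le_div_right (c := R ^ 5) g2.le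
      have e3 := (Nat.le_div_iff_mul_le hB).2 g1
      omega
    have hp'r : p' < r₁ := by
      by_contra hcon
      have := Nat.div_le_div_right (c := R ^ 5) (show r₁ ≤ p' by omega)
      omega
    -- The pairs `(p, r)` and `(p₁, r₁)` satisfy `r < r₁` and do not cross, so the later one
    -- encloses the earlier; disjointness would place `p₁` in the block of `r₁`.
    have hp1 : p₁ < p := by
      by_contra hcon
      rcases Nat.eq_or_lt_of_le (show p ≤ p₁ by omega) with heq | hlt3
      · subst heq; have := g3.unique_right a1; omega
      · have hpr1 : r < p₁ ∨ p₁ < r := by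
          rcases Nat.lt_trichotomy r p₁ with h | h | h
          · exact Or.inl h
          · have := g3.2.2.1; have := a1.2.1; rw [h] at *; omega
          · exact Or.inr h
        rcases hpr1 with h | h
        · have e1 := Nat.div_le_div_right (c := R ^ 5) h.le
          have e3 := (Nat.le_div_iff_mul_le hB).2 g1
          have e4 := Nat.div_le_div_right (c := R ^ 5) a1.1.le
          omega
        · exact g3.not_cross a1 hlt3 h g2
    -- The pioneer condition puts `p₁` into a block before that of `p`, which is also the block of
    -- `p'`. Then `p₁ < p' < r₁ < r'` is a crossing.
    have hp1' : p₁ < p' := by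
      by_contra hcon
      have e1 := Nat.div_le_div_right (c := R ^ 5) (show p' ≤ p₁ by omega)
      have e2 := Nat.div_le_div_right (c := R ^ 5) hp1.le
      omega
    exact a1.not_cross f3 hp1' hp'r (by omega)

end Pass

end ParenString

/-! ### Correctness of the second pass, the number of pioneers, and the whole index. -/

namespace ParenString

section Pass
variable {n k R : ℕ} {c E : ℕ → ℕ}

theorem pass₂_count (R : ℕ) (M : ℕ → ℕ → ℕ) (h12 : M 12 0 = 0) (q : ℕ) :
    pass₂ R M q 12 0 = Nat.count (fun p => M 10 p ≠ 0) q := by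
  induction q with
  | zero => exact h12
  | succ q ih =>
    show (if pass₂ R M q 10 q = 0 then pass₂ R M q 12 0 else pass₂ R M q 12 0 + 1) = _
    rw [pass₂_lt_twelve _ _ _ _ _ (by norm_num), ih, Nat.count_succ]
    by_cases h : M 10 q = 0 <;> simp [h]

theorem pass₂_base (hR : 0 < R) (M : ℕ → ℕ → ℕ) (h12 : M 12 0 = 0) (q : ℕ) :
    (∀ b, b * R ^ 5 < q → pass₂ R M q 13 b = Nat.count (fun p => M 10 p ≠ 0) (b * R ^ 5)) ∧
    baseCount R (pass₂ R M q) q = Nat.count (fun p => M 10 p ≠ 0) (q / R ^ 5 * R ^ 5) := by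
  have hB : 0 < R ^ 5 := pow_pos hR 5
  have key : ∀ q, (∀ b, b * R ^ 5 < q →
        pass₂ R M q 13 b = Nat.count (fun p => M 10 p ≠ 0) (b * R ^ 5)) →
      baseCount R (pass₂ R M q) q = Nat.count (fun p => M 10 p ≠ 0) (q / R ^ 5 * R ^ 5) := by
    intro q h
    unfold baseCount
    split
    · next h' => rw [pass₂_count R M h12, div_mul_of_mod h']
    · next h' => exact h _ (div_mul_lt_of_mod h')
  suffices h : ∀ b, b * R ^ 5 < q →
    pass₂ R M q 13 b = Nat.count (fun p => M 10 p ≠ 0) (b * R ^ 5) from ⟨h, key q h⟩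
  induction q with
  | zero => intro b hb; omega
  | succ q ih =>
    intro b hb
    show (if b = q / R ^ 5 then baseCount R (pass₂ R M q) q else pass₂ R M q 13 b) = _
    split
    · next h => rw [key q ih, h]
    · next h =>
      have := mul_lt_of_lt_div hB (lt_of_div_mul_lt hB hb h)
      rw [add_mul] at this
      exact ih b (by omega)

theorem pass₂_lR (hR : 0 < R) (M : ℕ → ℕ → ℕ) (h12 : M 12 0 = 0) (q x : ℕ) (hx : x * R ^ 2 < q) :
    pass₂ R M q 14 x = Nat.count (fun p => M 10 p ≠ 0) (x * R ^ 2) -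
      Nat.count (fun p => M 10 p ≠ 0) (x * R ^ 2 / R ^ 5 * R ^ 5) := by
  have hs : 0 < R ^ 2 := pow_pos hR 2
  induction q with
  | zero => omega
  | succ q ih =>
    show (if x = q / R ^ 2 then if q % R ^ 2 = 0 then pass₂ R M q 12 0 -
      baseCount R (pass₂ R M q) q else pass₂ R M q 14 (q / R ^ 2) else pass₂ R M q 14 x) = _
    split
    · next h =>
      split
      · next h' => rw [pass₂_count R M h12, (pass₂_base hR M h12 q).2, h, div_mul_of_mod h']
      · next h' => rw [← h]; exact ih (by rw [h]; exact div_mul_lt_of_mod h')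
    · next h =>
      have := mul_lt_of_lt_div hs (lt_of_div_mul_lt hs hx h)
      rw [add_mul] at this
      exact ih (by omega)

/-- The row is the number of pioneers met so far. After a pioneer this number has grown, so its row
is not written again. -/
theorem pass₂_pio (R : ℕ) (M : ℕ → ℕ → ℕ) (h12 : M 12 0 = 0) (q p : ℕ) (hp : p < q)
    (hM : M 10 p ≠ 0) :
    pass₂ R M q 15 (Nat.count (fun p => M 10 p ≠ 0) p) = p % R ^ 5 ∧
    pass₂ R M q 16 (Nat.count (fun p => M 10 p ≠ 0) p) = M 10 p - 1 ∧
    pass₂ R M q 17 (Nat.count (fun p => M 10 p ≠ 0) p) = M 11 p := by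
  induction q with
  | zero => omega
  | succ q ih =>
    have key : ∀ (r v u : ℕ), pass₂ R M q 12 0 = Nat.count (fun p => M 10 p ≠ 0) q →
        (if r = pass₂ R M q 12 0 then if pass₂ R M q 10 q = 0 then u else v else u) =
        if r = Nat.count (fun p => M 10 p ≠ 0) q ∧ M 10 q ≠ 0 then v else u := by
      intro r v u h
      rw [h, pass₂_lt_twelve _ _ _ _ _ (by norm_num)]
      by_cases h1 : r = Nat.count (fun p => M 10 p ≠ 0) q <;> by_cases h2 : M 10 q = 0 <;>
        simp [h1, h2]
    have hc := pass₂_count R M h12 q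
    have key' : ∀ (j r v : ℕ), (if r = pass₂ R M q 12 0 then
          if pass₂ R M q 10 q = 0 then pass₂ R M q j (pass₂ R M q 12 0) else v
          else pass₂ R M q j r) =
        if r = Nat.count (fun p => M 10 p ≠ 0) q ∧ M 10 q ≠ 0 then v else pass₂ R M q j r := by
      intro j r v
      rw [← key r v _ hc]
      split
      · next h => rw [h]
      · rfl
    have e15 : ∀ r, pass₂ R M (q + 1) 15 r = _ := fun r => key' 15 r (q % R ^ 5)
    have e16 : ∀ r, pass₂ R M (q + 1) 16 r = _ := fun r => key' 16 r (pass₂ R M q 10 q - 1)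
    have e17 : ∀ r, pass₂ R M (q + 1) 17 r = _ := fun r => key' 17 r (pass₂ R M q 11 q)
    rw [e15, e16, e17]
    rcases Nat.lt_or_ge p q with hlt | hge
    · have := Nat.count_strict_mono (p := fun p => M 10 p ≠ 0) hM hlt
      rw [if_neg (by omega), if_neg (by omega), if_neg (by omega)]
      exact ih hlt
    · have : p = q := by omega
      subst this
      rw [if_pos ⟨rfl, hM⟩, if_pos ⟨rfl, hM⟩, if_pos ⟨rfl, hM⟩,
        pass₂_lt_twelve _ _ _ _ _ (by norm_num), pass₂_lt_twelve _ _ _ _ _ (by norm_num)]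
      exact ⟨rfl, rfl, rfl⟩

theorem pass₂_pP_le (hR : 0 < R) (M : ℕ → ℕ → ℕ) (hM : ∀ r, M 15 r = 0) (q r : ℕ) :
    pass₂ R M q 15 r ≤ R ^ 5 := by
  induction q generalizing r with
  | zero => rw [pass₂, hM]; exact Nat.zero_le _
  | succ q ih =>
    show (if r = pass₂ R M q 12 0 then if pass₂ R M q 10 q = 0 then
      pass₂ R M q 15 (pass₂ R M q 12 0) else q % R ^ 5 else pass₂ R M q 15 r) ≤ _
    split
    · split
      · exact ih _
      · exact (Nat.mod_lt _ (pow_pos hR 5)).le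
    · exact ih r

/-- The two charges of `Walk.pio_injOn` use disjoint sets of labels, one label per block each, and
give an injection. -/
theorem Walk.count_pio_le (W : Walk n k c E) (hR : 0 < R) :
    Nat.count (fun p => pass₁ R k c n 10 p ≠ 0) n ≤ 2 * numBlocks R n := by
  classical
  have hB : 0 < R ^ 5 := pow_pos hR 5
  obtain ⟨-, hex⟩ := W.pass₁_pio (R := R) n
  have hex' : ∀ p, ∃ r, pass₁ R k c n 10 p ≠ 0 → r < n ∧ IsPio R k c E p r := by
    intro p
    by_cases h : pass₁ R k c n 10 p ≠ 0
    · obtain ⟨r, h1, h2⟩ := hex p h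
      exact ⟨r, fun _ => ⟨h1, h2⟩⟩
    · exact ⟨0, fun h' => absurd h' h⟩
  choose r hr using hex'
  rw [Nat.count_eq_card_filter_range]
  let g : ℕ → ℕ := fun p => if lastFar R (pass₁ R k c (r p)) (r p) = 0 then r p / R ^ 5 else
    numBlocks R n + (lastFar R (pass₁ R k c (r p)) (r p) - 1)
  have hblock : ∀ q < n, q / R ^ 5 < numBlocks R n := fun q hq => by
    unfold numBlocks
    exact Nat.lt_succ_of_le (Nat.div_le_div_right hq.le)
  refine (Finset.card_le_card_of_injOn (t := Finset.range (2 * numBlocks R n)) g ?_ ?_).trans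
    (by simp)
  · intro p hp
    simp only [Finset.coe_filter, Finset.mem_range, Set.mem_ofPred_eq] at hp
    obtain ⟨h1, h2⟩ := hr p hp.2
    have := hblock _ h1
    simp only [Finset.coe_range, Set.mem_Iio, g]
    split
    · omega
    · next h =>
      rcases W.pass₁_lastFar (R := R) (r p) with ⟨h', -⟩ | ⟨p', r', -, h3, h4, -, h5, -⟩
      · exact absurd h' h
      · have := hblock p' (by have := h4.1; omega)
        rw [h5]
        omega
  · intro p hp p' hp' hg
    simp only [Finset.coe_filter, Finset.mem_range, Set.mem_ofPred_eq] at hp hp'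
    obtain ⟨h1, h2⟩ := hr p hp.2
    obtain ⟨h1', h2'⟩ := hr p' hp'.2
    have hb := hblock _ h1
    have hb' := hblock _ h1'
    by_contra hne
    have hrr : r p ≠ r p' := fun h => hne (h2.1.unique_left (h ▸ h2'.1))
    simp only [g] at hg
    rcases Nat.lt_or_gt_of_ne hrr with hlt | hlt
    · obtain ⟨k1, k2⟩ := W.pio_injOn hR h2 h2' hlt
      split at hg <;> split at hg <;> omega
    · obtain ⟨k1, k2⟩ := W.pio_injOn hR h2' h2 hlt
      split at hg <;> split at hg <;> omega

theorem pass₁_leaf_zero (hR : 0 < R) (q x : ℕ) (hx : q ≤ x * R ^ 2) :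
    pass₁ R k c q 8 x = 0 ∧ pass₁ R k c q 9 x = 0 := by
  have hs : 0 < R ^ 2 := pow_pos hR 2
  induction q with
  | zero => exact ⟨rfl, rfl⟩
  | succ q ih =>
    have hne : x ≠ q / R ^ 2 := by
      rintro rfl
      have := Nat.div_mul_le_self q (R ^ 2)
      omega
    have e8 : pass₁ R k c (q + 1) 8 x = if x = q / R ^ 2 then _ else pass₁ R k c q 8 x := rfl
    have e9 : pass₁ R k c (q + 1) 9 x = if x = q / R ^ 2 then _ else pass₁ R k c q 9 x := rfl
    rw [e8, e9, if_neg hne, if_neg hne]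
    exact ih (by omega)

/-- The size bounds on minima and multiplicities are needed for all leaves, also those past the end
of the string, since a load fetches a whole block; there the entries are still the initial zeros. -/
theorem Walk.index (W : Walk n k c E) (hR : 0 < R) :
    Index R n k c E (pass₁ R k c n 10) (arraysOf (passes R k n c)) := by
  have hB : 0 < R ^ 5 := pow_pos hR 5
  have hs : 0 < R ^ 2 := pow_pos hR 2
  have h12 : pass₁ R k c n 12 0 = 0 := pass₁_twelve _ _ _ _ _ _ le_rfl
  have hdiv : ∀ x, x * R ^ 2 / R ^ 5 = x / R ^ 3 := fun x => by
    rw [show R ^ 5 = R ^ 3 * R ^ 2 by ring, Nat.mul_div_mul_right _ _ hs]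
  have hleaf : ∀ x, x / R ^ 3 * R ^ 5 ≤ x * R ^ 2 := fun x => by
    rw [← hdiv]; exact Nat.div_mul_le_self _ _
  have low : ∀ col r, col < 12 → passes R k n c col r = pass₁ R k c n col r :=
    fun col r h => pass₂_lt_twelve _ _ _ _ _ h
  have hbig := pow_five_lt R hR
  have hsB : R ^ 2 ≤ R ^ 5 := Nat.pow_le_pow_right hR (by norm_num)
  have leaf : ∀ x, x * R ^ 2 < n →
      (∀ r, x * R ^ 2 ≤ r → r < (x + 1) * R ^ 2 → r < n →
        passes R k n c 8 x + E (x / R ^ 3 * R ^ 5) ≤ E (r + 1) + R ^ 5) ∧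
      (∃ r, x * R ^ 2 ≤ r ∧ r < (x + 1) * R ^ 2 ∧ r < n ∧
        passes R k n c 8 x + E (x / R ^ 3 * R ^ 5) = E (r + 1) + R ^ 5) ∧
      ∀ v, v + R ^ 5 = passes R k n c 8 x + E (x / R ^ 3 * R ^ 5) →
        passes R k n c 9 x = ccount c E k v (x * R ^ 2) (min ((x + 1) * R ^ 2) n) := by
    intro x hx
    obtain ⟨r, h1, h2, h3, h4⟩ := pass₁_leaf_arrays (k := k) (c := c) hR n x hx
    obtain ⟨g1, ⟨r', g2, g3, g4⟩, g5⟩ := W.pass₁_leaf (R := R) r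
    have hb : r / R ^ 5 = x / R ^ 3 := by rw [← div_leaf, h1]
    rw [(W.pass₁_base hR r).2, hb] at h3
    rw [low _ _ (by norm_num), low _ _ (by norm_num), h3, h4, g5]
    rw [h1] at *
    have hx' := hleaf x
    obtain ⟨d, hd⟩ := Nat.exists_eq_add_of_le (show x / R ^ 3 * R ^ 5 ≤ r' + 1 by omega)
    have h5 := W.le_sub (x / R ^ 3 * R ^ 5) d
    rw [← hd] at h5
    have h6 := Nat.lt_div_mul_add hB (a := r)
    rw [hb] at h6
    generalize newMin R k (c r) (pass₁ R k c r) r = m at *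
    have hmin : r < (x + 1) * R ^ 2 ∧ r < n := by omega
    refine ⟨fun q hq hq' hqn => ?_, ⟨r', g2, by omega, by omega, by omega⟩, fun v hv => ?_⟩
    · have := g1 q hq (by omega); omega
    · rw [h2]
      congr 1
      omega
  refine ⟨?_, ?_, ?_, ?_, ?_, ?_, ?_, ?_, ?_, ?_, ?_, ?_, W.count_pio_le hR⟩
  · intro b hb
    exact (low _ _ (by norm_num)).trans ((W.pass₁_base hR n).1 b hb)
  · intro x hx
    show passes R k n c 7 x + _ = _
    rw [low _ _ (by norm_num), W.pass₁_lE hR n x hx, hdiv]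
    have := hleaf x
    obtain ⟨d, hd⟩ := Nat.exists_eq_add_of_le this
    have h5 := W.le_sub (x / R ^ 3 * R ^ 5) d
    rw [← hd] at h5
    have h6 := Nat.lt_div_mul_add hB (a := x * R ^ 2)
    rw [hdiv] at h6
    omega
  · intro x r h1 h2 h3
    exact (leaf x (by omega)).1 r h1 h2 h3
  · intro x hx
    exact (leaf x hx).2.1
  · intro x hx v hv
    exact (leaf x hx).2.2 v hv
  · intro x
    show passes R k n c 8 x < _
    rcases Nat.lt_or_ge (x * R ^ 2) n with hx | hx
    · obtain ⟨r, h1, h2, h3, h4⟩ := (leaf x hx).2.1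
      have hx' := hleaf x
      obtain ⟨d, hd⟩ := Nat.exists_eq_add_of_le (show x / R ^ 3 * R ^ 5 ≤ r + 1 by omega)
      have h5 := W.le_add (x / R ^ 3 * R ^ 5) d
      rw [← hd] at h5
      have h6 := mul_lt_of_lt_div hs (q := x / R ^ 3 * R ^ 5 + R ^ 5) (x := x) (by
        rw [Nat.lt_div_iff_mul_lt hs]
        have := Nat.lt_div_mul_add hB (a := x * R ^ 2)
        rw [hdiv] at this
        have e : R ^ 5 = R ^ 3 * R ^ 2 := by ring
        have e1 : x < x / R ^ 3 * R ^ 3 + R ^ 3 := Nat.lt_div_mul_add (pow_pos hR 3)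
        have e2 : (x + 1) * R ^ 2 ≤ (x / R ^ 3 * R ^ 3 + R ^ 3) * R ^ 2 :=
          Nat.mul_le_mul_right _ e1
        rw [add_mul, add_mul, mul_assoc, ← e] at e2
        omega)
      omega
    · rw [low _ _ (by norm_num), (pass₁_leaf_zero hR n x hx).1]
      omega
  · intro x
    show passes R k n c 9 x ≤ _
    rcases Nat.lt_or_ge (x * R ^ 2) n with hx | hx
    · obtain ⟨r, -, -, -, h4⟩ := (leaf x hx).2.1
      have e2 : (x + 1) * R ^ 2 = x * R ^ 2 + R ^ 2 := by ring
      rw [(leaf x hx).2.2 (E (r + 1)) h4.symm]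
      refine ccount_le.trans ?_
      have := min_le_left ((x + 1) * R ^ 2) n
      omega
    · rw [low _ _ (by norm_num), (pass₁_leaf_zero hR n x hx).2]
      omega
  · intro i
    have := pass₂_pP_le hR (pass₁ R k c n) (fun r => pass₁_twelve _ _ _ _ _ _ (by norm_num)) n i
    show passes R k n c 15 i < _
    unfold passes
    omega
  · intro b hb
    exact (pass₂_base hR _ h12 n).1 b hb
  · intro x hx
    show passes R k n c 14 x + _ = _
    unfold passes
    rw [pass₂_lR hR _ h12 n x hx, hdiv, Nat.sub_add_cancel]
    exact Nat.count_monotone _ (hleaf x)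
  · intro p hp
    obtain ⟨r, h1, h2⟩ := (W.pass₁_pio (R := R) n).2 p hp
    obtain ⟨h3, h4⟩ := (W.pass₁_pio (R := R) n).1 p r h1 h2
    have hpn := h2.1.1
    obtain ⟨h5, h6, h7⟩ := pass₂_pio R _ h12 n p (by omega) hp
    refine ⟨r, h2.1, h2.2.1, h5, ?_, ?_⟩
    · exact h6.trans (by rw [h3]; rfl)
    · exact h7.trans h4
  · intro i i' hp hb
    obtain ⟨p, p', h1, h2, h3, h4, h5⟩ := W.exists_pio hp hb
    have hi' := W.ran i' (Or.inr hp.2.2.1)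
    refine ⟨p, p', h1, ?_, h3.1, h4, h5⟩
    rw [((W.pass₁_pio (R := R) n).1 p p' (by omega) h3).1]
    exact Nat.succ_ne_zero _

end Pass

end ParenString

/-! ### Simultaneous stores. -/

namespace WordRAM
open BitString

theorem readBits_write {mem : ℕ → Bool} {a l v : ℕ} :
    readBits (writeBits mem a l v) a l = v % 2 ^ l := by
  refine readBits_eq_mod fun q hq => ?_
  rw [writeBits, if_pos ⟨by omega, by omega⟩, Nat.add_sub_cancel_left]

theorem write_of_disjoint {mem : ℕ → Bool} {a l v p : ℕ} (h : p < a ∨ a + l ≤ p) :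
    writeBits mem a l v p = mem p := by
  rw [writeBits, if_neg (by omega)]

theorem has_write {mem : ℕ → Bool} {a l v : ℕ} : Has (writeBits mem a l v) a (ofNat l v) := by
  intro p hp
  rw [length_ofNat] at hp
  rw [writeBits, if_pos ⟨by omega, by omega⟩, Nat.add_sub_cancel_left]
  simp [ofNat]

/-- Evaluates addresses and values of `m` pairs into the registers from `9` on. -/
def evalAll (A V : ℕ → Expr) : ℕ → Cmd
  | 0 => .basic (.const 9 0)
  | m + 1 => .seq (evalAll A V m) (.seq ((A m).code (9 + 2 * m)) ((V m).code (9 + 2 * m + 1)))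

/-- All addresses and values are computed before anything is stored, so new entries depend on the
old ones only, as `put` demands. The inputs stay in the registers below `8`, and register `8` is
kept for the length of the stores. -/
theorem evalAll_runs (A V : ℕ → Expr) (m w : ℕ) (reg : ℕ → ℕ) (mem : ℕ → Bool)
    (hA : ∀ j < m, (A j).Below 8) (hV : ∀ j < m, (V j).Below 8) :
    ∃ reg', Runs w (evalAll A V m) reg mem reg' mem
        (1 + ∑ j ∈ Finset.range m, ((A j).cost + (V j).cost)) ∧
      (∀ j < m, reg' (9 + 2 * j) = (A j).eval w reg mem ∧
        reg' (9 + 2 * j + 1) = (V j).eval w reg mem) ∧ ∀ r < 9, reg' r = reg r := by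
  induction m with
  | zero =>
    refine ⟨_, Runs.const _ _, fun j hj => by omega, fun r hr => ?_⟩
    simp [hr.ne]
  | succ m ih =>
    obtain ⟨r1, h1, h1v, h1r⟩ := ih (fun j hj => hA j (by omega)) fun j hj => hV j (by omega)
    obtain ⟨r2, h2, h2v, h2r⟩ := Expr.runs w (A m) (9 + 2 * m) r1 mem
      ((hA m (by omega)).mono (by omega))
    obtain ⟨r3, h3, h3v, h3r⟩ := Expr.runs w (V m) (9 + 2 * m + 1) r2 mem
      ((hV m (by omega)).mono (by omega))
    have e1 : ∀ r < 8, r1 r = reg r := fun r hr => h1r r (by omega)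
    have e2 : ∀ r < 8, r2 r = reg r := fun r hr => by rw [h2r r (by omega), h1r r (by omega)]
    refine ⟨r3, (Runs.seq h1 (Runs.seq h2 h3)).mono ?_, fun j hj => ?_, fun r hr => ?_⟩
    · rw [Finset.sum_range_succ]; omega
    · rcases Nat.lt_or_ge j m with hlt | hge
      · rw [h3r _ (by omega), h3r _ (by omega), h2r _ (by omega), h2r _ (by omega)]
        exact h1v j hlt
      · have : j = m := by omega
        subst this
        rw [h3v, h3r _ (by omega), h2v, Expr.eval_congr (hA j hj) e1,
          Expr.eval_congr (hV j hj) e2]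
        exact ⟨rfl, rfl⟩
    · rw [h3r r (by omega), h2r r (by omega), h1r r hr]

/-- Stores `m` values at their addresses. -/
def storeAll : ℕ → Cmd
  | 0 => .basic (.const 4 0)
  | m + 1 => .seq (storeAll m) (.basic (.store (9 + 2 * m + 1) (9 + 2 * m) 8))

/-- The memory after `m` values `v j` of length `l` have been written at the addresses `a j`. -/
def writeAll (l : ℕ) (a v : ℕ → ℕ) (mem : ℕ → Bool) : ℕ → ℕ → Bool
  | 0 => mem
  | m + 1 => writeBits (writeAll l a v mem m) (a m) l (v m)

theorem storeAll_runs (m w : ℕ) (reg : ℕ → ℕ) (mem : ℕ → Bool) (a v : ℕ → ℕ)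
    (h : ∀ j < m, reg (9 + 2 * j) = a j ∧ reg (9 + 2 * j + 1) = v j) :
    Runs w (storeAll m) reg mem (Function.update reg 4 0) (writeAll (min (reg 8) w) a v mem m)
      (m + 1) := by
  induction m with
  | zero =>
    have := Runs.const (w := w) (reg := reg) (mem := mem) 4 0
    rwa [Nat.zero_mod] at this
  | succ m ih =>
    have h1 := Runs.seq (ih fun j hj => h j (by omega)) (Runs.store (9 + 2 * m + 1) (9 + 2 * m) 8)
    obtain ⟨h2, h3⟩ := h m (by omega)
    simp only [Function.update_of_ne (show 9 + 2 * m + 1 ≠ 4 by omega),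
      Function.update_of_ne (show 9 + 2 * m ≠ 4 by omega),
      Function.update_of_ne (show 8 ≠ 4 by omega), h2, h3] at h1
    exact h1.mono (by omega)

end WordRAM

/-! ### The memory layout of the construction. -/

namespace ParenString
open WordRAM BitString

/-- A situation in the construction: the string, a counter and its bound, families of columns, and
the output so far. -/
structure Sit (t : ℕ) where
  S : List (Paren t)
  q : ℕ
  b : ℕ
  M : ℕ → ℕ → ℕ → ℕ
  O : List Bool

/-- The distance of the entries of the columns in the memory. -/
def stride (n : ℕ) : ℕ := 16 * (n + 1)

/-- The number of rows. -/
def rows (n : ℕ) : ℕ := (n + 2) ^ 16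

/-- The address of an entry. -/
def cell (t n ph col row : ℕ) : ℕ :=
  symBits t * n + (row * (32 * (2 * t + 1)) + (32 * ph + col)) * stride n

/-- The address of the output. -/
def outBase (t n : ℕ) : ℕ := symBits t * n + rows n * (32 * (2 * t + 1)) * stride n

/-- The representation of the situations of the construction. -/
def buildSys (t : ℕ) : Sys (Sit t) where
  u x := Nat.log 2 x.S.length + 1
  one_le _ := Nat.le_add_left _ _
  ok x := (∀ ph col r, x.M ph col r < rows x.S.length) ∧ x.q < rows x.S.length ∧
    x.O.length ≤ 200 * (t + 1) * rows x.S.length ∧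
    x.M (2 * t) 0 0 ^ 4 ≤ Nat.log 2 x.S.length + 1
  rel w x reg mem := (reg 0 = symBits t * x.S.length % 2 ^ w ∧ reg 1 = x.O.length % 2 ^ w ∧
      reg 2 = x.q % 2 ^ w ∧ reg 3 = x.b % 2 ^ w) ∧
    Has mem 0 (encode x.S) ∧
    (∀ ph < 2 * t + 1, ∀ col < 32, ∀ r < rows x.S.length,
      readBits mem (cell t x.S.length ph col r) (min (stride x.S.length) w) = x.M ph col r) ∧
    Has mem (outBase t x.S.length) x.O

theorem length_lt_two_pow (n : ℕ) : n < 2 ^ (Nat.log 2 n + 1) :=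
  Nat.lt_pow_succ_log_self (by norm_num) n

/-- A cell is accessed with the smaller of its stride and the word length. The first bound makes
entries fit into a word, the second into the stride. -/
theorem rows_le (n : ℕ) : rows n ≤ 2 ^ (32 * (Nat.log 2 n + 1)) ∧ rows n ≤ 2 ^ stride n := by
  have h1 := length_lt_two_pow n
  have h2 : n + 2 ≤ 2 ^ (2 * (Nat.log 2 n + 1)) := by
    rw [two_mul, pow_add]
    have : 2 ≤ 2 ^ (Nat.log 2 n + 1) := by
      calc 2 = 2 ^ 1 := rfl
        _ ≤ _ := Nat.pow_le_pow_right (by norm_num) (by omega)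
    nlinarith
  have h3 : n + 2 ≤ 2 ^ (n + 1) := Nat.lt_two_pow_self
  constructor
  · rw [rows, show 32 * (Nat.log 2 n + 1) = 2 * (Nat.log 2 n + 1) * 16 by ring, pow_mul]
    exact Nat.pow_le_pow_left h2 16
  · rw [rows, stride, mul_comm 16, pow_mul]
    exact Nat.pow_le_pow_left h3 16

section Comp
variable {t : ℕ} {F : Sit t → ℕ}

theorem comp_length_bits : Comp (buildSys t) fun x => symBits t * x.S.length := by
  refine Comp.register 0 (by norm_num) (fun x _ w reg mem h => h.1.1) ⟨symBits t + 1, fun x _ => ?_⟩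
  rw [add_mul, one_mul, pow_add]
  refine Nat.mul_lt_mul_of_lt_of_le ?_ (length_lt_two_pow _).le (by positivity)
  refine Nat.lt_two_pow_self.trans_le (Nat.pow_le_pow_right (by norm_num) ?_)
  exact Nat.le_mul_of_pos_right _ ((buildSys t).one_le x)

theorem symBits_pos (ht : 0 < t) : 0 < symBits t := Nat.clog_pos (by norm_num) (by omega)

theorem comp_length (ht : 0 < t) : Comp (buildSys t) fun x => x.S.length :=
  (comp_length_bits.div (Comp.const (symBits t))).congr fun _ _ =>
    Nat.mul_div_cancel_left _ (symBits_pos ht)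

theorem comp_counter : Comp (buildSys t) fun x => x.q :=
  Comp.register 2 (by norm_num) (fun _ _ _ _ _ h => h.1.2.2.1)
    ⟨32, fun _ hx => hx.2.1.trans_le (rows_le _).1⟩

theorem comp_output_length : Comp (buildSys t) fun x => x.O.length := by
  refine Comp.register 1 (by norm_num) (fun x _ w reg mem h => h.1.2.1)
    ⟨200 * (t + 1) + 32, fun x hx => ?_⟩
  refine hx.2.2.1.trans_lt ?_
  rw [add_mul, pow_add]
  refine Nat.mul_lt_mul_of_lt_of_le ?_ (rows_le _).1 (by positivity)
  exact Nat.lt_two_pow_self.trans_le (Nat.pow_le_pow_right (by norm_num)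
    (Nat.le_mul_of_pos_right _ ((buildSys t).one_le x)))

theorem comp_stride (ht : 0 < t) : Comp (buildSys t) fun x => stride x.S.length :=
  (Comp.const 16).mul ((comp_length ht).add (Comp.const 1))

theorem comp_cell_address (ht : 0 < t) (ph col : ℕ) (hF : Comp (buildSys t) F) :
    Comp (buildSys t) fun x => cell t x.S.length ph col (F x) :=
  comp_length_bits.add (((hF.mul (Comp.const _)).add (Comp.const _)).mul (comp_stride ht))

theorem comp_outBase (ht : 0 < t) : Comp (buildSys t) fun x => outBase t x.S.length :=
  comp_length_bits.add (((((comp_length ht).add (Comp.const 2)).pow 16).mul (Comp.const _)).mul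
    (comp_stride ht))

/-- `Comp.load` does not apply, as the stride is linear in `n` and not in the unit. Instead the load
is cut to the word length, and the representation speaks of exactly these bits. -/
theorem comp_entry (ht : 0 < t) {ph col : ℕ} (hph : ph < 2 * t + 1) (hcol : col < 32)
    (hF : Comp (buildSys t) F) (hlt : ∀ x, (buildSys t).ok x → F x < rows x.S.length) :
    Comp (buildSys t) fun x => x.M ph col (F x) := by
  obtain ⟨e1, K1, hb1, h1⟩ := comp_cell_address ht ph col hF
  obtain ⟨e2, K2, hb2, h2⟩ := comp_stride ht
  refine ⟨.load e1 e2, K1 + K2 + 32, ⟨hb1, hb2⟩, fun x hx w reg mem hw hr => ?_⟩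
  have l : ∀ {a b : ℕ}, a ≤ b → a * (buildSys t).u x ≤ b * (buildSys t).u x :=
    fun h => Nat.mul_le_mul_right _ h
  obtain ⟨g1, -⟩ := h1 x hx w reg mem ((l (by omega)).trans hw) hr
  obtain ⟨g2, -⟩ := h2 x hx w reg mem ((l (by omega)).trans hw) hr
  rw [Expr.eval, g1, g2]
  refine ⟨hr.2.2.1 ph hph col hcol _ (hlt x hx), ?_⟩
  exact (hx.1 _ _ _).trans_le ((rows_le _).1.trans (Nat.pow_le_pow_right (by norm_num)
    (l (by omega : 32 ≤ K1 + K2 + 32))))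

theorem comp_scode (ht : 0 < t) (hF : Comp (buildSys t) F) :
    Comp (buildSys t) fun x => scode x.S (F x) := by
  -- Outside the string zero bits are read, so the result does not depend on the cells behind it.
  have h1 : Comp (buildSys t) fun x => if F x < x.S.length then symBits t else 0 :=
    hF.ite_lt (comp_length ht) (Comp.const _) (Comp.const _)
  have h2 := Comp.load (m := fun x p => (encode x.S)[p]?.getD false)
    ((Comp.const (symBits t)).mul hF) h1
    ((Small.const (symBits t)).of_le fun x _ => by split <;> omega) (by
      intro x hx w reg mem h p hp hp'
      have hlt : p < (encode x.S).length := by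
        rw [length_encode]
        split at hp'
        · next h' =>
          have := Nat.mul_le_mul_left (symBits t) (show F x + 1 ≤ x.S.length from h')
          rw [mul_add] at this
          omega
        · omega
      have := h.2.1 p hlt
      rw [zero_add] at this
      rw [this, List.getElem?_eq_getElem hlt, Option.getD_some])
  refine (hF.ite_lt (comp_length ht) h2 (Comp.const (2 * t))).congr fun x _ => ?_
  by_cases h : F x < x.S.length
  · rw [if_pos h, if_pos h]
    have := (has_getD (encode x.S)).encode h
    rwa [zero_add] at this
  · rw [if_neg h, scode_of_le (by omega)]

theorem comp_param (ht : 0 < t) : Comp (buildSys t) fun x => x.M (2 * t) 0 0 + 1 :=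
  (comp_entry ht (by omega) (by norm_num) (Comp.const 0)
    (fun x _ => by unfold rows; positivity)).add (Comp.const 1)

theorem small_param : Small (buildSys t) fun x => (x.M (2 * t) 0 0 + 1) ^ 4 := by
  refine ⟨32, fun x hx => ?_⟩
  have h1 := hx.2.2.2
  have h2 : (x.M (2 * t) 0 0 + 1) ^ 4 ≤ 16 * x.M (2 * t) 0 0 ^ 4 + 16 := by
    generalize x.M (2 * t) 0 0 = r
    rcases Nat.eq_zero_or_pos r with rfl | hr
    · norm_num
    · have : (r + 1) ^ 4 ≤ (2 * r) ^ 4 := Nat.pow_le_pow_left (by omega) 4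
      rw [mul_pow] at this
      omega
  show (x.M (2 * t) 0 0 + 1) ^ 4 ≤ 32 * (Nat.log 2 x.S.length + 1)
  omega

end Comp

end ParenString

/-! ### Commands on situations: stores, output and loops. -/

namespace ParenString
open WordRAM BitString

variable {t : ℕ}

/-- Some command leads from every situation `x` with `pre x` to `f x`, in constantly many steps if
`e = 0`, and in linearly many if `e = 1`. -/
def Can (t : ℕ) (pre : Sit t → Prop) (f : Sit t → Sit t) (e : ℕ) : Prop :=
  ∃ (c : Cmd) (K C : ℕ), ∀ x, pre x → ∀ w reg mem, K * (buildSys t).u x ≤ w →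
    (buildSys t).rel w x reg mem → ∃ reg' mem',
      Runs w c reg mem reg' mem' (C * (x.S.length + 1) ^ e) ∧ (buildSys t).rel w (f x) reg' mem'

/-- Row, family and column are the digits of a mixed-radix number, which is multiplied by the
stride. -/
theorem cell_disjoint {n ph col r ph' col' r' : ℕ} (hph : ph < 2 * t + 1) (hcol : col < 32)
    (hph' : ph' < 2 * t + 1) (hcol' : col' < 32) (h : ¬ (ph = ph' ∧ col = col' ∧ r = r')) :
    cell t n ph col r + stride n ≤ cell t n ph' col' r' ∨
      cell t n ph' col' r' + stride n ≤ cell t n ph col r := by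
  have key : ∀ {a b : ℕ}, a < b → symBits t * n + a * stride n + stride n ≤
      symBits t * n + b * stride n := fun {a b} hab => by
    have := Nat.mul_le_mul_right (stride n) (show a + 1 ≤ b from hab)
    rw [add_mul, one_mul] at this
    omega
  have mono : ∀ {a b : ℕ}, a < b → a * (32 * (2 * t + 1)) + 32 * (2 * t + 1) ≤
      b * (32 * (2 * t + 1)) := fun {a b} hab => by
    have := Nat.mul_le_mul_right (32 * (2 * t + 1)) (show a + 1 ≤ b from hab)
    rwa [add_mul, one_mul] at this
  unfold cell
  rcases Nat.lt_trichotomy (r * (32 * (2 * t + 1)) + (32 * ph + col))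
    (r' * (32 * (2 * t + 1)) + (32 * ph' + col')) with hlt | heq | hlt
  · exact Or.inl (key hlt)
  · exfalso
    have hr : r = r' := by
      rcases Nat.lt_trichotomy r r' with hr | hr | hr
      · have := mono hr; omega
      · exact hr
      · have := mono hr; omega
    subst hr
    exact h ⟨by omega, by omega, rfl⟩
  · exact Or.inr (key hlt)

theorem cell_bounds {n ph col r : ℕ} (hph : ph < 2 * t + 1) (hcol : col < 32) (hr : r < rows n) :
    symBits t * n ≤ cell t n ph col r ∧ cell t n ph col r + stride n ≤ outBase t n := by
  unfold cell outBase
  refine ⟨Nat.le_add_right _ _, ?_⟩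
  have h1 := Nat.mul_le_mul_right (32 * (2 * t + 1)) (show r + 1 ≤ rows n from hr)
  have h2 := Nat.mul_le_mul_right (stride n) (show r * (32 * (2 * t + 1)) + (32 * ph + col) + 1 ≤
    rows n * (32 * (2 * t + 1)) by rw [add_mul, one_mul] at h1; omega)
  rw [add_mul, one_mul] at h2
  omega

theorem writeAll_outside {n ph w m : ℕ} {row v : ℕ → ℕ} {mem : ℕ → Bool} (hph : ph < 2 * t + 1)
    (hm : m ≤ 32) (hr : ∀ j < m, row j < rows n) {p : ℕ}
    (hp : p < symBits t * n ∨ outBase t n ≤ p) :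
    writeAll (min (stride n) w) (fun j => cell t n ph j (row j)) v mem m p = mem p := by
  induction m with
  | zero => rfl
  | succ m ih =>
    have h1 := cell_bounds (t := t) (n := n) hph (col := m) (by omega) (hr m (by omega))
    have h2 := min_le_left (stride n) w
    rw [writeAll, write_of_disjoint, ih (by omega) fun j hj => hr j (by omega)]
    omega

theorem writeAll_cell {n ph w m : ℕ} {row v : ℕ → ℕ} {mem : ℕ → Bool} (hph : ph < 2 * t + 1)
    (hm : m ≤ 32) (hv : ∀ j < m, v j < 2 ^ min (stride n) w) {ph' col r : ℕ}
    (hph' : ph' < 2 * t + 1) (hcol : col < 32) :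
    readBits (writeAll (min (stride n) w) (fun j => cell t n ph j (row j)) v mem m)
      (cell t n ph' col r) (min (stride n) w) =
      if ph' = ph ∧ col < m ∧ r = row col then v col else
        readBits mem (cell t n ph' col r) (min (stride n) w) := by
  induction m with
  | zero => rw [if_neg (by omega)]; rfl
  | succ m ih =>
    have ih := ih (by omega) fun j hj => hv j (by omega)
    rw [writeAll]
    by_cases h : ph' = ph ∧ col = m ∧ r = row m
    · obtain ⟨rfl, rfl, rfl⟩ := h
      rw [readBits_write, if_pos ⟨rfl, by omega, rfl⟩, Nat.mod_eq_of_lt (hv _ (by omega))]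
    · have h1 := cell_disjoint (n := n) (r' := row m) hph' hcol hph (show m < 32 by omega) h
      have h2 := min_le_left (stride n) w
      rw [readBits_congr (mem' := writeAll (min (stride n) w) (fun j => cell t n ph j (row j)) v
        mem m) fun p hp hp' => write_of_disjoint (by omega), ih]
      by_cases h3 : ph' = ph ∧ col < m ∧ r = row col
      · rw [if_pos h3, if_pos ⟨h3.1, by omega, h3.2.2⟩]
      · rw [if_neg h3, if_neg]
        rintro ⟨k1, k2, k3⟩
        rcases Nat.lt_or_ge col m with hlt | hge
        · exact h3 ⟨k1, hlt, k3⟩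
        · have : col = m := by omega
          subst this
          exact h ⟨k1, rfl, k3⟩

/-- The situation after every column of the family `ph` has got a new entry. -/
def putSit (ph : ℕ) (row val : ℕ → Sit t → ℕ) (x : Sit t) : Sit t :=
  { x with M := Function.update x.M ph (put (x.M ph) (fun j => row j x) fun j => val j x) }

theorem choose_exprs {F : ℕ → Sit t → ℕ} {m : ℕ} (hF : ∀ j < m, Comp (buildSys t) (F j)) :
    ∃ (e : ℕ → Expr) (K : ℕ), (∀ j < m, (e j).Below 8) ∧ ∀ j < m, ∀ x, (buildSys t).ok x →
      ∀ w reg mem, K * (buildSys t).u x ≤ w → (buildSys t).rel w x reg mem →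
        (e j).eval w reg mem = F j x ∧ F j x < 2 ^ (K * (buildSys t).u x) := by
  induction m with
  | zero => exact ⟨fun _ => .const 0, 0, fun j hj => by omega, fun j hj => by omega⟩
  | succ m ih =>
    obtain ⟨e, K, he, hK⟩ := ih fun j hj => hF j (by omega)
    obtain ⟨e', K', he', hK'⟩ := hF m (by omega)
    refine ⟨Function.update e m e', K + K', fun j hj => ?_, fun j hj x hx w reg mem hw hr => ?_⟩
    · by_cases h : j = m
      · subst h; simpa using he'
      · simpa [h] using he j (by omega)
    · rw [add_mul] at hw ⊢
      have l : ∀ {a b : ℕ}, a ≤ b → 2 ^ a ≤ 2 ^ b := fun h =>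
        Nat.pow_le_pow_right (by norm_num) h
      by_cases h : j = m
      · subst h
        obtain ⟨g1, g2⟩ := hK' x hx w reg mem (by omega) hr
        exact ⟨by simpa using g1, g2.trans_le (l (by omega))⟩
      · obtain ⟨g1, g2⟩ := hK j (by omega) x hx w reg mem (by omega) hr
        exact ⟨by simpa [h] using g1, g2.trans_le (l (by omega))⟩

/-- Columns from `m` on need no store, because by `hrest` their new entry equals the old one. Values
below `rows` survive both the cut to the stride and the cut to the word. -/
theorem can_put (ht : 0 < t) {ph m : ℕ} (hph : ph < 2 * t + 1) (hm : m ≤ 32)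
    {row val : ℕ → Sit t → ℕ} (hrow : ∀ j < m, Comp (buildSys t) (row j))
    (hval : ∀ j < m, Comp (buildSys t) (val j)) {pre : Sit t → Prop}
    (hok : ∀ x, pre x → (buildSys t).ok x)
    (hlt : ∀ x, pre x → ∀ j < m, row j x < rows x.S.length ∧ val j x < rows x.S.length)
    (hrest : ∀ x, pre x → ∀ j, m ≤ j → val j x = x.M ph j (row j x)) :
    Can t pre (putSit ph row val) 0 := by
  obtain ⟨A, K1, hA, hA'⟩ := choose_exprs fun j hj => comp_cell_address ht ph j (hrow j hj)
  obtain ⟨V, K2, hV, hV'⟩ := choose_exprs hval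
  obtain ⟨e, K3, he, he'⟩ := comp_stride ht
  refine ⟨.seq (e.code 8) (.seq (evalAll A V m) (storeAll m)), K1 + K2 + K3 + 32, e.cost +
    ((1 + ∑ j ∈ Finset.range m, ((A j).cost + (V j).cost)) + (m + 1)),
    fun x hx w reg mem hw hr => ?_⟩
  rw [add_mul, add_mul, add_mul] at hw
  have hx' := hok x hx
  obtain ⟨r1, h1, h1v, h1r⟩ := Expr.runs w e 8 reg mem he
  obtain ⟨r2, h2, h2v, h2r⟩ := evalAll_runs A V m w r1 mem hA hV
  have hstride : r2 8 = stride x.S.length := by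
    rw [h2r 8 (by norm_num), h1v, (he' x hx' w reg mem (by omega) hr).1]
  have hAV : ∀ j < m, r2 (9 + 2 * j) = cell t x.S.length ph j (row j x) ∧
      r2 (9 + 2 * j + 1) = val j x := fun j hj => by
    rw [(h2v j hj).1, (h2v j hj).2, Expr.eval_congr (hA j hj) h1r, Expr.eval_congr (hV j hj) h1r,
      (hA' j hj x hx' w reg mem (by omega) hr).1, (hV' j hj x hx' w reg mem (by omega) hr).1]
    exact ⟨rfl, rfl⟩
  have h3 := storeAll_runs m w r2 mem _ _ hAV
  rw [hstride] at h3
  refine ⟨_, _, (Runs.seq h1 (Runs.seq h2 h3)).mono (by simp), ?_⟩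
  obtain ⟨⟨q0, q1, q2, q3⟩, hin, hcells, hout⟩ := hr
  have hreg : ∀ r < 4, Function.update r2 4 0 r = reg r := fun r hr => by
    rw [Function.update_of_ne (by omega), h2r r (by omega), h1r r (by omega)]
  have hrl := fun j hj => (hlt x hx j hj).1
  refine ⟨⟨?_, ?_, ?_, ?_⟩, fun p hp => ?_, fun ph' hph' col hcol r hr => ?_, fun p hp => ?_⟩
  · rw [hreg 0 (by norm_num)]; exact q0
  · rw [hreg 1 (by norm_num)]; exact q1
  · rw [hreg 2 (by norm_num)]; exact q2
  · rw [hreg 3 (by norm_num)]; exact q3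
  · rw [writeAll_outside hph hm hrl]
    · exact hin p hp
    · left
      have : p < (encode x.S).length := hp
      rw [length_encode] at this
      omega
  · show readBits _ (cell t x.S.length ph' col r) (min (stride x.S.length) w) = _
    have hpow : rows x.S.length ≤ 2 ^ min (stride x.S.length) w := by
      have := rows_le x.S.length
      rcases min_choice (stride x.S.length) w with h | h <;> rw [h]
      · exact this.2
      · refine this.1.trans (Nat.pow_le_pow_right (by norm_num) ?_)
        show 32 * (buildSys t).u x ≤ w
        omega
    rw [writeAll_cell hph hm (fun j hj => ((hlt x hx j hj).2).trans_le hpow) hph' hcol,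
      hcells ph' hph' col hcol r hr]
    show _ = Function.update x.M ph (put (x.M ph) (fun j => row j x) fun j => val j x) ph' col r
    by_cases h : ph' = ph
    · subst h
      rw [Function.update_self, put]
      by_cases h2 : r = row col x
      · by_cases h3 : col < m
        · rw [if_pos ⟨rfl, h3, h2⟩, if_pos h2]
        · rw [if_neg (by omega), if_pos h2, hrest x hx col (by omega), h2]
      · rw [if_neg (fun h => h2 h.2.2), if_neg h2]
    · rw [if_neg (fun h' => h h'.1), Function.update_of_ne h]
  · exact (writeAll_outside hph hm hrl (Or.inr (Nat.le_add_right _ _))).trans (hout p hp)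

/-- The situation after `width x` bits of `val x` have been output. -/
def emitSit (width val : Sit t → ℕ) (x : Sit t) : Sit t :=
  { x with O := x.O ++ ofNat (width x) (val x) }

/-- The output lies behind all cells, so appending to it disturbs neither the columns nor the input;
the width must fit into a word to be written in one store. -/
theorem can_emit (ht : 0 < t) {width val : Sit t → ℕ} (hwidth : Comp (buildSys t) width)
    (hs : Small (buildSys t) width) (hval : Comp (buildSys t) val) :
    Can t (buildSys t).ok (emitSit width val) 0 := by
  obtain ⟨e1, K1, h1, h1'⟩ := (comp_outBase ht).add comp_output_length
  obtain ⟨e2, K2, h2, h2'⟩ := hval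
  obtain ⟨e4, K4, h4, h4'⟩ := comp_output_length.add hwidth
  obtain ⟨e3, K3, h3, h3'⟩ := hwidth
  obtain ⟨K5, hK5⟩ := hs
  let A : ℕ → Expr := fun j => if j = 0 then e1 else e3
  let V : ℕ → Expr := fun j => if j = 0 then e2 else e4
  refine ⟨.seq (evalAll A V 2) (.seq (.basic (.store 10 9 11)) (.seq (.basic (.const 1 0))
    (.basic (.op .or 1 1 12)))), K1 + K2 + K3 + K4 + K5,
    (1 + ∑ j ∈ Finset.range 2, ((A j).cost + (V j).cost)) + 3, fun x hx w reg mem hw hr => ?_⟩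
  simp only [add_mul] at hw
  obtain ⟨r1, g1, g1v, g1r⟩ := evalAll_runs A V 2 w reg mem
    (fun j _ => by by_cases h : j = 0 <;> simp [A, h, h1, h3])
    (fun j _ => by by_cases h : j = 0 <;> simp [V, h, h2, h4])
  have v9 : r1 9 = outBase t x.S.length + x.O.length :=
    ((g1v 0 (by norm_num)).1).trans (h1' x hx w reg mem (by omega) hr).1
  have v10 : r1 10 = val x :=
    ((g1v 0 (by norm_num)).2).trans (h2' x hx w reg mem (by omega) hr).1
  have v11 : r1 11 = width x :=
    ((g1v 1 (by norm_num)).1).trans (h3' x hx w reg mem (by omega) hr).1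
  have v12 : r1 12 = x.O.length + width x :=
    ((g1v 1 (by norm_num)).2).trans (h4' x hx w reg mem (by omega) hr).1
  have hww : width x ≤ w := (hK5 x hx).trans (by omega)
  refine ⟨_, _, (Runs.seq g1 (Runs.seq (Runs.store _ _ _) (Runs.seq (Runs.const _ _)
    (Runs.op _ _ _ _)))).mono (by simp), ?_⟩
  rw [v9, v10, v11, min_eq_left hww]
  obtain ⟨⟨q0, q1, q2, q3⟩, hin, hcells, hout⟩ := hr
  refine ⟨⟨?_, ?_, ?_, ?_⟩, fun p hp => ?_, fun ph hph col hcol r hr => ?_, ?_⟩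
  · simpa [g1r, emitSit] using q0
  · simp [Op.eval, v12, emitSit, length_ofNat]
  · simpa [g1r, emitSit] using q2
  · simpa [g1r, emitSit] using q3
  · rw [write_of_disjoint]
    · exact hin p hp
    · left
      have : p < (encode x.S).length := hp
      rw [length_encode] at this
      unfold outBase
      omega
  · have hb := cell_bounds (n := x.S.length) hph hcol hr
    rw [readBits_congr (mem' := mem) fun p hp hp' => write_of_disjoint (by
      have : p < cell t x.S.length ph col r + min (stride x.S.length) w := hp'
      have := min_le_left (stride x.S.length) w
      omega)]
    exact hcells ph hph col hcol r hr
  · show Has _ _ (x.O ++ ofNat (width x) (val x))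
    rw [Has.append_iff]
    refine ⟨fun p hp => ?_, has_write⟩
    rw [write_of_disjoint (Or.inl (by show outBase t x.S.length + p < _; omega))]
    exact hout p hp

/-- The situation after `i` runs of the body of a loop. -/
def iterSit (f : Sit t → Sit t) (x : Sit t) : ℕ → Sit t
  | 0 => { x with q := 0 }
  | i + 1 => { f (iterSit f x i) with q := i + 1 }

/-- The bound is evaluated once and kept in register `3`, since the body may change the values it
depends on; register `2` counts the rounds. -/
theorem can_loop {pre : Sit t → Prop} {f : Sit t → Sit t} (h : Can t pre f 0)
    (hf : ∀ x, (f x).S = x.S ∧ (f x).b = x.b ∧ (f x).q = x.q) {B : Sit t → ℕ}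
    (hB : Comp (buildSys t) B) {L : ℕ} {pre' : Sit t → Prop}
    (hp : ∀ x, pre' x → (buildSys t).ok x ∧ B x ≤ L * (x.S.length + 1) ∧
      ∀ i < B x, pre (iterSit f { x with b := B x } i)) :
    Can t pre' (fun x => iterSit f { x with b := B x } (B x)) 1 := by
  obtain ⟨c, K, C, h⟩ := h
  obtain ⟨e, K', he, he'⟩ := hB
  refine ⟨.seq (e.code 8) (.seq (.basic (.const 3 0)) (.seq (.basic (.op .or 3 3 8))
    (.seq (.basic (.const 2 0)) (.loop 2 3 (.seq c (.seq (.basic (.const 8 1))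
      (.basic (.op .add 2 2 8)))))))), K + K' + 1, e.cost + 5 + L * (C + 4),
    fun x hx w reg mem hw hr => ?_⟩
  obtain ⟨hok, hL, hpre⟩ := hp x hx
  rw [add_mul, add_mul, one_mul] at hw
  obtain ⟨hb1, hb2⟩ := he' x hok w reg mem (by omega) hr
  have hbw : B x < 2 ^ w := hb2.trans_le (Nat.pow_le_pow_right (by norm_num) (by omega))
  set y : Sit t := { x with b := B x } with hy
  have hinv : ∀ i, (iterSit f y i).S = x.S ∧ (iterSit f y i).b = B x ∧ (iterSit f y i).q = i := by
    intro i
    induction i with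
    | zero => exact ⟨rfl, rfl, rfl⟩
    | succ i ih => exact ⟨(hf _).1.trans ih.1, (hf _).2.1.trans ih.2.1, rfl⟩
  have h1w : 1 < 2 ^ w := by
    refine Nat.one_lt_two_pow ?_
    have := (buildSys t).one_le x
    omega
  have loop : ∀ d i, i + d = B x → ∀ reg mem, (buildSys t).rel w (iterSit f y i) reg mem →
      ∃ reg' mem', Runs w (.loop 2 3 (.seq c (.seq (.basic (.const 8 1))
        (.basic (.op .add 2 2 8))))) reg mem reg' mem' (d * (C + 4) + 2) ∧
        (buildSys t).rel w (iterSit f y (B x)) reg' mem' := by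
    intro d
    induction d with
    | zero =>
      intro i hi reg mem hr
      have hi' : i = B x := by omega
      subst hi'
      refine ⟨reg, mem, (Runs.loop_exit ?_).mono (by omega), hr⟩
      rw [hr.1.2.2.1, hr.1.2.2.2, (hinv _).2.1, (hinv _).2.2]
      exact lt_irrefl _
    | succ d ih =>
      intro i hi reg mem hr
      have hlt : reg 2 < reg 3 := by
        rw [hr.1.2.2.1, hr.1.2.2.2, (hinv _).2.1, (hinv _).2.2, Nat.mod_eq_of_lt hbw,
          Nat.mod_eq_of_lt (by omega)]
        omega
      have hu : (buildSys t).u (iterSit f y i) = (buildSys t).u x := by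
        show Nat.log 2 (iterSit f y i).S.length + 1 = _
        rw [(hinv i).1]; rfl
      obtain ⟨r1, m1, g1, g2⟩ := h _ (hpre i (by omega)) w reg mem (by rw [hu]; omega) hr
      rw [pow_zero, mul_one] at g1
      have step := Runs.seq g1 (Runs.seq (Runs.const (w := w) 8 1) (Runs.op .add 2 2 8))
      have hrel : (buildSys t).rel w (iterSit f y (i + 1))
          (Function.update (Function.update r1 8 (1 % 2 ^ w)) 2 (Op.add.eval w
            (Function.update r1 8 (1 % 2 ^ w) 2) (Function.update r1 8 (1 % 2 ^ w) 8))) m1 := by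
        obtain ⟨⟨q0, q1, q2, q3⟩, hin, hcells, hout⟩ := g2
        refine ⟨⟨?_, ?_, ?_, ?_⟩, hin, hcells, hout⟩
        · simpa [iterSit] using q0
        · simpa [iterSit] using q1
        · have : (f (iterSit f y i)).q = i := by rw [(hf _).2.2, (hinv i).2.2]
          rw [this] at q2
          simp [Op.eval, q2, iterSit]
        · simpa [iterSit] using q3
      obtain ⟨r2, m2, g3, g4⟩ := ih (i + 1) (by omega) _ _ hrel
      exact ⟨r2, m2, (Runs.loop_step hlt step g3).mono (by rw [add_mul]; omega), g4⟩
  obtain ⟨r1, h1, h1v, h1r⟩ := Expr.runs w e 8 reg mem he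
  have start := Runs.seq h1 (Runs.seq (Runs.const (w := w) 3 0) (Runs.seq (Runs.op .or 3 3 8)
    (Runs.const 2 0)))
  have hrel : (buildSys t).rel w (iterSit f y 0) (Function.update (Function.update
      (Function.update r1 3 (0 % 2 ^ w)) 3 (Op.or.eval w (Function.update r1 3 (0 % 2 ^ w) 3)
      (Function.update r1 3 (0 % 2 ^ w) 8))) 2 (0 % 2 ^ w)) mem := by
    obtain ⟨⟨q0, q1, q2, q3⟩, hin, hcells, hout⟩ := hr
    refine ⟨⟨?_, ?_, ?_, ?_⟩, hin, hcells, hout⟩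
    · simpa [h1r, iterSit, hy] using q0
    · simpa [h1r, iterSit, hy] using q1
    · simp [iterSit]
    · simp [Op.eval, h1v, hb1, iterSit, hy]
  obtain ⟨r2, m2, g3, g4⟩ := loop (B x) 0 (by omega) _ _ hrel
  refine ⟨r2, m2, ?_, g4⟩
  have := Runs.seq h1 (Runs.seq (Runs.const (w := w) 3 0) (Runs.seq (Runs.op .or 3 3 8)
    (Runs.seq (Runs.const 2 0) g3)))
  refine this.mono ?_
  have e1 := Nat.mul_le_mul_right (C + 4) hL
  have e2 : L * (x.S.length + 1) * (C + 4) = L * (C + 4) * (x.S.length + 1) := by ring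
  rw [pow_one, add_mul]
  have e3 : e.cost + 5 ≤ (e.cost + 5) * (x.S.length + 1) :=
    Nat.le_mul_of_pos_right _ (Nat.succ_pos _)
  omega

end ParenString

namespace ParenString
open WordRAM BitString

/-! ### The parameter -/

/-- Searches the largest `r ≤ i` with `2 ^ r ^ 4 ≤ n`. -/
def lowParam (n : ℕ) : ℕ → ℕ
  | 0 => 0
  | i + 1 => if 2 ^ (lowParam n i + 1) ^ 4 ≤ n then lowParam n i + 1 else lowParam n i

/-- The parameter of the data structure, of the order of `(log n) ^ (1 / 4)`. -/
def param (n : ℕ) : ℕ := lowParam n n + 1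

theorem lowParam_le (n i : ℕ) : lowParam n i = 0 ∨ 2 ^ lowParam n i ^ 4 ≤ n := by
  induction i with
  | zero => exact Or.inl rfl
  | succ i ih =>
    rw [lowParam]
    split
    · next h => exact Or.inr h
    · exact ih

theorem lowParam_pow_le (n i : ℕ) : lowParam n i ^ 4 ≤ Nat.log 2 n + 1 := by
  rcases lowParam_le n i with h | h
  · rw [h]; exact Nat.zero_le _
  · exact (Nat.le_log_of_pow_le (by norm_num) h).trans (Nat.le_succ _)

theorem lowParam_le_self (n i : ℕ) : lowParam n i ≤ n := by
  rcases lowParam_le n i with h | h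
  · rw [h]; exact Nat.zero_le _
  · have h1 : lowParam n i ≤ lowParam n i ^ 4 := Nat.le_self_pow (by norm_num) _
    have h2 : lowParam n i ^ 4 < 2 ^ lowParam n i ^ 4 := Nat.lt_two_pow_self
    omega

theorem param_le (n : ℕ) : param n ≤ n + 1 := Nat.succ_le_succ (lowParam_le_self n n)

theorem param_pos (n : ℕ) : 0 < param n := Nat.succ_pos _

/-- The scan stays behind its counter only after the next candidate has failed, which is the claim.
If it never failed, the value is `n` itself and the bound is trivial. -/
theorem lt_two_pow_param (n : ℕ) : n < 2 ^ param n ^ 4 := by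
  have key : ∀ i, lowParam n i = i ∨ n < 2 ^ (lowParam n i + 1) ^ 4 := by
    intro i
    induction i with
    | zero => exact Or.inl rfl
    | succ i ih =>
      rw [lowParam]
      split
      · next h =>
        rcases ih with h' | h'
        · exact Or.inl (by rw [h'])
        · omega
      · next h => exact Or.inr (by omega)
  rcases key n with h | h
  · rw [param, h]
    have h1 : n + 1 ≤ (n + 1) ^ 4 := Nat.le_self_pow (by norm_num) _
    have h2 : (n + 1) ^ 4 < 2 ^ (n + 1) ^ 4 := Nat.lt_two_pow_self
    omega
  · exact h

theorem param_pow_le (n : ℕ) : param n ^ 4 ≤ 32 * (Nat.log 2 n + 1) := by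
  have h1 := lowParam_pow_le n n
  have h2 : (lowParam n n + 1) ^ 4 ≤ 16 * lowParam n n ^ 4 + 16 := by
    generalize lowParam n n = r
    rcases Nat.eq_zero_or_pos r with rfl | hr
    · norm_num
    · have : (r + 1) ^ 4 ≤ (2 * r) ^ 4 := Nat.pow_le_pow_left (by omega) 4
      rw [mul_pow] at this
      omega
  unfold param
  omega

theorem lt_rows (n : ℕ) : n + 2 + param n ^ 5 < rows n := by
  have h1 : param n ^ 5 < (n + 2) ^ 5 :=
    Nat.pow_lt_pow_left (by have := param_le n; omega) (by norm_num)
  have h2 : n + 2 ≤ (n + 2) ^ 5 := Nat.le_self_pow (by norm_num) _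
  have h3 : (n + 2) ^ 5 * 2 ≤ (n + 2) ^ 5 * (n + 2) := Nat.mul_le_mul_left _ (by omega)
  have h4 : (n + 2) ^ 6 ≤ (n + 2) ^ 16 := Nat.pow_le_pow_right (by omega) (by norm_num)
  have h5 : (n + 2) ^ 5 * (n + 2) = (n + 2) ^ 6 := by ring
  unfold rows
  omega

/-! ### Reaching situations -/

variable {t : ℕ}

/-- From the start, some command leads in linearly many steps to columns `M S` and output `O S`. -/
def Reach (t : ℕ) (M : List (Paren t) → ℕ → ℕ → ℕ → ℕ) (O : List (Paren t) → List Bool) : Prop :=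
  ∃ (c : Cmd) (K C : ℕ), ∀ S, Balanced S → ∀ w reg mem, K * (Nat.log 2 S.length + 1) ≤ w →
    (buildSys t).rel w ⟨S, 0, 0, fun _ _ _ => 0, []⟩ reg mem → ∃ q b reg' mem',
      q < rows S.length ∧ Runs w c reg mem reg' mem' (C * (S.length + 1)) ∧
      (buildSys t).rel w ⟨S, q, b, M S, O S⟩ reg' mem'

theorem Reach.zero : Reach t (fun _ _ _ _ => 0) fun _ => [] := by
  refine ⟨.basic (.const 4 0), 0, 1, fun S _ w reg mem _ hr =>
    ⟨0, 0, Function.update reg 4 (0 % 2 ^ w), mem, ?_, ?_, ?_⟩⟩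
  · unfold rows; positivity
  · exact (Runs.const 4 0).mono (by omega)
  · obtain ⟨⟨q0, q1, q2, q3⟩, h⟩ := hr
    exact ⟨⟨by simpa using q0, by simpa using q1, by simpa using q2, by simpa using q3⟩, h⟩

section Reach
variable {M M' : List (Paren t) → ℕ → ℕ → ℕ → ℕ} {O O' : List (Paren t) → List Bool}

theorem Reach.congr (h : Reach t M O) (hM : ∀ S, Balanced S → M S = M' S ∧ O S = O' S) :
    Reach t M' O' := by
  obtain ⟨c, K, C, h⟩ := h
  refine ⟨c, K, C, fun S hS => ?_⟩
  rw [← (hM S hS).1, ← (hM S hS).2]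
  exact h S hS

theorem Reach.step (h : Reach t M O) {pre : Sit t → Prop} {f : Sit t → Sit t} {e : ℕ} (he : e ≤ 1)
    (hf : Can t pre f e)
    (hp : ∀ S, Balanced S → ∀ q b, q < rows S.length → pre ⟨S, q, b, M S, O S⟩ ∧
      ∃ q' b', q' < rows S.length ∧ f ⟨S, q, b, M S, O S⟩ = ⟨S, q', b', M' S, O' S⟩) :
    Reach t M' O' := by
  obtain ⟨c, K, C, h⟩ := h
  obtain ⟨c', K', C', h'⟩ := hf
  refine ⟨.seq c c', K + K', C + C', fun S hS w reg mem hw hr => ?_⟩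
  rw [add_mul] at hw
  obtain ⟨q, b, r1, m1, g0, g1, g2⟩ := h S hS w reg mem (by omega) hr
  obtain ⟨g3, q', b', g4, g5⟩ := hp S hS q b g0
  obtain ⟨r2, m2, g6, g7⟩ := h' _ g3 w r1 m1 (le_trans (Nat.le_add_left _ _) hw) g2
  refine ⟨q', b', r2, m2, g4, (Runs.seq g1 g6).mono ?_, by rw [← g5]; exact g7⟩
  have : (S.length + 1) ^ e ≤ S.length + 1 := by
    calc (S.length + 1) ^ e ≤ (S.length + 1) ^ 1 := Nat.pow_le_pow_right (by omega) he
      _ = _ := pow_one _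
  have := Nat.mul_le_mul_left C' this
  rw [add_mul]
  exact Nat.add_le_add_left this _

/-- The bounds for columns and output. -/
def Fine (S : List (Paren t)) (M : ℕ → ℕ → ℕ → ℕ) (O : List Bool) : Prop :=
  (∀ ph col r, M ph col r < rows S.length) ∧ O.length ≤ 200 * (t + 1) * rows S.length ∧
    M (2 * t) 0 0 ^ 4 ≤ Nat.log 2 S.length + 1

theorem Fine.ok {S : List (Paren t)} {M : ℕ → ℕ → ℕ → ℕ} {O : List Bool} (h : Fine S M O)
    {q b : ℕ} (hq : q < rows S.length) : (buildSys t).ok ⟨S, q, b, M, O⟩ :=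
  ⟨h.1, hq, h.2.1, h.2.2⟩

/-- `M'` and `O'` are the loop invariants: columns and output after `i` rounds. Counter and bound
before the loop are arbitrary, because earlier commands leave them in an unknown state. -/
theorem Reach.loop (h : Reach t M O) {pre : Sit t → Prop} {f : Sit t → Sit t} (hf : Can t pre f 0)
    (hf' : ∀ x, (f x).S = x.S ∧ (f x).b = x.b ∧ (f x).q = x.q)
    {B : Sit t → ℕ} (hB : Comp (buildSys t) B) (N : List (Paren t) → ℕ) (L : ℕ)
    (hN : ∀ S, Balanced S → N S ≤ L * (S.length + 1) ∧ N S < rows S.length)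
    (hBN : ∀ S, Balanced S → ∀ q b, B ⟨S, q, b, M S, O S⟩ = N S)
    (hfine : ∀ S, Balanced S → Fine S (M S) (O S))
    (M' : List (Paren t) → ℕ → ℕ → ℕ → ℕ → ℕ) (O' : List (Paren t) → ℕ → List Bool)
    (h0 : ∀ S, Balanced S → M' S 0 = M S ∧ O' S 0 = O S)
    (hstep : ∀ S, Balanced S → ∀ i < N S, pre ⟨S, i, N S, M' S i, O' S i⟩ ∧
      (f ⟨S, i, N S, M' S i, O' S i⟩).M = M' S (i + 1) ∧
      (f ⟨S, i, N S, M' S i, O' S i⟩).O = O' S (i + 1)) :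
    Reach t (fun S => M' S (N S)) fun S => O' S (N S) := by
  have key : ∀ S, Balanced S → ∀ q, ∀ i ≤ N S,
      iterSit f ⟨S, q, N S, M S, O S⟩ i = ⟨S, i, N S, M' S i, O' S i⟩ := by
    intro S hS q i hi
    induction i with
    | zero => rw [iterSit, (h0 S hS).1, (h0 S hS).2]
    | succ i ih =>
      rw [iterSit, ih (by omega)]
      obtain ⟨-, g1, g2⟩ := hstep S hS i (by omega)
      obtain ⟨g3, g4, -⟩ := hf' ⟨S, i, N S, M' S i, O' S i⟩
      rw [g1, g2, g3, g4]
  refine h.step (pre := fun x => Balanced x.S ∧ x.q < rows x.S.length ∧ x.M = M x.S ∧ x.O = O x.S)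
    le_rfl (can_loop hf hf' hB (L := L) fun x hx => ?_) fun S hS q b hq =>
      ⟨⟨hS, hq, rfl, rfl⟩, N S, N S, (hN S hS).2, ?_⟩
  · obtain ⟨S, q, b, M₀, O₀⟩ := x
    obtain ⟨hS, hq, h1, h2⟩ := hx
    simp only at hS hq h1 h2
    subst h1 h2
    simp only [hBN S hS]
    refine ⟨(hfine S hS).ok hq, (hN S hS).1, fun i hi => ?_⟩
    rw [key S hS q i hi.le]
    exact (hstep S hS i hi).1
  · simp only [hBN S hS]
    exact key S hS q _ le_rfl

end Reach

/-! ### Columns -/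

/-- The codes of the symbols read in a phase: those of the string or of its reversal. -/
def phaseCode (S : List (Paren t)) (ph : ℕ) : ℕ → ℕ :=
  if ph % 2 = 0 then scode S else scode (rev S)

/-- The columns that hold a single number. -/
def single (v : ℕ) : ℕ → ℕ → ℕ := fun col r => if col = 0 ∧ r = 0 then v else 0

/-- The columns after `J` phases. -/
def phases (S : List (Paren t)) (J ph : ℕ) : ℕ → ℕ → ℕ :=
  if ph = 2 * t then single (lowParam S.length S.length) else
    if ph < J then passes (param S.length) (ph / 2) S.length (phaseCode S ph) else fun _ _ => 0

theorem rows_pos (n : ℕ) : 0 < rows n := by unfold rows; positivity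

theorem passes_lt (n k : ℕ) (c : ℕ → ℕ) :
    (∀ q ≤ n, ∀ col r, pass₁ (param n) k c q col r < rows n) ∧
    ∀ q ≤ n, ∀ col r, pass₂ (param n) (pass₁ (param n) k c n) q col r ≤ n + 1 + param n ^ 5 := by
  have h := lt_rows n
  have h1 : ∀ q ≤ n, ∀ col r, pass₁ (param n) k c q col r ≤ n + 1 + param n ^ 5 := by
    intro q hq col r
    have := pass₁_le (param n) k c q col r
    split at this <;> omega
  refine ⟨fun q hq col r => by have := h1 q hq col r; omega, fun q hq => ?_⟩
  exact (pass₂_le (h1 n le_rfl) (pass₁_twelve _ _ _ _ _ _ le_rfl) q (by omega)).1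

theorem single_lt (n i : ℕ) (col r : ℕ) : single (lowParam n i) col r < rows n := by
  have := lt_rows n
  have := lowParam_le_self n i
  unfold single
  split <;> omega

theorem phases_lt (S : List (Paren t)) (J ph col r : ℕ) : phases S J ph col r < rows S.length := by
  unfold phases
  split
  · exact single_lt _ _ _ _
  · split
    · have := (passes_lt S.length (ph / 2) (phaseCode S ph)).2 _ le_rfl col r
      have := lt_rows S.length
      unfold passes
      omega
    · exact rows_pos _

theorem phases_param (S : List (Paren t)) (J : ℕ) :
    phases S J (2 * t) 0 0 = lowParam S.length S.length := by
  simp [phases, single]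

theorem fine_update {S : List (Paren t)} {J : ℕ} (hJ : J < 2 * t) {N : ℕ → ℕ → ℕ}
    (hN : ∀ col r, N col r < rows S.length) :
    Fine S (Function.update (phases S J) J N) [] := by
  refine ⟨fun ph col r => ?_, Nat.zero_le _, ?_⟩
  · by_cases h : ph = J
    · subst h; rw [Function.update_self]; exact hN col r
    · rw [Function.update_of_ne h]; exact phases_lt _ _ _ _ _
  · rw [Function.update_of_ne (by omega), phases_param]
    exact lowParam_pow_le _ _

/-- No logarithm is available as an operation, so the parameter is found by `n` rounds of a linear
scan; its predecessor is kept in the extra family `2 * t`. -/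
theorem reach_param (ht : 0 < t) : Reach t (fun S => phases S 0) fun _ => [] := by
  let row : ℕ → Sit t → ℕ := fun _ _ => 0
  let val : ℕ → Sit t → ℕ := fun j x => if j = 0 then
    if 2 ^ (x.M (2 * t) 0 0 + 1) ^ 4 ≤ x.S.length then x.M (2 * t) 0 0 + 1 else x.M (2 * t) 0 0
    else x.M (2 * t) j 0
  have e0 : Comp (buildSys t) fun x => x.M (2 * t) 0 0 :=
    comp_entry ht (by omega) (by norm_num) (Comp.const 0) fun _ _ => rows_pos _
  have hput := can_put ht (ph := 2 * t) (m := 1) (by omega) (by norm_num) (row := row) (val := val)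
    (fun j _ => Comp.const 0) (fun j hj => by
      have : j = 0 := by omega
      subst this
      exact (((comp_param ht).pow 4).two_pow small_param).ite_le (comp_length ht) (comp_param ht)
        e0) (pre := fun x => (buildSys t).ok x ∧ x.M (2 * t) 0 0 ≤ x.S.length)
    (fun x hx => hx.1) (fun x hx j hj => by
      have : j = 0 := by omega
      subst this
      have := lt_rows x.S.length
      refine ⟨rows_pos _, ?_⟩
      simp only [val, if_true]
      split <;> omega) (fun x _ j hj => by simp [val, row, show j ≠ 0 by omega])
  have hz : ∀ (S : List (Paren t)), Fine S (fun _ _ _ => 0) [] := fun S =>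
    ⟨fun _ _ _ => rows_pos _, Nat.zero_le _, by simp⟩
  refine (Reach.zero.loop hput (fun x => ⟨rfl, rfl, rfl⟩) (comp_length ht)
    (fun S => S.length) 1 (fun S _ => ⟨by omega, by have := lt_rows S.length; omega⟩)
    (fun S _ q b => rfl) (fun S _ => hz S)
    (fun S i ph => if ph = 2 * t then single (lowParam S.length i) else fun _ _ => 0)
    (fun _ _ => []) (fun S _ => ⟨?_, rfl⟩) fun S _ i hi => ⟨⟨⟨?_, ?_, ?_, ?_⟩, ?_⟩, ?_, rfl⟩).congr
    fun S _ => ⟨?_, rfl⟩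
  · funext ph col r
    by_cases h : ph = 2 * t <;> simp [h, single, lowParam]
  · intro ph col r
    dsimp only
    split
    · exact single_lt _ _ _ _
    · exact rows_pos _
  · show i < rows S.length
    have := lt_rows S.length
    omega
  · exact Nat.zero_le _
  · simp [single, lowParam_pow_le]
  · simp [single, lowParam_le_self]
  · funext ph
    show Function.update _ _ _ ph = _
    by_cases h : ph = 2 * t
    · subst h
      rw [Function.update_self]
      funext col r
      simp only [if_true, put, row, val, lowParam, single]
      by_cases hc : col = 0 <;> by_cases hr : r = 0 <;> simp [hc, hr]
    · rw [Function.update_of_ne h]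
      simp [h]
  · funext ph
    unfold phases
    split
    · rfl
    · rw [if_neg (Nat.not_lt_zero _)]

end ParenString

namespace ParenString
open WordRAM BitString

/-! ### The passes -/

section Passes
variable {t : ℕ}

/-- In the odd phases the symbol at the mirrored position is read and its lowest bit flipped, so the
reversed string is never written down. -/
theorem comp_phaseCode (ht : 0 < t) (J : ℕ) :
    Comp (buildSys t) fun x => phaseCode x.S J x.q := by
  unfold phaseCode
  by_cases hJ : J % 2 = 0
  · simp only [hJ, if_true]
    exact comp_scode ht comp_counter
  · simp only [hJ, if_false]
    have h := comp_scode (F := fun x => x.S.length - 1 - x.q) ht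
      (((comp_length ht).sub (Comp.const 1)).sub comp_counter)
    refine (comp_counter.ite_lt (comp_length ht) ((h.mod (Comp.const 2)).ite_eq (Comp.const 1)
      (h.sub (Comp.const 1)) (h.add (Comp.const 1))) (Comp.const (2 * t))).congr fun x _ => ?_
    split
    · next hq => rw [scode_rev x.S hq]
    · rw [scode_of_le]
      rw [length_rev]
      omega

/-- The rows in the first pass of phase `J`. -/
def passRow₁ (J j : ℕ) (x : Sit t) : ℕ :=
  row₁ (x.M (2 * t) 0 0 + 1) (J / 2) (phaseCode x.S J x.q) (x.M J) x.q j

/-- The entries in the first pass of phase `J`. -/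
def passVal₁ (J j : ℕ) (x : Sit t) : ℕ :=
  val₁ (x.M (2 * t) 0 0 + 1) (J / 2) (phaseCode x.S J x.q) (x.M J) x.q j

/-- The rows in the second pass of phase `J`. -/
def passRow₂ (J j : ℕ) (x : Sit t) : ℕ := row₂ (x.M (2 * t) 0 0 + 1) (x.M J) x.q j

/-- The entries in the second pass of phase `J`. -/
def passVal₂ (J j : ℕ) (x : Sit t) : ℕ := val₂ (x.M (2 * t) 0 0 + 1) (x.M J) x.q j

section Comp
variable (ht : 0 < t) {J : ℕ} (hJ : J < 2 * t)
include ht hJ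

theorem comp_at {col : ℕ} (hcol : col < 32) {F : Sit t → ℕ} (hF : Comp (buildSys t) F)
    (hlt : ∀ x, (buildSys t).ok x → F x < rows x.S.length) :
    Comp (buildSys t) fun x => x.M J col (F x) :=
  comp_entry ht (by omega) hcol hF hlt

theorem comp_zero {col : ℕ} (hcol : col < 32) : Comp (buildSys t) fun x => x.M J col 0 :=
  comp_at ht hJ hcol (Comp.const 0) fun _ _ => rows_pos _

theorem comp_top : Comp (buildSys t) fun x => top (x.M J) :=
  comp_at ht hJ (by norm_num) ((comp_zero ht hJ (by norm_num)).sub (Comp.const 1))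
    fun x hx => (Nat.sub_le _ _).trans_lt (hx.1 J 0 0)

omit hJ in
theorem comp_div (e : ℕ) : Comp (buildSys t) fun x => x.q / (x.M (2 * t) 0 0 + 1) ^ e :=
  comp_counter.div ((comp_param ht).pow e)

omit hJ in
theorem comp_mod (e : ℕ) : Comp (buildSys t) fun x => x.q % (x.M (2 * t) 0 0 + 1) ^ e :=
  comp_counter.mod ((comp_param ht).pow e)

theorem comp_at_div (e : ℕ) {col : ℕ} (hcol : col < 32) :
    Comp (buildSys t) fun x => x.M J col (x.q / (x.M (2 * t) 0 0 + 1) ^ e) :=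
  comp_at ht hJ hcol (comp_div ht e) fun _ hx => (Nat.div_le_self _ _).trans_lt hx.2.1

theorem comp_row₁ (j : ℕ) : Comp (buildSys t) (passRow₁ J j) := by
  have h0 := comp_zero ht hJ (col := 0) (by norm_num)
  unfold passRow₁ row₁
  split
  · exact h0
  · exact (comp_phaseCode ht J).ite_eq (Comp.const _) (h0.add (Comp.const 1))
      (h0.sub (Comp.const 1))
  · exact comp_div ht 5
  · exact comp_div ht 2
  · exact comp_div ht 2
  · exact comp_div ht 2
  · exact comp_top ht hJ
  · exact comp_top ht hJ
  · exact Comp.const 0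

theorem comp_newLevel : Comp (buildSys t) fun x =>
    newLevel (J / 2) (phaseCode x.S J x.q) (x.M J) := by
  have h0 := comp_zero ht hJ (col := 0) (by norm_num)
  have hy := comp_phaseCode ht J
  exact hy.ite_eq (Comp.const _) (h0.add (Comp.const 1))
    (hy.ite_eq (Comp.const _) (h0.sub (Comp.const 1)) h0)

theorem comp_lastFar : Comp (buildSys t) fun x =>
    lastFar (x.M (2 * t) 0 0 + 1) (x.M J) x.q :=
  (comp_mod ht 5).ite_eq (Comp.const 0) (Comp.const 0) (comp_zero ht hJ (by norm_num))

theorem comp_baseLevel : Comp (buildSys t) fun x =>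
    baseLevel (x.M (2 * t) 0 0 + 1) (x.M J) x.q :=
  (comp_mod ht 5).ite_eq (Comp.const 0) (comp_zero ht hJ (by norm_num))
    (comp_at_div ht hJ 5 (by norm_num))

theorem comp_newMin : Comp (buildSys t) fun x =>
    newMin (x.M (2 * t) 0 0 + 1) (J / 2) (phaseCode x.S J x.q) (x.M J) x.q :=
  (comp_mod ht 2).ite_eq (Comp.const 0) (comp_newLevel ht hJ)
    ((comp_zero ht hJ (by norm_num)).min (comp_newLevel ht hJ))

theorem comp_newCount : Comp (buildSys t) fun x =>
    newCount (x.M (2 * t) 0 0 + 1) (J / 2) (phaseCode x.S J x.q) (x.M J) x.q :=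
  ((comp_mod ht 2).ite_eq (Comp.const 0) (Comp.const 0)
    ((comp_newLevel ht hJ).ite_lt (comp_zero ht hJ (by norm_num)) (Comp.const 0)
      (comp_zero ht hJ (by norm_num)))).add
    ((comp_phaseCode ht J).ite_eq (Comp.const _)
      ((comp_newLevel ht hJ).ite_eq (comp_newMin ht hJ) (Comp.const 1) (Comp.const 0))
      (Comp.const 0))

theorem comp_ifPioneer {F G : Sit t → ℕ} (hF : Comp (buildSys t) F) (hG : Comp (buildSys t) G) :
    Comp (buildSys t) fun x => ifPioneer (x.M (2 * t) 0 0 + 1) (J / 2) (phaseCode x.S J x.q)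
      (x.M J) x.q (F x) (G x) :=
  (comp_phaseCode ht J).ite_eq (Comp.const _)
    (((comp_top ht hJ).div ((comp_param ht).pow 5)).ite_eq (comp_div ht 5) hG
      ((comp_lastFar ht hJ).ite_eq
        (((comp_top ht hJ).div ((comp_param ht).pow 5)).add (Comp.const 1)) hG hF)) hG

theorem comp_val₁ {j : ℕ} (hj : j < 32) : Comp (buildSys t) (passVal₁ J j) := by
  have h0 := comp_zero ht hJ (col := 0) (by norm_num)
  have hy := comp_phaseCode ht J
  have hb := (comp_top ht hJ).div ((comp_param ht).pow 5)
  have hl : ∀ {col}, col < 32 → Comp (buildSys t) fun x => x.M J col (x.M J 0 0) := fun hcol =>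
    comp_at ht hJ hcol h0 fun x hx => hx.1 J 0 0
  have hl' : ∀ {col}, col < 32 → Comp (buildSys t) fun x => x.M J col (x.M J 0 0 - 1) :=
    fun hcol => comp_at ht hJ hcol (h0.sub (Comp.const 1))
      fun x hx => (Nat.sub_le _ _).trans_lt (hx.1 J 0 0)
  have ht' : ∀ {col}, col < 32 → Comp (buildSys t) fun x => x.M J col (top (x.M J)) :=
    fun hcol => comp_at ht hJ hcol (comp_top ht hJ) fun _ hx => hx.1 J _ _
  have hR := (comp_param ht).pow 5
  unfold passVal₁ val₁
  split
  · exact comp_newLevel ht hJ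
  · exact hy.ite_eq (Comp.const _) (hb.ite_eq (comp_div ht 5) (comp_lastFar ht hJ)
      (hb.add (Comp.const 1))) (comp_lastFar ht hJ)
  · exact comp_newMin ht hJ
  · exact comp_newCount ht hJ
  · exact hy.ite_eq (Comp.const _) comp_counter (hl (by norm_num))
  · exact hy.ite_eq (Comp.const _) (Comp.const 0) (hy.ite_eq (Comp.const _)
      ((hl' (by norm_num)).add (Comp.const 1)) (hl' (by norm_num)))
  · exact comp_baseLevel ht hJ
  · exact (comp_mod ht 2).ite_eq (Comp.const 0) ((h0.add hR).sub (comp_baseLevel ht hJ))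
      (comp_at_div ht hJ 2 (by norm_num))
  · exact ((comp_newMin ht hJ).add hR).sub (comp_baseLevel ht hJ)
  · exact comp_newCount ht hJ
  · exact comp_ifPioneer ht hJ ((comp_div ht 5).add (Comp.const 1)) (ht' (by norm_num))
  · exact comp_ifPioneer ht hJ (hl (by norm_num)) (ht' (by norm_num))
  · exact comp_zero ht hJ hj

theorem comp_row₂ (j : ℕ) : Comp (buildSys t) (passRow₂ J j) := by
  have h := comp_zero ht hJ (col := 12) (by norm_num)
  unfold passRow₂ row₂
  split
  · exact comp_div ht 5
  · exact comp_div ht 2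
  · exact h
  · exact h
  · exact h
  · exact Comp.const 0

theorem comp_baseCount : Comp (buildSys t) fun x =>
    baseCount (x.M (2 * t) 0 0 + 1) (x.M J) x.q :=
  (comp_mod ht 5).ite_eq (Comp.const 0) (comp_zero ht hJ (by norm_num))
    (comp_at_div ht hJ 5 (by norm_num))

theorem comp_val₂ {j : ℕ} (hj : j < 32) : Comp (buildSys t) (passVal₂ J j) := by
  have h := comp_zero ht hJ (col := 12) (by norm_num)
  have hl : ∀ {col}, col < 32 → Comp (buildSys t) fun x => x.M J col (x.M J 12 0) := fun hcol =>
    comp_at ht hJ hcol h fun x hx => hx.1 J 12 0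
  have hq : ∀ {col}, col < 32 → Comp (buildSys t) fun x => x.M J col x.q := fun hcol =>
    comp_at ht hJ hcol comp_counter fun x hx => hx.2.1
  have h10 := hq (col := 10) (by norm_num)
  unfold passVal₂ val₂
  split
  · exact h10.ite_eq (Comp.const 0) h (h.add (Comp.const 1))
  · exact comp_baseCount ht hJ
  · exact (comp_mod ht 2).ite_eq (Comp.const 0) (h.sub (comp_baseCount ht hJ))
      (comp_at_div ht hJ 2 (by norm_num))
  · exact h10.ite_eq (Comp.const 0) (hl (by norm_num)) (comp_mod ht 5)
  · exact h10.ite_eq (Comp.const 0) (hl (by norm_num)) (h10.sub (Comp.const 1))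
  · exact h10.ite_eq (Comp.const 0) (hl (by norm_num)) (hq (by norm_num))
  · exact comp_zero ht hJ hj

end Comp

theorem passRow₁_lt {J : ℕ} {x : Sit t} (hx : (buildSys t).ok x) (hl : x.M J 0 0 + 1 <
    rows x.S.length) (j : ℕ) : passRow₁ J j x < rows x.S.length := by
  have hq := hx.2.1
  have hd := fun e => (Nat.div_le_self x.q ((x.M (2 * t) 0 0 + 1) ^ e)).trans_lt hq
  unfold passRow₁ row₁
  split
  · omega
  · split <;> omega
  · exact hd 5
  · exact hd 2
  · exact hd 2
  · exact hd 2
  · exact hx.1 _ _ _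
  · exact hx.1 _ _ _
  · omega

theorem passRow₂_lt {J : ℕ} {x : Sit t} (hx : (buildSys t).ok x) (j : ℕ) :
    passRow₂ J j x < rows x.S.length := by
  have hq := hx.2.1
  have hd := fun e => (Nat.div_le_self x.q ((x.M (2 * t) 0 0 + 1) ^ e)).trans_lt hq
  unfold passRow₂ row₂
  split
  · exact hd 5
  · exact hd 2
  · exact hx.1 _ _ _
  · exact hx.1 _ _ _
  · exact hx.1 _ _ _
  · exact rows_pos _

/-- Both passes together use `18` columns; in all further ones the step rewrites the old entry of
row `0`. -/
theorem can_pass₁ (ht : 0 < t) {J : ℕ} (hJ : J < 2 * t) :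
    Can t (fun x => (buildSys t).ok x ∧ x.M J 0 0 + 1 < rows x.S.length ∧
      ∀ j < 18, passVal₁ J j x < rows x.S.length) (putSit J (passRow₁ J) (passVal₁ J)) 0 := by
  refine can_put ht (m := 18) (by omega) (by norm_num) (fun j _ => comp_row₁ ht hJ j)
    (fun j hj => comp_val₁ ht hJ (by omega)) (fun x hx => hx.1)
    (fun x hx j hj => ⟨passRow₁_lt hx.1 hx.2.1 j, hx.2.2 j hj⟩) fun x _ j hj => ?_
  unfold passVal₁ passRow₁ val₁ row₁
  split <;> first | omega | skip
  split <;> omega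

theorem can_pass₂ (ht : 0 < t) {J : ℕ} (hJ : J < 2 * t) :
    Can t (fun x => (buildSys t).ok x ∧ ∀ j < 18, passVal₂ J j x < rows x.S.length)
      (putSit J (passRow₂ J) (passVal₂ J)) 0 := by
  refine can_put ht (m := 18) (by omega) (by norm_num) (fun j _ => comp_row₂ ht hJ j)
    (fun j hj => comp_val₂ ht hJ (by omega)) (fun x hx => hx.1)
    (fun x hx j hj => ⟨passRow₂_lt hx.1 j, hx.2 j hj⟩) fun x _ j hj => ?_
  unfold passVal₂ passRow₂ val₂ row₂
  split <;> first | omega | skip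
  split <;> omega

theorem put_at {M : ℕ → ℕ → ℕ} {row val : ℕ → ℕ} (col : ℕ) :
    put M row val col (row col) = val col := if_pos rfl

theorem phases_pass {S : List (Paren t)} {J : ℕ} (hJ : J < 2 * t) :
    Function.update (phases S J) J (passes (param S.length) (J / 2) S.length (phaseCode S J)) =
      phases S (J + 1) := by
  funext ph
  by_cases h : ph = J
  · subst h
    rw [Function.update_self, phases, if_neg (by omega), if_pos (by omega)]
  · rw [Function.update_of_ne h, phases, phases]
    by_cases h1 : ph = 2 * t
    · rw [if_pos h1, if_pos h1]
    · by_cases h2 : ph < J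
      · rw [if_neg h1, if_neg h1, if_pos h2, if_pos (by omega)]
      · rw [if_neg h1, if_neg h1, if_neg h2, if_neg (by omega)]

theorem update_param {S : List (Paren t)} {J : ℕ} (hJ : J < 2 * t) (N : ℕ → ℕ → ℕ) :
    Function.update (phases S J) J N (2 * t) 0 0 + 1 = param S.length := by
  rw [Function.update_of_ne (by omega), phases_param, param]

theorem reach_phase (ht : 0 < t) {J : ℕ} (hJ : J < 2 * t)
    (h : Reach t (fun S => phases S J) fun _ => []) :
    Reach t (fun S => phases S (J + 1)) fun _ => [] := by
  have hfine : ∀ S : List (Paren t), Fine S (phases S J) [] := fun S =>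
    ⟨phases_lt _ _, Nat.zero_le _, by rw [phases_param]; exact lowParam_pow_le _ _⟩
  have hN : ∀ S : List (Paren t), S.length ≤ 1 * (S.length + 1) ∧ S.length < rows S.length :=
    fun S => ⟨by omega, by have := lt_rows S.length; omega⟩
  have h1 := h.loop (can_pass₁ ht hJ) (fun x => ⟨rfl, rfl, rfl⟩) (comp_length ht)
    (fun S => S.length) 1 (fun S _ => hN S) (fun S _ q b => rfl) (fun S _ => hfine S)
    (fun S i => Function.update (phases S J) J
      (pass₁ (param S.length) (J / 2) (phaseCode S J) i)) (fun _ _ => []) (fun S _ => ⟨?_, rfl⟩)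
    fun S _ i hi => ?_
  · have h2 := h1.loop (can_pass₂ ht hJ) (fun x => ⟨rfl, rfl, rfl⟩) (comp_length ht)
      (fun S => S.length) 1 (fun S _ => hN S) (fun S _ q b => rfl)
      (fun S _ => fine_update hJ fun col r => (passes_lt _ _ _).1 _ le_rfl col r)
      (fun S i => Function.update (phases S J) J (pass₂ (param S.length)
        (pass₁ (param S.length) (J / 2) (phaseCode S J) S.length) i)) (fun _ _ => [])
      (fun S _ => ⟨rfl, rfl⟩) fun S _ i hi => ?_
    · exact h2.congr fun S _ => ⟨phases_pass hJ, rfl⟩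
    · have hb := fun i (hi : i ≤ S.length) => (passes_lt S.length (J / 2) (phaseCode S J)).2 i hi
      have hlt := lt_rows S.length
      set P := pass₁ (param S.length) (J / 2) (phaseCode S J) S.length
      have hput : ∀ j, passVal₂ J j ⟨S, i, S.length, Function.update (phases S J) J
          (pass₂ (param S.length) P i), []⟩ = val₂ (param S.length)
          (pass₂ (param S.length) P i) i j := fun j => by
        unfold passVal₂; simp only [update_param hJ, Function.update_self]
      have hrow : ∀ j, passRow₂ J j ⟨S, i, S.length, Function.update (phases S J) J
          (pass₂ (param S.length) P i), []⟩ = row₂ (param S.length)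
          (pass₂ (param S.length) P i) i j := fun j => by
        unfold passRow₂; simp only [update_param hJ, Function.update_self]
      refine ⟨⟨(fine_update hJ fun col r => (hb i hi.le col r).trans_lt (by omega)).ok
        (hi.trans (hN S).2), fun j _ => ?_⟩, ?_, rfl⟩
      · rw [hput]
        -- The new entry occurs in the columns of the next stage, so the bound for these columns
        -- also bounds the value to be stored.
        have := hb (i + 1) hi j (row₂ (param S.length) (pass₂ (param S.length) P i) i j)
        rw [pass₂, put_at] at this
        show _ < rows S.length
        omega
      · show Function.update _ _ _ = _
        simp only [hput, hrow, Function.update_self, Function.update_idem]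
        rfl
  · show Function.update _ _ _ = _
    funext ph
    by_cases h : ph = J
    · subst h
      rw [Function.update_self, phases, if_neg (by omega), if_neg (lt_irrefl _)]
      rfl
    · rw [Function.update_of_ne h]
  · have hb := fun i (hi : i ≤ S.length) => (passes_lt S.length (J / 2) (phaseCode S J)).1 i hi
    have hlt := lt_rows S.length
    have hle := pass₁_le (param S.length) (J / 2) (phaseCode S J) i 0 0
    have hput : ∀ j, passVal₁ J j ⟨S, i, S.length, Function.update (phases S J) J
        (pass₁ (param S.length) (J / 2) (phaseCode S J) i), []⟩ = val₁ (param S.length) (J / 2)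
        (phaseCode S J i) (pass₁ (param S.length) (J / 2) (phaseCode S J) i) i j := fun j => by
      unfold passVal₁; simp only [update_param hJ, Function.update_self]
    have hrow : ∀ j, passRow₁ J j ⟨S, i, S.length, Function.update (phases S J) J
        (pass₁ (param S.length) (J / 2) (phaseCode S J) i), []⟩ = row₁ (param S.length) (J / 2)
        (phaseCode S J i) (pass₁ (param S.length) (J / 2) (phaseCode S J) i) i j := fun j => by
      unfold passRow₁; simp only [update_param hJ, Function.update_self]
    refine ⟨⟨(fine_update hJ fun col r => hb i hi.le col r).ok (hi.trans (hN S).2), ?_,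
      fun j _ => ?_⟩, ?_, rfl⟩
    · show Function.update (phases S J) J (pass₁ (param S.length) (J / 2) (phaseCode S J) i) J 0 0
        + 1 < rows S.length
      rw [Function.update_self]
      simp at hle
      omega
    · rw [hput]
      have := hb (i + 1) hi j (row₁ (param S.length) (J / 2) (phaseCode S J i)
        (pass₁ (param S.length) (J / 2) (phaseCode S J) i) i j)
      rwa [pass₁, put_at] at this
    · show Function.update _ _ _ = _
      simp only [hput, hrow, Function.update_self, Function.update_idem]
      rfl

theorem reach_phases (ht : 0 < t) {J : ℕ} (hJ : J ≤ 2 * t) :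
    Reach t (fun S => phases S J) fun _ => [] := by
  induction J with
  | zero => exact reach_param ht
  | succ J ih => exact reach_phase ht hJ (ih (by omega))

end Passes

end ParenString

namespace ParenString
open WordRAM BitString

/-! ### The output -/

section Output
variable {t : ℕ}

theorem pow_param_le (n : ℕ) : param n ^ 4 ≤ 32 * (n + 1) :=
  (param_pow_le n).trans (by have := Nat.log_le_self 2 n; omega)

theorem pow_param_mono (n : ℕ) {e e' : ℕ} (h : e ≤ e') : param n ^ e ≤ param n ^ e' :=
  Nat.pow_le_pow_right (param_pos n) h

theorem pow_mul_numBlocks_le (R n : ℕ) {e : ℕ} (he : e ≤ 5) (hR : 0 < R) :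
    R ^ e * numBlocks R n ≤ n + R ^ e := by
  have h1 : R ^ e * (n / R ^ 5) ≤ R ^ 5 * (n / R ^ 5) :=
    Nat.mul_le_mul_right _ (Nat.pow_le_pow_right hR he)
  have h2 := Nat.mul_div_le n (R ^ 5)
  rw [numBlocks, mul_add, mul_one]
  omega

theorem numBlocks_le (n : ℕ) : numBlocks (param n) n ≤ n + 1 := by
  have := Nat.div_le_self n (param n ^ 5)
  unfold numBlocks
  omega

theorem numLeaves_le (n : ℕ) : numLeaves (param n) n ≤ 33 * (n + 1) := by
  have h1 := pow_mul_numBlocks_le (param n) n (e := 3) (by norm_num) (param_pos n)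
  have h2 := pow_param_mono n (show 3 ≤ 4 by norm_num)
  have h3 := pow_param_le n
  unfold numLeaves
  rw [mul_comm]
  omega

theorem numPio_le (n : ℕ) : numPio (param n) n ≤ 34 * (n + 1) := by
  have h1 := numBlocks_le n
  have h2 := pow_param_mono n (show 2 ≤ 4 by norm_num)
  have h3 := pow_param_le n
  unfold numPio
  omega

theorem mul_pow_le_rows (n : ℕ) : 1024 * (n + 2) ^ 6 ≤ rows n := by
  have h1 : 2 ^ 10 ≤ (n + 2) ^ 10 := Nat.pow_le_pow_left (by omega) 10
  have h2 : rows n = (n + 2) ^ 10 * (n + 2) ^ 6 := by unfold rows; ring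
  rw [h2]
  exact Nat.mul_le_mul_right _ h1

/-- Everything is dominated by `R ^ 4` bits per block, that is, by about `n / R` bits. -/
theorem chunkLen_le (R n : ℕ) :
    chunkLen R n ≤ 54 * (R ^ 4 * numBlocks R n) + 8 * R ^ 3 + 2 * R ^ 6 := by
  have h1 : chunkLen R n = 38 * (R ^ 4 * numBlocks R n) + 16 * (R * numBlocks R n) + 8 * R ^ 3 +
      2 * R ^ 6 := by
    unfold chunkLen numPio numLeaves
    ring
  have h2 : R * numBlocks R n ≤ R ^ 4 * numBlocks R n :=
    Nat.mul_le_mul_right _ (Nat.le_self_pow (by norm_num) _)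
  omega

theorem chunkLen_le_rows (n : ℕ) : chunkLen (param n) n ≤ rows n := by
  have h1 := pow_mul_numBlocks_le (param n) n (e := 4) (by norm_num) (param_pos n)
  have h2 := pow_param_mono n (show 3 ≤ 6 by norm_num)
  have h3 := pow_param_mono n (show 4 ≤ 6 by norm_num)
  have h4 : param n ^ 6 ≤ (n + 2) ^ 6 :=
    Nat.pow_le_pow_left (by have := param_le n; omega) 6
  have h5 : n + 2 ≤ (n + 2) ^ 6 := Nat.le_self_pow (by norm_num) _
  have h6 := mul_pow_le_rows n
  have h7 := chunkLen_le (param n) n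
  omega

theorem mul_lt_rows (n : ℕ) : 34 * (n + 1) < rows n := by
  have h5 : n + 2 ≤ (n + 2) ^ 6 := Nat.le_self_pow (by norm_num) _
  have h6 := mul_pow_le_rows n
  omega

theorem fine_phases (S : List (Paren t)) (J : ℕ) {O : List Bool}
    (hO : O.length ≤ 200 * (t + 1) * rows S.length) : Fine S (phases S J) O :=
  ⟨phases_lt _ _, hO, by rw [phases_param]; exact lowParam_pow_le _ _⟩

/-- The output `O` can be reached, with all columns in place. -/
def Emits (t : ℕ) (O : List (Paren t) → List Bool) : Prop :=
  Reach t (fun S => phases S (2 * t)) O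

theorem Emits.array (ht : 0 < t) {O : List (Paren t) → List Bool} (h : Emits t O)
    {width val B : Sit t → ℕ} (hw : Comp (buildSys t) width) (hs : Small (buildSys t) width)
    (hv : Comp (buildSys t) val) (hB : Comp (buildSys t) B) (W N : List (Paren t) → ℕ)
    (v : List (Paren t) → ℕ → ℕ)
    (hW : ∀ S q b O, width ⟨S, q, b, phases S (2 * t), O⟩ = W S ∧
      val ⟨S, q, b, phases S (2 * t), O⟩ = v S q ∧ B ⟨S, q, b, phases S (2 * t), O⟩ = N S)
    (hN : ∀ S, N S ≤ 34 * (S.length + 1))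
    (hO : ∀ S, (O S).length + W S * N S ≤ 200 * (t + 1) * rows S.length) :
    Emits t fun S => O S ++ arr (W S) (N S) (v S) := by
  have hN' : ∀ S, N S < rows S.length := fun S => (hN S).trans_lt (mul_lt_rows _)
  refine Reach.loop h (can_emit ht hw hs hv) (fun x => ⟨rfl, rfl, rfl⟩) hB N 34
    (fun S _ => ⟨hN S, hN' S⟩) (fun S _ q b => (hW S q b _).2.2)
    (fun S _ => fine_phases S _ (by have := hO S; omega)) (fun S _ => phases S (2 * t))
    (fun S i => O S ++ arr (W S) i (v S)) (fun S _ => ⟨rfl, by simp [arr]⟩)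
    fun S _ i hi => ⟨(fine_phases S _ ?_).ok (hi.trans (hN' S)), rfl, ?_⟩
  · rw [List.length_append, length_arr]
    have := Nat.mul_le_mul_left (W S) hi.le
    have := hO S
    omega
  · show O S ++ arr (W S) i (v S) ++ ofNat (width _) (val _) = _
    rw [(hW S _ _ _).1, (hW S _ _ _).2.1, arr_succ, List.append_assoc]

/-- The arrays of a phase. -/
def phaseChunk (S : List (Paren t)) (ph : ℕ) : List Bool :=
  chunk (param S.length) S.length
    (arraysOf (passes (param S.length) (ph / 2) S.length (phaseCode S ph)))

theorem Emits.chunk (ht : 0 < t) {O : List (Paren t) → List Bool} (h : Emits t O) {ph : ℕ}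
    (hph : ph < 2 * t) (hO : ∀ S, (O S).length + chunkLen (param S.length) S.length ≤
      200 * (t + 1) * rows S.length) : Emits t fun S => O S ++ phaseChunk S ph := by
  have hR := comp_param ht
  have hs : Small (buildSys t) fun x => (x.M (2 * t) 0 0 + 1) ^ 4 := small_param
  have hs' : Small (buildSys t) fun x => 8 * (x.M (2 * t) 0 0 + 1) :=
    (small_param.of_le fun x _ => Nat.le_self_pow (by norm_num) _).const_mul 8
  have hw := hR.pow 4
  have hw' := (Comp.const 8).mul hR
  have hv : ∀ {col}, col < 32 → Comp (buildSys t) fun x => x.M ph col x.q := fun hcol =>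
    comp_entry ht (by omega) hcol comp_counter fun _ hx => hx.2.1
  have hnb := ((comp_length ht).div (hR.pow 5)).add (Comp.const 1)
  have hnl := hnb.mul (hR.pow 3)
  have hnp := ((Comp.const 2).mul hnb).add (hR.pow 2)
  have hc : ∀ S : List (Paren t), phases S (2 * t) ph =
      passes (param S.length) (ph / 2) S.length (phaseCode S ph) := fun S => by
    rw [phases, if_neg (by omega), if_pos hph]
  have hp : ∀ S : List (Paren t), phases S (2 * t) (2 * t) 0 0 + 1 = param S.length := fun S => by
    rw [phases_param, param]
  -- The columns are output in the order of the arrays in `chunk`: `6`, `13`, `7`, `8`, `9`, `14`,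
  -- `15`, `16`, `17`.
  have h1 := h.array ht hw hs (hv (col := 6) (by norm_num)) hnb (fun S => param S.length ^ 4)
    (fun S => numBlocks (param S.length) S.length)
    (fun S => passes (param S.length) (ph / 2) S.length (phaseCode S ph) 6)
    (fun S q b O => ⟨by rw [hp], by simp only [hc], by rw [hp]; rfl⟩)
    (fun S => (numBlocks_le _).trans (by omega)) (fun S => by
      have := hO S; unfold chunkLen at this; omega)
  have h2 := h1.array ht hw hs (hv (col := 13) (by norm_num)) hnb (fun S => param S.length ^ 4)
    (fun S => numBlocks (param S.length) S.length)
    (fun S => passes (param S.length) (ph / 2) S.length (phaseCode S ph) 13)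
    (fun S q b O => ⟨by rw [hp], by simp only [hc], by rw [hp]; rfl⟩)
    (fun S => (numBlocks_le _).trans (by omega)) (fun S => by
      have := hO S; unfold chunkLen at this
      simp only [List.length_append, length_arr]; omega)
  have h3 := h2.array ht hw' hs' (hv (col := 7) (by norm_num)) hnl (fun S => 8 * param S.length)
    (fun S => numLeaves (param S.length) S.length)
    (fun S => passes (param S.length) (ph / 2) S.length (phaseCode S ph) 7)
    (fun S q b O => ⟨by rw [hp], by simp only [hc], by rw [hp]; rfl⟩)
    (fun S => (numLeaves_le _).trans (by omega)) (fun S => by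
      have := hO S; unfold chunkLen at this
      simp only [List.length_append, length_arr]; omega)
  have h4 := h3.array ht hw' hs' (hv (col := 8) (by norm_num)) hnl (fun S => 8 * param S.length)
    (fun S => numLeaves (param S.length) S.length)
    (fun S => passes (param S.length) (ph / 2) S.length (phaseCode S ph) 8)
    (fun S q b O => ⟨by rw [hp], by simp only [hc], by rw [hp]; rfl⟩)
    (fun S => (numLeaves_le _).trans (by omega)) (fun S => by
      have := hO S; unfold chunkLen at this
      simp only [List.length_append, length_arr]; omega)
  have h5 := h4.array ht hw' hs' (hv (col := 9) (by norm_num)) hnl (fun S => 8 * param S.length)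
    (fun S => numLeaves (param S.length) S.length)
    (fun S => passes (param S.length) (ph / 2) S.length (phaseCode S ph) 9)
    (fun S q b O => ⟨by rw [hp], by simp only [hc], by rw [hp]; rfl⟩)
    (fun S => (numLeaves_le _).trans (by omega)) (fun S => by
      have := hO S; unfold chunkLen at this
      simp only [List.length_append, length_arr]; omega)
  have h6 := h5.array ht hw' hs' (hv (col := 14) (by norm_num)) hnl (fun S => 8 * param S.length)
    (fun S => numLeaves (param S.length) S.length)
    (fun S => passes (param S.length) (ph / 2) S.length (phaseCode S ph) 14)
    (fun S q b O => ⟨by rw [hp], by simp only [hc], by rw [hp]; rfl⟩)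
    (fun S => (numLeaves_le _).trans (by omega)) (fun S => by
      have := hO S; unfold chunkLen at this
      simp only [List.length_append, length_arr]; omega)
  have h7 := h6.array ht hw' hs' (hv (col := 15) (by norm_num)) hnp (fun S => 8 * param S.length)
    (fun S => numPio (param S.length) S.length)
    (fun S => passes (param S.length) (ph / 2) S.length (phaseCode S ph) 15)
    (fun S q b O => ⟨by rw [hp], by simp only [hc], by rw [hp]; rfl⟩)
    (fun S => numPio_le _) (fun S => by
      have := hO S; unfold chunkLen at this
      simp only [List.length_append, length_arr]; omega)
  have h8 := h7.array ht hw hs (hv (col := 16) (by norm_num)) hnp (fun S => param S.length ^ 4)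
    (fun S => numPio (param S.length) S.length)
    (fun S => passes (param S.length) (ph / 2) S.length (phaseCode S ph) 16)
    (fun S q b O => ⟨by rw [hp], by simp only [hc], by rw [hp]; rfl⟩)
    (fun S => numPio_le _) (fun S => by
      have := hO S; unfold chunkLen at this
      simp only [List.length_append, length_arr]; omega)
  have h9 := h8.array ht hw hs (hv (col := 17) (by norm_num)) hnp (fun S => param S.length ^ 4)
    (fun S => numPio (param S.length) S.length)
    (fun S => passes (param S.length) (ph / 2) S.length (phaseCode S ph) 17)
    (fun S q b O => ⟨by rw [hp], by simp only [hc], by rw [hp]; rfl⟩)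
    (fun S => numPio_le _) (fun S => by
      have := hO S; unfold chunkLen at this
      simp only [List.length_append, length_arr]; omega)
  refine Reach.congr h9 fun S _ => ⟨rfl, ?_⟩
  simp only [phaseChunk, BitString.arr, ParenString.chunk, arraysOf, List.append_assoc]

/-- The auxiliary string with the arrays of the first `J` phases. -/
def indexTo (S : List (Paren t)) (J : ℕ) : List Bool :=
  selfDelim (param S.length) ++ (List.range J).flatMap (phaseChunk S)

theorem length_indexTo (S : List (Paren t)) (J : ℕ) : (indexTo S J).length =
    2 * param S.length + 1 + J * chunkLen (param S.length) S.length := by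
  rw [indexTo, List.length_append, length_selfDelim, length_flatMap_const
    (w := chunkLen (param S.length) S.length) (g := phaseChunk S) fun _ => length_chunk _ _ _,
    List.length_range,
    mul_comm J]

theorem length_indexTo_le (S : List (Paren t)) {J : ℕ} (hJ : J ≤ 2 * t) :
    (indexTo S J).length ≤ 200 * (t + 1) * rows S.length := by
  have h1 := chunkLen_le_rows S.length
  have h2 := mul_lt_rows S.length
  have h3 := param_le S.length
  have h4 := Nat.mul_le_mul hJ h1
  have h5 : 200 * (t + 1) * rows S.length =
      2 * t * rows S.length + rows S.length + (198 * t + 199) * rows S.length := by ring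
  rw [length_indexTo, h5]
  omega

/-- The code is written as three arrays: ones of width `1`, a single zero bit, and the number in as
many bits as its value. -/
theorem emits_selfDelim (ht : 0 < t) : Emits t fun S => selfDelim (param S.length) := by
  have hR := comp_param ht
  have hs : Small (buildSys t) fun x => x.M (2 * t) 0 0 + 1 :=
    small_param.of_le fun x _ => Nat.le_self_pow (by norm_num) _
  have hp : ∀ S : List (Paren t), phases S (2 * t) (2 * t) 0 0 + 1 = param S.length := fun S => by
    rw [phases_param, param]
  have hb : ∀ S : List (Paren t), 2 * param S.length + 1 ≤ 200 * (t + 1) * rows S.length :=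
    fun S => by
      have := length_indexTo_le S (Nat.zero_le (2 * t))
      rw [length_indexTo] at this
      omega
  have h0 : Emits t fun _ => [] := reach_phases ht le_rfl
  have h1 := h0.array ht (Comp.const 1) (Small.const 1) (Comp.const 1) hR (fun _ => 1)
    (fun S => param S.length) (fun _ _ => 1) (fun S q b O => ⟨rfl, rfl, hp S⟩)
    (fun S => (param_le _).trans (by omega)) (fun S => by
      have := hb S; simp only [List.length_nil]; omega)
  have h2 := h1.array ht (Comp.const 1) (Small.const 1) (Comp.const 0) (Comp.const 1) (fun _ => 1)
    (fun S => 1) (fun _ _ => 0) (fun S q b O => ⟨rfl, rfl, rfl⟩)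
    (fun S => by omega) (fun S => by
      have := hb S; simp only [List.length_append, length_arr, List.length_nil]; omega)
  have h3 := h2.array ht hR hs hR (Comp.const 1) (fun S => param S.length)
    (fun S => 1) (fun S _ => param S.length) (fun S q b O => ⟨hp S, hp S, rfl⟩)
    (fun S => by omega) (fun S => by
      have := hb S; simp only [List.length_append, length_arr, List.length_nil]; omega)
  refine Reach.congr h3 fun S _ => ⟨rfl, ?_⟩
  have e1 : arr 1 (param S.length) (fun _ => 1) = List.replicate (param S.length) true := by
    generalize param S.length = R
    induction R with
    | zero => rfl
    | succ R ih => rw [arr_succ, ih, List.replicate_succ']; rfl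
  rw [e1, arr_succ, arr_succ]
  simp [selfDelim, arr, ofNat]

theorem emits_indexTo (ht : 0 < t) {J : ℕ} (hJ : J ≤ 2 * t) : Emits t fun S => indexTo S J := by
  induction J with
  | zero => exact Reach.congr (emits_selfDelim ht) fun S _ => ⟨rfl, by simp [indexTo]⟩
  | succ J ih =>
    refine Reach.congr ((ih (by omega)).chunk ht hJ fun S => ?_) fun S _ => ⟨rfl, ?_⟩
    · have := length_indexTo_le S hJ
      rw [length_indexTo, add_mul, one_mul] at this
      rw [length_indexTo]
      omega
    · simp [indexTo, List.range_succ]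

/-- The auxiliary string. -/
def auxString (S : List (Paren t)) : List Bool := indexTo S (2 * t)

end Output

end ParenString

namespace WordRAM

theorem Runs.halts {w : ℕ} {c : Cmd} {reg reg' : ℕ → ℕ} {mem mem' : ℕ → Bool} {T : ℕ}
    (h : Runs w c reg mem reg' mem' T) :
    HaltsWithin w (c.compile 0) T ⟨0, reg, mem⟩ ⟨c.size, reg', mem'⟩ := by
  have h1 := h (c.compile 0) 0 (fun i hi => by rw [zero_add]) 0 ⟨c.size, reg', mem'⟩
  rw [add_zero, zero_add] at h1
  refine h1 (.done _ _ ?_)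
  rw [List.getElem?_eq_none]
  rw [Cmd.length_compile]

end WordRAM

namespace ParenString
open WordRAM BitString

section Build
variable {t : ℕ}

theorem exists_build (ht : 0 < t) : ∃ (build : Program) (c C : ℕ), ∀ S : List (Paren t),
    Balanced S → ∀ w, c * (Nat.log 2 S.length + 1) ≤ w → ∃ s : State,
      HaltsWithin w build (C * (S.length + 1)) (init w (encode S) []) s ∧
        s.output = auxString S := by
  obtain ⟨c, K, C, h⟩ := emits_indexTo ht le_rfl
  obtain ⟨e, K', he, he'⟩ := comp_outBase ht
  obtain ⟨K'', hK''⟩ := (comp_output_length (t := t)).bound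
  refine ⟨Cmd.compile (.seq c (.seq (e.code 8) (.seq (.basic (.const 0 0))
    (.basic (.op .or 0 0 8))))) 0, K + K' + K'', C + (e.cost + 2), fun S hS w hw => ?_⟩
  rw [add_mul, add_mul] at hw
  -- The memory behind the input is zero, which already represents columns full of zeros; no
  -- initialization is needed.
  have hrel : (buildSys t).rel w ⟨S, 0, 0, fun _ _ _ => 0, []⟩ (init w (encode S) []).reg
      (init w (encode S) []).mem := by
    refine ⟨⟨?_, ?_, ?_, ?_⟩, has_getD _, fun ph _ col _ r _ => ?_, fun p hp => ?_⟩
    · simp [init, length_encode]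
    · simp [init]
    · simp [init]
    · simp [init]
    · refine (readBits_eq_mod fun q _ => ?_).trans (Nat.zero_mod _)
      rw [Nat.zero_testBit]
      simp only [init]
      rw [List.getElem?_eq_none]
      · rfl
      · rw [length_encode]
        show _ ≤ symBits t * S.length + _ + q
        omega
    · simp at hp
  obtain ⟨q, b, r1, m1, hq, h1, h2⟩ := h S hS w _ _ (by omega) hrel
  have hok := (fine_phases S (2 * t) (length_indexTo_le S le_rfl)).ok (b := b) hq
  obtain ⟨r2, g1, g2, g3⟩ := Expr.runs w e 8 r1 m1 he
  have h3 : e.eval w r1 m1 = outBase t S.length := (he' _ hok w r1 m1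
    (by show _ * (Nat.log 2 S.length + 1) ≤ _; omega) h2).1
  have h4 : (indexTo S (2 * t)).length < 2 ^ w := (hK'' _ hok w r1 m1
    (by show _ * (Nat.log 2 S.length + 1) ≤ _; omega) h2).trans_le (Nat.pow_le_pow_right
      (by norm_num) (by show _ * (Nat.log 2 S.length + 1) ≤ _; omega))
  have h5 : outBase t S.length < 2 ^ w := (he' _ hok w r1 m1
    (by show _ * (Nat.log 2 S.length + 1) ≤ _; omega) h2).2.trans_le (Nat.pow_le_pow_right
      (by norm_num) (by show _ * (Nat.log 2 S.length + 1) ≤ _; omega))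
  refine ⟨_, ((Runs.seq h1 (Runs.seq g1 (Runs.seq (Runs.const 0 0)
    (Runs.op .or 0 0 8)))).mono ?_).halts, ?_⟩
  · rw [add_mul]
    have := Nat.le_mul_of_pos_right (e.cost + 2) (Nat.succ_pos S.length)
    rw [Nat.succ_eq_add_one] at this
    omega
  · obtain ⟨⟨-, q1, -, -⟩, -, -, hout⟩ := h2
    have e0 : Function.update (Function.update r2 0 (0 % 2 ^ w)) 0 (Op.or.eval w
        (Function.update r2 0 (0 % 2 ^ w) 0) (Function.update r2 0 (0 % 2 ^ w) 8)) 0 =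
        outBase t S.length := by
      simp [Op.eval, g2, h3, Nat.mod_eq_of_lt h5]
    have e1 : Function.update (Function.update r2 0 (0 % 2 ^ w)) 0 (Op.or.eval w
        (Function.update r2 0 (0 % 2 ^ w) 0) (Function.update r2 0 (0 % 2 ^ w) 8)) 1 =
        (indexTo S (2 * t)).length := by
      simp only [Function.update_of_ne (show (1 : ℕ) ≠ 0 by norm_num)]
      rw [g3 1 (by norm_num), q1]
      exact Nat.mod_eq_of_lt h4
    rw [State.output]
    simp only [e0, e1]
    refine List.ext_getElem (by simp [auxString]) fun p hp hp' => ?_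
    rw [List.getElem_map, List.getElem_range]
    exact hout p hp'

end Build

/-! ### The length of the auxiliary string -/

section Length

theorem lt_param {n r : ℕ} (h : 2 ^ r ^ 4 ≤ n) : r < param n := by
  by_contra hle
  have h1 : param n ^ 4 ≤ r ^ 4 := Nat.pow_le_pow_left (not_lt.1 hle) 4
  have h2 := Nat.pow_le_pow_right (show 0 < 2 by norm_num) h1
  have := lt_two_pow_param n
  omega

/-- Multiplying by the parameter avoids division: `R ^ 5` bits per block amount to `n` plus a power
of `R`. -/
theorem chunkLen_mul_le (n : ℕ) :
    chunkLen (param n) n * param n ≤ 54 * n + 64 * param n ^ 7 := by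
  have h1 := chunkLen_le (param n) n
  have h2 := pow_mul_numBlocks_le (param n) n (e := 5) le_rfl (param_pos n)
  have h3 := Nat.mul_le_mul_right (param n) h1
  have h4 : (54 * (param n ^ 4 * numBlocks (param n) n) + 8 * param n ^ 3 + 2 * param n ^ 6) *
      param n = 54 * (param n ^ 5 * numBlocks (param n) n) + 8 * param n ^ 4 +
      2 * param n ^ 7 := by ring
  have h5 := pow_param_mono n (show 4 ≤ 7 by norm_num)
  have h6 := pow_param_mono n (show 5 ≤ 7 by norm_num)
  omega

theorem log_sq_le (n : ℕ) (hn : 0 < n) : (Nat.log 2 n + 1) ^ 2 ≤ 8 * n := by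
  have h1 := Nat.pow_log_le_self 2 hn.ne'
  have h2 : ∀ l : ℕ, (l + 1) ^ 2 ≤ 8 * 2 ^ l := by
    intro l
    have h := fun (m : ℕ) => Nat.lt_two_pow_self (n := m)
    induction l with
    | zero => norm_num
    | succ l ih =>
      have := h l
      rw [pow_succ 2 l]
      nlinarith
  exact (h2 _).trans (Nat.mul_le_mul_left _ h1)

/-- `R ^ 4` is of logarithmic size, and the square of the logarithm is linearly bounded; this
absorbs the additive powers of `R`. -/
theorem pow_eight_le (n : ℕ) (hn : 0 < n) : param n ^ 8 ≤ 8192 * n := by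
  have h1 := Nat.pow_le_pow_left (param_pow_le n) 2
  have h2 := log_sq_le n hn
  rw [← pow_mul, mul_pow] at h1
  norm_num at h1
  omega

variable {t : ℕ}

theorem length_auxString_mul_le (S : List (Paren t)) (hS : 0 < S.length) :
    (auxString S).length * param S.length ≤ 2 ^ 21 * (t + 1) * S.length := by
  have h1 := chunkLen_mul_le S.length
  have h2 := pow_eight_le S.length hS
  have h3 := pow_param_mono S.length (show 1 ≤ 8 by norm_num)
  have h4 := pow_param_mono S.length (show 2 ≤ 8 by norm_num)
  have h5 := pow_param_mono S.length (show 7 ≤ 8 by norm_num)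
  have h6 : (auxString S).length * param S.length = 2 * param S.length ^ 2 + param S.length ^ 1 +
      2 * t * (chunkLen (param S.length) S.length * param S.length) := by
    rw [auxString, length_indexTo]
    ring
  have h7 := Nat.mul_le_mul_left (2 * t) (h1.trans (show _ ≤ 600000 * S.length by omega))
  have h8 : 2 ^ 21 * (t + 1) * S.length = 2 * t * (600000 * S.length) + 897152 * (t * S.length) +
    2 ^ 21 * S.length := by ring
  omega

theorem length_auxString_isLittleO (t : ℕ) (ε : ℝ) (hε : 0 < ε) :
    ∃ N : ℕ, ∀ S : List (Paren t), N ≤ S.length →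
      ((auxString S).length : ℝ) ≤ ε * (S.length : ℝ) := by
  obtain ⟨r, hr⟩ := exists_nat_gt ((2 ^ 21 * (t + 1) : ℝ) / ε)
  -- From this length on the parameter exceeds `r`, and `r` was chosen so that the constant divided
  -- by `r` is below `ε`.
  refine ⟨2 ^ r ^ 4, fun S hS => ?_⟩
  have h0 : 0 < S.length := (by positivity : 0 < 2 ^ r ^ 4).trans_le hS
  have h1 := length_auxString_mul_le S h0
  have h2 := Nat.mul_le_mul_left (auxString S).length (lt_param hS).le
  have h3 : ((auxString S).length : ℝ) * r ≤ 2 ^ 21 * (t + 1) * S.length := by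
    exact_mod_cast h2.trans h1
  rw [div_lt_iff₀ hε] at hr
  have h4 : (2 ^ 21 * (t + 1) : ℝ) * S.length ≤ r * ε * S.length :=
    mul_le_mul_of_nonneg_right hr.le (Nat.cast_nonneg _)
  have hr0 : (0 : ℝ) < r := by
    by_contra h
    have : (r : ℝ) * ε ≤ 0 := mul_nonpos_of_nonpos_of_nonneg (not_lt.1 h) hε.le
    have : (0 : ℝ) < 2 ^ 21 * (t + 1) := by positivity
    linarith
  refine le_of_mul_le_mul_right ?_ hr0
  calc _ ≤ _ := h3
    _ ≤ _ := h4
    _ = _ := by ring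

end Length

end ParenString

/-! ### Parsing the headers, and computability of the query functions. -/

namespace WordRAM
open BitString Packed

section Parse
variable {σ : Type} {Y : Sys σ} {F N L : σ → ℕ}

/-- The number `N` of bits to be loaded may exceed the word; the load is then cut, which is harmless
because the code itself fits. -/
theorem comp_parse (hF : Comp Y F) (hN : Comp Y N) (hL : Small Y L)
    (hLN : ∀ x, Y.ok x → 2 * L x + 1 ≤ N x)
    (hm : ∀ x, Y.ok x → ∀ w reg mem, Y.rel w x reg mem → Has mem (F x) (selfDelim (L x))) :
    Comp Y L := by
  obtain ⟨e1, K1, hb1, h1⟩ := hF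
  obtain ⟨e2, K2, hb2, h2⟩ := hN
  obtain ⟨K, hK⟩ := hL
  let v : Expr := .load e1 e2
  let z : Expr := .op .add (.op .xor v (.op .add v (.const 1))) (.const 1)
  refine ⟨.op .mod (.op .div v z) (.op .div z (.const 2)), K1 + K2 + 2 * K + 2, by simp [v, z,
    Expr.Below, hb1, hb2], fun x hx w reg mem hw hr => ?_⟩
  have hu := Y.one_le x
  simp only [add_mul, mul_assoc] at hw ⊢
  obtain ⟨g1, -⟩ := h1 x hx w reg mem (by omega) hr
  obtain ⟨g2, -⟩ := h2 x hx w reg mem (by omega) hr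
  have hKx := hK x hx
  have hl : 2 * L x + 1 ≤ min (N x) w := le_min (hLN x hx) (by omega)
  obtain ⟨y, hy, hy'⟩ := readBits_selfDelim (hm x hx w reg mem hr) hl
  have hp := parse_eq hy'
  rw [← hy] at hp
  have hlt := (readBits_lt mem (F x) (min (N x) w)).trans_le
    (Nat.pow_le_pow_right (show 0 < 2 by norm_num) (min_le_right _ _))
  have hv : v.eval w reg mem = readBits mem (F x) (min (N x) w) := by
    simp only [v, Expr.eval, g1, g2]
  generalize readBits mem (F x) (min (N x) w) = V at hp hy hlt hv
  have hxor := xor_succ_eq (L x) y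
  rw [← hy] at hxor
  have hpos : 1 ≤ 2 ^ L x := Nat.one_le_two_pow
  have hs : 2 ^ (L x + 1) = 2 ^ L x * 2 := pow_succ 2 (L x)
  -- The successor does not overflow: the zero after the unary part lies within the word. Formally,
  -- `V + 1` is `2 ^ L` times an odd number, and `L + 1 ≤ w`.
  have hVw : V + 1 < 2 ^ w := by
    refine lt_of_le_of_ne hlt fun h => ?_
    obtain ⟨d, hd⟩ := Nat.exists_eq_add_of_le (show L x + 1 ≤ w by omega)
    rw [hd, pow_add, hy, show 2 ^ L x - 1 + 2 ^ (L x + 1) * y + 1 = 2 ^ L x * (1 + 2 * y) by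
      rw [hs, mul_add, mul_assoc]; omega, hs, mul_assoc] at h
    have := Nat.eq_of_mul_eq_mul_left hpos h
    omega
  have hLw : 2 ^ (L x + 1) < 2 ^ w := Nat.pow_lt_pow_right (by norm_num) (by omega)
  have h1w : 1 % 2 ^ w = 1 := Nat.mod_eq_of_lt (by omega)
  have h2w : 2 % 2 ^ w = 2 := by
    refine Nat.mod_eq_of_lt (lt_of_lt_of_le (show 2 < 2 ^ 2 by norm_num) ?_)
    exact Nat.pow_le_pow_right (by norm_num) (by omega)
  have hz : z.eval w reg mem = 2 ^ (L x + 1) := by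
    simp only [z, Expr.eval, Op.eval, hv, h1w]
    rw [Nat.mod_eq_of_lt hVw, hxor, Nat.mod_eq_of_lt (show 2 ^ (L x + 1) - 1 < 2 ^ w by omega),
      show 2 ^ (L x + 1) - 1 + 1 = 2 ^ (L x + 1) by omega, Nat.mod_eq_of_lt hLw]
  refine ⟨?_, ?_⟩
  · simp only [Expr.eval, Op.eval, hv, hz, h2w]
    rw [BitString.parse, hxor, show 2 ^ (L x + 1) - 1 + 1 = 2 ^ (L x + 1) by omega] at hp
    rw [Nat.mod_eq_of_lt ((Nat.div_le_self V _).trans_lt hlt),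
      Nat.mod_eq_of_lt ((Nat.div_le_self (2 ^ (L x + 1)) 2).trans_lt hLw), hp]
    refine Nat.mod_eq_of_lt (Nat.lt_two_pow_self.trans_le (Nat.pow_le_pow_right (by norm_num) ?_))
    omega
  · refine Nat.lt_two_pow_self.trans_le (Nat.pow_le_pow_right (by norm_num) ?_)
    omega

end Parse

end WordRAM

namespace ParenString
open WordRAM BitString Packed

/-- The data of the queries are computable. -/
structure QueryComp {σ : Type} (Y : Sys σ) (Q : σ → Query) : Prop where
  bw : Comp Y fun x => (Q x).bw
  n : Comp Y fun x => (Q x).n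
  R : Comp Y fun x => (Q x).R
  k : Comp Y fun x => (Q x).k
  d : Comp Y fun x => (Q x).d
  S : Comp Y fun x => (Q x).S
  a : Comp Y fun x => (Q x).a
  small : Small Y fun x => (Q x).β
  mem : ∀ x, Y.ok x → ∀ w reg mem, Y.rel w x reg mem → mem = (Q x).mem

namespace QueryComp
variable {σ : Type} {Y : Sys σ} {Q : σ → Query} (h : QueryComp Y Q)
  {F G H I J : σ → ℕ} (hF : Comp Y F) (hG : Comp Y G) (hH : Comp Y H) (hI : Comp Y I)
  (hJ : Comp Y J)
include h

/-- From here to `degree` every function of `Query` is treated by following its definition. The cuts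
at `β` in `rd` and `pw` make this possible without any correctness assumption on the memory. -/
theorem β : Comp Y fun x => (Q x).β := ((Comp.const 40).mul h.bw).mul (h.R.pow 4)
theorem f : Comp Y fun x => (Q x).f := ((Comp.const 9).mul h.bw).mul (h.R.pow 2)
theorem g : Comp Y fun x => (Q x).g := (Comp.const 8).mul h.R
theorem nb : Comp Y fun x => (Q x).nb := (h.n.div (h.R.pow 5)).add (Comp.const 1)
theorem nl : Comp Y fun x => (Q x).nl := h.nb.mul (h.R.pow 3)
theorem np : Comp Y fun x => (Q x).np := ((Comp.const 2).mul h.nb).add (h.R.pow 2)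

include hF

theorem pw : Comp Y fun x => pw (Q x).β (F x) :=
  (hF.min h.β).two_pow (h.small.of_le fun _ _ => min_le_right _ _)

include hG

theorem rd : Comp Y fun x => (Q x).rd (F x) (G x) :=
  Comp.load hF (hG.min h.β) (h.small.of_le fun _ _ => min_le_right _ _)
    fun x hx w reg mem hr p _ _ => by rw [h.mem x hx w reg mem hr]

theorem ones : Comp Y fun x => ones (Q x).β (F x) (G x) :=
  ((h.pw (hF.mul hG)).sub (Comp.const 1)).div ((h.pw hF).sub (Comp.const 1))

theorem fsum : Comp Y fun x => fsum (Q x).β (F x) (G x) :=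
  hG.mod ((h.pw hF).sub (Comp.const 1))

include hH

theorem psum : Comp Y fun x => psum (Q x).β (F x) (G x) (H x) :=
  (hH.mul (h.ones hF hG)).mod (h.pw (hF.mul hG))

theorem dropF : Comp Y fun x => dropF (Q x).β (F x) (G x) (H x) :=
  (hH.div (h.pw (hF.mul hG))).mul (h.pw (hF.mul hG))

theorem takeF : Comp Y fun x => takeF (Q x).β (F x) (G x) (H x) := hH.mod (h.pw (hF.mul hG))

theorem getF : Comp Y fun x => getF (Q x).β (F x) (G x) (H x) :=
  (hH.div (h.pw (hF.mul hG))).mod (h.pw hF)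

theorem selF : Comp Y fun x => selF (Q x).β (F x) (G x) (H x) :=
  hG.and (((h.pw hF).sub (Comp.const 1)).mul hH)

include hI

theorem geq : Comp Y fun x => geq (Q x).β (F x) (G x) (H x) (I x) :=
  (((hH.add ((h.pw (hF.sub (Comp.const 1))).mul (h.ones hF hG))).sub
    (hI.mul (h.ones hF hG))).div (h.pw (hF.sub (Comp.const 1)))).and (h.ones hF hG)

theorem spread : Comp Y fun x => spread (Q x).β (F x) (G x) (H x) (I x) :=
  (hI.mul (h.ones (hG.sub hF) hH)).and (((h.pw hF).sub (Comp.const 1)).mul (h.ones hG hH))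

theorem spreadRev : Comp Y fun x => spreadRev (Q x).β (F x) (G x) (H x) (I x) :=
  ((hI.mul (h.ones (hG.add hF) hH)).div (h.pw ((hH.sub (Comp.const 1)).mul hF))).and
    (((h.pw hF).sub (Comp.const 1)).mul (h.ones hG hH))

omit hI

theorem first : Comp Y fun x => first (Q x).β (F x) (G x) (H x) :=
  hG.sub (h.fsum hF (h.geq hF hG (h.psum hF hG hH) (Comp.const 1)))

omit hG hH

theorem bE : Comp Y fun x => (Q x).bE (F x) := h.rd (h.a.add ((h.R.pow 4).mul hF)) (h.R.pow 4)

theorem bR : Comp Y fun x => (Q x).bR (F x) :=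
  h.rd ((h.a.add ((h.R.pow 4).mul h.nb)).add ((h.R.pow 4).mul hF)) (h.R.pow 4)

omit hF in
theorem oL : Comp Y fun x => (Q x).oL :=
  (h.a.add ((h.R.pow 4).mul h.nb)).add ((h.R.pow 4).mul h.nb)

theorem lE : Comp Y fun x => (Q x).lE (F x) := h.rd (h.oL.add (h.g.mul hF)) h.g

theorem LM : Comp Y fun x => (Q x).LM (F x) :=
  h.rd ((h.oL.add (h.g.mul h.nl)).add (h.g.mul (hF.mul (h.R.pow 3)))) (h.g.mul (h.R.pow 3))

theorem LC : Comp Y fun x => (Q x).LC (F x) :=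
  h.rd (((h.oL.add (h.g.mul h.nl)).add (h.g.mul h.nl)).add (h.g.mul (hF.mul (h.R.pow 3))))
    (h.g.mul (h.R.pow 3))

theorem lR : Comp Y fun x => (Q x).lR (F x) :=
  h.rd ((((h.oL.add (h.g.mul h.nl)).add (h.g.mul h.nl)).add (h.g.mul h.nl)).add (h.g.mul hF)) h.g

omit hF in
theorem oP : Comp Y fun x => (Q x).oP :=
  (((h.oL.add (h.g.mul h.nl)).add (h.g.mul h.nl)).add (h.g.mul h.nl)).add (h.g.mul h.nl)

theorem PP : Comp Y fun x => (Q x).PP (F x) :=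
  h.rd (h.oP.add (h.g.mul hF)) (h.g.mul (h.R.pow 2))

theorem pP : Comp Y fun x => (Q x).pP (F x) := h.rd (h.oP.add (h.g.mul hF)) h.g

theorem pB : Comp Y fun x => (Q x).pB (F x) :=
  h.rd ((h.oP.add (h.g.mul h.np)).add ((h.R.pow 4).mul hF)) (h.R.pow 4)

theorem pD : Comp Y fun x => (Q x).pD (F x) :=
  h.rd (((h.oP.add (h.g.mul h.np)).add ((h.R.pow 4).mul h.np)).add ((h.R.pow 4).mul hF))
    (h.R.pow 4)

theorem cnt : Comp Y fun x => (Q x).cnt (F x) := (h.R.pow 2).min (h.n.sub (hF.mul (h.R.pow 2)))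

theorem syms : Comp Y fun x => (Q x).syms (F x) :=
  have hc := h.cnt hF
  h.d.ite_eq (Comp.const 0)
    (h.spread h.bw h.f hc (h.rd (h.S.add (h.bw.mul (hF.mul (h.R.pow 2)))) (h.bw.mul hc)))
    (h.spreadRev h.bw h.f hc (h.rd (h.S.add (h.bw.mul ((h.n.sub (hF.mul (h.R.pow 2))).sub hc)))
      (h.bw.mul hc)))

include hG in
theorem eqMask : Comp Y fun x => (Q x).eqMask (F x) (G x) :=
  (h.geq h.f (h.cnt hF) (h.syms hF) hG).sub
    (h.geq h.f (h.cnt hF) (h.syms hF) (hG.add (Comp.const 1)))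

theorem opn : Comp Y fun x => (Q x).opn (F x) :=
  h.d.ite_eq (Comp.const 0) (h.eqMask hF (((Comp.const 2).mul h.k).add (Comp.const 1)))
    (h.eqMask hF ((Comp.const 2).mul h.k))

theorem cls : Comp Y fun x => (Q x).cls (F x) :=
  h.d.ite_eq (Comp.const 0) (h.eqMask hF ((Comp.const 2).mul h.k))
    (h.eqMask hF (((Comp.const 2).mul h.k).add (Comp.const 1)))

theorem levels : Comp Y fun x => (Q x).levels (F x) :=
  (((h.lE hF).mul (h.ones h.f (h.cnt hF))).add (h.psum h.f (h.cnt hF) (h.opn hF))).sub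
    (h.psum h.f (h.cnt hF) (h.cls hF))

theorem lev : Comp Y fun x => (Q x).lev (F x) :=
  h.getF h.f (hF.mod (h.R.pow 2)) (h.levels (hF.div (h.R.pow 2)))

theorem rank : Comp Y fun x => (Q x).rank (F x) :=
  (h.bR (hF.div (h.R.pow 5))).add (h.lR (hF.div (h.R.pow 2)))

theorem pioIdx : Comp Y fun x => (Q x).pioIdx (F x) :=
  (h.rank hF).add (h.first h.g (h.R.pow 2) (h.geq h.g (h.R.pow 2) (h.PP (h.rank hF))
    (hF.mod (h.R.pow 5))))

include hG in
theorem levAt : Comp Y fun x => (Q x).levAt (F x) (G x) :=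
  ((h.lev hF).add (h.bE (hF.div (h.R.pow 5)))).sub (h.bE hG)

include hG hH

theorem leafSearch : Comp Y fun x => (Q x).leafSearch (F x) (G x) (H x) :=
  h.first h.f (h.cnt hF) (h.dropF h.f hG ((h.ones h.f (h.cnt hF)).sub
    (h.geq h.f (h.cnt hF) (h.levels hF) hH)))

theorem sumSearch : Comp Y fun x => (Q x).sumSearch (F x) (G x) (H x) :=
  h.first h.g (h.R.pow 3) (h.dropF h.g hG ((h.ones h.g (h.R.pow 3)).sub
    (h.geq h.g (h.R.pow 3) (h.LM hF) hH)))

include hI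

theorem find : Comp Y fun x => (Q x).find (F x) (G x) (H x) (I x) :=
  have hl := h.leafSearch hG hH hI
  have hb := hF.mul (h.R.pow 3)
  have hs := h.sumSearch hF ((hG.sub hb).add (Comp.const 1)) hI
  hl.ite_lt (h.cnt hG) ((hG.mul (h.R.pow 2)).add hl) (hs.ite_lt (h.R.pow 3)
    (((hb.add hs).mul (h.R.pow 2)).add (h.leafSearch (hb.add hs) (Comp.const 0) hI)) h.n)

theorem leafCount : Comp Y fun x => (Q x).leafCount (F x) (G x) (H x) (I x) :=
  h.fsum h.f (h.takeF h.f hH (h.dropF h.f hG (((h.geq h.f (h.cnt hF) (h.levels hF) hI).sub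
    (h.geq h.f (h.cnt hF) (h.levels hF) (hI.add (Comp.const 1)))).and (h.cls hF))))

theorem sumCount : Comp Y fun x => (Q x).sumCount (F x) (G x) (H x) (I x) :=
  h.fsum h.g (h.takeF h.g hH (h.dropF h.g hG (h.selF h.g (h.LC hF)
    ((h.geq h.g (h.R.pow 3) (h.LM hF) hI).sub
      (h.geq h.g (h.R.pow 3) (h.LM hF) (hI.add (Comp.const 1)))))))

omit hG hH hI

theorem close : Comp Y fun x => (Q x).close (F x) :=
  h.find (hF.div (h.R.pow 5)) (hF.div (h.R.pow 2)) (hF.mod (h.R.pow 2)) (h.lev hF)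

include hG in
theorem near : Comp Y fun x => (Q x).near (F x) (G x) :=
  have s := h.R.pow 2
  have m := h.R.pow 3
  have hl := h.lev hF
  (hF.div s).ite_eq (hG.div s) (h.leafCount (hF.div s) (hF.mod s) (hG.mod s) hl)
    (((h.leafCount (hF.div s) (hF.mod s) s hl).add
      (h.sumCount (hF.div (h.R.pow 5)) (((hF.div s).mod m).add (Comp.const 1)) ((hG.div s).mod m)
        hl)).add (h.leafCount (hG.div s) (Comp.const 0) (hG.mod s) hl))

include hG in
theorem closeIn : Comp Y fun x => (Q x).closeIn (F x) (G x) :=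
  h.find hG (hG.mul (h.R.pow 3)) (Comp.const 0) (h.levAt hF hG)

include hG hH in
theorem far : Comp Y fun x => (Q x).far (F x) (G x) (H x) :=
  have s := h.R.pow 2
  have m := h.R.pow 3
  have hl := h.lev hF
  ((h.leafCount (hF.div s) (hF.mod s) s hl).add
    (h.sumCount (hF.div (h.R.pow 5)) (((hF.div s).mod m).add (Comp.const 1)) m hl)).add
    ((h.sumCount hG (Comp.const 0) ((hH.div s).mod m) (h.levAt hF hG)).add
      (h.leafCount (hH.div s) (Comp.const 0) (hH.mod s) (h.levAt hF hG)))

theorem degree : Comp Y fun x => (Q x).degree (F x) :=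
  have hb := h.pB (h.pioIdx hF)
  (h.close hF).ite_lt h.n (h.near hF (h.close hF))
    ((h.pP (h.pioIdx hF)).ite_eq (hF.mod (h.R.pow 5)) (h.pD (h.pioIdx hF))
      (h.far hF hb (h.closeIn hF hb)))

end QueryComp

end ParenString

/-! ### Queries on the stored concatenation. -/

namespace ParenString
open WordRAM BitString Packed

section Answer
variable {t : ℕ}

/-- The string read in a phase. -/
def phaseString (S : List (Paren t)) (ph : ℕ) : List (Paren t) := if ph % 2 = 0 then S else rev S

theorem phaseCode_eq (S : List (Paren t)) (ph : ℕ) :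
    phaseCode S ph = scode (phaseString S ph) := by
  unfold phaseCode phaseString
  split <;> rfl

theorem length_phaseString (S : List (Paren t)) (ph : ℕ) :
    (phaseString S ph).length = S.length := by
  unfold phaseString
  split
  · rfl
  · exact length_rev S

theorem Balanced.phaseString {S : List (Paren t)} (hS : Balanced S) (ph : ℕ) :
    Balanced (phaseString S ph) := by
  unfold ParenString.phaseString
  split
  · exact hS
  · exact hS.rev

/-- The arrays of the phase `ph` give `son` at the open parentheses of the string read in it. -/
theorem two_mul_degree (ht : 0 < t) {S : List (Paren t)} (hS : Balanced S) {ph : ℕ} {k : Fin t}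
    (hk : ph / 2 = k) {s a : ℕ} {mem : ℕ → Bool} (hs : Has mem s (encode S))
    (ha : Has mem a (phaseChunk S ph)) {i : ℕ} (hi : (phaseString S ph)[i]? = some ⟨k, true⟩) :
    2 * (Query.mk (symBits t) S.length (param S.length) (ph / 2) (ph % 2) s a mem).degree i =
      sonOpen (phaseString S ph) k i := by
  have W := (hS.phaseString ph k).walk
  obtain ⟨i', hp⟩ := W.mat i ((scode_open _ _ _).1 hi)
  have W' := W
  rw [length_phaseString, ← hk] at W'
  have hgood : (Query.mk (symBits t) S.length (param S.length) (ph / 2) (ph % 2) s a mem).Good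
      (scode (phaseString S ph)) (nlvl (scode (phaseString S ph)) k) _ _ :=
    { bw_pos := symBits_pos ht
      R_pos := param_pos _
      n_lt := lt_two_pow_param _
      walk := by rw [hk] at W' ⊢; exact W'
      k_lt := by
        have h1 := Nat.le_pow_clog (show 1 < 2 by norm_num) (2 * t)
        have := k.isLt
        show 2 * (ph / 2) + 1 < 2 ^ Nat.clog 2 (2 * t)
        omega
      sym0 := fun h0 p hp => by
        rw [hs.encode hp, phaseString, if_pos h0]
      sym1 := fun h0 p hp => by
        have hp' : p < S.length := hp
        rw [hs.encode (show S.length - 1 - p < S.length by omega), phaseString, if_neg h0,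
          scode_rev S hp]
      has := by
        rw [phaseChunk, phaseCode_eq] at ha
        exact ha
      index := by
        have := W'.index (param_pos S.length)
        rw [hk] at this ⊢
        exact this }
  rw [(hS.phaseString ph k).sonOpen_eq hp, hgood.degree_eq (i' := i') (by rw [hk]; exact hp), hk]

/-- The number of bits of the two numbers in the header. -/
def headerBits (S : List (Paren t)) : ℕ :=
  Nat.size ((encode S).length + (auxString S).length)

/-- The memory of the queries. -/
def queryMem (S : List (Paren t)) (p : ℕ) : Bool :=
  (join (encode S) (auxString S))[p]?.getD false

/-- The representation of a string and a position in a query. -/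
def querySys (t : ℕ) : Sys (List (Paren t) × ℕ) where
  u x := Nat.log 2 x.1.length + 1
  one_le _ := Nat.le_add_left _ _
  ok x := Balanced x.1 ∧ x.2 < x.1.length
  rel w x reg mem := (reg 0 = (join (encode x.1) (auxString x.1)).length % 2 ^ w ∧
    reg 1 = x.2 % 2 ^ w) ∧ mem = queryMem x.1

theorem length_lt_two_pow_mul (t : ℕ) : ∃ K, ∀ S : List (Paren t),
    (encode S).length + (auxString S).length < 2 ^ (K * (Nat.log 2 S.length + 1)) := by
  refine ⟨symBits t + 200 * (t + 1) + 32, fun S => ?_⟩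
  have h1 := length_indexTo_le S (le_refl (2 * t))
  have h2 : S.length ≤ rows S.length := by have := lt_rows S.length; omega
  have h3 := Nat.mul_le_mul_left (symBits t) h2
  have h4 := (rows_le S.length).1
  rw [length_encode, auxString, add_mul, pow_add]
  refine lt_of_le_of_lt (b := (symBits t + 200 * (t + 1)) * rows S.length)
    (by rw [add_mul]; omega) ?_
  refine Nat.mul_lt_mul_of_lt_of_le ?_ h4 (by positivity)
  refine Nat.lt_two_pow_self.trans_le (Nat.pow_le_pow_right (by norm_num) ?_)
  exact Nat.le_mul_of_pos_right _ (Nat.succ_pos _)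

theorem length_join (A B : List Bool) : (join A B).length =
    4 * Nat.size (A.length + B.length) + 1 + A.length + B.length := by
  simp only [join_eq, List.length_append, length_selfDelim, length_ofNat]
  ring

/-- The parts of the memory of the queries. -/
theorem has_join (S : List (Paren t)) :
    Has (queryMem S) 0 (selfDelim (headerBits S)) ∧
    Has (queryMem S) (2 * headerBits S + 1) (ofNat (headerBits S) (encode S).length) ∧
    Has (queryMem S) (4 * headerBits S + 1) (encode S) ∧
    Has (queryMem S) (4 * headerBits S + 1 + (encode S).length) (auxString S) := by
  have h := has_getD (join (encode S) (auxString S))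
  rw [show (fun p => (join (encode S) (auxString S))[p]?.getD false) = queryMem S from rfl,
    join_eq, Has.append_iff, Has.append_iff, Has.append_iff, Has.append_iff] at h
  simp only [length_selfDelim, length_ofNat, zero_add] at h
  rw [show 4 * headerBits S + 1 = 2 * headerBits S + 1 + headerBits S + headerBits S by ring]
  exact ⟨h.1, h.2.1, h.2.2.2.1, h.2.2.2.2⟩

theorem init_mem (S : List (Paren t)) (w : ℕ) (args : List ℕ) :
    (init w (join (encode S) (auxString S)) args).mem = queryMem S := by
  funext p
  simp only [init]
  unfold queryMem
  rfl

attribute [irreducible] queryMem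

section Comp

theorem small_headerBits : Small (querySys t) fun x => headerBits x.1 := by
  obtain ⟨K, hK⟩ := length_lt_two_pow_mul t
  exact ⟨K, fun x _ => Nat.size_le.2 (hK x.1)⟩

theorem comp_join_length :
    Comp (querySys t) fun x => (join (encode x.1) (auxString x.1)).length := by
  obtain ⟨K, hK⟩ := length_lt_two_pow_mul t
  refine Comp.register 0 (by norm_num) (fun x _ w reg mem h => h.1.1) ⟨K + 3, fun x _ => ?_⟩
  have h1 := hK x.1
  have h2 : Nat.size ((encode x.1).length + (auxString x.1).length) ≤
      (encode x.1).length + (auxString x.1).length := Nat.size_le.2 Nat.lt_two_pow_self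
  have h3 := (querySys t).one_le x
  have h4 : 2 ^ (K * (Nat.log 2 x.1.length + 1)) * 2 ^ 3 ≤ 2 ^ ((K + 3) * (querySys t).u x) := by
    rw [← pow_add]
    refine Nat.pow_le_pow_right (by norm_num) ?_
    rw [add_mul]
    show K * (querySys t).u x + 3 ≤ _
    omega
  rw [length_join]
  omega

theorem comp_position : Comp (querySys t) fun x => x.2 := by
  refine Comp.register 1 (by norm_num) (fun x _ w reg mem h => h.1.2) ⟨1, fun x hx => ?_⟩
  rw [one_mul]
  exact hx.2.trans (length_lt_two_pow _)

/-- The start of a chain: the size of the header gives the length of the encoded string, hence the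
length of the string and the place of the auxiliary string, whose own header gives the parameter. -/
theorem comp_headerBits : Comp (querySys t) fun x => headerBits x.1 := by
  refine comp_parse (Comp.const 0) comp_join_length small_headerBits (fun x _ => ?_)
    fun x _ w reg mem h => ?_
  · rw [length_join]
    show 2 * headerBits x.1 + 1 ≤ 4 * headerBits x.1 + 1 + _ + _
    omega
  · rw [h.2]
    exact (has_join x.1).1

theorem comp_encode_length : Comp (querySys t) fun x => (encode x.1).length := by
  refine (Comp.load (m := fun x => queryMem x.1)
    (((Comp.const 2).mul comp_headerBits).add (Comp.const 1)) comp_headerBits small_headerBits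
    fun x _ w reg mem h p _ _ => by rw [h.2]).congr fun x _ => ?_
  rw [(has_join x.1).2.1.readBits, Nat.mod_eq_of_lt]
  have := Nat.lt_size_self ((encode x.1).length + (auxString x.1).length)
  exact lt_of_le_of_lt (Nat.le_add_right _ _) this

theorem comp_string_length (ht : 0 < t) : Comp (querySys t) fun x => x.1.length :=
  (comp_encode_length.div (Comp.const (symBits t))).congr fun x _ => by
    rw [length_encode, Nat.mul_div_cancel_left _ (symBits_pos ht)]

theorem comp_string_start : Comp (querySys t) fun x => 4 * headerBits x.1 + 1 :=
  ((Comp.const 4).mul comp_headerBits).add (Comp.const 1)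

theorem small_string_param : Small (querySys t) fun x => param x.1.length ^ 4 :=
  ⟨32, fun _ _ => param_pow_le _⟩

theorem comp_string_param : Comp (querySys t) fun x => param x.1.length := by
  refine comp_parse (comp_string_start.add comp_encode_length) comp_join_length
    (small_string_param.of_le fun _ _ => Nat.le_self_pow (by norm_num) _) (fun x _ => ?_)
    fun x _ w reg mem h => ?_
  · rw [length_join, auxString, length_indexTo]
    omega
  · rw [h.2]
    have := (has_join x.1).2.2.2
    rw [auxString, indexTo, Has.append_iff] at this
    exact this.1

theorem comp_symbol : Comp (querySys t) fun x => scode x.1 x.2 := by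
  refine (Comp.load (m := fun x => queryMem x.1)
    (comp_string_start.add ((Comp.const (symBits t)).mul comp_position)) (Comp.const (symBits t))
    (Small.const _) fun x _ w reg mem h p _ _ => by rw [h.2]).congr fun x hx => ?_
  exact (has_join x.1).2.2.1.encode hx.2

end Comp

/-- The phase whose arrays are used for a position. -/
def phaseOf (S : List (Paren t)) (i : ℕ) : ℕ :=
  if scode S i % 2 = 1 then scode S i - 1 else scode S i + 1

/-- The place of a position in the string that is read in its phase. -/
def placeOf (S : List (Paren t)) (i : ℕ) : ℕ :=
  if scode S i % 2 = 1 then i else S.length - 1 - i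

/-- The query for a position. -/
def queryOf (x : List (Paren t) × ℕ) : Query :=
  ⟨symBits t, x.1.length, param x.1.length, phaseOf x.1 x.2 / 2, phaseOf x.1 x.2 % 2,
    4 * headerBits x.1 + 1, 4 * headerBits x.1 + 1 + (encode x.1).length +
      (2 * param x.1.length + 1) + chunkLen (param x.1.length) x.1.length * phaseOf x.1 x.2,
    queryMem x.1⟩

theorem comp_phaseOf : Comp (querySys t) fun x => phaseOf x.1 x.2 :=
  (comp_symbol.mod (Comp.const 2)).ite_eq (Comp.const 1) (comp_symbol.sub (Comp.const 1))
    (comp_symbol.add (Comp.const 1))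

theorem comp_chunkLen (ht : 0 < t) :
    Comp (querySys t) fun x => chunkLen (param x.1.length) x.1.length :=
  have hR := comp_string_param
  have nb := ((comp_string_length ht).div (hR.pow 5)).add (Comp.const 1)
  have nl := nb.mul (hR.pow 3)
  have np := ((Comp.const 2).mul nb).add (hR.pow 2)
  have b := (hR.pow 4).mul nb
  have l := ((Comp.const 8).mul hR).mul nl
  have p := (hR.pow 4).mul np
  (((((((b.add b).add l).add l).add l).add l).add (((Comp.const 8).mul hR).mul np)).add p).add p

theorem queryComp (ht : 0 < t) : QueryComp (querySys t) queryOf where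
  bw := (Comp.const (symBits t)).congr fun _ _ => rfl
  n := comp_string_length ht
  R := comp_string_param
  k := comp_phaseOf.div (Comp.const 2)
  d := comp_phaseOf.mod (Comp.const 2)
  S := comp_string_start
  a := ((comp_string_start.add comp_encode_length).add
    (((Comp.const 2).mul comp_string_param).add (Comp.const 1))).add
      ((comp_chunkLen ht).mul comp_phaseOf)
  small := (small_string_param.const_mul (40 * symBits t)).of_le fun _ _ => le_rfl
  mem _ _ _ _ _ h := h.2

/-- An open parenthesis of type `k` uses phase `2 * k` at its own place, a close one uses phase `2 *
k + 1` at the mirrored place, where the reversed string has an open parenthesis. -/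
theorem son_eq (ht : 0 < t) {S : List (Paren t)} (hS : Balanced S) {i : ℕ} (hi : i < S.length) :
    2 * (queryOf (S, i)).degree (placeOf S i) = son S i := by
  have hc := (scode_lt_iff S i).2 hi
  obtain ⟨⟨k, o⟩, hp⟩ : ∃ p, S[i]? = some p := ⟨_, List.getElem?_eq_getElem hi⟩
  have hk := k.isLt
  have hcode := (scode_eq_iff S i k o).1 hp
  have hph : phaseOf S i < 2 * t ∧ phaseOf S i / 2 = k := by
    unfold phaseOf
    cases o <;> simp at hcode <;> rw [hcode] <;> split <;> omega
  have ha : Has (queryMem S) (4 * headerBits S + 1 + (encode S).length +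
      (2 * param S.length + 1) + chunkLen (param S.length) S.length * phaseOf S i)
      (phaseChunk S (phaseOf S i)) := by
    have := (has_join S).2.2.2
    rw [auxString, indexTo, Has.append_iff, length_selfDelim] at this
    have := Has.flatMap (w := chunkLen (param S.length) S.length) (g := phaseChunk S)
      (fun _ => length_chunk _ _ _) this.2 (j := phaseOf S i) (by simpa using hph.1)
    simpa using this
  have key := fun (i' : ℕ) (h : (phaseString S (phaseOf S i))[i']? = some ⟨k, true⟩) =>
    two_mul_degree ht hS hph.2 (has_join S).2.2.1 ha h
  cases o
  · simp only [Bool.false_eq_true, if_false, add_zero] at hcode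
    have h2 : phaseString S (phaseOf S i) = rev S := by
      rw [phaseString, phaseOf, if_neg]
      rw [hcode]; split <;> omega
    have h3 : placeOf S i = S.length - 1 - i := by
      rw [placeOf, if_neg]; omega
    rw [h2] at key
    rw [h3, son, hp]
    refine key _ ?_
    rw [rev_getElem? S (by omega), show S.length - 1 - (S.length - 1 - i) = i by omega, hp]
    rfl
  · simp only [if_true] at hcode
    have h2 : phaseString S (phaseOf S i) = S := by
      rw [phaseString, phaseOf, if_pos]
      rw [hcode]; split <;> omega
    have h3 : placeOf S i = i := by
      rw [placeOf, if_pos]; omega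
    rw [h2] at key
    rw [h3, son, hp]
    exact key _ hp

theorem exists_query (ht : 0 < t) : ∃ (query : Program) (c C : ℕ), ∀ S : List (Paren t),
    Balanced S → ∀ w, c * (Nat.log 2 S.length + 1) ≤ w → ∀ i < S.length, ∃ s : State,
      HaltsWithin w query C (init w (join (encode S) (auxString S)) [i]) s ∧
        s.reg 0 = son S i := by
  have hplace : Comp (querySys t) fun x => placeOf x.1 x.2 :=
    (comp_symbol.mod (Comp.const 2)).ite_eq (Comp.const 1) comp_position
      (((comp_string_length ht).sub (Comp.const 1)).sub comp_position)
  obtain ⟨e, K, he, he'⟩ := (Comp.const 2).mul ((queryComp ht).degree hplace)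
  refine ⟨Cmd.compile (.seq (e.code 8) (.seq (.basic (.const 0 0)) (.basic (.op .or 0 0 8)))) 0,
    K, e.cost + 2, fun S hS w hw i hi => ?_⟩
  obtain ⟨r, g1, g2, -⟩ := Expr.runs w e 8 (init w (join (encode S) (auxString S)) [i]).reg
    (init w (join (encode S) (auxString S)) [i]).mem he
  have hrel : (querySys t).rel w (S, i) (init w (join (encode S) (auxString S)) [i]).reg
      (init w (join (encode S) (auxString S)) [i]).mem := by
    exact ⟨⟨by simp [init], by simp [init]⟩, init_mem _ _ _⟩
  obtain ⟨h1, h2⟩ := he' (S, i) ⟨hS, hi⟩ w _ _ hw hrel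
  generalize hm : (init w (join (encode S) (auxString S)) [i]).mem = mem at *
  generalize hr : (init w (join (encode S) (auxString S)) [i]).reg = reg at *
  have hinit : init w (join (encode S) (auxString S)) [i] = ⟨0, reg, mem⟩ := by
    rw [← hm, ← hr, init]
  rw [hinit]
  refine ⟨_, ((Runs.seq g1 (Runs.seq (Runs.const 0 0) (Runs.op .or 0 0 8))).mono
    (by omega)).halts, ?_⟩
  have h3 := h2.trans_le (Nat.pow_le_pow_right (show 0 < 2 by norm_num) hw)
  simp only [son_eq ht hS hi] at h1 h3
  simp [Op.eval, Nat.mod_eq_of_lt h3, g2, h1]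

theorem exists_programs (ht : 0 < t) :
    ∃ (χ : List (Paren t) → List Bool) (build query : Program) (c C : ℕ),
      (∀ ε : ℝ, 0 < ε → ∃ N : ℕ, ∀ S : List (Paren t), Balanced S →
        N ≤ S.length → ((χ S).length : ℝ) ≤ ε * (S.length : ℝ)) ∧
      ∀ S : List (Paren t), Balanced S → ∀ w : ℕ, c * (Nat.log 2 S.length + 1) ≤ w →
        (∃ s : State, HaltsWithin w build (C * (S.length + 1)) (init w (encode S) []) s ∧
          s.output = χ S) ∧
        ∀ i : ℕ, i < S.length → ∃ s : State,
          HaltsWithin w query C (init w (join (encode S) (χ S)) [i]) s ∧ s.reg 0 = son S i := by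
  obtain ⟨build, c, C, h⟩ := exists_build ht
  obtain ⟨query, c', C', h'⟩ := exists_query ht
  refine ⟨auxString, build, query, c + c', C + C', fun ε hε => ?_, fun S hS w hw => ⟨?_, ?_⟩⟩
  · obtain ⟨N, hN⟩ := length_auxString_isLittleO t ε hε
    exact ⟨N, fun S _ => hN S⟩
  · rw [add_mul] at hw
    obtain ⟨s, h1, h2⟩ := h S hS w (by omega)
    exact ⟨s, h1.mono (Nat.mul_le_mul_right _ (by omega)), h2⟩
  · rw [add_mul] at hw
    intro i hi
    obtain ⟨s, h1, h2⟩ := h' S hS w (by omega) i hi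
    exact ⟨s, h1.mono (by omega), h2⟩

end Answer

end ParenString

theorem mainTheorem8 (t : ℕ) :
    ∃ (χ : List (ParenString.Paren t) → List Bool) (build query : WordRAM.Program) (c C : ℕ),
      -- the auxiliary string has `o(|S|)` bits
      (∀ ε : ℝ, 0 < ε → ∃ N : ℕ, ∀ S : List (ParenString.Paren t), ParenString.Balanced S →
        N ≤ S.length → ((χ S).length : ℝ) ≤ ε * (S.length : ℝ)) ∧
      ∀ S : List (ParenString.Paren t), ParenString.Balanced S →
        ∀ w : ℕ, c * (Nat.log 2 S.length + 1) ≤ w →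
          -- it is computable from `S` in `O(|S|)` time
          (∃ s : WordRAM.State,
            WordRAM.HaltsWithin w build (C * (S.length + 1))
              (WordRAM.init w (BitString.encode S) []) s ∧
            s.output = χ S) ∧
          -- `son S i` is computable from the concatenation of `S` and `χ S` in `O(1)` time
          ∀ i : ℕ, i < S.length →
            ∃ s : WordRAM.State,
              WordRAM.HaltsWithin w query C
                (WordRAM.init w (BitString.join (BitString.encode S) (χ S)) [i]) s ∧
              s.reg 0 = ParenString.son S i := by
  -- Without types only the empty string exists. The case is separate because symbols then have no
  -- bits and the length cannot be recovered by division.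
  rcases Nat.eq_zero_or_pos t with rfl | ht
  · have hnil : ∀ S : List (ParenString.Paren 0), S = [] := fun S => by
      rcases S with _ | ⟨p, S⟩
      · rfl
      · exact p.kind.elim0
    refine ⟨fun _ => [], [], [], 0, 0, fun ε hε => ⟨0, fun S _ _ => ?_⟩,
      fun S _ w _ => ⟨⟨_, .done _ _ rfl, ?_⟩, fun i hi => ?_⟩⟩
    · rw [hnil S]; simp
    · rw [hnil S]; simp [WordRAM.State.output, WordRAM.init, BitString.encode]
    · rw [hnil S] at hi; exact absurd hi (Nat.not_lt_zero i)
  · exact ParenString.exists_programs ht
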